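/- **Setting.** Let $(\mathcal V,\mu)$ and $(\mathcal Z,\nu)$ be probability spaces, $\phi(\boldsymbol x;\boldsymbol w,z)\in\mathbb R$ a random feature ($\boldsymbol x\in\mathbb R^d$, $\boldsymbol w\in\mathcal V$, $z\in\mathcal Z$), measurable in $(\boldsymbol w,z)$ and integrable in $z$, and let $\overline\phi(\boldsymbol x;\boldsymbol w)=\int\phi(\boldsymbol x;\boldsymbol w,z)\,\nu(\mathrm dz)$. Fix $n\ge1$ data points $\boldsymbol x_i\in\mathbb R^d$ and $\boldsymbol y\in\mathbb R^n$. For $\boldsymbol w\sim\mu$ and independent $z_1,\dots,z_n\sim\nu$ put $\boldsymbol\phi_n=(\phi(\boldsymbol x_i;\boldsymbol w,z_i))_{i\le n}$, assumed square integrable, $\boldsymbol K_n=\mathbb E[\boldsymbol\phi_n\boldsymbol\phi_n^{\mathsf T}]$ and $\boldsymbol\psi_n=\boldsymbol K_n^{-1/2}\boldsymbol\phi_n$. Let $\boldsymbol w_j$, $\boldsymbol\phi_{n,j}$ ($j\le N$, $N\ge 1$) be $N$ i.i.d. copies of $\boldsymbol w$, $\boldsymbol\phi_n$. For a penalty $\rho:\mathbb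 R\to\mathbb R$ let $\rho^*(t)=\sup_u\{tu-\rho(u)\}$, $s=(\rho^*)'$, and $$F(\boldsymbol\lambda)=\langle\boldsymbol\lambda,\boldsymbol y\rangle-\mathbb E[\rho^*(\langle\boldsymbol\phi_n,\boldsymbol\lambda\rangle)],\qquad F_N(\boldsymbol\lambda)=\langle\boldsymbol\lambda,\boldsymbol y\rangle-\frac1N\sum_{j\le N}\rho^*(\langle\boldsymbol\phi_{n,j},\boldsymbol\lambda\rangle),$$ $$\hat f(\boldsymbol x;\boldsymbol\lambda)=\mathbb E[\overline\phi(\boldsymbol x;\boldsymbol w)\,s(\langle\boldsymbol\phi_n,\boldsymbol\lambda\rangle)],\qquad \hat f_N(\boldsymbol x;\boldsymbol\lambda)=\frac1N\sum_{j\le N}\overline\phi(\boldsymbol x;\boldsymbol w_j)\,s(\langle\boldsymbol\phi_{n,j},\boldsymbol\lambda\rangle).$$ $F$ and $F_N$ are the duals of the infinite-width and of the finite-width ($N$ random features) minimum-complexity interpolation problems. With $\hat{\boldsymbol\lambda}=\arg\max F$ and $\hat{\boldsymbol\lambda}_N=\arg\max F_N$, the corresponding interpolators are $\hat f(\cdot;\hat{\boldsymbol\lambda})$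 and $\hat f_N(\cdot;\hat{\boldsymbol\lambda}_N)$. A random vector $\boldsymbol X$ is $\gamma^2$-sub-Gaussian if $\mathbb E\,e^{\langle\boldsymbol v,\boldsymbol X\rangle}\le e^{\gamma^2\|\boldsymbol v\|^2/2}$ for all $\boldsymbol v$. **Assumptions**, with constants $C,c,r_0>0$, $Q_1,Q_2,q_1,q_2>1$ and $(C_r)_{r\in(-1,0)}$: * FEAT1: $1\le\tau\le n^C$; $\overline\phi(\boldsymbol x;\boldsymbol w)$ is $\tau^2$-sub-Gaussian whenever $\|\boldsymbol x\|_2\le r_0\sqrt d$; $\boldsymbol\psi_n$ is $\tau^2$-sub-Gaussian. * FEAT2: $\overline\phi(\cdot;\boldsymbol w)$ is $L(\boldsymbol w)$-Lipschitz and $\overline\phi(\boldsymbol 0;\boldsymbol w)\le L(\boldsymbol w)$ for all $\boldsymbol w$, with $\mathbb P(L(\boldsymbol w)\ge t)\le Ce^{-t^2/(2\tau^2)}$ for $t>0$. * FEAT3: $n^{-C}\le\eta\le1$ and $\mathbb P(|\langle\boldsymbol u,\boldsymbol\psi_n\rangle|\ge\eta,\ |\langle\boldsymbol v,\boldsymbol\psi_n\rangle|\ge\eta)\ge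 c$ for all unit vectors $\boldsymbol u,\boldsymbol v$. * FEAT3': $\mathbb E[|\langle\boldsymbol\psi_n,\boldsymbol v\rangle|^r]\le C_r\eta^r$ for all $r\in(-1,0)$ and all unit vectors $\boldsymbol v$. * PEN: $\rho$ is strictly convex and minimized at $0$, $\rho^*$ is finite, $s$ is locally Lipschitz on $\mathbb R\setminus\{0\}$, and for all $t_2\ne0$ $$c\,|s(t_2)/t_2|\,(|t_1/t_2|^{q_1-2}\wedge|t_1/t_2|^{q_2-2})\le s'(t_1)\le C\,|s(t_2)/t_2|\,(|t_1/t_2|^{Q_1-2}\vee|t_1/t_2|^{Q_2-2}),$$ $$c\,|s(t_2)|\,(|t_1/t_2|^{q_1-1}\wedge|t_1/t_2|^{q_2-1})\le|s(t_1)|\le C\,|s(t_2)|\,(|t_1/t_2|^{Q_1-1}\vee|t_1/t_2|^{Q_2-1}),$$ where the first line is required for almost every $t_1$ and the second for every $t_1\ne0$. Write $Q=Q_1\vee Q_2$, $Q'=Q_1\wedge Q_2$, $q=q_1\vee q_2$, $q'=q_1\wedge q_2$. **Theorem.** There are constants $C',c'>0$ depending only on $C,c,r_0,Q_1,Q_2,q_1,q_2,(C_r)$,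 and constants $C''(\delta)$ depending in addition only on $\delta$, such that the following holds. Let $\|\boldsymbol x_i\|_2\le r_0\sqrt d$ for all $i\le n$, let $\mathbb P$ be a probability distribution supported on $\{\boldsymbol x\in\mathbb R^d:\|\boldsymbol x\|_2\le r_0\sqrt d\}$, and let FEAT1, FEAT2, FEAT3 and PEN hold, and also FEAT3' if $Q'<2$. Suppose $n\ge c'd$ and $N\ge N_1\vee N_2$, where $$N_1=C'\Big(\frac{\tau^{Q\vee2}}{\eta^{q\vee3}}\Big)^2 n\log n,\qquad N_2=C'\,\frac{\tau^{Q\vee2}}{\eta^{q\vee3}}\,(n\log n)^{(Q/2)\vee1}.$$ Then $F$ has a unique maximizer $\hat{\boldsymbol\lambda}$ and, for every $\delta>0$, with probability at least $1-C'N^{-c'n}$, $F_N$ has a unique maximizer $\hat{\boldsymbol\lambda}_N$ and $$\|\hat f_N(\cdot;\hat{\boldsymbol\lambda}_N)-\hat f(\cdot;\hat{\boldsymbol\lambda})\|_{L_2(\mathbb P)}\le M(\delta,\tau,\eta)\Big(\sqrt{\frac{n\log N}{N}}\vee\frac{(n\log N)^{Q/2}}{N}\Big)\|\boldsymbol K_n^{-1/2}\boldsymbol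 y\|_2,$$ $$M(\delta,\tau,\eta)=C''(\delta)\,\frac{\tau^{Q+2+(2-q'+\delta)_+}}{\eta^{q\vee3}}\,(\tau^{Q-2}\vee\eta^{Q'-2}).$$ If $q_1=q_2\ge2$, the same holds with $\delta=0$, $C''(0)<\infty$. -/

import Mathlib

open MeasureTheory

noncomputable section

namespace RandomFeatures

/-! ### Penalty -/

/-- The convex conjugate `ρ*(x) = sup_y (x y - ρ y)`. Its finiteness is part of `PEN`. -/
def conjugate (ρ : ℝ → ℝ) (x : ℝ) : ℝ := ⨆ y : ℝ, (x * y - ρ y)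

/-- The function `s = (ρ*)'`. -/
def link (ρ : ℝ → ℝ) : ℝ → ℝ := deriv (conjugate ρ)

/-- Polynomial growth. The penalty is strictly convex and minimized at `0`, its conjugate is
finite, `s = (ρ*)'` is locally Lipschitz away from `0` (so that `s'` exists almost everywhere and
`s` is the integral of `s'`), and `s'` and `s` satisfy two-sided polynomial growth bounds. -/
structure PEN (C c Q₁ Q₂ q₁ q₂ : ℝ) (ρ : ℝ → ℝ) : Prop where
  strictConvex : StrictConvexOn ℝ Set.univ ρ
  minimized : ∀ t : ℝ, ρ 0 ≤ ρ t
  conjugate_finite : ∀ t : ℝ, BddAbove (Set.range fun y : ℝ => t * y - ρ y)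
  locallyLipschitz : LocallyLipschitzOn ({0}ᶜ : Set ℝ) (link ρ)
  deriv_bounds : ∀ᵐ t₁ : ℝ, ∀ t₂ : ℝ, t₁ ≠ 0 → t₂ ≠ 0 →
    c * |link ρ t₂ / t₂| * min (|t₁ / t₂| ^ (q₁ - 2)) (|t₁ / t₂| ^ (q₂ - 2)) ≤ deriv (link ρ) t₁ ∧
    deriv (link ρ) t₁ ≤ C * |link ρ t₂ / t₂| * max (|t₁ / t₂| ^ (Q₁ - 2)) (|t₁ / t₂| ^ (Q₂ - 2))
  bounds : ∀ t₁ t₂ : ℝ, t₁ ≠ 0 → t₂ ≠ 0 →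
    c * |link ρ t₂| * min (|t₁ / t₂| ^ (q₁ - 1)) (|t₁ / t₂| ^ (q₂ - 1)) ≤ |link ρ t₁| ∧
    |link ρ t₁| ≤ C * |link ρ t₂| * max (|t₁ / t₂| ^ (Q₁ - 1)) (|t₁ / t₂| ^ (Q₂ - 1))

/-! ### Random features

`φ x w z` is the value of the feature with weight `w` and auxiliary randomness `z` at the
covariate `x`. One random feature evaluated at the `n` data points is encoded by a point
`p = (w, (z_1, …, z_n))` of `V × (Fin n → Z)`, with law `μ ⊗ ν^n`. -/

variable {V : Type*} {Z : Type*} [MeasurableSpace V] [MeasurableSpace Z] {d n N : ℕ}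

/-- The law `μ ⊗ ν^n` of `(w, z_1, …, z_n)`. -/
def featureLaw (μ : Measure V) (ν : Measure Z) (n : ℕ) : Measure (V × (Fin n → Z)) :=
  μ.prod (Measure.pi fun _ : Fin n => ν)

/-- The law of `N` independent copies of `(w, z_1, …, z_n)`. -/
def sampleLaw (μ : Measure V) (ν : Measure Z) (n N : ℕ) :
    Measure (Fin N → V × (Fin n → Z)) :=
  Measure.pi fun _ : Fin N => featureLaw μ ν n

/-- The average feature `φ̄(x; w) = E_z φ(x; w, z)`. -/
def avgFeature (ν : Measure Z) (φ : EuclideanSpace ℝ (Fin d) → V → Z → ℝ)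
    (x : EuclideanSpace ℝ (Fin d)) (w : V) : ℝ :=
  ∫ z, φ x w z ∂ν

/-- The feature vector `φ_n = (φ(x_1; w, z_1), …, φ(x_n; w, z_n))`. -/
def featureVec (φ : EuclideanSpace ℝ (Fin d) → V → Z → ℝ)
    (x : Fin n → EuclideanSpace ℝ (Fin d)) (p : V × (Fin n → Z)) : EuclideanSpace ℝ (Fin n) :=
  WithLp.toLp 2 fun i => φ (x i) p.1 (p.2 i)

/-- The empirical kernel matrix `K_n = E[φ_n φ_nᵀ]`. -/
def kernelMatrix (μ : Measure V) (ν : Measure Z) (φ : EuclideanSpace ℝ (Fin d) → V → Z → ℝ)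
    (x : Fin n → EuclideanSpace ℝ (Fin d)) : Matrix (Fin n) (Fin n) ℝ :=
  Matrix.of fun i j => ∫ p, featureVec φ x p i * featureVec φ x p j ∂(featureLaw μ ν n)

/-- The linear map `u ↦ K^{-1/2} u`, where `K^{-1/2}` is given by the spectral calculus of the
symmetric matrix `K`. -/
def invSqrt (K : Matrix (Fin n) (Fin n) ℝ) :
    EuclideanSpace ℝ (Fin n) →ₗ[ℝ] EuclideanSpace ℝ (Fin n) :=
  Matrix.toEuclideanLin (cfc (fun t : ℝ => t ^ (-(1 / 2) : ℝ)) K)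

/-- The whitened feature vector `ψ_n = K_n^{-1/2} φ_n`. -/
def whitened (μ : Measure V) (ν : Measure Z) (φ : EuclideanSpace ℝ (Fin d) → V → Z → ℝ)
    (x : Fin n → EuclideanSpace ℝ (Fin d)) (p : V × (Fin n → Z)) : EuclideanSpace ℝ (Fin n) :=
  invSqrt (kernelMatrix μ ν φ x) (featureVec φ x p)

/-- A random vector `X` is `γ2`-sub-Gaussian if `E exp⟨v, X⟩ ≤ exp(γ2 ‖v‖² / 2)` for all `v`. -/
def IsSubgaussian {Ω E : Type*} [MeasurableSpace Ω] [NormedAddCommGroup E]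
    [InnerProductSpace ℝ E] (γ2 : ℝ) (X : Ω → E) (P : Measure Ω) : Prop :=
  ∀ v : E, Integrable (fun ω => Real.exp (inner ℝ v (X ω))) P ∧
    ∫ ω, Real.exp (inner ℝ v (X ω)) ∂P ≤ Real.exp (γ2 * ‖v‖ ^ 2 / 2)

/-- Regularity under which the average features and the kernel matrix are well defined. -/
structure Regular (μ : Measure V) (ν : Measure Z) (φ : EuclideanSpace ℝ (Fin d) → V → Z → ℝ)
    (x : Fin n → EuclideanSpace ℝ (Fin d)) : Prop where
  measurable : ∀ u, Measurable fun p : V × Z => φ u p.1 p.2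
  integrable : ∀ u w, Integrable (φ u w) ν
  sqIntegrable : ∀ i, MemLp (fun p => featureVec φ x p i) 2 (featureLaw μ ν n)

/-- Sub-Gaussian features. -/
structure FEAT1 (C r₀ τ : ℝ) (μ : Measure V) (ν : Measure Z)
    (φ : EuclideanSpace ℝ (Fin d) → V → Z → ℝ) (x : Fin n → EuclideanSpace ℝ (Fin d)) :
    Prop where
  one_le : 1 ≤ τ
  le_pow : τ ≤ (n : ℝ) ^ C
  avg : ∀ u : EuclideanSpace ℝ (Fin d), ‖u‖ ≤ r₀ * √d →
    IsSubgaussian (τ ^ 2) (fun w => avgFeature ν φ u w) μ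
  vec : IsSubgaussian (τ ^ 2) (whitened μ ν φ x) (featureLaw μ ν n)

/-- Lipschitz average features, with a random Lipschitz constant `L w` of sub-Gaussian tail. -/
def FEAT2 (C τ : ℝ) (μ : Measure V) (ν : Measure Z)
    (φ : EuclideanSpace ℝ (Fin d) → V → Z → ℝ) : Prop :=
  ∃ L : V → ℝ, Measurable L ∧
    (∀ w u u', |avgFeature ν φ u w - avgFeature ν φ u' w| ≤ L w * ‖u - u'‖) ∧
    (∀ w, avgFeature ν φ 0 w ≤ L w) ∧
    ∀ t : ℝ, 0 < t → μ.real {w | t ≤ L w} ≤ C * Real.exp (-t ^ 2 / (2 * τ ^ 2))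

/-- Small ball property. -/
structure FEAT3 (C c η : ℝ) (μ : Measure V) (ν : Measure Z)
    (φ : EuclideanSpace ℝ (Fin d) → V → Z → ℝ) (x : Fin n → EuclideanSpace ℝ (Fin d)) :
    Prop where
  pow_le : (n : ℝ) ^ (-C) ≤ η
  le_one : η ≤ 1
  smallBall : ∀ u v : EuclideanSpace ℝ (Fin n), ‖u‖ = 1 → ‖v‖ = 1 →
    c ≤ (featureLaw μ ν n).real {p | η ≤ |inner ℝ u (whitened μ ν φ x p)| ∧
      η ≤ |inner ℝ v (whitened μ ν φ x p)|}

/-- Negative moments: `E |⟨v, ψ_n⟩|^r ≤ C_r η^r` for `-1 < r < 0`, where `0^r = ∞`. -/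
def FEAT3' (Cr : ℝ → ℝ) (η : ℝ) (μ : Measure V) (ν : Measure Z)
    (φ : EuclideanSpace ℝ (Fin d) → V → Z → ℝ) (x : Fin n → EuclideanSpace ℝ (Fin d)) : Prop :=
  ∀ r : ℝ, -1 < r → r < 0 → ∀ v : EuclideanSpace ℝ (Fin n), ‖v‖ = 1 →
    ∫⁻ p, (ENNReal.ofReal |inner ℝ v (whitened μ ν φ x p)|) ^ r ∂(featureLaw μ ν n) ≤
      ENNReal.ofReal (Cr r * η ^ r)

/-! ### Dual problems and predictors -/

/-- The infinite-width dual objective `F`. -/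
def dualInf (ρ : ℝ → ℝ) (μ : Measure V) (ν : Measure Z)
    (φ : EuclideanSpace ℝ (Fin d) → V → Z → ℝ) (x : Fin n → EuclideanSpace ℝ (Fin d))
    (y lam : EuclideanSpace ℝ (Fin n)) : ℝ :=
  inner ℝ lam y -
    ∫ w, ∫ z, conjugate ρ (inner ℝ (featureVec φ x (w, z)) lam) ∂(Measure.pi fun _ => ν) ∂μ

/-- The finite-width dual objective `F_N`. -/
def dualFin (ρ : ℝ → ℝ) (φ : EuclideanSpace ℝ (Fin d) → V → Z → ℝ)
    (x : Fin n → EuclideanSpace ℝ (Fin d)) (y : EuclideanSpace ℝ (Fin n))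
    (ω : Fin N → V × (Fin n → Z)) (lam : EuclideanSpace ℝ (Fin n)) : ℝ :=
  inner ℝ lam y - (1 / (N : ℝ)) * ∑ j, conjugate ρ (inner ℝ (featureVec φ x (ω j)) lam)

/-- The infinite-width predictor `f̂(· ; λ)`. -/
def predictorInf (ρ : ℝ → ℝ) (μ : Measure V) (ν : Measure Z)
    (φ : EuclideanSpace ℝ (Fin d) → V → Z → ℝ) (x : Fin n → EuclideanSpace ℝ (Fin d))
    (lam : EuclideanSpace ℝ (Fin n)) (u : EuclideanSpace ℝ (Fin d)) : ℝ :=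
  ∫ w, avgFeature ν φ u w *
    ∫ z, link ρ (inner ℝ (featureVec φ x (w, z)) lam) ∂(Measure.pi fun _ => ν) ∂μ

/-- The finite-width predictor `f̂_N(· ; λ)`. -/
def predictorFin (ρ : ℝ → ℝ) (ν : Measure Z)
    (φ : EuclideanSpace ℝ (Fin d) → V → Z → ℝ) (x : Fin n → EuclideanSpace ℝ (Fin d))
    (ω : Fin N → V × (Fin n → Z)) (lam : EuclideanSpace ℝ (Fin n))
    (u : EuclideanSpace ℝ (Fin d)) : ℝ :=
  (1 / (N : ℝ)) * ∑ j, avgFeature ν φ u (ω j).1 * link ρ (inner ℝ (featureVec φ x (ω j)) lam)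

/-- `a` is the arg max of `F`: it is a global maximizer, and the only one. -/
def IsArgMax {α : Type*} (F : α → ℝ) (a : α) : Prop :=
  (∀ b, F b ≤ F a) ∧ ∀ a', (∀ b, F b ≤ F a') → a' = a

/-- The factor `M(δ, τ, η)`, with `Cδ` the value of `C''(δ)`. -/
def boundFactor (Q₁ Q₂ q₁ q₂ Cδ δ τ η : ℝ) : ℝ :=
  Cδ * (τ ^ (max Q₁ Q₂ + 2 + max (2 - min q₁ q₂ + δ) 0) / η ^ max (max q₁ q₂) 3) *
    max (τ ^ (max Q₁ Q₂ - 2)) (η ^ (min Q₁ Q₂ - 2))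

/-- The rate `√(n log N / N) ∨ (n log N)^{Q/2} / N`. -/
def rate (Q : ℝ) (n N : ℕ) : ℝ :=
  max (√((n : ℝ) * Real.log N / N)) (((n : ℝ) * Real.log N) ^ (Q / 2) / N)

end RandomFeatures

end

namespace RandomFeatures

open Set Filter Topology

/-! ### The convex conjugate -/

section Conjugate

variable {ρ : ℝ → ℝ}

/-! Substitute `λ = K_n^{-1/2} θ` and put `b = K_n^{-1/2} y`. The small ball property makes
`K_n^{-1/2}` injective, so both duals become problems in `θ` with linear term `b` and isotropic
sub-Gaussian features `ψ`. The population maximizer is `θ = α u` with `‖u‖ = 1` (if `θ = 0` then `b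
= 0` and there is nothing to estimate). The growth bounds make `s` behave like a homogeneous
function, so near `θ` everything is measured in units of `|s(α)|`. Stationarity in the direction `u`
bounds `|s(α)|` by a multiple of `τ^{(2-q'+δ)_+} ‖b‖` (`one_le_mul_integral_min`,
`WhitenedFeature.link_le`); this is the only place where `δ` enters.

Let `p = n log N` and `r = √(p/N) + p^{(Q∨2)/2}/N`. Outside an event of probability `O(exp(-p)) =
O(N^{-n})` three things hold. The gradient `g` of the empirical dual at `α u` has norm at most `G`,
of order `|s(α)| τ^Q r` (`gradient_event`). The empirical predictor at `α u` is within the same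
order of the population predictor in `L²(P)` (`predictor_event`). Finally the empirical dual is
curved: a fixed fraction of the samples has `|⟨u, ψ_j⟩|` in `[η, 1 + 2/c]` and, for every unit `v`
at once, many of them have `|⟨v, ψ_j⟩| ≥ η/2` (`count_event`), so moving from `α u` to `α (u + D v)`
costs at least `L D min(D, 1)` with `L` of order `|s(α)| η^{q∨2}` (`empirical_lower`). The first two
rest on `concentration`: a polynomial of sub-Gaussian variables is truncated at a level proportional
to `p`, the bounded part has exponential moments, the tail has an exponentially small second moment.
Uniformity over directions comes from nets of the sphere; the `L²(P)` norm over covariates is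
handled by averaging exponential moments, without any net.

The width conditions force `G < L`. Concavity then locates the empirical maximizer at `α (u + D v)`
with `D ≤ G/L`, and bounds the average of the Bregman terms `e_j = (s(α X'_j) - s(α X_j)) (X'_j -
X_j)` by `G²/L`, where `X_j = ⟨u, ψ_j⟩` and `X'_j = X_j + D ⟨v, ψ_j⟩` (`exists_empirical_isArgMax`).

It remains to compare predictors, that is, to average increments of `s`, whose derivative may blow
up at the origin or grow at infinity. With a cutoff `t = √(p/N)`, each increment is at most
`√(|s(α)| e_j W_j) + |s(α)| t W_j` up to constants, where `W_j` is the sum of a negative power of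
`max |X_j| t` and a nonnegative power of `max |X'_j| |X_j|` (`abs_increment_le`). By Cauchy–Schwarz
the squared error is of order `(|s(α)| G²/L + |s(α)|² t² U) U`, with `U` a bound on the average of
`(1 + a²) W`. The negative power involves only the fixed direction `u`, so negative moments in one
direction suffice (`weight_event`); the positive power involves the random direction `v` and uses
moments uniform over the sphere (`moment_event`). -/

theorem rightDeriv_subgradient {f : ℝ → ℝ} (hf : ConvexOn ℝ univ f) (x y : ℝ) :
    f x + derivWithin f (Ioi x) x * (y - x) ≤ f y := by
  have hx : x ∈ interior (univ : Set ℝ) := by simp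
  rcases lt_trichotomy x y with h | h | h
  · have := hf.rightDeriv_le_slope_of_mem_interior hx (mem_univ y) h
    rw [slope_def_field, le_div_iff₀ (sub_pos.2 h)] at this
    linarith
  · simp [h]
  · have h1 := hf.slope_le_leftDeriv_of_mem_interior (mem_univ y) hx h
    have h2 := hf.leftDeriv_le_rightDeriv_of_mem_interior hx
    have := h1.trans h2
    rw [slope_def_field, div_le_iff₀ (sub_pos.2 h)] at this
    linarith

theorem leftDeriv_subgradient {f : ℝ → ℝ} (hf : ConvexOn ℝ univ f) (x y : ℝ) :
    f x + derivWithin f (Iio x) x * (y - x) ≤ f y := by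
  have hx : x ∈ interior (univ : Set ℝ) := by simp
  rcases lt_trichotomy x y with h | h | h
  · have h1 := hf.rightDeriv_le_slope_of_mem_interior hx (mem_univ y) h
    have h2 := hf.leftDeriv_le_rightDeriv_of_mem_interior hx
    have := h2.trans h1
    rw [slope_def_field, le_div_iff₀ (sub_pos.2 h)] at this
    linarith
  · simp [h]
  · have := hf.slope_le_leftDeriv_of_mem_interior (mem_univ y) hx h
    rw [slope_def_field, div_le_iff₀ (sub_pos.2 h)] at this
    linarith

theorem mul_sub_le_conjugate (hfin : ∀ t : ℝ, BddAbove (range fun y : ℝ => t * y - ρ y))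
    (t y : ℝ) : t * y - ρ y ≤ conjugate ρ t :=
  le_ciSup (hfin t) y

theorem convexOn_conjugate (hfin : ∀ t : ℝ, BddAbove (range fun y : ℝ => t * y - ρ y)) :
    ConvexOn ℝ univ (conjugate ρ) := by
  refine ⟨convex_univ, fun a _ b _ p q hp hq hpq => ?_⟩
  refine ciSup_le fun y => ?_
  have h1 := mul_le_mul_of_nonneg_left (mul_sub_le_conjugate hfin a y) hp
  have h2 := mul_le_mul_of_nonneg_left (mul_sub_le_conjugate hfin b y) hq
  have h3 : (p + q) * ρ y = ρ y := by rw [hpq, one_mul]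
  simp only [smul_eq_mul]
  nlinarith

/-- A subgradient of the conjugate at `t` attains the supremum that defines it. -/
theorem conjugate_eq_of_subgradient (hρ : ConvexOn ℝ univ ρ)
    (hfin : ∀ t : ℝ, BddAbove (range fun y : ℝ => t * y - ρ y)) {t r : ℝ}
    (h : ∀ t', conjugate ρ t + r * (t' - t) ≤ conjugate ρ t') :
    conjugate ρ t = t * r - ρ r := by
  refine le_antisymm ?_ (mul_sub_le_conjugate hfin t r)
  -- For a subgradient `m` of `ρ` at `r`, the point `r` maximizes `m y - ρ y`, hence `ρ*(m) ≤ m r -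
  -- ρ r`. Evaluating the hypothesis at `t' = m` transports this bound to `t`.
  set m := derivWithin ρ (Ioi r) r
  have hm : conjugate ρ m ≤ m * r - ρ r := by
    refine ciSup_le fun y => ?_
    have := rightDeriv_subgradient hρ r y
    linarith
  have := h m
  linarith

theorem eq_of_attains (hρ : StrictConvexOn ℝ univ ρ)
    (hfin : ∀ t : ℝ, BddAbove (range fun y : ℝ => t * y - ρ y)) {t r r' : ℝ}
    (h : conjugate ρ t = t * r - ρ r) (h' : conjugate ρ t = t * r' - ρ r') : r = r' := by
  by_contra hne
  have h1 : ρ ((1 / 2 : ℝ) • r + (1 / 2 : ℝ) • r') < (1 / 2 : ℝ) • ρ r + (1 / 2 : ℝ) • ρ r' :=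
    hρ.2 (mem_univ r) (mem_univ r') hne (by norm_num) (by norm_num) (by norm_num)
  have h2 := mul_sub_le_conjugate hfin t ((1 / 2 : ℝ) • r + (1 / 2 : ℝ) • r')
  simp only [smul_eq_mul] at h1 h2
  nlinarith

/-- The left and right derivatives of the convex function `ρ*` are both subgradients, so both attain
the supremum that defines `ρ*(t)`. Strict convexity of `ρ` allows only one maximizer, so they
coincide. -/
theorem hasDerivAt_conjugate (hρ : StrictConvexOn ℝ univ ρ)
    (hfin : ∀ t : ℝ, BddAbove (range fun y : ℝ => t * y - ρ y)) (t : ℝ) :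
    HasDerivAt (conjugate ρ) (link ρ t) t := by
  have hc := convexOn_conjugate hfin
  have ht : t ∈ interior (univ : Set ℝ) := by simp
  have hr := conjugate_eq_of_subgradient hρ.convexOn hfin (rightDeriv_subgradient hc t)
  have hl := conjugate_eq_of_subgradient hρ.convexOn hfin (leftDeriv_subgradient hc t)
  have heq := eq_of_attains hρ hfin hr hl
  have h1 := (hc.hasDerivWithinAt_rightDeriv_of_mem_interior ht).Ici_of_Ioi
  have h2 := (hc.hasDerivWithinAt_leftDeriv_of_mem_interior ht).Iic_of_Iio
  rw [← heq] at h2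
  have h3 := h2.union h1
  rw [Iic_union_Ici, hasDerivWithinAt_univ] at h3
  exact h3.differentiableAt.hasDerivAt

theorem conjugate_add_link_mul_le (hρ : StrictConvexOn ℝ univ ρ)
    (hfin : ∀ t : ℝ, BddAbove (range fun y : ℝ => t * y - ρ y)) (t t' : ℝ) :
    conjugate ρ t + link ρ t * (t' - t) ≤ conjugate ρ t' := by
  have h := rightDeriv_subgradient (convexOn_conjugate hfin) t t'
  rwa [(hasDerivAt_conjugate hρ hfin t).hasDerivWithinAt.derivWithin
    (uniqueDiffWithinAt_Ioi t)] at h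

theorem conjugate_eq_link (hρ : StrictConvexOn ℝ univ ρ)
    (hfin : ∀ t : ℝ, BddAbove (range fun y : ℝ => t * y - ρ y)) (t : ℝ) :
    conjugate ρ t = t * link ρ t - ρ (link ρ t) :=
  conjugate_eq_of_subgradient hρ.convexOn hfin (conjugate_add_link_mul_le hρ hfin t)

theorem monotone_link (hρ : StrictConvexOn ℝ univ ρ)
    (hfin : ∀ t : ℝ, BddAbove (range fun y : ℝ => t * y - ρ y)) : Monotone (link ρ) := by
  intro a b hab
  rcases hab.eq_or_lt with rfl | hab
  · exact le_rfl
  have h1 := conjugate_add_link_mul_le hρ hfin a b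
  have h2 := conjugate_add_link_mul_le hρ hfin b a
  by_contra! h
  nlinarith

theorem continuous_conjugate (hρ : StrictConvexOn ℝ univ ρ)
    (hfin : ∀ t : ℝ, BddAbove (range fun y : ℝ => t * y - ρ y)) : Continuous (conjugate ρ) :=
  continuous_iff_continuousAt.2 fun t => (hasDerivAt_conjugate hρ hfin t).continuousAt

theorem link_zero (hρ : StrictConvexOn ℝ univ ρ)
    (hfin : ∀ t : ℝ, BddAbove (range fun y : ℝ => t * y - ρ y)) (hmin : ∀ t, ρ 0 ≤ ρ t) :
    link ρ 0 = 0 := by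
  refine eq_of_attains hρ hfin (conjugate_eq_link hρ hfin 0) (le_antisymm (ciSup_le fun y => ?_)
    (mul_sub_le_conjugate hfin 0 0))
  have := hmin y
  linarith

/-- Testing the supremum at `±M` gives linear growth of arbitrary slope. This is what makes the dual
coercive whatever the size of its linear term. -/
theorem mul_abs_sub_le_conjugate (hfin : ∀ t : ℝ, BddAbove (range fun y : ℝ => t * y - ρ y))
    (M t : ℝ) : M * |t| - max (ρ M) (ρ (-M)) ≤ conjugate ρ t := by
  rcases le_total 0 t with h | h
  · have := mul_sub_le_conjugate hfin t M
    rw [abs_of_nonneg h]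
    linarith [le_max_left (ρ M) (ρ (-M))]
  · have := mul_sub_le_conjugate hfin t (-M)
    rw [abs_of_nonpos h]
    linarith [le_max_right (ρ M) (ρ (-M))]

end Conjugate

/-! ### Increments of the link function -/

/-- An almost everywhere bound on the derivative can be integrated because a locally Lipschitz
function is Lipschitz, hence absolutely continuous, on a compact interval. -/
theorem increment_le_of_deriv_le {f : ℝ → ℝ} {a b m : ℝ} (hab : a ≤ b)
    (hf : LocallyLipschitzOn (Icc a b) f) (h : ∀ᵐ t, t ∈ Icc a b → deriv f t ≤ m) :
    f b - f a ≤ m * (b - a) := by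
  obtain ⟨K, hK⟩ := hf.exists_lipschitzOnWith_of_compact isCompact_Icc
  have hac : AbsolutelyContinuousOnInterval f a b :=
    LipschitzOnWith.absolutelyContinuousOnInterval (by rwa [uIcc_of_le hab])
  rw [← hac.integral_deriv_eq_sub]
  calc ∫ x in a..b, deriv f x ≤ ∫ _ in a..b, m := by
        refine intervalIntegral.integral_mono_ae_restrict hab hac.intervalIntegrable_deriv (by simp) ?_
        exact (ae_restrict_iff' measurableSet_Icc).2 h
    _ = m * (b - a) := by simp [mul_comm]

theorem le_increment_of_le_deriv {f : ℝ → ℝ} {a b m : ℝ} (hab : a ≤ b)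
    (hf : LocallyLipschitzOn (Icc a b) f) (h : ∀ᵐ t, t ∈ Icc a b → m ≤ deriv f t) :
    m * (b - a) ≤ f b - f a := by
  obtain ⟨K, hK⟩ := hf.exists_lipschitzOnWith_of_compact isCompact_Icc
  have hac : AbsolutelyContinuousOnInterval f a b :=
    LipschitzOnWith.absolutelyContinuousOnInterval (by rwa [uIcc_of_le hab])
  rw [← hac.integral_deriv_eq_sub]
  calc m * (b - a) = ∫ _ in a..b, m := by simp [mul_comm]
    _ ≤ ∫ x in a..b, deriv f x := by
        refine intervalIntegral.integral_mono_ae_restrict hab (by simp) hac.intervalIntegrable_deriv ?_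
        exact (ae_restrict_iff' measurableSet_Icc).2 h

theorem rpow_le_rpow_neg_add_rpow {x e β γ : ℝ} (hx : 0 < x) (h1 : -β ≤ e) (h2 : e ≤ γ) :
    x ^ e ≤ x ^ (-β) + x ^ γ := by
  rcases le_total x 1 with h | h
  · exact (Real.rpow_le_rpow_of_exponent_ge hx h h1).trans (le_add_of_nonneg_right (by positivity))
  · exact (Real.rpow_le_rpow_of_exponent_le h h2).trans (le_add_of_nonneg_left (by positivity))

namespace PEN

variable {C c Q₁ Q₂ q₁ q₂ : ℝ} {ρ : ℝ → ℝ}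

theorem hasDerivAt (hp : PEN C c Q₁ Q₂ q₁ q₂ ρ) (t : ℝ) :
    HasDerivAt (conjugate ρ) (link ρ t) t :=
  hasDerivAt_conjugate hp.strictConvex hp.conjugate_finite t

theorem continuous (hp : PEN C c Q₁ Q₂ q₁ q₂ ρ) : Continuous (conjugate ρ) :=
  continuous_conjugate hp.strictConvex hp.conjugate_finite

theorem monotone (hp : PEN C c Q₁ Q₂ q₁ q₂ ρ) : Monotone (link ρ) :=
  monotone_link hp.strictConvex hp.conjugate_finite

theorem link_zero (hp : PEN C c Q₁ Q₂ q₁ q₂ ρ) : link ρ 0 = 0 :=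
  RandomFeatures.link_zero hp.strictConvex hp.conjugate_finite hp.minimized

theorem subgradient (hp : PEN C c Q₁ Q₂ q₁ q₂ ρ) (t t' : ℝ) :
    conjugate ρ t + link ρ t * (t' - t) ≤ conjugate ρ t' :=
  conjugate_add_link_mul_le hp.strictConvex hp.conjugate_finite t t'

theorem mul_link_eq_abs (hp : PEN C c Q₁ Q₂ q₁ q₂ ρ) (t : ℝ) :
    t * link ρ t = |t| * |link ρ t| := by
  rw [← abs_mul, abs_of_nonneg]
  rcases le_total 0 t with h | h
  · have := hp.monotone h
    rw [hp.link_zero] at this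
    exact mul_nonneg h this
  · have := hp.monotone h
    rw [hp.link_zero] at this
    exact mul_nonneg_of_nonpos_of_nonpos h this

/-- A single zero away from the origin would force `s = 0` everywhere by the upper growth bound;
then `ρ*` would be bounded above, against its linear growth. The number `|s(α)|` can therefore serve
as a unit of scale. -/
theorem link_ne_zero (hp : PEN C c Q₁ Q₂ q₁ q₂ ρ) {t : ℝ} (ht : t ≠ 0) : link ρ t ≠ 0 := by
  intro h0
  have hz : ∀ t', link ρ t' = 0 := by
    intro t'
    rcases eq_or_ne t' 0 with rfl | h'
    · exact hp.link_zero
    · have := (hp.bounds t' t h' ht).2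
      rw [h0] at this
      simpa using this
  have hconst : ∀ t', conjugate ρ t' ≤ conjugate ρ 0 := by
    intro t'
    have := hp.subgradient t' 0
    rw [hz] at this
    linarith
  have h1 := mul_abs_sub_le_conjugate hp.conjugate_finite 1
    (conjugate ρ 0 + max (ρ 1) (ρ (-1)) + 1)
  have h2 := hconst (conjugate ρ 0 + max (ρ 1) (ρ (-1)) + 1)
  have h3 := le_abs_self (conjugate ρ 0 + max (ρ 1) (ρ (-1)) + 1)
  linarith

theorem abs_link_le (hp : PEN C c Q₁ Q₂ q₁ q₂ ρ) (hC : 0 < C)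
    {α : ℝ} (hα : 0 < α) (r : ℝ) :
    |link ρ (α * r)| ≤ C * |link ρ α| * max (|r| ^ (Q₁ - 1)) (|r| ^ (Q₂ - 1)) := by
  rcases eq_or_ne r 0 with rfl | hr
  · rw [mul_zero, hp.link_zero, abs_zero]
    positivity
  · have := (hp.bounds (α * r) α (by positivity) hα.ne').2
    rwa [mul_div_cancel_left₀ _ hα.ne'] at this

theorem le_abs_link (hp : PEN C c Q₁ Q₂ q₁ q₂ ρ) (hq₁ : 1 < q₁) (hq₂ : 1 < q₂)
    {α : ℝ} (hα : 0 < α) (r : ℝ) :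
    c * |link ρ α| * min (|r| ^ (q₁ - 1)) (|r| ^ (q₂ - 1)) ≤ |link ρ (α * r)| := by
  rcases eq_or_ne r 0 with rfl | hr
  · rw [abs_zero, Real.zero_rpow (by linarith), Real.zero_rpow (by linarith)]
    simp
  · have := (hp.bounds (α * r) α (by positivity) hα.ne').1
    rwa [mul_div_cancel_left₀ _ hα.ne'] at this

/-- Increments of the link function on an interval that stays away from the origin. -/
theorem increment_upper_away (hp : PEN C c Q₁ Q₂ q₁ q₂ ρ) (hC : 0 < C) (hQ₁ : 1 < Q₁)
    (hQ₂ : 1 < Q₂) {α : ℝ} (hα : 0 < α) {r r' M : ℝ} (hM : 0 < M) (h : r' ≤ r)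
    (hx : ∀ x ∈ Icc r' r, M / 2 ≤ |x| ∧ |x| ≤ M) :
    link ρ (α * r) - link ρ (α * r') ≤
      2 * C * |link ρ α| * (r - r') *
        (M ^ (-max (2 - min Q₁ Q₂) 0) + M ^ max (max Q₁ Q₂ - 2) 0) := by
  set β := max (2 - min Q₁ Q₂) 0
  set γ := max (max Q₁ Q₂ - 2) 0
  have hβ0 : 0 ≤ β := le_max_right _ _
  have hγ0 : 0 ≤ γ := le_max_right _ _
  have hβ1 : β ≤ 1 := max_le (by have := lt_min hQ₁ hQ₂; linarith) zero_le_one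
  have hsub : Icc (α * r') (α * r) ⊆ ({0}ᶜ : Set ℝ) := by
    intro t ht h0
    rw [mem_singleton_iff] at h0
    subst h0
    have := (hx 0 ⟨by have := ht.1; nlinarith, by have := ht.2; by_contra! hr; nlinarith⟩).1
    rw [abs_zero] at this
    linarith
  have key := increment_le_of_deriv_le (f := link ρ) (a := α * r') (b := α * r)
    (m := C * |link ρ α / α| * (2 * (M ^ (-β) + M ^ γ)))
    (mul_le_mul_of_nonneg_left h hα.le) (hp.locallyLipschitz.mono hsub) ?_
  · refine key.trans_eq ?_
    rw [abs_div, abs_of_pos hα]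
    field_simp
  · filter_upwards [hp.deriv_bounds] with t ht hmem
    have ht0 : t ≠ 0 := fun h0 => hsub hmem h0
    refine (ht α ht0 hα.ne').2.trans (mul_le_mul_of_nonneg_left ?_ (by positivity))
    have hxt := hx (t / α) ⟨by rw [le_div_iff₀ hα]; linarith [hmem.1],
      by rw [div_le_iff₀ hα]; linarith [hmem.2]⟩
    set x := |t / α|
    have hx0 : 0 < x := by linarith [hxt.1]
    -- Halving the argument costs a factor `2 ^ β ≤ 2`, since `β ≤ 1`.
    have h1 : x ^ (-β) ≤ 2 * M ^ (-β) := by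
      calc x ^ (-β) ≤ (M / 2) ^ (-β) :=
            Real.rpow_le_rpow_of_nonpos (by positivity) hxt.1 (by linarith)
        _ = 2 ^ β * M ^ (-β) := by
            rw [Real.div_rpow hM.le zero_le_two, Real.rpow_neg zero_le_two]
            field_simp
        _ ≤ 2 ^ (1 : ℝ) * M ^ (-β) := by
            gcongr
            norm_num
        _ = 2 * M ^ (-β) := by rw [Real.rpow_one]
    have h2 : x ^ γ ≤ 2 * M ^ γ := by
      have : x ^ γ ≤ M ^ γ := Real.rpow_le_rpow hx0.le hxt.2 hγ0
      have : 0 ≤ M ^ γ := by positivity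
      linarith
    refine (max_le (rpow_le_rpow_neg_add_rpow hx0 (β := β) (γ := γ) ?_ ?_)
      (rpow_le_rpow_neg_add_rpow hx0 (β := β) (γ := γ) ?_ ?_)).trans (by linarith)
    · linarith [le_max_left (2 - min Q₁ Q₂) 0, min_le_left Q₁ Q₂]
    · linarith [le_max_left (max Q₁ Q₂ - 2) 0, le_max_left Q₁ Q₂]
    · linarith [le_max_left (2 - min Q₁ Q₂) 0, min_le_right Q₁ Q₂]
    · linarith [le_max_left (max Q₁ Q₂ - 2) 0, le_max_right Q₁ Q₂]

theorem abs_link_le_mul (hp : PEN C c Q₁ Q₂ q₁ q₂ ρ) (hC : 0 < C) (hQ₁ : 1 < Q₁) (hQ₂ : 1 < Q₂)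
    {α : ℝ} (hα : 0 < α) {r M : ℝ} (hM : 0 < M) (hr : |r| ≤ M) :
    |link ρ (α * r)| ≤ C * |link ρ α| * (M *
        (M ^ (-max (2 - min Q₁ Q₂) 0) + M ^ max (max Q₁ Q₂ - 2) 0)) := by
  refine (hp.abs_link_le hC hα r).trans (mul_le_mul_of_nonneg_left ?_ (by positivity))
  have key : ∀ Q, 1 < Q → min Q₁ Q₂ ≤ Q → Q ≤ max Q₁ Q₂ → |r| ^ (Q - 1) ≤ M *
        (M ^ (-max (2 - min Q₁ Q₂) 0) + M ^ max (max Q₁ Q₂ - 2) 0) := by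
    intro Q hQ h1 h2
    calc |r| ^ (Q - 1) ≤ M ^ (Q - 1) := Real.rpow_le_rpow (abs_nonneg _) hr (by linarith)
      _ = M * M ^ (Q - 2) := by
          rw [show Q - 1 = 1 + (Q - 2) by ring, Real.rpow_add hM, Real.rpow_one]
      _ ≤ _ := by
          refine mul_le_mul_of_nonneg_left (rpow_le_rpow_neg_add_rpow hM ?_ ?_) hM.le
          · linarith [le_max_left (2 - min Q₁ Q₂) 0]
          · linarith [le_max_left (max Q₁ Q₂ - 2) 0]
  exact max_le (key _ hQ₁ (min_le_left _ _) (le_max_left _ _))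
    (key _ hQ₂ (min_le_right _ _) (le_max_right _ _))

/-- If `|r - r'| ≥ M / 2`, the two values are bounded separately and `M` is absorbed into `|r -
r'|`. Otherwise every point between `r'` and `r` is within `M / 2` of the endpoint of modulus `M`,
so the interval avoids the origin and the derivative bound can be integrated. -/
theorem increment_upper (hp : PEN C c Q₁ Q₂ q₁ q₂ ρ) (hC : 0 < C) (hQ₁ : 1 < Q₁)
    (hQ₂ : 1 < Q₂) {α : ℝ} (hα : 0 < α) {r r' M : ℝ} (hM : 0 < M) (hMdef : M = max |r| |r'|) :
    |link ρ (α * r) - link ρ (α * r')| ≤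
      4 * C * |link ρ α| * |r - r'| *
        (M ^ (-max (2 - min Q₁ Q₂) 0) + M ^ max (max Q₁ Q₂ - 2) 0) := by
  wlog h : r' ≤ r generalizing r r'
  · rw [abs_sub_comm, abs_sub_comm r r']
    exact this (hMdef.trans (max_comm _ _)) (le_of_not_ge h)
  have hr : |r| ≤ M := hMdef ▸ le_max_left _ _
  have hr' : |r'| ≤ M := hMdef ▸ le_max_right _ _
  set B := M ^ (-max (2 - min Q₁ Q₂) 0) + M ^ max (max Q₁ Q₂ - 2) 0
  have hB : 0 ≤ B := by positivity
  have hs : 0 ≤ |link ρ α| := abs_nonneg _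
  rcases le_or_gt (M / 2) |r - r'| with hbig | hsmall
  · have h1 := hp.abs_link_le_mul hC hQ₁ hQ₂ hα hM hr
    have h2 := hp.abs_link_le_mul hC hQ₁ hQ₂ hα hM hr'
    calc |link ρ (α * r) - link ρ (α * r')| ≤ |link ρ (α * r)| + |link ρ (α * r')| := abs_sub _ _
      _ ≤ 4 * C * |link ρ α| * (M / 2) * B := by linarith
      _ ≤ _ := by gcongr
  · have hx : ∀ x ∈ Icc r' r, M / 2 ≤ |x| ∧ |x| ≤ M := by
      intro x hx
      rw [abs_of_nonneg (sub_nonneg.2 h)] at hsmall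
      refine ⟨?_, abs_le.2 ⟨(abs_le.1 hr').1.trans hx.1, hx.2.trans (abs_le.1 hr).2⟩⟩
      rcases max_choice |r| |r'| with hm | hm
      · have : |r| - |x| ≤ |r - x| := abs_sub_abs_le_abs_sub _ _
        rw [abs_of_nonneg (sub_nonneg.2 hx.2)] at this
        linarith [hx.1, hx.2]
      · have : |r'| - |x| ≤ |r' - x| := abs_sub_abs_le_abs_sub _ _
        rw [abs_of_nonpos (sub_nonpos.2 hx.1)] at this
        linarith [hx.1, hx.2]
    have h1 := hp.increment_upper_away hC hQ₁ hQ₂ hα hM h hx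
    rw [abs_of_nonneg (sub_nonneg.2 (hp.monotone (mul_le_mul_of_nonneg_left h hα.le))),
      abs_of_nonneg (sub_nonneg.2 h)]
    refine h1.trans ?_
    have : 0 ≤ C * |link ρ α| * (r - r') * B :=
      mul_nonneg (mul_nonneg (by positivity) (sub_nonneg.2 h)) hB
    change 2 * C * |link ρ α| * (r - r') * B ≤ _
    linarith

/-- Increments of the link function are bounded below away from the origin. -/
theorem increment_lower_away (hp : PEN C c Q₁ Q₂ q₁ q₂ ρ) (hc : 0 < c) (hq₁ : 1 < q₁)
    (hq₂ : 1 < q₂) {α : ℝ} (hα : 0 < α) {r r' η A : ℝ} (hη : 0 < η) (hη1 : η ≤ 1) (hA : 1 ≤ A)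
    (h : r' ≤ r) (hx : ∀ x ∈ Icc r' r, η / 2 ≤ |x| ∧ |x| ≤ A + 1) :
    c * |link ρ α| * ((η / 2) ^ max (max q₁ q₂ - 2) 0 / (A + 1)) * (r - r') ≤
      link ρ (α * r) - link ρ (α * r') := by
  set e := max (max q₁ q₂ - 2) 0
  have he : 0 ≤ e := le_max_right _ _
  have hsub : Icc (α * r') (α * r) ⊆ ({0}ᶜ : Set ℝ) := by
    intro t ht h0
    rw [mem_singleton_iff] at h0
    subst h0
    have := (hx 0 ⟨by have := ht.1; nlinarith, by have := ht.2; by_contra! hr; nlinarith⟩).1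
    rw [abs_zero] at this
    linarith
  have key := le_increment_of_le_deriv (f := link ρ) (a := α * r') (b := α * r)
    (m := c * |link ρ α / α| * ((η / 2) ^ e / (A + 1)))
    (mul_le_mul_of_nonneg_left h hα.le) (hp.locallyLipschitz.mono hsub) ?_
  · refine le_of_eq_of_le ?_ key
    rw [abs_div, abs_of_pos hα]
    field_simp
  · filter_upwards [hp.deriv_bounds] with t ht hmem
    have ht0 : t ≠ 0 := fun h0 => hsub hmem h0
    refine le_trans (mul_le_mul_of_nonneg_left ?_ (by positivity)) (ht α ht0 hα.ne').1
    have hxt := hx (t / α) ⟨by rw [le_div_iff₀ hα]; linarith [hmem.1],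
      by rw [div_le_iff₀ hα]; linarith [hmem.2]⟩
    set x := |t / α|
    have hx0 : 0 < x := by linarith [hxt.1]
    have hA1 : 0 < A + 1 := by linarith
    have hb1 : (η / 2) ^ e ≤ 1 := Real.rpow_le_one (by linarith) (by linarith) he
    -- For `q ≥ 2` the worst case is the smallest modulus `η / 2`, for `q < 2` the largest one, `A +
    -- 1`. In the second case `q > 1` keeps the exponent above `-1`, whence the divisor `A + 1`.
    have key : ∀ q, 1 < q → q ≤ max q₁ q₂ → (η / 2) ^ e / (A + 1) ≤ x ^ (q - 2) := by
      intro q hq hqm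
      rcases le_total 0 (q - 2) with h0 | h0
      · calc (η / 2) ^ e / (A + 1) ≤ (η / 2) ^ e := div_le_self (by positivity) (by linarith)
          _ ≤ (η / 2) ^ (q - 2) := Real.rpow_le_rpow_of_exponent_ge (by positivity) (by linarith)
              (le_max_of_le_left (by linarith))
          _ ≤ x ^ (q - 2) := Real.rpow_le_rpow (by positivity) hxt.1 h0
      · calc (η / 2) ^ e / (A + 1) ≤ 1 / (A + 1) := by gcongr
          _ = (A + 1) ^ (-1 : ℝ) := by rw [Real.rpow_neg_one, one_div]
          _ ≤ (A + 1) ^ (q - 2) := Real.rpow_le_rpow_of_exponent_le (by linarith) (by linarith)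
          _ ≤ x ^ (q - 2) := Real.rpow_le_rpow_of_nonpos hx0 hxt.2 h0
    exact le_min (key _ hq₁ (le_max_left _ _)) (key _ hq₂ (le_max_right _ _))

/-- Only the first stretch from `r'` towards `r`, of length `min |r - r'| (η / 2)`, is used: there
the modulus stays between `η / 2` and `A + 1` and the derivative is bounded below. Monotonicity
takes care of the rest, so the bound is quadratic for short displacements and linear for long ones.
-/
theorem increment_lower (hp : PEN C c Q₁ Q₂ q₁ q₂ ρ) (hc : 0 < c) (hq₁ : 1 < q₁)
    (hq₂ : 1 < q₂) {α : ℝ} (hα : 0 < α) {r r' η A : ℝ} (hη : 0 < η) (hη1 : η ≤ 1) (hA : 1 ≤ A)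
    (h1 : η ≤ |r'|) (h2 : |r'| ≤ A) :
    c * |link ρ α| * ((η / 2) ^ max (max q₁ q₂ - 2) 0 / (A + 1)) *
        (|r - r'| * min |r - r'| (η / 2)) ≤
      (link ρ (α * r) - link ρ (α * r')) * (r - r') := by
  set k := (η / 2) ^ max (max q₁ q₂ - 2) 0 / (A + 1)
  have hnear : ∀ x, |x - r'| ≤ η / 2 → η / 2 ≤ |x| ∧ |x| ≤ A + 1 := by
    intro x hx
    have h3 := abs_sub_abs_le_abs_sub r' x
    have h4 := abs_sub_abs_le_abs_sub x r'
    rw [abs_sub_comm] at h3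
    constructor <;> linarith
  set h' := min |r - r'| (η / 2)
  have hh0 : 0 ≤ h' := le_min (abs_nonneg _) (by linarith)
  rcases le_total r' r with h | h
  · have hle : r' + h' ≤ r := by
      have : h' ≤ |r - r'| := min_le_left _ _
      rw [abs_of_nonneg (sub_nonneg.2 h)] at this
      linarith
    have h3 := hp.increment_lower_away hc hq₁ hq₂ hα hη hη1 hA (r := r' + h') (r' := r')
      (by linarith) (fun x hx => hnear x (by
        rw [abs_of_nonneg (sub_nonneg.2 hx.1)]
        have : h' ≤ η / 2 := min_le_right _ _
        linarith [hx.2]))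
    have h4 := hp.monotone (mul_le_mul_of_nonneg_left hle hα.le)
    rw [abs_of_nonneg (sub_nonneg.2 h)]
    have h5 : c * |link ρ α| * k * h' ≤ link ρ (α * r) - link ρ (α * r') := by
      have : c * |link ρ α| * k * (r' + h' - r') ≤ _ := h3
      rw [add_sub_cancel_left] at this
      linarith
    nlinarith [mul_le_mul_of_nonneg_right h5 (sub_nonneg.2 h)]
  · have hle : r ≤ r' - h' := by
      have : h' ≤ |r - r'| := min_le_left _ _
      rw [abs_of_nonpos (sub_nonpos.2 h)] at this
      linarith
    have h3 := hp.increment_lower_away hc hq₁ hq₂ hα hη hη1 hA (r := r') (r' := r' - h')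
      (by linarith) (fun x hx => hnear x (by
        rw [abs_of_nonpos (sub_nonpos.2 hx.2)]
        have : h' ≤ η / 2 := min_le_right _ _
        linarith [hx.1]))
    have h4 := hp.monotone (mul_le_mul_of_nonneg_left hle hα.le)
    rw [abs_of_nonpos (sub_nonpos.2 h)]
    have h5 : c * |link ρ α| * k * h' ≤ link ρ (α * r') - link ρ (α * r) := by
      have : c * |link ρ α| * k * (r' - (r' - h')) ≤ _ := h3
      rw [sub_sub_cancel] at this
      linarith
    nlinarith [mul_le_mul_of_nonneg_right h5 (sub_nonneg.2 h)]

end PEN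

/-! ### Exponential moments of i.i.d. sums -/

section Probability

open ProbabilityTheory

theorem lintegral_exp_sum_pi {Ω : Type*} [MeasurableSpace Ω] (μ : Measure Ω)
    [IsProbabilityMeasure μ] (N : ℕ) {f : Ω → ℝ} (hf : Measurable f) :
    ∫⁻ ω : Fin N → Ω, ENNReal.ofReal (Real.exp (∑ j, f (ω j))) ∂(Measure.pi fun _ => μ) =
      (∫⁻ ω, ENNReal.ofReal (Real.exp (f ω)) ∂μ) ^ N := by
  have hg : Measurable fun ω => ENNReal.ofReal (Real.exp (f ω)) := by fun_prop
  have hind := iIndepFun_pi (ι := Fin N) (μ := fun _ => μ)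
    (X := fun _ ω => ENNReal.ofReal (Real.exp (f ω))) (fun _ => hg.aemeasurable)
  have := lintegral_prod_eq_prod_lintegral_of_indepFun Finset.univ _ hind
    (fun i => hg.comp (measurable_pi_apply i))
  calc _ = ∫⁻ ω : Fin N → Ω, ∏ j, ENNReal.ofReal (Real.exp (f (ω j)))
        ∂(Measure.pi fun _ => μ) := by
        refine lintegral_congr fun ω => ?_
        rw [Real.exp_sum, ENNReal.ofReal_prod_of_nonneg fun _ _ => (Real.exp_pos _).le]
    _ = ∏ j : Fin N, ∫⁻ ω : Fin N → Ω, ENNReal.ofReal (Real.exp (f (ω j)))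
        ∂(Measure.pi fun _ => μ) := this
    _ = ∏ _j : Fin N, ∫⁻ ω, ENNReal.ofReal (Real.exp (f ω)) ∂μ := by
        refine Finset.prod_congr rfl fun j _ => ?_
        exact (measurePreserving_eval (fun _ : Fin N => μ) j).lintegral_comp hg
    _ = _ := by simp

theorem lintegral_mean_pi {Ω : Type*} [MeasurableSpace Ω] (μ : Measure Ω)
    [IsProbabilityMeasure μ] {N : ℕ} (hN : 1 ≤ N) {f : Ω → ℝ} (hf : Measurable f)
    (h0 : ∀ ω, 0 ≤ f ω) :
    ∫⁻ ω : Fin N → Ω, ENNReal.ofReal ((1 / (N : ℝ)) * ∑ j, f (ω j)) ∂(Measure.pi fun _ => μ) =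
      ∫⁻ ω, ENNReal.ofReal (f ω) ∂μ := by
  have hN0 : (0 : ℝ) < N := by exact_mod_cast hN
  calc _ = ∫⁻ ω : Fin N → Ω, ENNReal.ofReal (1 / (N : ℝ)) * ∑ j, ENNReal.ofReal (f (ω j))
        ∂(Measure.pi fun _ => μ) := by
        refine lintegral_congr fun ω => ?_
        rw [ENNReal.ofReal_mul (by positivity), ENNReal.ofReal_sum_of_nonneg fun _ _ => h0 _]
    _ = ENNReal.ofReal (1 / (N : ℝ)) * ∑ _j : Fin N, ∫⁻ ω, ENNReal.ofReal (f ω) ∂μ := by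
        rw [lintegral_const_mul _ (by fun_prop), lintegral_finsetSum _ (by fun_prop)]
        congr 1
        refine Finset.sum_congr rfl fun j _ => ?_
        exact (measurePreserving_eval (fun _ : Fin N => μ) j).lintegral_comp
          (f := fun ω => ENNReal.ofReal (f ω)) (by fun_prop)
    _ = _ := by
        rw [Finset.sum_const, Finset.card_univ, Fintype.card_fin, nsmul_eq_mul, ← mul_assoc,
          ← ENNReal.ofReal_natCast, ← ENNReal.ofReal_mul (by positivity),
          one_div_mul_cancel hN0.ne', ENNReal.ofReal_one, one_mul]

theorem exp_le_one_add_add_sq_mul (u : ℝ) :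
    Real.exp u ≤ 1 + u + u ^ 2 * Real.exp |u| := by
  have h := Complex.norm_exp_sub_sum_le_norm_mul_exp (u : ℂ) 2
  simp only [Finset.sum_range_succ, Finset.sum_range_zero] at h
  norm_num at h
  have h2 : (Complex.exp u - (1 + u)) = ((Real.exp u - (1 + u) : ℝ) : ℂ) := by push_cast; rfl
  rw [h2, Complex.norm_real, Real.norm_eq_abs] at h
  linarith [le_abs_self (Real.exp u - (1 + u))]

/-- The second-order expansion leaves the mean of `U` intact in the exponent, so after centring only
`B` remains. -/
theorem lintegral_exp_le_of_sq_exp_le {Ω : Type*} [MeasurableSpace Ω] {μ : Measure Ω}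
    [IsProbabilityMeasure μ] {U h : Ω → ℝ} {B : ℝ} (hU : Integrable U μ) (hh : Integrable h μ)
    (hle : ∀ ω, U ω ^ 2 * Real.exp |U ω| ≤ h ω) (hB : ∫ ω, h ω ∂μ ≤ B) :
    ∫⁻ ω, ENNReal.ofReal (Real.exp (U ω)) ∂μ ≤
      ENNReal.ofReal (Real.exp (∫ ω, U ω ∂μ + B)) := by
  have hi : Integrable (fun ω => 1 + U ω + h ω) μ := ((integrable_const 1).add hU).add hh
  calc ∫⁻ ω, ENNReal.ofReal (Real.exp (U ω)) ∂μ
      ≤ ∫⁻ ω, ENNReal.ofReal (1 + U ω + h ω) ∂μ := by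
        refine lintegral_mono fun ω => ENNReal.ofReal_le_ofReal ?_
        exact (exp_le_one_add_add_sq_mul _).trans (by linarith [hle ω])
    _ = ENNReal.ofReal (∫ ω, (1 + U ω + h ω) ∂μ) := by
        refine (ofReal_integral_eq_lintegral_ofReal hi (ae_of_all _ fun ω => ?_)).symm
        exact ((Real.exp_pos _).le.trans (exp_le_one_add_add_sq_mul (U ω))).trans
          (by linarith [hle ω])
    _ ≤ _ := by
        refine ENNReal.ofReal_le_ofReal ?_
        rw [integral_add (by fun_prop) hh, integral_add (by fun_prop) hU]
        simp only [integral_const, probReal_univ, smul_eq_mul, mul_one]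
        have := Real.add_one_le_exp (∫ ω, U ω ∂μ + B)
        linarith

/-- Markov's inequality for the average over a parameter. -/
theorem measure_one_lt_lintegral_le {Ω X : Type*} [MeasurableSpace Ω] [MeasurableSpace X]
    {μ : Measure Ω} [SFinite μ] {P : Measure X} [IsProbabilityMeasure P] {g : X → Ω → ENNReal}
    (hg : Measurable (Function.uncurry g)) {M : ENNReal} (hM : ∀ᵐ x ∂P, ∫⁻ ω, g x ω ∂μ ≤ M) :
    μ {ω | 1 < ∫⁻ x, g x ω ∂P} ≤ M := by
  have hmeas : Measurable fun ω => ∫⁻ x, g x ω ∂P :=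
    Measurable.lintegral_prod_right' (f := fun z : Ω × X => g z.2 z.1)
      (hg.comp measurable_swap)
  calc μ {ω | 1 < ∫⁻ x, g x ω ∂P} ≤ ∫⁻ ω, ∫⁻ x, g x ω ∂P ∂μ := by
        have := meas_le_lintegral₀ (μ := μ) (s := {ω | 1 < ∫⁻ x, g x ω ∂P})
          hmeas.aemeasurable fun ω hω => le_of_lt hω
        exact this
    _ = ∫⁻ x, ∫⁻ ω, g x ω ∂μ ∂P :=
        lintegral_lintegral_swap (f := fun ω x => g x ω) (hg.comp measurable_swap).aemeasurable
    _ ≤ ∫⁻ _, M ∂P := lintegral_mono_ae hM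
    _ = M := by simp

/-- Beyond `t₀ ≥ 2` one has `|t| ≤ t₀ exp((|t| - t₀) / 2)`. An average of squares is thus controlled
by an average of exponentials recentred at `t₀`. -/
theorem sq_le_sq_mul_one_add_exp {t t₀ : ℝ} (h : 2 ≤ t₀) :
    t ^ 2 ≤ t₀ ^ 2 * (1 + Real.exp (|t| - t₀)) := by
  rcases le_total |t| t₀ with h1 | h1
  · have : t ^ 2 ≤ t₀ ^ 2 := by rw [← sq_abs]; gcongr
    have : 0 ≤ t₀ ^ 2 * Real.exp (|t| - t₀) := by positivity
    linarith
  · set u := |t| - t₀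
    have hu : 0 ≤ u := sub_nonneg.2 h1
    have h2 : |t| ≤ t₀ * Real.exp (u / 2) := by
      have := Real.add_one_le_exp (u / 2)
      nlinarith
    have h3 : t ^ 2 ≤ t₀ ^ 2 * Real.exp u := by
      calc t ^ 2 = |t| ^ 2 := (sq_abs t).symm
        _ ≤ (t₀ * Real.exp (u / 2)) ^ 2 := by gcongr
        _ = t₀ ^ 2 * Real.exp u := by
            rw [mul_pow, ← Real.exp_nat_mul]
            congr 2
            push_cast
            ring
    nlinarith [sq_nonneg t₀]

theorem le_mul_one_add_exp {t t₀ : ℝ} (h : 1 ≤ t₀) :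
    t ≤ t₀ * (1 + Real.exp (t - t₀)) := by
  have := Real.add_one_le_exp (t - t₀)
  nlinarith [Real.exp_pos (t - t₀)]

/-- The exponential moments are averaged over `x` by Tonelli before Markov's inequality is applied.
Bounds for each fixed `x` then control the `L²(P)` norm with the same exponential decay, and no
union over `x` is taken. -/
theorem measure_lt_lintegral_sq_le {Ω X : Type*} [MeasurableSpace Ω] [MeasurableSpace X]
    {μ : Measure Ω} [SFinite μ] {P : Measure X} [IsProbabilityMeasure P] {S : X → Ω → ℝ}
    (hS : Measurable (Function.uncurry S)) {M t₀ : ℝ} (ht₀ : 2 ≤ t₀)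
    (hM : ∀ᵐ x ∂P, ∫⁻ ω, ENNReal.ofReal (Real.exp |S x ω|) ∂μ ≤ ENNReal.ofReal M) :
    μ {ω | ENNReal.ofReal (2 * t₀ ^ 2) < ∫⁻ x, ENNReal.ofReal (S x ω ^ 2) ∂P} ≤
      ENNReal.ofReal (M * Real.exp (-t₀)) := by
  have hS' : Measurable fun z : X × Ω => S z.1 z.2 := hS
  have key := measure_one_lt_lintegral_le (μ := μ) (P := P)
    (g := fun x ω => ENNReal.ofReal (Real.exp (|S x ω| - t₀)))
    (M := ENNReal.ofReal (M * Real.exp (-t₀)))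
    (by change Measurable fun z : X × Ω => ENNReal.ofReal (Real.exp (|S z.1 z.2| - t₀))
        fun_prop) ?_
  · refine (measure_mono fun ω hω => ?_).trans key
    simp only [mem_ofPred_eq] at hω ⊢
    by_contra! hle
    refine absurd hω (not_lt.2 ?_)
    have hSω : Measurable fun x => S x ω := hS'.comp measurable_prodMk_right
    calc ∫⁻ x, ENNReal.ofReal (S x ω ^ 2) ∂P
        ≤ ∫⁻ x, ENNReal.ofReal (t₀ ^ 2) * (1 + ENNReal.ofReal (Real.exp (|S x ω| - t₀))) ∂P := by
          refine lintegral_mono fun x => ?_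
          rw [← ENNReal.ofReal_one, ← ENNReal.ofReal_add zero_le_one (Real.exp_pos _).le,
            ← ENNReal.ofReal_mul (by positivity)]
          exact ENNReal.ofReal_le_ofReal (sq_le_sq_mul_one_add_exp ht₀)
      _ = ENNReal.ofReal (t₀ ^ 2) * (1 + ∫⁻ x, ENNReal.ofReal (Real.exp (|S x ω| - t₀)) ∂P) := by
          rw [lintegral_const_mul _ (by fun_prop), lintegral_add_left (by fun_prop)]
          simp
      _ ≤ ENNReal.ofReal (t₀ ^ 2) * (1 + 1) := by gcongr
      _ = ENNReal.ofReal (2 * t₀ ^ 2) := by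
          rw [mul_comm 2, ENNReal.ofReal_mul (by positivity)]
          norm_num
  · filter_upwards [hM] with x hx
    have hSx : Measurable fun ω => S x ω := hS'.comp measurable_prodMk_left
    calc ∫⁻ ω, ENNReal.ofReal (Real.exp (|S x ω| - t₀)) ∂μ
        = ∫⁻ ω, ENNReal.ofReal (Real.exp |S x ω|) * ENNReal.ofReal (Real.exp (-t₀)) ∂μ := by
          refine lintegral_congr fun ω => ?_
          rw [← ENNReal.ofReal_mul (Real.exp_pos _).le, ← Real.exp_add, sub_eq_add_neg]
      _ = (∫⁻ ω, ENNReal.ofReal (Real.exp |S x ω|) ∂μ) * ENNReal.ofReal (Real.exp (-t₀)) :=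
          lintegral_mul_const _ (by fun_prop)
      _ ≤ ENNReal.ofReal M * ENNReal.ofReal (Real.exp (-t₀)) := by gcongr
      _ = _ := by rw [← ENNReal.ofReal_mul' (Real.exp_pos _).le]

theorem measure_lt_lintegral_le {Ω X : Type*} [MeasurableSpace Ω] [MeasurableSpace X]
    {μ : Measure Ω} [SFinite μ] {P : Measure X} [IsProbabilityMeasure P] {S : X → Ω → ℝ}
    (hS : Measurable (Function.uncurry S)) {M t₀ : ℝ} (ht₀ : 1 ≤ t₀)
    (hM : ∀ᵐ x ∂P, ∫⁻ ω, ENNReal.ofReal (Real.exp (S x ω)) ∂μ ≤ ENNReal.ofReal M) :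
    μ {ω | ENNReal.ofReal (2 * t₀) < ∫⁻ x, ENNReal.ofReal (S x ω) ∂P} ≤
      ENNReal.ofReal (M * Real.exp (-t₀)) := by
  have hS' : Measurable fun z : X × Ω => S z.1 z.2 := hS
  have key := measure_one_lt_lintegral_le (μ := μ) (P := P)
    (g := fun x ω => ENNReal.ofReal (Real.exp (S x ω - t₀)))
    (M := ENNReal.ofReal (M * Real.exp (-t₀)))
    (by change Measurable fun z : X × Ω => ENNReal.ofReal (Real.exp (S z.1 z.2 - t₀))
        fun_prop) ?_
  · refine (measure_mono fun ω hω => ?_).trans key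
    simp only [mem_ofPred_eq] at hω ⊢
    by_contra! hle
    refine absurd hω (not_lt.2 ?_)
    have hSω : Measurable fun x => S x ω := hS'.comp measurable_prodMk_right
    calc ∫⁻ x, ENNReal.ofReal (S x ω) ∂P
        ≤ ∫⁻ x, ENNReal.ofReal t₀ * (1 + ENNReal.ofReal (Real.exp (S x ω - t₀))) ∂P := by
          refine lintegral_mono fun x => ?_
          rw [← ENNReal.ofReal_one, ← ENNReal.ofReal_add zero_le_one (Real.exp_pos _).le,
            ← ENNReal.ofReal_mul (by positivity)]
          exact ENNReal.ofReal_le_ofReal (le_mul_one_add_exp ht₀)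
      _ = ENNReal.ofReal t₀ * (1 + ∫⁻ x, ENNReal.ofReal (Real.exp (S x ω - t₀)) ∂P) := by
          rw [lintegral_const_mul _ (by fun_prop), lintegral_add_left (by fun_prop)]
          simp
      _ ≤ ENNReal.ofReal t₀ * (1 + 1) := by gcongr
      _ = ENNReal.ofReal (2 * t₀) := by
          rw [mul_comm 2, ENNReal.ofReal_mul (by positivity)]
          norm_num
  · filter_upwards [hM] with x hx
    have hSx : Measurable fun ω => S x ω := hS'.comp measurable_prodMk_left
    calc ∫⁻ ω, ENNReal.ofReal (Real.exp (S x ω - t₀)) ∂μ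
        = ∫⁻ ω, ENNReal.ofReal (Real.exp (S x ω)) * ENNReal.ofReal (Real.exp (-t₀)) ∂μ := by
          refine lintegral_congr fun ω => ?_
          rw [← ENNReal.ofReal_mul (Real.exp_pos _).le, ← Real.exp_add, sub_eq_add_neg]
      _ = (∫⁻ ω, ENNReal.ofReal (Real.exp (S x ω)) ∂μ) * ENNReal.ofReal (Real.exp (-t₀)) :=
          lintegral_mul_const _ (by fun_prop)
      _ ≤ ENNReal.ofReal M * ENNReal.ofReal (Real.exp (-t₀)) := by gcongr
      _ = _ := by rw [← ENNReal.ofReal_mul' (Real.exp_pos _).le]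

theorem exists_rpow_le_mul_exp_mul_sq (a : ℝ) {b : ℝ} (hb : 0 < b) :
    ∃ A : ℝ, 0 < A ∧ ∀ z : ℝ, 0 ≤ z → (1 + z) ^ a ≤ A * Real.exp (b * z ^ 2) := by
  have hcont : Continuous fun z : ℝ => (1 + |z|) ^ a * Real.exp (-(b * z ^ 2)) := by
    refine Continuous.mul (Continuous.rpow_const (by fun_prop) fun z => Or.inl ?_) (by fun_prop)
    positivity
  have hlim : Tendsto (fun z : ℝ => (1 + z) ^ |a| * Real.exp (-(1 * (1 + z)))) atTop (𝓝 0) := by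
    have := (tendsto_rpow_mul_exp_neg_mul_atTop_nhds_zero |a| 1 one_pos).comp
      (tendsto_atTop_add_const_left atTop 1 tendsto_id)
    refine this.congr fun z => ?_
    simp only [Function.comp_apply, id_eq, neg_mul]
  obtain ⟨M, hM⟩ := (hlim.eventually (gt_mem_nhds (zero_lt_one))).exists_forall_of_atTop
  set M' := max (max M 0) (2 / b)
  refine ⟨(1 + M') ^ |a| + Real.exp 2, by positivity, fun z hz => ?_⟩
  have hM'0 : 0 ≤ M' := le_max_of_le_left (le_max_right _ _)
  have h1 : (1 + z) ^ a ≤ (1 + z) ^ |a| :=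
    Real.rpow_le_rpow_of_exponent_le (by linarith) (le_abs_self a)
  refine h1.trans ?_
  rcases le_total z M' with h | h
  · calc (1 + z) ^ |a| ≤ (1 + M') ^ |a| := by gcongr
      _ ≤ ((1 + M') ^ |a| + Real.exp 2) * 1 := by linarith [Real.exp_pos 2]
      _ ≤ _ := by
          gcongr
          exact Real.one_le_exp (by positivity)
  · have h2 := hM z (le_trans (le_trans (le_max_left _ _) (le_max_left _ _)) h)
    have h3 : (1 + z) ^ |a| ≤ Real.exp (1 + z) := by
      have : Real.exp (1 + z) * ((1 + z) ^ |a| * Real.exp (-(1 * (1 + z)))) ≤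
          Real.exp (1 + z) * 1 := by gcongr
      rw [mul_comm, mul_assoc, ← Real.exp_add] at this
      simpa using this
    have hbz : 2 ≤ b * z := by
      have : 2 / b ≤ z := le_trans (le_max_right _ _) h
      rwa [div_le_iff₀' hb] at this
    calc (1 + z) ^ |a| ≤ Real.exp (1 + z) := h3
      _ ≤ Real.exp (2 + b * z ^ 2) := by
          gcongr
          · norm_num
          · nlinarith
      _ = Real.exp 2 * Real.exp (b * z ^ 2) := Real.exp_add _ _
      _ ≤ _ := by
          gcongr
          have : 0 ≤ (1 + M') ^ |a| := by positivity
          linarith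

end Probability

/-! ### Concentration of averages of polynomials of sub-Gaussian variables -/

section Concentration

/-- The part of `Y` on which `Z ^ 2 ≤ L`. -/
noncomputable def truncation {Ω : Type*} (L : ℝ) (Y Z : Ω → ℝ) (ω : Ω) : ℝ :=
  {ω | Z ω ^ 2 ≤ L}.indicator Y ω

theorem measurable_truncation {Ω : Type*} [MeasurableSpace Ω] {L : ℝ} {Y Z : Ω → ℝ}
    (hY : Measurable Y) (hZ : Measurable Z) : Measurable (truncation L Y Z) :=
  hY.indicator (measurableSet_le (by fun_prop) measurable_const)

theorem rpow_two_mul_le {z Q C₀ : ℝ} (hz : 1 ≤ z)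
    (hC₀ : ∀ z : ℝ, 0 ≤ z → (1 + z) ^ (2 * Q) ≤ C₀ * Real.exp (1 / 2 * z ^ 2)) (hQ : 2 ≤ Q) :
    (z ^ Q) ^ 2 ≤ C₀ * Real.exp (z ^ 2 / 2) := by
  have h0 : 0 ≤ z := by linarith
  calc (z ^ Q) ^ 2 = z ^ (2 * Q) := by
        rw [← Real.rpow_natCast, ← Real.rpow_mul h0]; congr 1; push_cast; ring
    _ ≤ (1 + z) ^ (2 * Q) := Real.rpow_le_rpow h0 (by linarith) (by linarith)
    _ ≤ C₀ * Real.exp (1 / 2 * z ^ 2) := hC₀ z h0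
    _ = _ := by congr 2; ring

/-- Where `Z² ≤ L`, one has `Z^Q ≤ L^{(Q-2)/2} Z²`, so the condition on `l` brings the exponent down
to `Z² / 2`. This uses half of the available moment `E exp(Z²)`; the other half pays for the
quadratic prefactor in the second-order expansion. -/
theorem abs_truncation_le {Ω : Type*} {L T Q l : ℝ} {Y Z : Ω → ℝ} (hQ : 2 ≤ Q) (hT : 0 < T)
    (hZ1 : ∀ ω, 1 ≤ Z ω) (hle : ∀ ω, |Y ω| ≤ T * Z ω ^ Q) (hl : 0 ≤ l)
    (hl1 : l * T * L ^ ((Q - 2) / 2) ≤ 1 / 2) (ω : Ω) :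
    |l * truncation L Y Z ω| ≤ Z ω ^ 2 / 2 ∧ |l * truncation L Y Z ω| ≤ l * T * Z ω ^ Q := by
  have hz0 : 0 < Z ω := by linarith [hZ1 ω]
  by_cases h : Z ω ^ 2 ≤ L
  · have ht : truncation L Y Z ω = Y ω := indicator_of_mem (s := {ω | Z ω ^ 2 ≤ L}) h Y
    rw [ht, abs_mul, abs_of_nonneg hl]
    have h2 : l * |Y ω| ≤ l * T * Z ω ^ Q := by
      rw [mul_assoc]; exact mul_le_mul_of_nonneg_left (hle ω) hl
    refine ⟨h2.trans ?_, h2⟩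
    have h3 : Z ω ^ (Q - 2) ≤ L ^ ((Q - 2) / 2) := by
      calc Z ω ^ (Q - 2) = (Z ω ^ 2) ^ ((Q - 2) / 2) := by
            rw [← Real.rpow_natCast, ← Real.rpow_mul hz0.le]; congr 1; push_cast; ring
        _ ≤ _ := Real.rpow_le_rpow (by positivity) h (by linarith)
    have h4 : Z ω ^ Q = Z ω ^ (Q - 2) * Z ω ^ 2 := by
      rw [← Real.rpow_natCast, ← Real.rpow_add hz0]; congr 1; push_cast; ring
    calc l * T * Z ω ^ Q = (l * T * Z ω ^ (Q - 2)) * Z ω ^ 2 := by rw [h4]; ring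
      _ ≤ (l * T * L ^ ((Q - 2) / 2)) * Z ω ^ 2 := by gcongr
      _ ≤ 1 / 2 * Z ω ^ 2 := by gcongr
      _ = _ := by ring
  · have ht : truncation L Y Z ω = 0 := indicator_of_notMem (s := {ω | Z ω ^ 2 ≤ L}) h Y
    rw [ht, mul_zero, abs_zero]
    exact ⟨by positivity, by positivity⟩

theorem lintegral_exp_abs_sum_truncation_le {Ω : Type*} [MeasurableSpace Ω] {μ : Measure Ω}
    [IsProbabilityMeasure μ] (N : ℕ) {L T Q l C₀ Ce : ℝ} {Y Z : Ω → ℝ} (hQ : 2 ≤ Q) (hT : 0 < T)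
    (hY : Measurable Y) (hZ : Measurable Z)
    (hZ1 : ∀ ω, 1 ≤ Z ω) (hle : ∀ ω, |Y ω| ≤ T * Z ω ^ Q)
    (hint : Integrable (fun ω => Real.exp (Z ω ^ 2)) μ) (hCe : ∫ ω, Real.exp (Z ω ^ 2) ∂μ ≤ Ce)
    (hC₀0 : 0 ≤ C₀)
    (hC₀ : ∀ z : ℝ, 0 ≤ z → (1 + z) ^ (2 * Q) ≤ C₀ * Real.exp (1 / 2 * z ^ 2)) (hl : 0 ≤ l)
    (hl1 : l * T * L ^ ((Q - 2) / 2) ≤ 1 / 2) :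
    ∫⁻ ω : Fin N → Ω, ENNReal.ofReal (Real.exp |∑ j, (l * truncation L Y Z (ω j) -
        ∫ ω, l * truncation L Y Z ω ∂μ)|) ∂(Measure.pi fun _ => μ) ≤
      ENNReal.ofReal (2 * Real.exp (N * ((l * T) ^ 2 * C₀ * Ce))) := by
  set U : Ω → ℝ := fun ω => l * truncation L Y Z ω
  have hUm : Measurable U := (measurable_truncation hY hZ).const_mul l
  have hbd := fun ω => abs_truncation_le hQ hT hZ1 hle hl hl1 ω
  have hUi : Integrable U μ := by
    refine hint.mono' hUm.aestronglyMeasurable (ae_of_all _ fun ω => ?_)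
    refine (hbd ω).1.trans ?_
    have := Real.add_one_le_exp (Z ω ^ 2)
    nlinarith [sq_nonneg (Z ω)]
  have hsq : ∀ ω, U ω ^ 2 * Real.exp |U ω| ≤ (l * T) ^ 2 * C₀ * Real.exp (Z ω ^ 2) := by
    intro ω
    have h1 : U ω ^ 2 ≤ (l * T) ^ 2 * (C₀ * Real.exp (Z ω ^ 2 / 2)) := by
      calc U ω ^ 2 = |U ω| ^ 2 := (sq_abs _).symm
        _ ≤ (l * T * Z ω ^ Q) ^ 2 := by gcongr; exact (hbd ω).2
        _ = (l * T) ^ 2 * (Z ω ^ Q) ^ 2 := by ring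
        _ ≤ _ := by gcongr; exact rpow_two_mul_le (hZ1 ω) hC₀ hQ
    calc U ω ^ 2 * Real.exp |U ω|
        ≤ ((l * T) ^ 2 * (C₀ * Real.exp (Z ω ^ 2 / 2))) * Real.exp (Z ω ^ 2 / 2) := by
          gcongr; exact (hbd ω).1
      _ = (l * T) ^ 2 * C₀ * (Real.exp (Z ω ^ 2 / 2) * Real.exp (Z ω ^ 2 / 2)) := by ring
      _ = _ := by rw [← Real.exp_add]; congr 2; ring
  set B := (l * T) ^ 2 * C₀ * Ce
  have hB : ∫ ω, (l * T) ^ 2 * C₀ * Real.exp (Z ω ^ 2) ∂μ ≤ B := by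
    rw [integral_const_mul]
    exact mul_le_mul_of_nonneg_left hCe (by positivity)
  set m := ∫ ω, U ω ∂μ
  have hone : ∀ s : ℝ, |s| = 1 → ∫⁻ ω : Fin N → Ω,
      ENNReal.ofReal (Real.exp (∑ j, (s * U (ω j) - s * m))) ∂(Measure.pi fun _ => μ) ≤
        ENNReal.ofReal (Real.exp (N * B)) := by
    intro s hs
    have hs2 : s ^ 2 = 1 := by rw [← sq_abs, hs, one_pow]
    rw [lintegral_exp_sum_pi μ N (f := fun ω => s * U ω - s * m) (by fun_prop)]
    have h1 := lintegral_exp_le_of_sq_exp_le (μ := μ) (U := fun ω => s * U ω)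
      (hUi.const_mul s) (hint.const_mul ((l * T) ^ 2 * C₀))
      (fun ω => by rw [abs_mul, hs, one_mul, mul_pow, hs2, one_mul]; exact hsq ω) hB
    rw [integral_const_mul] at h1
    have h2 : ∫⁻ ω, ENNReal.ofReal (Real.exp (s * U ω - s * m)) ∂μ ≤
        ENNReal.ofReal (Real.exp B) := by
      calc ∫⁻ ω, ENNReal.ofReal (Real.exp (s * U ω - s * m)) ∂μ
          = ∫⁻ ω, ENNReal.ofReal (Real.exp (s * U ω)) * ENNReal.ofReal (Real.exp (-(s * m))) ∂μ := by
            refine lintegral_congr fun ω => ?_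
            rw [← ENNReal.ofReal_mul (Real.exp_pos _).le, ← Real.exp_add, sub_eq_add_neg]
        _ = (∫⁻ ω, ENNReal.ofReal (Real.exp (s * U ω)) ∂μ) *
              ENNReal.ofReal (Real.exp (-(s * m))) := lintegral_mul_const _ (by fun_prop)
        _ ≤ ENNReal.ofReal (Real.exp (s * m + B)) * ENNReal.ofReal (Real.exp (-(s * m))) := by
            gcongr
        _ = _ := by
            rw [← ENNReal.ofReal_mul (Real.exp_pos _).le, ← Real.exp_add]
            congr 2; ring
    calc _ ≤ ENNReal.ofReal (Real.exp B) ^ N := by gcongr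
      _ = _ := by rw [← ENNReal.ofReal_pow (Real.exp_pos _).le, ← Real.exp_nat_mul]
  calc _ ≤ ∫⁻ ω : Fin N → Ω, (ENNReal.ofReal (Real.exp (∑ j, (1 * U (ω j) - 1 * m))) +
        ENNReal.ofReal (Real.exp (∑ j, (-1 * U (ω j) - -1 * m)))) ∂(Measure.pi fun _ => μ) := by
        refine lintegral_mono fun ω => ?_
        rw [← ENNReal.ofReal_add (Real.exp_pos _).le (Real.exp_pos _).le]
        refine ENNReal.ofReal_le_ofReal ?_
        have : ∑ j, (-1 * U (ω j) - -1 * m) = -∑ j, (U (ω j) - m) := by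
          rw [← Finset.sum_neg_distrib]
          exact Finset.sum_congr rfl fun _ _ => by ring
        simp only [one_mul]
        rw [this]
        exact Real.exp_abs_le _
    _ = _ := lintegral_add_left (by fun_prop) _
    _ ≤ ENNReal.ofReal (Real.exp (N * B)) + ENNReal.ofReal (Real.exp (N * B)) :=
        add_le_add (hone 1 (by norm_num)) (hone (-1) (by norm_num))
    _ = _ := by
        rw [← ENNReal.ofReal_add (Real.exp_pos _).le (Real.exp_pos _).le]
        congr 1; ring

theorem sq_integral_le_integral_sq {Ω : Type*} [MeasurableSpace Ω] {μ : Measure Ω}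
    [IsProbabilityMeasure μ] {f : Ω → ℝ} (hf : Integrable f μ)
    (hf2 : Integrable (fun ω => f ω ^ 2) μ) : (∫ ω, f ω ∂μ) ^ 2 ≤ ∫ ω, f ω ^ 2 ∂μ := by
  set m := ∫ ω, f ω ∂μ
  have h : 0 ≤ ∫ ω, (f ω - m) ^ 2 ∂μ := integral_nonneg fun ω => sq_nonneg _
  have h2 : ∫ ω, (f ω - m) ^ 2 ∂μ = ∫ ω, f ω ^ 2 ∂μ - m ^ 2 := by
    have : (fun ω => (f ω - m) ^ 2) = fun ω => f ω ^ 2 - 2 * m * f ω + m ^ 2 := by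
      ext ω; ring
    have hi : Integrable (fun ω => f ω ^ 2 - 2 * m * f ω) μ := hf2.sub (hf.const_mul _)
    rw [this, integral_add hi (integrable_const _), integral_sub hf2 (hf.const_mul _),
      integral_const_mul]
    simp only [integral_const, probReal_univ, smul_eq_mul, one_mul]
    change _ - 2 * m * m + m ^ 2 = _
    ring
  linarith

theorem sq_mean_le {N : ℕ} (hN : 1 ≤ N) (a : Fin N → ℝ) :
    ((1 / (N : ℝ)) * ∑ j, a j) ^ 2 ≤ (1 / (N : ℝ)) * ∑ j, a j ^ 2 := by
  have hN0 : (0 : ℝ) < N := by exact_mod_cast hN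
  have := sq_sum_le_card_mul_sum_sq (s := Finset.univ) (f := a)
  rw [Finset.card_univ, Fintype.card_fin] at this
  rw [mul_pow, div_pow, one_pow, div_mul_eq_mul_div, div_mul_eq_mul_div, div_le_div_iff₀
    (by positivity) hN0]
  nlinarith

/-- This forgoes the factor `1 / N` of a variance bound. It is applied to tails whose second moment
is exponentially small, so Jensen's inequality is enough. -/
theorem lintegral_sq_mean_sub_integral_le {Ω : Type*} [MeasurableSpace Ω] {μ : Measure Ω}
    [IsProbabilityMeasure μ] {N : ℕ} (hN : 1 ≤ N) {f : Ω → ℝ} (hfm : Measurable f)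
    (hf : Integrable f μ) (hf2 : Integrable (fun ω => f ω ^ 2) μ) :
    ∫⁻ ω : Fin N → Ω, ENNReal.ofReal (((1 / (N : ℝ)) * ∑ j, f (ω j) - ∫ ω, f ω ∂μ) ^ 2)
      ∂(Measure.pi fun _ => μ) ≤ ENNReal.ofReal (4 * ∫ ω, f ω ^ 2 ∂μ) := by
  set V := ∫ ω, f ω ^ 2 ∂μ
  have hV : 0 ≤ V := integral_nonneg fun ω => sq_nonneg _
  calc _ ≤ ∫⁻ ω : Fin N → Ω, (ENNReal.ofReal ((1 / (N : ℝ)) * ∑ j, 2 * f (ω j) ^ 2) +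
        ENNReal.ofReal (2 * V)) ∂(Measure.pi fun _ => μ) := by
        refine lintegral_mono fun ω => ?_
        rw [← ENNReal.ofReal_add (by positivity) (by positivity)]
        refine ENNReal.ofReal_le_ofReal ?_
        have h1 := sq_mean_le hN fun j => f (ω j)
        have h2 := sq_integral_le_integral_sq hf hf2
        rw [← Finset.mul_sum]
        nlinarith [sq_nonneg ((1 / (N : ℝ)) * ∑ j, f (ω j) + ∫ ω, f ω ∂μ)]
    _ = ∫⁻ ω, ENNReal.ofReal (2 * f ω ^ 2) ∂μ + ENNReal.ofReal (2 * V) := by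
        rw [lintegral_add_right _ measurable_const,
          lintegral_mean_pi μ hN (f := fun ω => 2 * f ω ^ 2) (by fun_prop) fun _ => by positivity]
        simp
    _ = _ := by
        rw [← ofReal_integral_eq_lintegral_ofReal (hf2.const_mul 2)
          (ae_of_all _ fun _ => by positivity), integral_const_mul,
          ← ENNReal.ofReal_add (by positivity) (by positivity)]
        congr 1; ring

/-- Off the event `Z² ≤ L` one has `exp(Z² / 2) ≤ exp(-L / 2) exp(Z²)`, which turns the moment of
`exp(Z²)` into exponential smallness of the discarded part. -/
theorem tail_moments {Ω : Type*} [MeasurableSpace Ω] {μ : Measure Ω} [IsProbabilityMeasure μ]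
    {L T Q C₀ Ce : ℝ} {Y Z : Ω → ℝ} (hQ : 2 ≤ Q) (hT : 0 < T)
    (hY : Measurable Y) (hZ : Measurable Z)
    (hZ1 : ∀ ω, 1 ≤ Z ω) (hle : ∀ ω, |Y ω| ≤ T * Z ω ^ Q)
    (hint : Integrable (fun ω => Real.exp (Z ω ^ 2)) μ) (hCe : ∫ ω, Real.exp (Z ω ^ 2) ∂μ ≤ Ce)
    (hC₀0 : 0 ≤ C₀)
    (hC₀ : ∀ z : ℝ, 0 ≤ z → (1 + z) ^ (2 * Q) ≤ C₀ * Real.exp (1 / 2 * z ^ 2)) :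
    Integrable Y μ ∧ Integrable (truncation L Y Z) μ ∧
      Integrable (fun ω => (Y ω - truncation L Y Z ω) ^ 2) μ ∧
      ∫ ω, (Y ω - truncation L Y Z ω) ^ 2 ∂μ ≤ T ^ 2 * C₀ * Ce * Real.exp (-L / 2) := by
  have hY2 : ∀ ω, Y ω ^ 2 ≤ T ^ 2 * C₀ * Real.exp (Z ω ^ 2 / 2) := fun ω => by
    calc Y ω ^ 2 = |Y ω| ^ 2 := (sq_abs _).symm
      _ ≤ (T * Z ω ^ Q) ^ 2 := by gcongr; exact hle ω
      _ = T ^ 2 * (Z ω ^ Q) ^ 2 := by ring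
      _ ≤ T ^ 2 * (C₀ * Real.exp (Z ω ^ 2 / 2)) := by
          gcongr; exact rpow_two_mul_le (hZ1 ω) hC₀ hQ
      _ = _ := by ring
  have hYi : Integrable Y μ := by
    refine (((integrable_const (1 : ℝ)).add (hint.const_mul (T ^ 2 * C₀)))).mono'
      hY.aestronglyMeasurable (ae_of_all _ fun ω => ?_)
    have h1 : |Y ω| ≤ 1 + Y ω ^ 2 := by
      rw [← sq_abs]; nlinarith [sq_nonneg (|Y ω| - 1), abs_nonneg (Y ω)]
    have h2 : T ^ 2 * C₀ * Real.exp (Z ω ^ 2 / 2) ≤ T ^ 2 * C₀ * Real.exp (Z ω ^ 2) := by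
      gcongr; linarith [sq_nonneg (Z ω)]
    simp only [Pi.add_apply, Real.norm_eq_abs]
    linarith [hY2 ω]
  have hti : Integrable (truncation L Y Z) μ :=
    hYi.indicator (measurableSet_le (by fun_prop) measurable_const)
  have hd : ∀ ω, (Y ω - truncation L Y Z ω) ^ 2 ≤
      T ^ 2 * C₀ * Real.exp (-L / 2) * Real.exp (Z ω ^ 2) := by
    intro ω
    by_cases h : Z ω ^ 2 ≤ L
    · have ht : truncation L Y Z ω = Y ω := indicator_of_mem (s := {ω | Z ω ^ 2 ≤ L}) h Y
      rw [ht, sub_self, zero_pow two_ne_zero]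
      positivity
    · have ht : truncation L Y Z ω = 0 := indicator_of_notMem (s := {ω | Z ω ^ 2 ≤ L}) h Y
      rw [ht, sub_zero, mul_assoc _ (Real.exp _), ← Real.exp_add]
      refine (hY2 ω).trans ?_
      push Not at h
      gcongr
      linarith
  have hi := hint.const_mul (T ^ 2 * C₀ * Real.exp (-L / 2))
  have hdi : Integrable (fun ω => (Y ω - truncation L Y Z ω) ^ 2) μ := by
    refine hi.mono' ((hY.sub (measurable_truncation hY hZ)).pow_const 2).aestronglyMeasurable
      (ae_of_all _ fun ω => ?_)
    rw [Real.norm_eq_abs, abs_of_nonneg (sq_nonneg _)]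
    exact hd ω
  refine ⟨hYi, hti, hdi, (integral_mono hdi hi hd).trans ?_⟩
  rw [integral_const_mul]
  calc T ^ 2 * C₀ * Real.exp (-L / 2) * ∫ ω, Real.exp (Z ω ^ 2) ∂μ
      ≤ T ^ 2 * C₀ * Real.exp (-L / 2) * Ce := by gcongr
    _ = _ := by ring

end Concentration

/-! ### The truncation level and the concentration inequality -/

section Concentration

/-- Here `m` is the scale of the exponential tilt. The bound `m² ≤ p / N` keeps the quadratic cost
of `N` terms below a multiple of `p`, and the second constraint keeps the truncated variable within
its exponential moment. A deviation `p / (m N)` then costs about `p`: the Gaussian rate when the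
first constraint binds, the heavy-tailed rate when the second does. -/
theorem concentration_scale {N : ℕ} (hN : 1 ≤ N) {Q K p : ℝ} (hK : 0 ≤ K) (hp : 0 < p) :
    ∃ m : ℝ, 0 < m ∧ m ^ 2 ≤ p / N ∧ m * (2 * (K + 1) * p) ^ ((Q - 2) / 2) ≤ 1 / 2 ∧
      p / (m * N) ≤ (1 + 2 * (2 * (K + 1)) ^ ((Q - 2) / 2)) *
        (√(p / N) + p ^ (Q / 2) / N) := by
  have hN0 : (0 : ℝ) < N := by exact_mod_cast hN
  set a := (2 * (K + 1)) ^ ((Q - 2) / 2)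
  have ha : 0 < a := by positivity
  have hL : (2 * (K + 1) * p) ^ ((Q - 2) / 2) = a * p ^ ((Q - 2) / 2) :=
    Real.mul_rpow (by positivity) hp.le
  set b := p ^ ((Q - 2) / 2)
  have hb : 0 < b := by positivity
  have hpb : p ^ (Q / 2) = p * b := by
    rw [show Q / 2 = 1 + (Q - 2) / 2 by ring, Real.rpow_add hp, Real.rpow_one]
  have hs : 0 < √(p / N) := Real.sqrt_pos.2 (by positivity)
  refine ⟨min (√(p / N)) (1 / (2 * (a * b))), lt_min hs (by positivity), ?_, ?_, ?_⟩
  · calc (min (√(p / N)) (1 / (2 * (a * b)))) ^ 2 ≤ (√(p / N)) ^ 2 := by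
          gcongr; exact min_le_left _ _
      _ = p / N := Real.sq_sqrt (by positivity)
  · rw [hL]
    calc _ ≤ 1 / (2 * (a * b)) * (a * b) := by gcongr; exact min_le_right _ _
      _ = 1 / 2 := by field_simp
  · rw [hpb]
    rcases min_choice (√(p / N)) (1 / (2 * (a * b))) with h | h
    · rw [h]
      have h1 : p / (√(p / N) * N) = √(p / N) := by
        rw [div_eq_iff (by positivity)]
        have := Real.mul_self_sqrt (show 0 ≤ p / N by positivity)
        rw [← mul_assoc, this]
        field_simp
      rw [h1]
      have : 0 ≤ p * b / N := by positivity
      nlinarith [mul_pos ha hs, mul_nonneg ha.le this]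
    · rw [h]
      have h1 : p / (1 / (2 * (a * b)) * N) = 2 * a * (p * b / N) := by field_simp
      rw [h1]
      have : 0 ≤ p * b / N := by positivity
      nlinarith [mul_pos ha hs, mul_nonneg ha.le this]

/-- The tail is compared with `T² p / N`, so Markov's inequality loses a factor `N / p`. It is
absorbed into `exp p`. -/
theorem div_le_two_mul_exp {N : ℕ} (hN : 1 ≤ N) {p : ℝ} (hp : 1 / 2 ≤ p)
    (hNp : Real.log N ≤ p) : N / p ≤ 2 * Real.exp p := by
  have hN0 : (0 : ℝ) < N := by exact_mod_cast hN
  have : (N : ℝ) ≤ Real.exp p := by rwa [← Real.log_le_iff_le_exp hN0]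
  rw [div_le_iff₀ (by linarith)]
  nlinarith [Real.exp_pos p]

theorem lintegral_sq_le_of_eq_add {X : Type*} [MeasurableSpace X] {P : Measure X}
    {y s t : X → ℝ} {a A B : ℝ} (hs : Measurable s) (ht : Measurable t)
    (h : ∀ᵐ x ∂P, y x = a * s x + t x) (hA : 0 ≤ A) (hB : 0 ≤ B)
    (hsA : ∫⁻ x, ENNReal.ofReal (s x ^ 2) ∂P ≤ ENNReal.ofReal A)
    (htB : ∫⁻ x, ENNReal.ofReal (t x ^ 2) ∂P ≤ ENNReal.ofReal B) :
    ∫⁻ x, ENNReal.ofReal (y x ^ 2) ∂P ≤ ENNReal.ofReal (2 * a ^ 2 * A + 2 * B) := by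
  calc _ ≤ ∫⁻ x, (ENNReal.ofReal (2 * a ^ 2) * ENNReal.ofReal (s x ^ 2) +
          ENNReal.ofReal 2 * ENNReal.ofReal (t x ^ 2)) ∂P := by
        refine lintegral_mono_ae ?_
        filter_upwards [h] with x hx
        rw [hx, ← ENNReal.ofReal_mul (by positivity), ← ENNReal.ofReal_mul (by positivity),
          ← ENNReal.ofReal_add (by positivity) (by positivity)]
        refine ENNReal.ofReal_le_ofReal ?_
        nlinarith [sq_nonneg (a * s x - t x)]
    _ = ENNReal.ofReal (2 * a ^ 2) * ∫⁻ x, ENNReal.ofReal (s x ^ 2) ∂P +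
          ENNReal.ofReal 2 * ∫⁻ x, ENNReal.ofReal (t x ^ 2) ∂P := by
        rw [lintegral_add_left (by fun_prop), lintegral_const_mul _ (by fun_prop),
          lintegral_const_mul _ (by fun_prop)]
    _ ≤ ENNReal.ofReal (2 * a ^ 2) * ENNReal.ofReal A + ENNReal.ofReal 2 * ENNReal.ofReal B := by
        gcongr
    _ = _ := by
        rw [← ENNReal.ofReal_mul (by positivity), ← ENNReal.ofReal_mul (by positivity),
          ← ENNReal.ofReal_add (by positivity) (by positivity)]

/-- Concentration of the average of `N` independent copies of `Y x`, in `L²` over the parameter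
`x`, when `Y` is bounded by a power of a variable with Gaussian tails. -/
theorem concentration {Q : ℝ} (hQ : 2 ≤ Q) {Ce K : ℝ} (hCe : 0 ≤ Ce) (hK : 0 ≤ K) :
    ∃ A : ℝ, 0 < A ∧ ∀ (Ω X : Type*) [MeasurableSpace Ω] [MeasurableSpace X] (μ : Measure Ω)
      (P : Measure X) [IsProbabilityMeasure μ] [IsProbabilityMeasure P] (N : ℕ) (p T : ℝ)
      (Y Z : X → Ω → ℝ), 1 ≤ N → 1 / 2 ≤ p → Real.log N ≤ p → 0 < T →
      Measurable (Function.uncurry Y) → Measurable (Function.uncurry Z) →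
      (∀ x ω, 1 ≤ Z x ω) → (∀ x ω, |Y x ω| ≤ T * Z x ω ^ Q) →
      (∀ᵐ x ∂P, Integrable (fun ω => Real.exp (Z x ω ^ 2)) μ ∧
        ∫ ω, Real.exp (Z x ω ^ 2) ∂μ ≤ Ce) →
      (Measure.pi fun _ : Fin N => μ) {ω | ENNReal.ofReal
          ((A * T * (√(p / N) + p ^ (Q / 2) / N)) ^ 2) <
        ∫⁻ x, ENNReal.ofReal (((1 / (N : ℝ)) * ∑ j, Y x (ω j) - ∫ ω, Y x ω ∂μ) ^ 2) ∂P} ≤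
      ENNReal.ofReal (A * Real.exp (-(K * p))) := by
  obtain ⟨C₀, hC₀0, hC₀⟩ := exists_rpow_le_mul_exp_mul_sq (2 * Q) (b := 1 / 2) (by norm_num)
  -- The deviation level will be `B * p`: the term `C₀ * Ce` cancels the exponential moment, `K` is
  -- the wanted decay, and `4` ensures `B * p ≥ 2` because `p ≥ 1 / 2`.
  set B := C₀ * Ce + K + 4
  have hB : 4 ≤ B := by
    have : 0 ≤ C₀ * Ce := by positivity
    linarith
  set κ := 1 + 2 * (2 * (K + 1)) ^ ((Q - 2) / 2)
  have hκ : 0 < κ := by positivity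
  refine ⟨2 * B * κ + 2 + (2 + 8 * (C₀ * Ce)), by positivity, ?_⟩
  intro Ω X _ _ μ P _ _ N p T Y Z hN hp hNp hT hYm hZm hZ1 hle hexp
  have hp0 : 0 < p := by linarith
  have hN0 : (0 : ℝ) < N := by exact_mod_cast hN
  obtain ⟨m, hm0, hm1, hm2, hm3⟩ := concentration_scale (Q := Q) hN hK hp0
  set r := √(p / N) + p ^ (Q / 2) / N
  have hr : 0 < r := by positivity
  have hsr : √(p / N) ≤ r := le_add_of_nonneg_right (by positivity)
  -- Then `exp(-L / 2) = exp(-(K + 1) p)`; the extra factor `exp(-p)` compensates the loss `N / p ≤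
  -- 2 exp p` in the tail estimate.
  set L := 2 * (K + 1) * p with hLdef
  set l := m / T
  have hl : 0 < l := by positivity
  have hlT : l * T = m := div_mul_cancel₀ _ hT.ne'
  have hYx : ∀ x, Measurable (Y x) := fun x => hYm.comp measurable_prodMk_left
  have hZx : ∀ x, Measurable (Z x) := fun x => hZm.comp measurable_prodMk_left
  set Y' : X → Ω → ℝ := fun x => truncation L (Y x) (Z x)
  have hY'm : Measurable (Function.uncurry Y') := measurable_truncation (L := L) hYm hZm
  have hY'x : ∀ x, Measurable (Y' x) := fun x => hY'm.comp measurable_prodMk_left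
  have hint' : Measurable fun x => ∫ ω, Y' x ω ∂μ :=
    (hY'm.stronglyMeasurable.integral_prod_right (ν := μ)).measurable
  have hint : Measurable fun x => ∫ ω, Y x ω ∂μ :=
    (hYm.stronglyMeasurable.integral_prod_right (ν := μ)).measurable
  set S : X → (Fin N → Ω) → ℝ := fun x ω => ∑ j, (l * Y' x (ω j) - ∫ ω, l * Y' x ω ∂μ)
  have hSm : Measurable (Function.uncurry S) := by
    have h1 : ∀ j : Fin N, Measurable fun z : X × (Fin N → Ω) => Y' z.1 (z.2 j) := fun j =>
      hY'm.comp (measurable_fst.prodMk ((measurable_pi_apply j).comp measurable_snd))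
    have h2 : Measurable fun z : X × (Fin N → Ω) => ∑ j, (l * Y' z.1 (z.2 j) -
        l * ∫ ω, Y' z.1 ω ∂μ) :=
      Finset.measurable_sum _ fun j _ => ((h1 j).const_mul l).sub
        ((hint'.comp measurable_fst).const_mul l)
    have h3 : Function.uncurry S = fun z : X × (Fin N → Ω) => ∑ j, (l * Y' z.1 (z.2 j) -
        l * ∫ ω, Y' z.1 ω ∂μ) := by
      ext z
      simp only [S, Function.uncurry, integral_const_mul]
    rw [h3]
    exact h2
  set D : X → (Fin N → Ω) → ℝ := fun x ω =>
    (1 / (N : ℝ)) * ∑ j, (Y x (ω j) - Y' x (ω j)) - ∫ ω, (Y x ω - Y' x ω) ∂μ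
  have hdm : Measurable (Function.uncurry fun x ω => Y x ω - Y' x ω) := hYm.sub hY'm
  have hDm : Measurable (Function.uncurry D) := by
    have h1 : ∀ j : Fin N, Measurable fun z : X × (Fin N → Ω) => Y z.1 (z.2 j) - Y' z.1 (z.2 j) :=
      fun j => hdm.comp (measurable_fst.prodMk ((measurable_pi_apply j).comp measurable_snd))
    have h2 : Measurable fun x => ∫ ω, (Y x ω - Y' x ω) ∂μ :=
      (hdm.stronglyMeasurable.integral_prod_right (ν := μ)).measurable
    exact ((Finset.measurable_sum _ fun j _ => h1 j).const_mul (1 / (N : ℝ))).sub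
      (h2.comp measurable_fst)
  -- the truncated part
  have hpart1 := measure_lt_lintegral_sq_le (μ := Measure.pi fun _ : Fin N => μ) (P := P) hSm
    (M := 2 * Real.exp (p * (C₀ * Ce))) (t₀ := B * p) (by nlinarith) (by
      filter_upwards [hexp] with x hx
      refine (lintegral_exp_abs_sum_truncation_le N (L := L) hQ hT (hYx x) (hZx x) (hZ1 x) (hle x)
        hx.1 hx.2 hC₀0.le hC₀ hl.le (by rw [hlT]; exact hm2)).trans (ENNReal.ofReal_le_ofReal ?_)
      refine mul_le_mul_of_nonneg_left (Real.exp_le_exp.2 ?_) zero_le_two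
      rw [hlT]
      calc (N : ℝ) * (m ^ 2 * C₀ * Ce) = N * m ^ 2 * (C₀ * Ce) := by ring
        _ ≤ N * (p / N) * (C₀ * Ce) := by gcongr
        _ = p * (C₀ * Ce) := by field_simp)
  -- the tail
  set v := T ^ 2 * (p / N)
  have hv : 0 < v := by positivity
  have hpart2 := measure_one_lt_lintegral_le (μ := Measure.pi fun _ : Fin N => μ) (P := P)
    (g := fun x ω => ENNReal.ofReal v⁻¹ * ENNReal.ofReal (D x ω ^ 2))
    (M := ENNReal.ofReal (8 * (C₀ * Ce) * Real.exp (-(K * p))))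
    (((hDm.pow_const 2).ennreal_ofReal).const_mul _) (by
      filter_upwards [hexp] with x hx
      obtain ⟨hYi, hti, hdi, hdle⟩ := tail_moments (L := L) hQ hT (hYx x) (hZx x) (hZ1 x) (hle x)
        hx.1 hx.2 hC₀0.le hC₀
      have hDx : Measurable (D x) := hDm.comp measurable_prodMk_left
      rw [lintegral_const_mul _ ((hDx.pow_const 2).ennreal_ofReal)]
      have h1 := lintegral_sq_mean_sub_integral_le (μ := μ) hN (f := fun ω => Y x ω - Y' x ω)
        ((hYx x).sub (hY'x x)) (hYi.sub hti) hdi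
      calc _ ≤ ENNReal.ofReal v⁻¹ * ENNReal.ofReal (4 * ∫ ω, (Y x ω - Y' x ω) ^ 2 ∂μ) :=
            mul_le_mul_right h1 _
        _ ≤ ENNReal.ofReal v⁻¹ * ENNReal.ofReal (4 * (T ^ 2 * C₀ * Ce * Real.exp (-L / 2))) := by
            gcongr
        _ ≤ _ := by
            rw [← ENNReal.ofReal_mul (by positivity)]
            refine ENNReal.ofReal_le_ofReal ?_
            have h2 := div_le_two_mul_exp hN hp hNp
            calc v⁻¹ * (4 * (T ^ 2 * C₀ * Ce * Real.exp (-L / 2)))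
                = 4 * (C₀ * Ce) * (N / p) * Real.exp (-L / 2) := by
                  simp only [v]; field_simp
              _ ≤ 4 * (C₀ * Ce) * (2 * Real.exp p) * Real.exp (-L / 2) := by gcongr
              _ = 8 * (C₀ * Ce) * (Real.exp p * Real.exp (-L / 2)) := by ring
              _ = _ := by rw [← Real.exp_add, hLdef]; congr 2; ring)
  refine (measure_mono (t := {ω | ENNReal.ofReal (2 * (B * p) ^ 2) <
      ∫⁻ x, ENNReal.ofReal (S x ω ^ 2) ∂P} ∪ {ω | 1 <
      ∫⁻ x, ENNReal.ofReal v⁻¹ * ENNReal.ofReal (D x ω ^ 2) ∂P}) ?_).trans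
    ((measure_union_le _ _).trans ((add_le_add hpart1 hpart2).trans ?_))
  · intro ω hω
    by_contra hcon
    simp only [mem_union, mem_ofPred_eq, not_or, not_lt] at hcon hω
    obtain ⟨h1, h2⟩ := hcon
    refine absurd hω (not_lt.2 ?_)
    have hSω : Measurable fun x => S x ω := hSm.of_uncurry_right
    have hDω : Measurable fun x => D x ω := hDm.of_uncurry_right
    have h3 : ∫⁻ x, ENNReal.ofReal (D x ω ^ 2) ∂P ≤ ENNReal.ofReal v := by
      rw [lintegral_const_mul _ (by fun_prop)] at h2
      have := mul_le_mul_right h2 (ENNReal.ofReal v)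
      rwa [← mul_assoc, ← ENNReal.ofReal_mul hv.le, mul_inv_cancel₀ hv.ne', ENNReal.ofReal_one,
        one_mul, mul_one] at this
    have hae : ∀ᵐ x ∂P, (1 / (N : ℝ)) * ∑ j, Y x (ω j) - ∫ ω, Y x ω ∂μ =
        1 / (l * N) * S x ω + D x ω := by
      filter_upwards [hexp] with x hx
      obtain ⟨hYi, hti, hdi, hdle⟩ := tail_moments (L := L) hQ hT (hYx x) (hZx x) (hZ1 x) (hle x)
        hx.1 hx.2 hC₀0.le hC₀
      have e1 : ∫ ω, (Y x ω - Y' x ω) ∂μ = ∫ ω, Y x ω ∂μ - ∫ ω, Y' x ω ∂μ :=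
        integral_sub hYi hti
      simp only [S, D, Finset.sum_sub_distrib, e1, integral_const_mul, ← Finset.mul_sum,
        Finset.sum_const, Finset.card_univ, Fintype.card_fin, nsmul_eq_mul]
      field_simp
      ring
    refine (lintegral_sq_le_of_eq_add hSω hDω hae (by positivity) hv.le h1 h3).trans
      (ENNReal.ofReal_le_ofReal ?_)
    have e1 : 2 * (1 / (l * N)) ^ 2 * (2 * (B * p) ^ 2) = (2 * B * T * (p / (m * N))) ^ 2 := by
      simp only [l]; field_simp
    have e2 : (2 * B * T * (p / (m * N))) ^ 2 ≤ (2 * B * T * (κ * r)) ^ 2 := by gcongr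
    have e3 : 2 * v ≤ (2 * T * r) ^ 2 := by
      have : p / N ≤ r ^ 2 := by
        calc p / N = √(p / N) ^ 2 := (Real.sq_sqrt (by positivity)).symm
          _ ≤ r ^ 2 := by gcongr
      calc 2 * v = 2 * (T ^ 2 * (p / N)) := rfl
        _ ≤ 2 * (T ^ 2 * r ^ 2) := by gcongr
        _ ≤ 4 * (T ^ 2 * r ^ 2) := by
            have : 0 ≤ T ^ 2 * r ^ 2 := by positivity
            linarith
        _ = _ := by ring
    have e4 : 0 ≤ (2 * B * T * (κ * r)) * (2 * T * r) := by positivity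
    have e5 : 0 ≤ C₀ * Ce := by positivity
    calc 2 * (1 / (l * N)) ^ 2 * (2 * (B * p) ^ 2) + 2 * v
        ≤ (2 * B * T * (κ * r) + 2 * T * r) ^ 2 := by rw [e1, add_sq]; linarith
      _ = ((2 * B * κ + 2) * T * r) ^ 2 := by ring
      _ ≤ _ := pow_le_pow_left₀ (by positivity) (mul_le_mul_of_nonneg_right
          (mul_le_mul_of_nonneg_right (by linarith) hT.le) hr.le) 2
  · rw [← ENNReal.ofReal_add (by positivity) (by positivity)]
    refine ENNReal.ofReal_le_ofReal ?_
    have e1 : 2 * Real.exp (p * (C₀ * Ce)) * Real.exp (-(B * p)) ≤ 2 * Real.exp (-(K * p)) := by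
      rw [mul_assoc, ← Real.exp_add]
      gcongr
      simp only [B]
      nlinarith
    have e2 : 0 ≤ (2 * B * κ + 2) * Real.exp (-(K * p)) := by positivity
    linarith

end Concentration

/-! ### Gaussian tails -/

section SubGaussian

open ProbabilityTheory

/-- `E exp (X² / (4 τ²)) ≤ 2`. -/
def HasSqExpMoment {Ω : Type*} [MeasurableSpace Ω] (τ : ℝ) (X : Ω → ℝ) (μ : Measure Ω) : Prop :=
  Integrable (fun ω => Real.exp (X ω ^ 2 / (4 * τ ^ 2))) μ ∧
    ∫ ω, Real.exp (X ω ^ 2 / (4 * τ ^ 2)) ∂μ ≤ 2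

/-- Completing the square turns the density of variance `1 / (2 τ²)` into `√2` times the density of
variance `1 / τ²`. -/
theorem lintegral_exp_sq_gaussianReal {τ : ℝ} (hτ : 0 < τ) :
    ∫⁻ t, ENNReal.ofReal (Real.exp (τ ^ 2 * t ^ 2 / 2))
      ∂(gaussianReal 0 ⟨1 / (2 * τ ^ 2), by positivity⟩) ≤ 2 := by
  set v : NNReal := ⟨1 / (2 * τ ^ 2), by positivity⟩ with hv
  have hv0 : v ≠ 0 := by
    have : (0 : ℝ) < 1 / (2 * τ ^ 2) := by positivity
    exact fun h => this.ne' (congrArg NNReal.toReal h)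
  have hvr : (v : ℝ) = 1 / (2 * τ ^ 2) := rfl
  set v2 : NNReal := ⟨1 / τ ^ 2, by positivity⟩
  have hv20 : v2 ≠ 0 := by
    have : (0 : ℝ) < 1 / τ ^ 2 := by positivity
    exact fun h => this.ne' (congrArg NNReal.toReal h)
  have hv2r : (v2 : ℝ) = 1 / τ ^ 2 := rfl
  rw [gaussianReal_of_var_ne_zero _ hv0, lintegral_withDensity_eq_lintegral_mul _
    (measurable_gaussianPDF _ _) (by fun_prop)]
  calc _ = ∫⁻ t, ENNReal.ofReal (√2) * gaussianPDF 0 v2 t := by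
        refine lintegral_congr fun t => ?_
        simp only [Pi.mul_apply, gaussianPDF]
        rw [← ENNReal.ofReal_mul (gaussianPDFReal_nonneg _ _ _),
          ← ENNReal.ofReal_mul (Real.sqrt_nonneg _)]
        congr 1
        simp only [gaussianPDFReal, hvr, hv2r, sub_zero]
        rw [mul_assoc, ← Real.exp_add, ← mul_assoc]
        congr 1
        · rw [show 2 * Real.pi * (1 / τ ^ 2) = 2 * (2 * Real.pi * (1 / (2 * τ ^ 2))) by
            field_simp, Real.sqrt_mul zero_le_two]
          field_simp
        · congr 1
          field_simp
          ring
    _ = ENNReal.ofReal (√2) := by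
        rw [lintegral_const_mul _ (measurable_gaussianPDF _ _),
          lintegral_gaussianPDF_eq_one _ hv20, mul_one]
    _ ≤ ENNReal.ofReal 2 := by
        refine ENNReal.ofReal_le_ofReal ?_
        rw [Real.sqrt_le_left zero_le_two]
        norm_num
    _ = 2 := by simp

/-- Gaussian linearization: `exp(X² / (4 τ²))` is the average of `exp(t X)` over a centred Gaussian
`t` of variance `1 / (2 τ²)`. After Tonelli the sub-Gaussian bound applies for each fixed `t`, and
the remaining Gaussian integral is at most `2`. -/
theorem hasSqExpMoment_of_subgaussian {Ω : Type*} [MeasurableSpace Ω] {μ : Measure Ω}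
    [IsProbabilityMeasure μ] {τ : ℝ} (hτ : 0 < τ) {X : Ω → ℝ} (hX : Measurable X)
    (h : ∀ t : ℝ, Integrable (fun ω => Real.exp (t * X ω)) μ ∧
      ∫ ω, Real.exp (t * X ω) ∂μ ≤ Real.exp (τ ^ 2 * t ^ 2 / 2)) : HasSqExpMoment τ X μ := by
  set v : NNReal := ⟨1 / (2 * τ ^ 2), by positivity⟩ with hv
  have key : ∫⁻ ω, ENNReal.ofReal (Real.exp (X ω ^ 2 / (4 * τ ^ 2))) ∂μ ≤ 2 := by
    calc ∫⁻ ω, ENNReal.ofReal (Real.exp (X ω ^ 2 / (4 * τ ^ 2))) ∂μ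
        = ∫⁻ ω, ∫⁻ t, ENNReal.ofReal (Real.exp (t * X ω)) ∂(gaussianReal 0 v) ∂μ := by
          refine lintegral_congr fun ω => ?_
          have hi : Integrable (fun t : ℝ => Real.exp (t * X ω)) (gaussianReal 0 v) := by
            have := integrable_exp_mul_gaussianReal (μ := 0) (v := v) (X ω)
            simpa only [mul_comm] using this
          rw [← ofReal_integral_eq_lintegral_ofReal hi (ae_of_all _ fun _ => (Real.exp_pos _).le)]
          congr 1
          have := congrFun (mgf_id_gaussianReal (μ := 0) (v := v)) (X ω)
          simp only [mgf, id_eq] at this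
          have h2 : (fun t : ℝ => Real.exp (t * X ω)) = fun t => Real.exp (X ω * t) := by
            ext t; rw [mul_comm]
          rw [h2, this]
          congr 1
          have : (v : ℝ) = 1 / (2 * τ ^ 2) := rfl
          rw [this]
          field_simp
          ring
      _ = ∫⁻ t, ∫⁻ ω, ENNReal.ofReal (Real.exp (t * X ω)) ∂μ ∂(gaussianReal 0 v) :=
          lintegral_lintegral_swap (by fun_prop)
      _ ≤ ∫⁻ t, ENNReal.ofReal (Real.exp (τ ^ 2 * t ^ 2 / 2)) ∂(gaussianReal 0 v) := by
          refine lintegral_mono fun t => ?_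
          rw [← ofReal_integral_eq_lintegral_ofReal (h t).1
            (ae_of_all _ fun _ => (Real.exp_pos _).le)]
          exact ENNReal.ofReal_le_ofReal (h t).2
      _ ≤ 2 := lintegral_exp_sq_gaussianReal hτ
  have hm : Measurable fun ω => Real.exp (X ω ^ 2 / (4 * τ ^ 2)) := by fun_prop
  refine ⟨⟨hm.aestronglyMeasurable, ?_⟩, ?_⟩
  · rw [hasFiniteIntegral_iff_ofReal (ae_of_all _ fun _ => (Real.exp_pos _).le)]
    exact key.trans_lt (by simp)
  · rw [integral_eq_lintegral_of_nonneg_ae (ae_of_all _ fun _ => (Real.exp_pos _).le)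
      hm.aestronglyMeasurable]
    exact ENNReal.toReal_le_of_le_ofReal zero_le_two (key.trans (by simp))

/-- A variable that dominates `1`, `U₁ / (6 τ)` and `U₂ / (6 τ)`. -/
noncomputable def envelope (τ u₁ u₂ : ℝ) : ℝ := 1 + (|u₁| + |u₂|) / (6 * τ)

theorem one_le_envelope {τ : ℝ} (hτ : 0 < τ) (u₁ u₂ : ℝ) : 1 ≤ envelope τ u₁ u₂ :=
  le_add_of_nonneg_right (by positivity)

theorem abs_left_le_envelope {τ : ℝ} (hτ : 0 < τ) (u₁ u₂ : ℝ) :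
    |u₁| ≤ 6 * τ * envelope τ u₁ u₂ := by
  rw [envelope, mul_add, mul_div_cancel₀ _ (by positivity)]
  linarith [abs_nonneg u₂]

/-- The constant `6` in the envelope leaves room: `2 ((|u₁| + |u₂|) / (6 τ))²` is at most `2 / 9` of
the larger square over `τ²`, below the `1 / 4` that the moment condition allows. -/
theorem exp_envelope_sq_le {τ : ℝ} (hτ : 0 < τ) (u₁ u₂ : ℝ) :
    Real.exp (envelope τ u₁ u₂ ^ 2) ≤ Real.exp 2 *
      (Real.exp (u₁ ^ 2 / (4 * τ ^ 2)) + Real.exp (u₂ ^ 2 / (4 * τ ^ 2))) := by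
  have h1 : envelope τ u₁ u₂ ^ 2 ≤ 2 + max (u₁ ^ 2 / (4 * τ ^ 2)) (u₂ ^ 2 / (4 * τ ^ 2)) := by
    have h2 : envelope τ u₁ u₂ ^ 2 ≤ 2 + 2 * ((|u₁| + |u₂|) / (6 * τ)) ^ 2 := by
      rw [envelope]
      nlinarith [sq_nonneg (1 - (|u₁| + |u₂|) / (6 * τ))]
    have h3 : 2 * ((|u₁| + |u₂|) / (6 * τ)) ^ 2 ≤
        max (u₁ ^ 2 / (4 * τ ^ 2)) (u₂ ^ 2 / (4 * τ ^ 2)) := by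
      rw [max_div_div_right (by positivity : (0 : ℝ) ≤ 4 * τ ^ 2), div_pow, mul_div_assoc', div_le_div_iff₀
        (by positivity) (by positivity)]
      have ha : u₁ ^ 2 ≤ max (u₁ ^ 2) (u₂ ^ 2) := le_max_left _ _
      have hb : u₂ ^ 2 ≤ max (u₁ ^ 2) (u₂ ^ 2) := le_max_right _ _
      have hc : (|u₁| + |u₂|) ^ 2 ≤ 4 * max (u₁ ^ 2) (u₂ ^ 2) := by
        nlinarith [sq_nonneg (|u₁| - |u₂|), sq_abs u₁, sq_abs u₂]
      have hm : 0 ≤ max (u₁ ^ 2) (u₂ ^ 2) := (sq_nonneg _).trans ha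
      nlinarith [mul_le_mul_of_nonneg_right hc (sq_nonneg τ), mul_nonneg hm (sq_nonneg τ)]
    linarith
  refine (Real.exp_le_exp.2 h1).trans ?_
  rw [Real.exp_add]
  gcongr
  rcases max_choice (u₁ ^ 2 / (4 * τ ^ 2)) (u₂ ^ 2 / (4 * τ ^ 2)) with h | h <;> rw [h]
  · linarith [Real.exp_pos (u₂ ^ 2 / (4 * τ ^ 2))]
  · linarith [Real.exp_pos (u₁ ^ 2 / (4 * τ ^ 2))]

theorem integral_exp_envelope_sq_le {Ω : Type*} [MeasurableSpace Ω] {μ : Measure Ω} {τ : ℝ}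
    (hτ : 0 < τ) {U₁ U₂ : Ω → ℝ} (hU₁ : Measurable U₁) (hU₂ : Measurable U₂)
    (h₁ : HasSqExpMoment τ U₁ μ) (h₂ : HasSqExpMoment τ U₂ μ) :
    Integrable (fun ω => Real.exp (envelope τ (U₁ ω) (U₂ ω) ^ 2)) μ ∧
      ∫ ω, Real.exp (envelope τ (U₁ ω) (U₂ ω) ^ 2) ∂μ ≤ 4 * Real.exp 2 := by
  have hi := (h₁.1.add h₂.1).const_mul (Real.exp 2)
  have hint : Integrable (fun ω => Real.exp (envelope τ (U₁ ω) (U₂ ω) ^ 2)) μ := by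
    refine hi.mono' (Measurable.aestronglyMeasurable ?_) (ae_of_all _ fun ω => ?_)
    · simp only [envelope]
      fun_prop
    · rw [Real.norm_eq_abs, abs_of_pos (Real.exp_pos _)]
      exact exp_envelope_sq_le hτ _ _
  refine ⟨hint, (integral_mono hint hi fun ω => exp_envelope_sq_le hτ _ _).trans ?_⟩
  rw [integral_const_mul]
  have : ∫ ω, ((fun ω => Real.exp (U₁ ω ^ 2 / (4 * τ ^ 2))) +
      fun ω => Real.exp (U₂ ω ^ 2 / (4 * τ ^ 2))) ω ∂μ ≤ 2 + 2 := by
    rw [integral_add' h₁.1 h₂.1]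
    exact add_le_add h₁.2 h₂.2
  nlinarith [Real.exp_pos 2]

/-- Concentration for polynomials of two sub-Gaussian variables. -/
theorem concentration_envelope {Q : ℝ} (hQ : 2 ≤ Q) {K : ℝ} (hK : 0 ≤ K) :
    ∃ A : ℝ, 0 < A ∧ ∀ (Ω X : Type*) [MeasurableSpace Ω] [MeasurableSpace X] (μ : Measure Ω)
      (P : Measure X) [IsProbabilityMeasure μ] [IsProbabilityMeasure P] (N : ℕ) (p T τ : ℝ)
      (Y U₁ U₂ : X → Ω → ℝ), 1 ≤ N → 1 / 2 ≤ p → Real.log N ≤ p → 0 < T → 0 < τ →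
      Measurable (Function.uncurry Y) → Measurable (Function.uncurry U₁) →
      Measurable (Function.uncurry U₂) →
      (∀ x ω, |Y x ω| ≤ T * envelope τ (U₁ x ω) (U₂ x ω) ^ Q) →
      (∀ᵐ x ∂P, HasSqExpMoment τ (U₁ x) μ ∧ HasSqExpMoment τ (U₂ x) μ) →
      (Measure.pi fun _ : Fin N => μ) {ω | ENNReal.ofReal
          ((A * T * (√(p / N) + p ^ (Q / 2) / N)) ^ 2) <
        ∫⁻ x, ENNReal.ofReal (((1 / (N : ℝ)) * ∑ j, Y x (ω j) - ∫ ω, Y x ω ∂μ) ^ 2) ∂P} ≤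
      ENNReal.ofReal (A * Real.exp (-(K * p))) := by
  obtain ⟨A, hA, h⟩ := concentration hQ (Ce := 4 * Real.exp 2) (by positivity) hK
  refine ⟨A, hA, ?_⟩
  intro Ω X _ _ μ P _ _ N p T τ Y U₁ U₂ hN hp hNp hT hτ hY hU₁ hU₂ hle hexp
  have h1 : Measurable fun z : X × Ω => U₁ z.1 z.2 := hU₁
  have h2 : Measurable fun z : X × Ω => U₂ z.1 z.2 := hU₂
  refine h Ω X μ P N p T Y (fun x ω => envelope τ (U₁ x ω) (U₂ x ω)) hN hp hNp hT hY ?_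
    (fun x ω => one_le_envelope hτ _ _) hle ?_
  · change Measurable fun z : X × Ω => envelope τ (U₁ z.1 z.2) (U₂ z.1 z.2)
    simp only [envelope]
    fun_prop
  · filter_upwards [hexp] with x hx
    exact integral_exp_envelope_sq_le hτ hU₁.of_uncurry_left hU₂.of_uncurry_left hx.1 hx.2

/-- Upper bound, with exponentially small exceptional probability, for the average of
`(1 + U²) W`, when `U` is sub-Gaussian and `W ≤ N / p` has a moment of order `a > 1`. -/
theorem weighted_average_le {a Cw K : ℝ} (ha : 1 < a) (hCw : 0 ≤ Cw) (hK : 0 ≤ K) :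
    ∃ B : ℝ, 0 < B ∧ ∀ (Ω X : Type*) [MeasurableSpace Ω] [MeasurableSpace X] (μ : Measure Ω)
      (P : Measure X) [IsProbabilityMeasure μ] [IsProbabilityMeasure P] (N : ℕ) (p τ w : ℝ)
      (U : X → Ω → ℝ) (W : Ω → ℝ), 1 ≤ N → 1 / 2 ≤ p → 1 ≤ τ → 1 ≤ w →
      Measurable (Function.uncurry U) → Measurable W → (∀ ω, 0 ≤ W ω) → (∀ ω, W ω ≤ N / p) →
      ∫⁻ ω, ENNReal.ofReal (W ω ^ a) ∂μ ≤ ENNReal.ofReal (Cw * w ^ a) →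
      (∀ᵐ x ∂P, HasSqExpMoment τ (U x) μ) →
      (Measure.pi fun _ : Fin N => μ) {ω | ENNReal.ofReal (B * τ ^ 2 * w) <
        ∫⁻ x, ENNReal.ofReal ((1 / (N : ℝ)) * ∑ j, (1 + U x (ω j) ^ 2) * W (ω j)) ∂P} ≤
      ENNReal.ofReal (Real.exp (-(K * p))) := by
  set a' := a / (a - 1)
  have haa : a.HolderConjugate a' := Real.HolderConjugate.conjExponent ha
  have ha'1 : 1 < a' := haa.symm.lt
  have ha'0 : 0 < a' := by linarith
  -- With this normalization, raising `exp(2 R)` to the conjugate exponent `a'` produces exactly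
  -- `exp(U² / (4 τ²))`, up to a constant.
  set κ := 8 * a'
  have hκ : 1 ≤ κ := by simp only [κ]; linarith
  set C₁ := Cw + 2 * Real.exp (2 * a')
  have hC₁ : 0 ≤ C₁ := by positivity
  refine ⟨κ * (2 * (C₁ + K + 2)), by positivity, ?_⟩
  intro Ω X _ _ μ P _ _ N p τ w U W hN hp hτ hw hU hW hW0 hWle hWa hexp
  have hN0 : (0 : ℝ) < N := by exact_mod_cast hN
  have hp0 : 0 < p := by linarith
  have hτ0 : 0 < τ := by linarith
  have hw0 : 0 < w := by linarith
  have hU' : Measurable fun z : X × Ω => U z.1 z.2 := hU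
  set R : X → Ω → ℝ := fun x ω => 1 + U x ω ^ 2 / (κ * τ ^ 2)
  have hR0 : ∀ x ω, 0 ≤ R x ω := fun x ω => by simp only [R]; positivity
  -- This is the largest tilt for which `l * W ≤ 1`. Since then `l R W ≤ R`, the exponential of the
  -- product is controlled by that of `R`, and `W` itself enters only linearly, through Young's
  -- inequality with its `a`-th moment.
  set l := p / N
  have hl0 : 0 < l := by positivity
  set S : X → (Fin N → Ω) → ℝ := fun x ω => ∑ j, l * (R x (ω j) * W (ω j))
  have hSm : Measurable (Function.uncurry S) := by
    have h1 : ∀ j : Fin N, Measurable fun z : X × (Fin N → Ω) => U z.1 (z.2 j) := fun j =>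
      hU'.comp (measurable_fst.prodMk ((measurable_pi_apply j).comp measurable_snd))
    have h2 : ∀ j : Fin N, Measurable fun z : X × (Fin N → Ω) => W (z.2 j) := fun j =>
      hW.comp ((measurable_pi_apply j).comp measurable_snd)
    exact Finset.measurable_sum _ fun j _ =>
      (((((h1 j).pow_const 2).div_const _).const_add 1).mul (h2 j)).const_mul l
  have hmgf : ∀ᵐ x ∂P, ∫⁻ ω, ENNReal.ofReal (Real.exp (S x ω)) ∂(Measure.pi fun _ : Fin N => μ) ≤
      ENNReal.ofReal (Real.exp (p * w * C₁)) := by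
    filter_upwards [hexp] with x hx
    have hUx : Measurable (U x) := hU.of_uncurry_left
    have hRx : Measurable (R x) := ((hUx.pow_const 2).div_const _).const_add 1
    rw [lintegral_exp_sum_pi μ N (f := fun ω => l * (R x ω * W ω)) ((hRx.mul hW).const_mul l)]
    have hpt : ∀ ω, Real.exp (l * (R x ω * W ω)) ≤
        1 + l * w * (w⁻¹ ^ a * W ω ^ a) +
          l * w * (Real.exp (2 * a') * Real.exp (U x ω ^ 2 / (4 * τ ^ 2))) := by
      intro ω
      have hlW : l * W ω ≤ 1 := by
        calc l * W ω ≤ p / N * (N / p) := mul_le_mul_of_nonneg_left (hWle ω) hl0.le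
          _ = 1 := by field_simp
      set f := l * (R x ω * W ω)
      have hf0 : 0 ≤ f := by have := hR0 x ω; have := hW0 ω; positivity
      have hfR : f ≤ R x ω := by
        calc f = (l * W ω) * R x ω := by simp only [f]; ring
          _ ≤ 1 * R x ω := mul_le_mul_of_nonneg_right hlW (hR0 x ω)
          _ = R x ω := one_mul _
      have h1 : Real.exp f ≤ 1 + f * Real.exp f := by
        have := Real.add_one_le_exp (-f)
        have h2 : Real.exp f * Real.exp (-f) = 1 := by rw [← Real.exp_add]; simp
        nlinarith [Real.exp_pos f]
      have h2 : f * Real.exp f ≤ f * Real.exp (R x ω) := by gcongr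
      have h3 : R x ω * Real.exp (R x ω) ≤ Real.exp (2 * R x ω) := by
        have h := Real.add_one_le_exp (R x ω)
        calc R x ω * Real.exp (R x ω) ≤ Real.exp (R x ω) * Real.exp (R x ω) := by
              gcongr; linarith
          _ = _ := by rw [← Real.exp_add]; congr 1; ring
      have h4 : f * Real.exp (R x ω) ≤ l * w * ((w⁻¹ * W ω) * Real.exp (2 * R x ω)) := by
        calc f * Real.exp (R x ω) = l * W ω * (R x ω * Real.exp (R x ω)) := by
              simp only [f]; ring
          _ ≤ l * W ω * Real.exp (2 * R x ω) := by
              have := hW0 ω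
              gcongr
          _ = _ := by field_simp
      have h5 := Real.young_inequality_of_nonneg (a := w⁻¹ * W ω) (b := Real.exp (2 * R x ω))
        (mul_nonneg (by positivity) (hW0 ω)) (Real.exp_pos _).le haa
      have h6 : (w⁻¹ * W ω) ^ a = w⁻¹ ^ a * W ω ^ a := Real.mul_rpow (by positivity) (hW0 ω)
      have h7 : Real.exp (2 * R x ω) ^ a' =
          Real.exp (2 * a') * Real.exp (U x ω ^ 2 / (4 * τ ^ 2)) := by
        rw [← Real.exp_mul, ← Real.exp_add]
        congr 1
        simp only [R, κ]
        field_simp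
        ring
      have h8 : (w⁻¹ * W ω) ^ a / a ≤ w⁻¹ ^ a * W ω ^ a := by
        rw [h6]
        have := hW0 ω
        exact div_le_self (by positivity) ha.le
      have h9 : Real.exp (2 * R x ω) ^ a' / a' ≤
          Real.exp (2 * a') * Real.exp (U x ω ^ 2 / (4 * τ ^ 2)) := by
        rw [h7]
        exact div_le_self (by positivity) ha'1.le
      have h10 : l * w * ((w⁻¹ * W ω) * Real.exp (2 * R x ω)) ≤ l * w *
          (w⁻¹ ^ a * W ω ^ a + Real.exp (2 * a') * Real.exp (U x ω ^ 2 / (4 * τ ^ 2))) := by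
        gcongr
        linarith
      linarith
    have hone : ∫⁻ ω, ENNReal.ofReal (Real.exp (l * (R x ω * W ω))) ∂μ ≤
        ENNReal.ofReal (Real.exp (l * w * C₁)) := by
      calc _ ≤ ∫⁻ ω, (ENNReal.ofReal 1 + ENNReal.ofReal (l * w * w⁻¹ ^ a) *
            ENNReal.ofReal (W ω ^ a) + ENNReal.ofReal (l * w * Real.exp (2 * a')) *
            ENNReal.ofReal (Real.exp (U x ω ^ 2 / (4 * τ ^ 2)))) ∂μ := by
            refine lintegral_mono fun ω => ?_
            have := hW0 ω
            rw [← ENNReal.ofReal_mul (by positivity), ← ENNReal.ofReal_mul (by positivity),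
              ← ENNReal.ofReal_add (by positivity) (by positivity),
              ← ENNReal.ofReal_add (by positivity) (by positivity)]
            refine ENNReal.ofReal_le_ofReal ((hpt ω).trans_eq ?_)
            ring
        _ = ENNReal.ofReal 1 + ENNReal.ofReal (l * w * w⁻¹ ^ a) *
            ∫⁻ ω, ENNReal.ofReal (W ω ^ a) ∂μ + ENNReal.ofReal (l * w * Real.exp (2 * a')) *
            ∫⁻ ω, ENNReal.ofReal (Real.exp (U x ω ^ 2 / (4 * τ ^ 2))) ∂μ := by
            rw [lintegral_add_left (by fun_prop), lintegral_add_left (by fun_prop),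
              lintegral_const_mul _ (by fun_prop), lintegral_const_mul _ (by fun_prop)]
            simp
        _ ≤ ENNReal.ofReal 1 + ENNReal.ofReal (l * w * w⁻¹ ^ a) *
            ENNReal.ofReal (Cw * w ^ a) + ENNReal.ofReal (l * w * Real.exp (2 * a')) *
            ENNReal.ofReal 2 := by
            gcongr
            rw [← ofReal_integral_eq_lintegral_ofReal hx.1
              (ae_of_all _ fun _ => (Real.exp_pos _).le)]
            exact ENNReal.ofReal_le_ofReal hx.2
        _ ≤ _ := by
            rw [← ENNReal.ofReal_mul (by positivity), ← ENNReal.ofReal_mul (by positivity),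
              ← ENNReal.ofReal_add (by positivity) (by positivity),
              ← ENNReal.ofReal_add (by positivity) (by positivity)]
            refine ENNReal.ofReal_le_ofReal ?_
            have h1 : w⁻¹ ^ a * w ^ a = 1 := by
              rw [← Real.mul_rpow (by positivity) hw0.le, inv_mul_cancel₀ hw0.ne', Real.one_rpow]
            have h2 := Real.add_one_le_exp (l * w * C₁)
            have h3 : l * w * w⁻¹ ^ a * (Cw * w ^ a) = l * w * Cw * (w⁻¹ ^ a * w ^ a) := by ring
            rw [h3, h1]
            simp only [C₁] at h2 ⊢
            linarith
    calc _ ≤ ENNReal.ofReal (Real.exp (l * w * C₁)) ^ N := by gcongr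
      _ = _ := by
          rw [← ENNReal.ofReal_pow (Real.exp_pos _).le, ← Real.exp_nat_mul]
          congr 2
          simp only [l]
          field_simp
  have key := measure_lt_lintegral_le (μ := Measure.pi fun _ : Fin N => μ) (P := P) hSm
    (t₀ := p * w * (C₁ + K + 2)) (by
      have h1 : 1 / 2 * (1 : ℝ) ≤ p * w := mul_le_mul hp hw zero_le_one hp0.le
      have h2 : 1 / 2 * 2 ≤ p * w * (C₁ + K + 2) :=
        mul_le_mul (by linarith) (by linarith) zero_le_two (by positivity)
      linarith) hmgf
  refine (measure_mono fun ω hω => ?_).trans (key.trans (ENNReal.ofReal_le_ofReal ?_))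
  · simp only [mem_ofPred_eq] at hω ⊢
    by_contra! hcon
    refine absurd hω (not_lt.2 ?_)
    have hSω : Measurable fun x => S x ω := hSm.of_uncurry_right
    calc _ ≤ ∫⁻ x, ENNReal.ofReal (κ * τ ^ 2 / p) * ENNReal.ofReal (S x ω) ∂P := by
          refine lintegral_mono fun x => ?_
          rw [← ENNReal.ofReal_mul (by positivity)]
          refine ENNReal.ofReal_le_ofReal ?_
          simp only [S]
          rw [← Finset.mul_sum, ← mul_assoc]
          have hcst : κ * τ ^ 2 / p * l = 1 / (N : ℝ) * (κ * τ ^ 2) := by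
            simp only [l]; field_simp
          rw [hcst, mul_assoc (1 / (N : ℝ)), Finset.mul_sum Finset.univ _ (κ * τ ^ 2)]
          refine mul_le_mul_of_nonneg_left (Finset.sum_le_sum fun j _ => ?_) (by positivity : (0 : ℝ) ≤ 1 / (N : ℝ))
          rw [← mul_assoc]
          refine mul_le_mul_of_nonneg_right ?_ (hW0 _)
          have : κ * τ ^ 2 * R x (ω j) = κ * τ ^ 2 + U x (ω j) ^ 2 := by
            simp only [R]; field_simp
          rw [this]
          have := one_le_mul_of_one_le_of_one_le hκ (one_le_pow₀ hτ : 1 ≤ τ ^ 2)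
          linarith
      _ = ENNReal.ofReal (κ * τ ^ 2 / p) * ∫⁻ x, ENNReal.ofReal (S x ω) ∂P :=
          lintegral_const_mul _ (by fun_prop)
      _ ≤ ENNReal.ofReal (κ * τ ^ 2 / p) * ENNReal.ofReal (2 * (p * w * (C₁ + K + 2))) := by
          gcongr
      _ = _ := by
          rw [← ENNReal.ofReal_mul (by positivity)]
          congr 1
          field_simp
  · rw [← Real.exp_add]
    refine Real.exp_le_exp.2 ?_
    nlinarith [mul_nonneg hp0.le hK, mul_nonneg (mul_nonneg hp0.le hK) (sub_nonneg.2 hw)]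

end SubGaussian

/-! ### Nets of the sphere -/

section Nets

variable {n : ℕ}

/-- Volume comparison: the balls of radius `ε / 2` around the points are disjoint and lie in the
ball of radius `3 / 2`. -/
theorem card_le_of_separated_ball {ε : ℝ} (hε : 0 < ε) (hε1 : ε ≤ 1)
    (s : Finset (EuclideanSpace ℝ (Fin n))) (hs : ∀ c ∈ s, ‖c‖ = 1)
    (h : ∀ c ∈ s, ∀ d ∈ s, c ≠ d → ε ≤ ‖c - d‖) : (s.card : ℝ) ≤ (3 / ε) ^ n := by
  let μ : Measure (EuclideanSpace ℝ (Fin n)) := volume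
  have hδ : 0 < ε / 2 := by positivity
  have hfr : Module.finrank ℝ (EuclideanSpace ℝ (Fin n)) = n := by simp
  have hdis : Set.Pairwise (s : Set (EuclideanSpace ℝ (Fin n)))
      (Function.onFun Disjoint fun c => Metric.ball c (ε / 2)) := by
    intro c hc d hd hcd
    apply Metric.ball_disjoint_ball
    rw [dist_eq_norm]
    linarith [h c hc d hd hcd]
  have hsub : (⋃ c ∈ s, Metric.ball c (ε / 2)) ⊆ Metric.ball 0 (3 / 2) := by
    refine iUnion₂_subset fun x hx => Metric.ball_subset_ball' ?_
    rw [dist_zero_right, hs x hx]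
    linarith
  have hI : (s.card : ENNReal) * ENNReal.ofReal ((ε / 2) ^ n) * μ (Metric.ball 0 1) ≤
      ENNReal.ofReal ((3 / 2) ^ n) * μ (Metric.ball 0 1) := by
    calc _ = μ (⋃ c ∈ s, Metric.ball c (ε / 2)) := by
          rw [measure_biUnion_finset hdis fun c _ => measurableSet_ball]
          simp only [μ.addHaar_ball_of_pos _ hδ, hfr, Finset.sum_const, nsmul_eq_mul, mul_assoc]
      _ ≤ μ (Metric.ball 0 (3 / 2)) := measure_mono hsub
      _ = _ := by rw [μ.addHaar_ball_of_pos _ (by norm_num), hfr]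
  have hJ := (ENNReal.mul_le_mul_iff_left (Metric.measure_ball_pos _ _ zero_lt_one).ne'
    measure_ball_lt_top.ne).1 hI
  have hK := ENNReal.toReal_le_of_le_ofReal (by positivity) hJ
  rw [ENNReal.toReal_mul, ENNReal.toReal_ofReal (by positivity)] at hK
  have hK' : (s.card : ℝ) * (ε / 2) ^ n ≤ (3 / 2) ^ n := by simpa using hK
  calc (s.card : ℝ) ≤ (3 / 2) ^ n / (ε / 2) ^ n := by rwa [le_div_iff₀ (by positivity)]
    _ = (3 / ε) ^ n := by
        rw [← div_pow]
        congr 1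
        field_simp

/-- A separated subset of the sphere of maximal cardinality is a net, for otherwise a point could be
added. -/
theorem exists_sphere_net (n : ℕ) {ε : ℝ} (hε : 0 < ε) (hε1 : ε ≤ 1) :
    ∃ s : Finset (EuclideanSpace ℝ (Fin n)), (∀ c ∈ s, ‖c‖ = 1) ∧ (s.card : ℝ) ≤ (3 / ε) ^ n ∧
      ∀ v, ‖v‖ = 1 → ∃ c ∈ s, ‖v - c‖ ≤ ε := by
  classical
  set S : Set ℕ := {k | ∃ s : Finset (EuclideanSpace ℝ (Fin n)), (∀ c ∈ s, ‖c‖ = 1) ∧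
    (∀ c ∈ s, ∀ d ∈ s, c ≠ d → ε ≤ ‖c - d‖) ∧ s.card = k}
  have hne : S.Nonempty := ⟨0, ∅, by simp, by simp, rfl⟩
  have hbdd : BddAbove S := by
    refine ⟨⌊(3 / ε) ^ n⌋₊, fun k hk => ?_⟩
    obtain ⟨s, h1, h2, rfl⟩ := hk
    exact Nat.le_floor (card_le_of_separated_ball hε hε1 s h1 h2)
  obtain ⟨s, h1, h2, h3⟩ := Nat.sSup_mem hne hbdd
  refine ⟨s, h1, card_le_of_separated_ball hε hε1 s h1 h2, fun v hv => ?_⟩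
  by_contra! hcon
  have hvs : v ∉ s := fun hmem => by
    have := hcon v hmem
    rw [sub_self, norm_zero] at this
    linarith
  have hmem : (insert v s).card ∈ S := by
    refine ⟨insert v s, ?_, ?_, rfl⟩
    · intro c hc
      rcases Finset.mem_insert.1 hc with rfl | hc
      · exact hv
      · exact h1 c hc
    · intro c hc d hd hcd
      rcases Finset.mem_insert.1 hc with hc' | hc' <;>
        rcases Finset.mem_insert.1 hd with hd' | hd'
      · exact absurd (hc'.trans hd'.symm) hcd
      · rw [hc']; exact (hcon d hd').le
      · rw [hd', norm_sub_rev]; exact (hcon c hc').le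
      · exact h2 c hc' d hd' hcd
  have := le_csSup hbdd hmem
  rw [Finset.card_insert_of_notMem hvs] at this
  omega

theorem norm_le_of_net {s : Finset (EuclideanSpace ℝ (Fin n))}
    (hnet : ∀ v, ‖v‖ = 1 → ∃ c ∈ s, ‖v - c‖ ≤ 1 / 2) {g : EuclideanSpace ℝ (Fin n)} {B : ℝ}
    (hB : 0 ≤ B) (h : ∀ c ∈ s, |inner ℝ c g| ≤ B) : ‖g‖ ≤ 2 * B := by
  rcases eq_or_ne g 0 with rfl | hg
  · simpa using hB
  have hg0 : 0 < ‖g‖ := norm_pos_iff.2 hg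
  set v := (‖g‖⁻¹ : ℝ) • g
  have hv : ‖v‖ = 1 := by simp [v, norm_smul, hg0.ne']
  obtain ⟨c, hc, hvc⟩ := hnet v hv
  have h1 : inner ℝ v g = ‖g‖ := by
    simp only [v, real_inner_smul_left, real_inner_self_eq_norm_sq]
    field_simp
  have h2 : inner ℝ v g = inner ℝ c g + inner ℝ (v - c) g := by rw [inner_sub_left]; ring
  have h3 : inner ℝ (v - c) g ≤ 1 / 2 * ‖g‖ :=
    (real_inner_le_norm _ _).trans (by gcongr)
  have h4 := (le_abs_self _).trans (h c hc)
  linarith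

/-- A bound on the empirical `Q`-th moments over a net extends to the sphere. -/
theorem moment_le_of_net {N : ℕ} {Q : ℝ} (hQ : 1 ≤ Q) {s : Finset (EuclideanSpace ℝ (Fin n))}
    (hnet : ∀ v, ‖v‖ = 1 → ∃ c ∈ s, ‖v - c‖ ≤ 1 / 2) (ψ : Fin N → EuclideanSpace ℝ (Fin n))
    {B : ℝ} (hB : 0 ≤ B) (h : ∀ c ∈ s, ∑ j, |inner ℝ c (ψ j)| ^ Q ≤ B ^ Q)
    (v : EuclideanSpace ℝ (Fin n)) : ∑ j, |inner ℝ v (ψ j)| ^ Q ≤ (2 * B * ‖v‖) ^ Q := by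
  have hQ0 : 0 < Q := by linarith
  rcases eq_or_ne v 0 with rfl | hv
  · simp [Real.zero_rpow hQ0.ne']
  set f : EuclideanSpace ℝ (Fin n) → ℝ := fun v => (∑ j, |inner ℝ v (ψ j)| ^ Q) ^ (1 / Q)
  have hf0 : ∀ w, 0 ≤ f w := fun w => by positivity
  have hfQ : ∀ w, f w ^ Q = ∑ j, |inner ℝ w (ψ j)| ^ Q := fun w => by
    rw [← Real.rpow_mul (by positivity), one_div_mul_cancel hQ0.ne', Real.rpow_one]
  have hadd : ∀ a b, f (a + b) ≤ f a + f b := fun a b => by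
    have := Real.Lp_add_le Finset.univ (fun j => inner ℝ a (ψ j)) (fun j => inner ℝ b (ψ j)) hQ
    simpa only [f, inner_add_left] using this
  have hsmul : ∀ (r : ℝ) w, f (r • w) = |r| * f w := fun r w => by
    have h1 : ∑ j, |inner ℝ (r • w) (ψ j)| ^ Q = |r| ^ Q * ∑ j, |inner ℝ w (ψ j)| ^ Q := by
      rw [Finset.mul_sum]
      refine Finset.sum_congr rfl fun j _ => ?_
      rw [real_inner_smul_left, abs_mul, Real.mul_rpow (abs_nonneg _) (abs_nonneg _)]
    simp only [f]
    rw [h1, Real.mul_rpow (by positivity) (by positivity), ← Real.rpow_mul (abs_nonneg _),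
      mul_one_div_cancel hQ0.ne', Real.rpow_one]
  have hcont : Continuous f := by
    refine Continuous.rpow_const (continuous_finsetSum _ fun j _ => ?_) fun _ => Or.inr (by positivity)
    exact Continuous.rpow_const (by fun_prop) fun _ => Or.inr hQ0.le
  have hcomp : IsCompact (Metric.sphere (0 : EuclideanSpace ℝ (Fin n)) 1) := isCompact_sphere 0 1
  have hunit : ∀ w : EuclideanSpace ℝ (Fin n), w ≠ 0 → ‖(‖w‖⁻¹ : ℝ) • w‖ = 1 := fun w hw => by
    simp [norm_smul, hw]
  obtain ⟨m, hm, hmax⟩ := hcomp.exists_isMaxOn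
    ⟨(‖v‖⁻¹ : ℝ) • v, by rw [mem_sphere_zero_iff_norm]; exact hunit v hv⟩ hcont.continuousOn
  have hle : ∀ w, f w ≤ ‖w‖ * f m := fun w => by
    rcases eq_or_ne w 0 with rfl | hw
    · have := hsmul 0 0
      simp only [zero_smul, abs_zero, zero_mul] at this
      simp [this]
    · have h1 : f ((‖w‖⁻¹ : ℝ) • w) ≤ f m :=
        hmax (by rw [mem_sphere_zero_iff_norm]; exact hunit w hw)
      have hw0 : 0 < ‖w‖ := norm_pos_iff.2 hw
      rw [hsmul, abs_of_pos (inv_pos.2 hw0), inv_mul_le_iff₀ hw0] at h1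
      exact h1
  -- At a maximizer `m` of the seminorm `f` on the sphere, a net point within `1 / 2` gives `f m ≤ B
  -- + f m / 2`.
  have hmB : f m ≤ 2 * B := by
    obtain ⟨c, hc, hmc⟩ := hnet m (mem_sphere_zero_iff_norm.1 hm)
    have h1 : f m ≤ f c + f (m - c) := by
      have := hadd c (m - c)
      rwa [add_sub_cancel] at this
    have h2 : f (m - c) ≤ 1 / 2 * f m := (hle _).trans (mul_le_mul_of_nonneg_right hmc (hf0 m))
    have h3 : f c ≤ B := by
      rw [← Real.rpow_le_rpow_iff (hf0 c) hB hQ0, hfQ]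
      exact h c hc
    linarith
  rw [← hfQ]
  refine Real.rpow_le_rpow (hf0 v) ?_ hQ0.le
  calc f v ≤ ‖v‖ * f m := hle v
    _ ≤ ‖v‖ * (2 * B) := by gcongr
    _ = _ := by ring

/-- A small-ball count over a net extends to the sphere. -/
theorem count_le_of_net {N : ℕ} {Q κ η B ε : ℝ} (hQ : 1 ≤ Q) (hη : 0 < η) (hB : 0 < B)
    (hε : 0 ≤ ε) (hεB : 2 * B * ε / η ≤ κ / 2) (hκ : κ ≤ 1) {s : Finset (EuclideanSpace ℝ (Fin n))}
    (hnet : ∀ v, ‖v‖ = 1 → ∃ c ∈ s, ‖v - c‖ ≤ ε) (ψ : Fin N → EuclideanSpace ℝ (Fin n))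
    (hmom : ∀ v, ∑ j, |inner ℝ v (ψ j)| ^ Q ≤ N * (B * ‖v‖) ^ Q) (J : Finset (Fin N))
    (hcount : ∀ c ∈ s, κ * N ≤ (J.filter fun j => η ≤ |inner ℝ c (ψ j)|).card)
    {v : EuclideanSpace ℝ (Fin n)} (hv : ‖v‖ = 1) :
    κ / 2 * N ≤ (J.filter fun j => η / 2 ≤ |inner ℝ v (ψ j)|).card := by
  classical
  obtain ⟨c, hc, hvc⟩ := hnet v hv
  have hQ0 : 0 < Q := by linarith
  -- These are the indices at which replacing the net point `c` by `v` may lose more than `η / 2`.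
  -- By Markov's inequality for the `Q`-th moment in the direction `v - c`, there are at most `κ / 2
  -- * N` of them.
  set F := Finset.univ.filter fun j => η / 2 < |inner ℝ (v - c) (ψ j)|
  have hF : (F.card : ℝ) * (η / 2) ^ Q ≤ N * (B * ε) ^ Q := by
    calc (F.card : ℝ) * (η / 2) ^ Q = ∑ _j ∈ F, (η / 2) ^ Q := by
          rw [Finset.sum_const, nsmul_eq_mul]
      _ ≤ ∑ j ∈ F, |inner ℝ (v - c) (ψ j)| ^ Q := by
          refine Finset.sum_le_sum fun j hj => ?_
          exact Real.rpow_le_rpow (by positivity) (Finset.mem_filter.1 hj).2.le hQ0.le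
      _ ≤ ∑ j, |inner ℝ (v - c) (ψ j)| ^ Q :=
          Finset.sum_le_sum_of_subset_of_nonneg (Finset.subset_univ _) fun _ _ _ => by positivity
      _ ≤ N * (B * ‖v - c‖) ^ Q := hmom _
      _ ≤ N * (B * ε) ^ Q := by gcongr
  have hF2 : (F.card : ℝ) ≤ κ / 2 * N := by
    have h1 : (B * ε) ^ Q ≤ κ / 2 * (η / 2) ^ Q := by
      have h2 : B * ε = (2 * B * ε / η) * (η / 2) := by field_simp
      rw [h2, Real.mul_rpow (by positivity) (by positivity)]
      gcongr
      calc (2 * B * ε / η) ^ Q ≤ (2 * B * ε / η) ^ (1 : ℝ) :=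
            Real.rpow_le_rpow_of_exponent_ge_of_imp (by positivity) (by linarith) hQ
              (fun _ h => absurd h hQ0.ne')
        _ ≤ κ / 2 := by rwa [Real.rpow_one]
    have h3 : (0 : ℝ) < (η / 2) ^ Q := by positivity
    have h4 : (F.card : ℝ) * (η / 2) ^ Q ≤ (κ / 2 * N) * (η / 2) ^ Q := by
      calc _ ≤ N * (B * ε) ^ Q := hF
        _ ≤ N * (κ / 2 * (η / 2) ^ Q) := by gcongr
        _ = _ := by ring
    exact le_of_mul_le_mul_right h4 h3
  have hsub : (J.filter fun j => η ≤ |inner ℝ c (ψ j)|) ⊆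
      (J.filter fun j => η / 2 ≤ |inner ℝ v (ψ j)|) ∪ F := by
    intro j hj
    obtain ⟨hjJ, hj⟩ := Finset.mem_filter.1 hj
    rw [Finset.mem_union, Finset.mem_filter, Finset.mem_filter]
    by_cases hjF : η / 2 < |inner ℝ (v - c) (ψ j)|
    · exact Or.inr ⟨Finset.mem_univ j, hjF⟩
    · refine Or.inl ⟨hjJ, ?_⟩
      have h1 : inner ℝ c (ψ j) = inner ℝ v (ψ j) - inner ℝ (v - c) (ψ j) := by
        rw [inner_sub_left]; ring
      have h2 := abs_sub (inner ℝ v (ψ j)) (inner ℝ (v - c) (ψ j))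
      rw [← h1] at h2
      push Not at hjF
      linarith
  have h5 : ((J.filter fun j => η ≤ |inner ℝ c (ψ j)|).card : ℝ) ≤
      (J.filter fun j => η / 2 ≤ |inner ℝ v (ψ j)|).card + F.card := by
    exact_mod_cast (Finset.card_le_card hsub).trans (Finset.card_union_le _ _)
  linarith [hcount c hc]

end Nets

/-- A lower Chernoff bound for the number of occurrences of an event. -/
theorem measure_count_le {Ω : Type*} [MeasurableSpace Ω] {μ : Measure Ω} [IsProbabilityMeasure μ]
    (N : ℕ) {E : Set Ω} (hE : MeasurableSet E) {κ : ℝ} (hκ : κ ≤ μ.real E) :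
    (Measure.pi fun _ : Fin N => μ) {ω | ∑ j, E.indicator (fun _ => (1 : ℝ)) (ω j) < κ / 4 * N} ≤
      ENNReal.ofReal (Real.exp (-(κ / 4 * N))) := by
  set f : Ω → ℝ := fun ω => -E.indicator (fun _ => (1 : ℝ)) ω
  have hf : Measurable f := (measurable_const.indicator hE).neg
  have hexp : ∀ ω, Real.exp (f ω) = 1 - (1 - Real.exp (-1)) * E.indicator (fun _ => (1 : ℝ)) ω := by
    intro ω
    by_cases h : ω ∈ E <;> simp [f, h]
  have hi : Integrable (E.indicator fun _ => (1 : ℝ)) μ := (integrable_const 1).indicator hE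
  have hi2 : Integrable (fun ω => Real.exp (f ω)) μ := by
    simp_rw [hexp]
    exact (integrable_const 1).sub (hi.const_mul _)
  -- A unit tilt suffices: `1 - exp(-1) ≥ 1 / 2`, so the moment is at most `1 - κ / 2 ≤ exp(-(κ /
  -- 2))`. Half of this exponent is spent on the threshold `κ / 4 * N`.
  have hone : ∫⁻ ω, ENNReal.ofReal (Real.exp (f ω)) ∂μ ≤ ENNReal.ofReal (Real.exp (-(κ / 2))) := by
    rw [← ofReal_integral_eq_lintegral_ofReal hi2 (ae_of_all _ fun _ => (Real.exp_pos _).le)]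
    refine ENNReal.ofReal_le_ofReal ?_
    simp_rw [hexp]
    rw [integral_sub (integrable_const 1) (hi.const_mul _), integral_const_mul,
      integral_indicator_const _ hE]
    simp only [integral_const, probReal_univ, smul_eq_mul, mul_one]
    have h1 : Real.exp (-1) ≤ 1 / 2 := by
      rw [Real.exp_neg, inv_le_comm₀ (Real.exp_pos _) (by norm_num)]
      have := Real.add_one_le_exp (1 : ℝ)
      norm_num at this ⊢
      linarith
    have h2 := Real.add_one_le_exp (-(κ / 2))
    have h3 : 0 ≤ μ.real E := measureReal_nonneg
    nlinarith
  calc (Measure.pi fun _ : Fin N => μ) {ω | ∑ j, E.indicator (fun _ => (1 : ℝ)) (ω j) < κ / 4 * N}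
      ≤ (Measure.pi fun _ : Fin N => μ) {ω | ENNReal.ofReal (Real.exp (-(κ / 4 * N))) ≤
          ENNReal.ofReal (Real.exp (∑ j, f (ω j)))} := by
        refine measure_mono fun ω hω => ?_
        simp only [mem_ofPred_eq] at hω ⊢
        refine ENNReal.ofReal_le_ofReal (Real.exp_le_exp.2 ?_)
        simp only [f, Finset.sum_neg_distrib]
        linarith
    _ ≤ (∫⁻ ω : Fin N → Ω, ENNReal.ofReal (Real.exp (∑ j, f (ω j))) ∂(Measure.pi fun _ => μ)) /
          ENNReal.ofReal (Real.exp (-(κ / 4 * N))) := by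
        refine meas_ge_le_lintegral_div (Measurable.aemeasurable ?_) ?_ (by simp)
        · have : ∀ j : Fin N, Measurable fun ω : Fin N → Ω => f (ω j) := fun j =>
            hf.comp (measurable_pi_apply j)
          fun_prop
        · simpa using Real.exp_pos _
    _ ≤ ENNReal.ofReal (Real.exp (-(κ / 2))) ^ N / ENNReal.ofReal (Real.exp (-(κ / 4 * N))) := by
        rw [lintegral_exp_sum_pi μ N hf]
        gcongr
    _ = _ := by
        rw [← ENNReal.ofReal_pow (Real.exp_pos _).le, ← Real.exp_nat_mul,
          ← ENNReal.ofReal_div_of_pos (Real.exp_pos _), ← Real.exp_sub]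
        congr 2
        ring

/-! ### The population problem -/

section Population

/-- The properties of the whitened feature vector that the analysis uses. -/
structure WhitenedFeature {Ω : Type*} [MeasurableSpace Ω] {n : ℕ} (c η τ : ℝ) (μ : Measure Ω)
    (ψ : Ω → EuclideanSpace ℝ (Fin n)) : Prop where
  measurable : Measurable ψ
  one_le_tau : 1 ≤ τ
  eta_pos : 0 < η
  eta_le : η ≤ 1
  moment : ∀ v, ‖v‖ = 1 → HasSqExpMoment τ (fun ω => inner ℝ v (ψ ω)) μ
  isotropic : ∀ v, ‖v‖ = 1 → ∫ ω, (inner ℝ v (ψ ω) : ℝ) ^ 2 ∂μ = 1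
  smallBall : ∀ u v, ‖u‖ = 1 → ‖v‖ = 1 →
    c ≤ μ.real {ω | η ≤ |inner ℝ u (ψ ω)| ∧ η ≤ |inner ℝ v (ψ ω)|}

variable {Ω : Type*} [MeasurableSpace Ω] {n : ℕ} {c η τ : ℝ} {μ : Measure Ω}
  {ψ : Ω → EuclideanSpace ℝ (Fin n)} {C Q₁ Q₂ q₁ q₂ : ℝ} {ρ : ℝ → ℝ}

theorem PEN.abs_link_le_rpow (hp : PEN C c Q₁ Q₂ q₁ q₂ ρ) (hC : 0 < C) (hQ₁ : 1 < Q₁)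
    (hQ₂ : 1 < Q₂) {α : ℝ} (hα : 0 < α) (r : ℝ) :
    |link ρ (α * r)| ≤ C * |link ρ α| * (1 + |r|) ^ (max Q₁ Q₂ - 1) := by
  refine (hp.abs_link_le hC hα r).trans (mul_le_mul_of_nonneg_left ?_ (by positivity))
  have key : ∀ Q, 1 < Q → Q ≤ max Q₁ Q₂ → |r| ^ (Q - 1) ≤ (1 + |r|) ^ (max Q₁ Q₂ - 1) :=
    fun Q h1 h2 => (Real.rpow_le_rpow (abs_nonneg _) (by linarith) (by linarith)).trans
      (Real.rpow_le_rpow_of_exponent_le (by linarith [abs_nonneg r]) (by linarith))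
  exact max_le (key _ hQ₁ (le_max_left _ _)) (key _ hQ₂ (le_max_right _ _))

theorem PEN.abs_conjugate_sub_le (hp : PEN C c Q₁ Q₂ q₁ q₂ ρ) (hC : 0 < C) (hQ₁ : 1 < Q₁)
    (hQ₂ : 1 < Q₂) (t : ℝ) :
    |conjugate ρ t - conjugate ρ 0| ≤ C * |link ρ 1| * (1 + |t|) ^ (max Q₁ Q₂) := by
  have h1 := hp.subgradient t 0
  have h2 := hp.subgradient 0 t
  rw [hp.link_zero] at h2
  have h3 := hp.abs_link_le_rpow hC hQ₁ hQ₂ one_pos t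
  rw [one_mul] at h3
  have h4 := hp.mul_link_eq_abs t
  have h5 : |t| * |link ρ t| ≤ (1 + |t|) * (C * |link ρ 1| * (1 + |t|) ^ (max Q₁ Q₂ - 1)) :=
    mul_le_mul (by linarith) h3 (abs_nonneg _) (by positivity)
  have h6 : (1 + |t|) ^ (max Q₁ Q₂) = (1 + |t|) * (1 + |t|) ^ (max Q₁ Q₂ - 1) := by
    rw [← Real.rpow_one_add' (by positivity) (by linarith [le_max_left Q₁ Q₂])]
    congr 1; ring
  rw [h6, abs_of_nonneg (by linarith)]
  linarith

/-- The link function is strictly increasing. -/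
theorem PEN.increment_pos (hp : PEN C c Q₁ Q₂ q₁ q₂ ρ) (hc : 0 < c) (hq₁ : 1 < q₁)
    (hq₂ : 1 < q₂) {a b : ℝ} (h : a ≠ b) : 0 < (link ρ a - link ρ b) * (a - b) := by
  rcases eq_or_ne b 0 with rfl | hb
  · rw [hp.link_zero, sub_zero, sub_zero, mul_comm, hp.mul_link_eq_abs]
    have := hp.link_ne_zero h
    positivity
  · have h1 := hp.increment_lower hc hq₁ hq₂ one_pos (r := a) (r' := b) (η := min |b| 1)
      (A := max |b| 1) (lt_min (abs_pos.2 hb) one_pos) (min_le_right _ _) (le_max_right _ _)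
      (min_le_left _ _) (le_max_left _ _)
    rw [one_mul, one_mul] at h1
    refine lt_of_lt_of_le ?_ h1
    have h2 : 0 < min |b| 1 := lt_min (abs_pos.2 hb) one_pos
    have h3 : 0 < |a - b| := abs_pos.2 (sub_ne_zero.2 h)
    have h4 : 0 < |link ρ 1| := abs_pos.2 (hp.link_ne_zero one_ne_zero)
    have h5 : 0 < min |a - b| (min |b| 1 / 2) := lt_min h3 (by positivity)
    positivity

theorem HasSqExpMoment.integrable_rpow {τ : ℝ} (hτ : 0 < τ) {X : Ω → ℝ} (hX : Measurable X)
    (h : HasSqExpMoment τ X μ) (k a : ℝ) (hk : 0 ≤ k) (ha : 0 ≤ a) :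
    Integrable (fun ω => (1 + k * |X ω|) ^ a) μ := by
  obtain ⟨A, hA, hle⟩ := exists_rpow_le_mul_exp_mul_sq a (b := 1 / (4 * τ ^ 2)) (by positivity)
  refine (h.1.const_mul ((1 + k) ^ a * A)).mono' (Measurable.aestronglyMeasurable (by fun_prop))
    (ae_of_all _ fun ω => ?_)
  rw [Real.norm_eq_abs, abs_of_nonneg (by positivity)]
  calc (1 + k * |X ω|) ^ a ≤ ((1 + k) * (1 + |X ω|)) ^ a := by
        gcongr
        nlinarith [abs_nonneg (X ω)]
    _ = (1 + k) ^ a * (1 + |X ω|) ^ a := Real.mul_rpow (by positivity) (by positivity)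
    _ ≤ (1 + k) ^ a * (A * Real.exp (1 / (4 * τ ^ 2) * |X ω| ^ 2)) := by
        gcongr
        exact hle _ (abs_nonneg _)
    _ = _ := by rw [sq_abs, mul_assoc, one_div_mul_eq_div]

namespace WhitenedFeature

theorem measurable_inner (hw : WhitenedFeature c η τ μ ψ) (v : EuclideanSpace ℝ (Fin n)) :
    Measurable fun ω => inner ℝ v (ψ ω) := by
  have := hw.measurable
  fun_prop

theorem integrable_rpow [IsFiniteMeasure μ] (hw : WhitenedFeature c η τ μ ψ)
    (v : EuclideanSpace ℝ (Fin n)) {a k : ℝ} (ha : 0 ≤ a) (hk : 0 ≤ k) :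
    Integrable (fun ω => (1 + k * |inner ℝ v (ψ ω)|) ^ a) μ := by
  rcases eq_or_ne v 0 with rfl | hv
  · simp
  · have hv0 : 0 < ‖v‖ := norm_pos_iff.2 hv
    have hu : ‖(‖v‖⁻¹ : ℝ) • v‖ = 1 := by simp [norm_smul, hv]
    have := (hw.moment _ hu).integrable_rpow (by linarith [hw.one_le_tau]) (hw.measurable_inner _)
      (k * ‖v‖) a (by positivity) ha
    refine this.congr (ae_of_all _ fun ω => ?_)
    simp only [real_inner_smul_left, abs_mul, abs_of_pos (inv_pos.2 hv0)]
    congr 2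
    field_simp

theorem integrable_rpow_two [IsFiniteMeasure μ] (hw : WhitenedFeature c η τ μ ψ)
    (u v : EuclideanSpace ℝ (Fin n)) {a : ℝ} (ha : 0 ≤ a) :
    Integrable (fun ω => (1 + |inner ℝ u (ψ ω)| + |inner ℝ v (ψ ω)|) ^ a) μ := by
  refine ((hw.integrable_rpow u ha zero_le_two).add (hw.integrable_rpow v ha zero_le_two)).mono'
    ?_ (ae_of_all _ fun ω => ?_)
  · have h1 := hw.measurable_inner u
    have h2 := hw.measurable_inner v
    exact Measurable.aestronglyMeasurable (by fun_prop)
  · rw [Real.norm_eq_abs, abs_of_nonneg (by positivity), Pi.add_apply]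
    set x := |inner ℝ u (ψ ω)|
    set y := |inner ℝ v (ψ ω)|
    have hx : 0 ≤ x := abs_nonneg _
    have hy : 0 ≤ y := abs_nonneg _
    rcases le_total x y with h | h
    · have : (1 + x + y) ^ a ≤ (1 + 2 * y) ^ a :=
        Real.rpow_le_rpow (by positivity) (by linarith) ha
      have : 0 ≤ (1 + 2 * x) ^ a := by positivity
      linarith
    · have : (1 + x + y) ^ a ≤ (1 + 2 * x) ^ a :=
        Real.rpow_le_rpow (by positivity) (by linarith) ha
      have : 0 ≤ (1 + 2 * y) ^ a := by positivity
      linarith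

variable [IsProbabilityMeasure μ]

theorem integrable_conjugate (hw : WhitenedFeature c η τ μ ψ) (hp : PEN C c Q₁ Q₂ q₁ q₂ ρ)
    (hC : 0 < C) (hQ₁ : 1 < Q₁) (hQ₂ : 1 < Q₂) (θ : EuclideanSpace ℝ (Fin n)) :
    Integrable (fun ω => conjugate ρ (inner ℝ (ψ ω) θ)) μ := by
  have h0 := (hw.integrable_rpow θ (a := max Q₁ Q₂) (by linarith [le_max_left Q₁ Q₂])
    zero_le_one).const_mul (C * |link ρ 1|)
  refine ((integrable_const |conjugate ρ 0|).add h0).mono' ?_ (ae_of_all _ fun ω => ?_)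
  · have := hw.measurable
    exact (hp.continuous.measurable.comp (by fun_prop)).aestronglyMeasurable
  · have h1 := hp.abs_conjugate_sub_le hC hQ₁ hQ₂ (inner ℝ (ψ ω) θ)
    rw [Pi.add_apply, one_mul, real_inner_comm (ψ ω) θ, Real.norm_eq_abs]
    have h2 := abs_sub_abs_le_abs_sub (conjugate ρ (inner ℝ (ψ ω) θ)) (conjugate ρ 0)
    linarith

/-- Stationarity: directional derivatives of the dual objective. -/
theorem hasDerivAt_dual (hw : WhitenedFeature c η τ μ ψ) (hp : PEN C c Q₁ Q₂ q₁ q₂ ρ)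
    (hC : 0 < C) (hQ₁ : 1 < Q₁) (hQ₂ : 1 < Q₂) (b θ v : EuclideanSpace ℝ (Fin n)) :
    Integrable (fun ω => inner ℝ v (ψ ω) * link ρ (inner ℝ (ψ ω) θ)) μ ∧
    HasDerivAt (fun t : ℝ => inner ℝ (θ + t • v) b -
      ∫ ω, conjugate ρ (inner ℝ (ψ ω) (θ + t • v)) ∂μ)
      (inner ℝ v b - ∫ ω, inner ℝ v (ψ ω) * link ρ (inner ℝ (ψ ω) θ) ∂μ) 0 := by
  have hQ : 1 < max Q₁ Q₂ := lt_max_of_lt_left hQ₁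
  have key := hasDerivAt_integral_of_dominated_loc_of_deriv_le (μ := μ) (𝕜 := ℝ)
    (s := Metric.ball (0 : ℝ) 1) (x₀ := 0)
    (F := fun t ω => conjugate ρ (inner ℝ (ψ ω) (θ + t • v)))
    (F' := fun t ω => inner ℝ v (ψ ω) * link ρ (inner ℝ (ψ ω) (θ + t • v)))
    (bound := fun ω => C * |link ρ 1| * (1 + |inner ℝ θ (ψ ω)| + |inner ℝ v (ψ ω)|) ^ (max Q₁ Q₂))
    (Metric.ball_mem_nhds 0 one_pos)
    (Eventually.of_forall fun t =>
      (hw.integrable_conjugate hp hC hQ₁ hQ₂ (θ + t • v)).aestronglyMeasurable)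
    (hw.integrable_conjugate hp hC hQ₁ hQ₂ _)
    (by
      have := hw.measurable
      exact ((hw.measurable_inner v).mul
        (hp.monotone.measurable.comp (by fun_prop))).aestronglyMeasurable)
    (ae_of_all _ fun ω t ht => by
      rw [mem_ball_zero_iff, Real.norm_eq_abs] at ht
      have h1 := hp.abs_link_le_rpow hC hQ₁ hQ₂ one_pos (inner ℝ (ψ ω) (θ + t • v))
      rw [one_mul] at h1
      have h2 : |inner ℝ (ψ ω) (θ + t • v)| ≤ |inner ℝ θ (ψ ω)| + |inner ℝ v (ψ ω)| := by
        rw [inner_add_right, real_inner_smul_right, real_inner_comm (ψ ω) θ,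
          real_inner_comm (ψ ω) v]
        refine (abs_add_le _ _).trans (add_le_add le_rfl ?_)
        rw [abs_mul]
        exact mul_le_of_le_one_left (abs_nonneg _) ht.le
      rw [Real.norm_eq_abs, abs_mul]
      set x := |inner ℝ θ (ψ ω)|
      set y := |inner ℝ v (ψ ω)|
      have hx : 0 ≤ x := abs_nonneg _
      have hy : 0 ≤ y := abs_nonneg _
      calc y * |link ρ (inner ℝ (ψ ω) (θ + t • v))|
          ≤ (1 + x + y) * (C * |link ρ 1| * (1 + |inner ℝ (ψ ω) (θ + t • v)|) ^
              (max Q₁ Q₂ - 1)) := mul_le_mul (by linarith) h1 (abs_nonneg _) (by linarith)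
        _ ≤ (1 + x + y) * (C * |link ρ 1| * (1 + x + y) ^ (max Q₁ Q₂ - 1)) := by
            have : 0 ≤ max Q₁ Q₂ - 1 := by linarith
            have : 1 + |inner ℝ (ψ ω) (θ + t • v)| ≤ 1 + x + y := by linarith
            gcongr
        _ = C * |link ρ 1| * ((1 + x + y) * (1 + x + y) ^ (max Q₁ Q₂ - 1)) := by ring
        _ = _ := by
            rw [← Real.rpow_one_add' (by positivity) (by linarith)]
            congr 2; ring)
    ((hw.integrable_rpow_two θ v (by linarith)).const_mul _)
    (ae_of_all _ fun ω t _ => by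
      have h1 : HasDerivAt (fun t : ℝ => (inner ℝ (ψ ω) (θ + t • v) : ℝ)) (inner ℝ v (ψ ω)) t := by
        have : (fun t : ℝ => (inner ℝ (ψ ω) (θ + t • v) : ℝ)) =
            fun t => inner ℝ (ψ ω) θ + t * inner ℝ v (ψ ω) := by
          ext t
          rw [inner_add_right, real_inner_smul_right, real_inner_comm v]
        rw [this]
        simpa using ((hasDerivAt_id t).mul_const (inner ℝ v (ψ ω) : ℝ)).const_add
          (inner ℝ (ψ ω) θ : ℝ)
      have h2 := (hp.hasDerivAt (inner ℝ (ψ ω) (θ + t • v))).comp t h1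
      rw [mul_comm] at h2
      exact h2)
  simp only [zero_smul, add_zero] at key
  refine ⟨key.1, HasDerivAt.sub ?_ key.2⟩
  have : (fun t : ℝ => (inner ℝ (θ + t • v) b : ℝ)) = fun t => inner ℝ θ b + t * inner ℝ v b := by
    ext t
    rw [inner_add_left, real_inner_smul_left]
  rw [this]
  simpa using ((hasDerivAt_id (0 : ℝ)).mul_const (inner ℝ v b : ℝ)).const_add (inner ℝ θ b : ℝ)

theorem stationary (hw : WhitenedFeature c η τ μ ψ) (hp : PEN C c Q₁ Q₂ q₁ q₂ ρ)
    (hC : 0 < C) (hQ₁ : 1 < Q₁) (hQ₂ : 1 < Q₂) {b θ : EuclideanSpace ℝ (Fin n)}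
    (hmax : ∀ θ', inner ℝ θ' b - ∫ ω, conjugate ρ (inner ℝ (ψ ω) θ') ∂μ ≤
      inner ℝ θ b - ∫ ω, conjugate ρ (inner ℝ (ψ ω) θ) ∂μ) (v : EuclideanSpace ℝ (Fin n)) :
    ∫ ω, inner ℝ v (ψ ω) * link ρ (inner ℝ (ψ ω) θ) ∂μ = inner ℝ v b := by
  have h := (hw.hasDerivAt_dual hp hC hQ₁ hQ₂ b θ v).2
  have hm : IsLocalMax (fun t : ℝ => inner ℝ (θ + t • v) b -
      ∫ ω, conjugate ρ (inner ℝ (ψ ω) (θ + t • v)) ∂μ) 0 :=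
    Eventually.of_forall fun t => by
      have := hmax (θ + t • v)
      simpa using this
  have := hm.hasDerivAt_eq_zero h
  linarith

theorem exists_isArgMax (hw : WhitenedFeature c η τ μ ψ) (hp : PEN C c Q₁ Q₂ q₁ q₂ ρ)
    (hC : 0 < C) (hc : 0 < c) (hQ₁ : 1 < Q₁) (hQ₂ : 1 < Q₂) (hq₁ : 1 < q₁) (hq₂ : 1 < q₂)
    (b : EuclideanSpace ℝ (Fin n)) :
    ∃ θ, IsArgMax (fun θ => inner ℝ θ b - ∫ ω, conjugate ρ (inner ℝ (ψ ω) θ) ∂μ) θ := by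
  have hi := hw.integrable_conjugate hp hC hQ₁ hQ₂
  set H : EuclideanSpace ℝ (Fin n) → ℝ := fun θ => ∫ ω, conjugate ρ (inner ℝ (ψ ω) θ) ∂μ
  have hHconv : ConvexOn ℝ univ H := by
    refine ⟨convex_univ, fun x _ y _ a a' ha ha' hsum => ?_⟩
    simp only [H, smul_eq_mul]
    rw [← integral_const_mul, ← integral_const_mul, ← integral_add ((hi x).const_mul a)
      ((hi y).const_mul a')]
    refine integral_mono (hi _) (((hi x).const_mul a).add ((hi y).const_mul a')) fun ω => ?_
    have := (convexOn_conjugate hp.conjugate_finite).2 (mem_univ (inner ℝ (ψ ω) x))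
      (mem_univ (inner ℝ (ψ ω) y)) ha ha' hsum
    simpa only [inner_add_right, real_inner_smul_right, smul_eq_mul] using this
  have hHcont : Continuous H := hHconv.locallyLipschitz.continuous
  set F : EuclideanSpace ℝ (Fin n) → ℝ := fun θ => inner ℝ θ b - H θ
  have hFcont : Continuous F := by fun_prop
  have hη := hw.eta_pos
  -- Since `|⟨ψ, θ⟩| ≥ η ‖θ‖` with probability at least `c`, the slope `M` makes the expected
  -- conjugate at least `(‖b‖ + 1) ‖θ‖` minus a constant, which beats the linear term with slope one
  -- to spare.
  set M := (‖b‖ + 1) / (c * η)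
  have hM : 0 < M := by positivity
  have hbound : ∀ θ, F θ ≤ max (ρ M) (ρ (-M)) - ‖θ‖ := by
    intro θ
    rcases eq_or_ne θ 0 with rfl | hθ
    · have : -max (ρ M) (ρ (-M)) ≤ conjugate ρ 0 := by
        have := mul_abs_sub_le_conjugate hp.conjugate_finite M 0
        simpa using this
      simp only [F, H, inner_zero_left, inner_zero_right, integral_const, probReal_univ, norm_zero]
      simp only [smul_eq_mul, one_mul]
      linarith
    · have hθ0 : 0 < ‖θ‖ := norm_pos_iff.2 hθ
      have hu : ‖(‖θ‖⁻¹ : ℝ) • θ‖ = 1 := by simp [norm_smul, hθ]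
      set u := (‖θ‖⁻¹ : ℝ) • θ
      have hθu : θ = ‖θ‖ • u := by simp only [u]; rw [smul_smul, mul_inv_cancel₀ hθ0.ne', one_smul]
      set S := {ω | η ≤ |inner ℝ u (ψ ω)| ∧ η ≤ |inner ℝ u (ψ ω)|}
      have hSm : MeasurableSet S := by
        have : MeasurableSet {ω | η ≤ |inner ℝ u (ψ ω)|} := measurableSet_le measurable_const
          (continuous_abs.measurable.comp (hw.measurable_inner u))
        exact this.inter this
      have hpt : ∀ ω, M * (‖θ‖ * η) * S.indicator (fun _ => (1 : ℝ)) ω - max (ρ M) (ρ (-M)) ≤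
          conjugate ρ (inner ℝ (ψ ω) θ) := by
        intro ω
        refine le_trans (sub_le_sub_right ?_ _)
          (mul_abs_sub_le_conjugate hp.conjugate_finite M (inner ℝ (ψ ω) θ))
        rw [mul_assoc]
        refine mul_le_mul_of_nonneg_left ?_ hM.le
        by_cases hω : ω ∈ S
        · rw [indicator_of_mem hω, mul_one, hθu, real_inner_smul_right, abs_mul, norm_smul, hu,
            mul_one, norm_norm, abs_of_pos hθ0, real_inner_comm]
          exact mul_le_mul_of_nonneg_left hω.1 hθ0.le
        · rw [indicator_of_notMem hω, mul_zero]
          exact abs_nonneg _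
      have hii : Integrable (S.indicator fun _ => (1 : ℝ)) μ := (integrable_const 1).indicator hSm
      have hle : ∫ ω, (M * (‖θ‖ * η) * S.indicator (fun _ => (1 : ℝ)) ω -
          max (ρ M) (ρ (-M))) ∂μ ≤ ∫ ω, conjugate ρ (inner ℝ (ψ ω) θ) ∂μ :=
        integral_mono ((hii.const_mul (M * (‖θ‖ * η))).sub (integrable_const _)) (hi θ) hpt
      rw [integral_sub (hii.const_mul _) (integrable_const _), integral_const_mul,
        integral_indicator_const _ hSm] at hle
      simp only [integral_const, probReal_univ, smul_eq_mul, one_mul, mul_one] at hle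
      have h1 : (‖b‖ + 1) * ‖θ‖ ≤ M * (‖θ‖ * η) * μ.real S := by
        calc (‖b‖ + 1) * ‖θ‖ = M * (‖θ‖ * η) * c := by simp only [M]; field_simp
          _ ≤ _ := by gcongr; exact hw.smallBall u u hu hu
      have h2 := real_inner_le_norm θ b
      simp only [F, H]
      linarith
  obtain ⟨θ, hθ⟩ := hFcont.exists_forall_ge_of_isBounded 0 (by
    refine (Metric.isBounded_closedBall (x := (0 : EuclideanSpace ℝ (Fin n)))
      (r := max (ρ M) (ρ (-M)) - F 0)).subset fun x hx => ?_
    rw [mem_closedBall_zero_iff]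
    have := hbound x
    have hx' : F 0 ≤ F x := hx
    linarith)
  refine ⟨θ, hθ, fun θ' hθ' => ?_⟩
  by_contra hne
  have hv : θ' - θ ≠ 0 := sub_ne_zero.2 hne
  have s1 := hw.stationary hp hC hQ₁ hQ₂ (b := b) hθ (θ' - θ)
  have s2 := hw.stationary hp hC hQ₁ hQ₂ (b := b) hθ' (θ' - θ)
  have i1 := (hw.hasDerivAt_dual hp hC hQ₁ hQ₂ b θ (θ' - θ)).1
  have i2 := (hw.hasDerivAt_dual hp hC hQ₁ hQ₂ b θ' (θ' - θ)).1
  -- Two maximizers satisfy the same stationarity equation. The integrand is nonnegative by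
  -- monotonicity of `s`, hence vanishes almost surely; strict monotonicity then gives `⟨θ' - θ, ψ⟩
  -- = 0` almost surely, which the small ball property excludes.
  have hzero : ∫ ω, (inner ℝ (θ' - θ) (ψ ω) * link ρ (inner ℝ (ψ ω) θ') -
      inner ℝ (θ' - θ) (ψ ω) * link ρ (inner ℝ (ψ ω) θ)) ∂μ = 0 := by
    rw [integral_sub i2 i1, s1, s2, sub_self]
  have hform : ∀ ω, inner ℝ (θ' - θ) (ψ ω) * link ρ (inner ℝ (ψ ω) θ') -
      inner ℝ (θ' - θ) (ψ ω) * link ρ (inner ℝ (ψ ω) θ) =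
      (link ρ (inner ℝ (ψ ω) θ') - link ρ (inner ℝ (ψ ω) θ)) *
        (inner ℝ (ψ ω) θ' - inner ℝ (ψ ω) θ) := fun ω => by
    rw [inner_sub_left, real_inner_comm (ψ ω) θ, real_inner_comm (ψ ω) θ']; ring
  have hnn : ∀ ω, 0 ≤ inner ℝ (θ' - θ) (ψ ω) * link ρ (inner ℝ (ψ ω) θ') -
      inner ℝ (θ' - θ) (ψ ω) * link ρ (inner ℝ (ψ ω) θ) := fun ω => by
    rw [hform]
    rcases eq_or_ne (inner ℝ (ψ ω) θ' : ℝ) (inner ℝ (ψ ω) θ) with h | h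
    · rw [h]; simp
    · exact (hp.increment_pos hc hq₁ hq₂ h).le
  have hae := (integral_eq_zero_iff_of_nonneg hnn (i2.sub i1)).1 hzero
  have hu : ‖(‖θ' - θ‖⁻¹ : ℝ) • (θ' - θ)‖ = 1 := by simp [norm_smul, hv]
  have hball := hw.smallBall _ _ hu hu
  have hnull : μ {ω | η ≤ |inner ℝ ((‖θ' - θ‖⁻¹ : ℝ) • (θ' - θ)) (ψ ω)| ∧
      η ≤ |inner ℝ ((‖θ' - θ‖⁻¹ : ℝ) • (θ' - θ)) (ψ ω)|} = 0 := by
    refine measure_mono_null (fun ω hω => ?_) (ae_iff.1 hae)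
    simp only [mem_ofPred_eq, Pi.zero_apply] at hω ⊢
    rw [hform]
    intro h0
    have heq : (inner ℝ (ψ ω) θ' : ℝ) = inner ℝ (ψ ω) θ := by
      by_contra h
      exact (hp.increment_pos hc hq₁ hq₂ h).ne' h0
    have := hω.1
    rw [real_inner_smul_left, inner_sub_left, real_inner_comm (ψ ω) θ, real_inner_comm (ψ ω) θ',
      heq, sub_self, mul_zero, abs_zero] at this
    linarith
  rw [measureReal_def, hnull] at hball
  simp only [ENNReal.toReal_zero] at hball
  linarith

end WhitenedFeature

end Population

/-! ### The scale of the population link -/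

section Scale

theorem mul_min_rpow_of_one_le {x q₁ q₂ : ℝ} (hx : 1 ≤ x) :
    x * min (x ^ (q₁ - 1)) (x ^ (q₂ - 1)) = x ^ min q₁ q₂ := by
  have hx0 : 0 < x := by linarith
  have key : ∀ q : ℝ, x * x ^ (q - 1) = x ^ q := fun q => by
    rw [Real.rpow_sub_one hx0.ne']; field_simp
  rcases le_total q₁ q₂ with h | h
  · rw [min_eq_left (Real.rpow_le_rpow_of_exponent_le hx (by linarith)), min_eq_left h, key]
  · rw [min_eq_right (Real.rpow_le_rpow_of_exponent_le hx (by linarith)), min_eq_right h, key]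

theorem mul_min_rpow_of_le_one {x q₁ q₂ : ℝ} (hx : 0 < x) (hx1 : x ≤ 1) :
    x * min (x ^ (q₁ - 1)) (x ^ (q₂ - 1)) = x ^ max q₁ q₂ := by
  have key : ∀ q : ℝ, x * x ^ (q - 1) = x ^ q := fun q => by
    rw [Real.rpow_sub_one hx.ne']; field_simp
  rcases le_total q₁ q₂ with h | h
  · rw [min_eq_right (Real.rpow_le_rpow_of_exponent_ge hx hx1 (by linarith)), max_eq_right h, key]
  · rw [min_eq_left (Real.rpow_le_rpow_of_exponent_ge hx hx1 (by linarith)), max_eq_left h, key]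

theorem sq_le_half_add_of_le_one {x q₁ q₂ : ℝ} (hq₁ : 1 < q₁) (hx : 0 ≤ x) (hx1 : x ≤ 1) :
    x ^ 2 ≤ 1 / 2 + 2 ^ max q₁ q₂ * (x * min (x ^ (q₁ - 1)) (x ^ (q₂ - 1))) := by
  have hnn : 0 ≤ (2:ℝ) ^ max q₁ q₂ * (x * min (x ^ (q₁ - 1)) (x ^ (q₂ - 1))) := by positivity
  rcases le_total x (1 / 2) with h | h
  · nlinarith
  · have hx0 : 0 < x := by linarith
    rw [mul_min_rpow_of_le_one hx0 hx1, ← Real.mul_rpow (by norm_num) hx]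
    have : 1 ≤ (2 * x) ^ max q₁ q₂ :=
      Real.one_le_rpow (by linarith) (by linarith [le_max_left q₁ q₂])
    nlinarith

theorem sq_le_mul_of_one_le {x T q₁ q₂ : ℝ} (hx1 : 1 ≤ x) (hxT : x ≤ T) :
    x ^ 2 ≤ T ^ max (2 - min q₁ q₂) 0 * (x * min (x ^ (q₁ - 1)) (x ^ (q₂ - 1))) := by
  have hx0 : 0 < x := by linarith
  rw [mul_min_rpow_of_one_le hx1]
  calc x ^ 2 = x ^ (2 - min q₁ q₂) * x ^ min q₁ q₂ := by
        rw [← Real.rpow_add hx0, ← Real.rpow_natCast]; congr 1; push_cast; ring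
    _ ≤ x ^ max (2 - min q₁ q₂) 0 * x ^ min q₁ q₂ := by
        gcongr
        exact le_max_left _ _
    _ ≤ _ := by gcongr

/-- At the level `A τ^{1+δ}` the Gaussian tail is exponentially small in `τ^{2δ}` and beats the
factor `τ²`. At a fixed multiple of `τ` it would not, which is the reason for the loss `δ > 0`. -/
theorem exists_truncation_level {δ : ℝ} (hδ : 0 < δ) :
    ∃ A : ℝ, 1 ≤ A ∧ ∀ τ : ℝ, 1 ≤ τ →
      16 * τ ^ 2 * Real.exp (-((A * τ ^ (1 + δ)) ^ 2 / (8 * τ ^ 2))) ≤ 1 / 4 := by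
  obtain ⟨B, hB, hle⟩ := exists_rpow_le_mul_exp_mul_sq (2 / δ) (b := 1 / 8) (by norm_num)
  refine ⟨1 + 512 * B, by linarith, fun τ hτ => ?_⟩
  have hτ0 : 0 < τ := by linarith
  set z := τ ^ δ
  have hz1 : 1 ≤ z := Real.one_le_rpow hτ hδ.le
  have h1 : τ ^ 2 ≤ B * Real.exp (1 / 8 * z ^ 2) := by
    refine le_trans ?_ (hle z (by linarith))
    calc τ ^ 2 = z ^ (2 / δ) := by
          simp only [z]
          rw [← Real.rpow_mul hτ0.le, mul_div_cancel₀ _ hδ.ne', ← Real.rpow_natCast]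
          norm_num
      _ ≤ _ := Real.rpow_le_rpow (by linarith) (by linarith) (by positivity)
  have h2 : ((1 + 512 * B) * τ ^ (1 + δ)) ^ 2 / (8 * τ ^ 2) = (1 + 512 * B) ^ 2 * z ^ 2 / 8 := by
    rw [Real.rpow_add hτ0, Real.rpow_one]
    simp only [z]
    field_simp
  have h3 : 1 / 8 * z ^ 2 + 64 * B ≤ (1 + 512 * B) ^ 2 * z ^ 2 / 8 := by
    have : 1 ≤ z ^ 2 := one_le_pow₀ hz1
    nlinarith [mul_le_mul_of_nonneg_left this hB.le, mul_pos hB hB, sq_nonneg (B * z)]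
  rw [h2]
  have h4 : 64 * B ≤ Real.exp (64 * B) := by linarith [Real.add_one_le_exp (64 * B)]
  calc 16 * τ ^ 2 * Real.exp (-((1 + 512 * B) ^ 2 * z ^ 2 / 8))
      ≤ 16 * (B * Real.exp (1 / 8 * z ^ 2)) * Real.exp (-(1 / 8 * z ^ 2 + 64 * B)) := by gcongr
    _ = 16 * B * Real.exp (-(64 * B)) := by
        rw [neg_add, Real.exp_add, Real.exp_neg (1 / 8 * z ^ 2)]
        field_simp
    _ = 16 * B / Real.exp (64 * B) := by rw [Real.exp_neg]; rfl
    _ ≤ 1 / 4 := by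
        rw [div_le_iff₀ (Real.exp_pos _)]; linarith

/-- A unit second moment and a sub-Gaussian tail bound lower-order moments from below. -/
theorem one_le_mul_integral_min {q₁ q₂ δ : ℝ} (hq₁ : 1 < q₁) (hq₂ : 1 < q₂)
    (hδ : 0 < δ ∨ δ = 0 ∧ 2 ≤ min q₁ q₂) :
    ∃ B : ℝ, 0 < B ∧ ∀ (Ω : Type*) [MeasurableSpace Ω] (μ : Measure Ω) [IsProbabilityMeasure μ]
      (τ : ℝ) (X : Ω → ℝ), 1 ≤ τ → Measurable X → HasSqExpMoment τ X μ → ∫ ω, X ω ^ 2 ∂μ = 1 →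
      1 ≤ B * τ ^ max (2 - min q₁ q₂ + δ) 0 *
        ∫ ω, |X ω| * min (|X ω| ^ (q₁ - 1)) (|X ω| ^ (q₂ - 1)) ∂μ := by
  have hint : ∀ (Ω : Type _) [MeasurableSpace Ω] (μ : Measure Ω) [IsProbabilityMeasure μ]
      (τ : ℝ) (X : Ω → ℝ), 1 ≤ τ → Measurable X → HasSqExpMoment τ X μ →
      Integrable (fun ω => |X ω| * min (|X ω| ^ (q₁ - 1)) (|X ω| ^ (q₂ - 1))) μ := by
    intro Ω _ μ _ τ X hτ hX hm
    refine (hm.integrable_rpow (by linarith) hX 1 q₁ zero_le_one (by linarith)).mono'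
      (Measurable.aestronglyMeasurable (by fun_prop)) (ae_of_all _ fun ω => ?_)
    rw [Real.norm_eq_abs, abs_of_nonneg (by positivity), one_mul]
    have h0 := abs_nonneg (X ω)
    calc |X ω| * min (|X ω| ^ (q₁ - 1)) (|X ω| ^ (q₂ - 1))
        ≤ (1 + |X ω|) * (1 + |X ω|) ^ (q₁ - 1) := by
          refine mul_le_mul (by linarith) ((min_le_left _ _).trans ?_) (by positivity)
            (by positivity)
          exact Real.rpow_le_rpow h0 (by linarith) (by linarith)
      _ = _ := by
          rw [← Real.rpow_one_add' (by positivity) (by linarith)]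
          congr 1; ring
  have hsq : ∀ (Ω : Type _) [MeasurableSpace Ω] (μ : Measure Ω) (X : Ω → ℝ),
      ∫ ω, X ω ^ 2 ∂μ = 1 → Integrable (fun ω => X ω ^ 2) μ := fun Ω _ μ X h => by
    by_contra hn
    rw [integral_undef hn] at h
    exact zero_ne_one h
  set K := (2 : ℝ) ^ max q₁ q₂
  have hK : 0 < K := by positivity
  -- If both exponents are at least `2`, the minimum of powers dominates `x²` for `x ≥ 1`, no
  -- truncation is needed and `δ = 0` is allowed. Otherwise the range `1 ≤ |X| ≤ T` costs a factor
  -- `T^{2-q'}`, and the part beyond `T = A τ^{1+δ}` contributes at most `1 / 4` to the second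
  -- moment.
  rcases le_or_gt 2 (min q₁ q₂) with he | he
  · refine ⟨2 * (K + 1), by positivity, fun Ω _ μ _ τ X hτ hX hm h1 => ?_⟩
    set m := fun ω => |X ω| * min (|X ω| ^ (q₁ - 1)) (|X ω| ^ (q₂ - 1))
    have hmi := hint Ω μ τ X hτ hX hm
    have hm0 : 0 ≤ ∫ ω, m ω ∂μ := integral_nonneg fun ω => by positivity
    have hle : ∫ ω, X ω ^ 2 ∂μ ≤ ∫ ω, (1 / 2 + (K + 1) * m ω) ∂μ := by
      refine integral_mono (hsq Ω μ X h1) ((integrable_const _).add (hmi.const_mul _)) fun ω => ?_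
      have hmω : 0 ≤ m ω := by positivity
      rw [← sq_abs]
      rcases le_total |X ω| 1 with h | h
      · have := sq_le_half_add_of_le_one (q₂ := q₂) hq₁ (abs_nonneg (X ω)) h
        change _ ≤ 1 / 2 + (K + 1) * m ω
        change _ ≤ 1 / 2 + K * m ω at this
        linarith
      · have := sq_le_mul_of_one_le (q₁ := q₁) (q₂ := q₂) h le_rfl
        rw [max_eq_right (by linarith), Real.rpow_zero, one_mul] at this
        change _ ≤ 1 / 2 + (K + 1) * m ω
        change _ ≤ m ω at this
        nlinarith
    rw [h1, integral_add (integrable_const _) (hmi.const_mul _), integral_const_mul] at hle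
    simp only [integral_const, probReal_univ, one_smul] at hle
    have h2 : 1 ≤ τ ^ max (2 - min q₁ q₂ + δ) 0 := Real.one_le_rpow hτ (le_max_right _ _)
    calc 1 ≤ 2 * (K + 1) * 1 * ∫ ω, m ω ∂μ := by linarith
      _ ≤ _ := by gcongr
  · have hδ0 : 0 < δ := hδ.resolve_right fun h => by linarith [h.2]
    obtain ⟨A, hA, htail⟩ := exists_truncation_level hδ0
    set e := max (2 - min q₁ q₂) 0
    have hq' : 1 < min q₁ q₂ := lt_min hq₁ hq₂
    have he' : e = 2 - min q₁ q₂ := max_eq_left (by linarith)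
    have hA0 : 0 < A := by linarith
    refine ⟨4 * (K + A ^ e), by positivity, fun Ω _ μ _ τ X hτ hX hm h1 => ?_⟩
    have hτ0 : 0 < τ := by linarith
    set m := fun ω => |X ω| * min (|X ω| ^ (q₁ - 1)) (|X ω| ^ (q₂ - 1))
    have hmi := hint Ω μ τ X hτ hX hm
    have hm0 : 0 ≤ ∫ ω, m ω ∂μ := integral_nonneg fun ω => by positivity
    set T := A * τ ^ (1 + δ)
    have hT0 : 0 < T := by positivity
    set R := 8 * τ ^ 2 * Real.exp (-(T ^ 2 / (8 * τ ^ 2)))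
    have hle : ∫ ω, X ω ^ 2 ∂μ ≤
        ∫ ω, (1 / 2 + ((K + T ^ e) * m ω + R * Real.exp (X ω ^ 2 / (4 * τ ^ 2)))) ∂μ := by
      refine integral_mono (hsq Ω μ X h1) ((integrable_const _).add ((hmi.const_mul _).add
        (hm.1.const_mul _))) fun ω => ?_
      have hmω : 0 ≤ m ω := by positivity
      have hTe : 0 ≤ T ^ e := by positivity
      have hR : 0 ≤ R * Real.exp (X ω ^ 2 / (4 * τ ^ 2)) := by positivity
      change X ω ^ 2 ≤ 1 / 2 + ((K + T ^ e) * m ω + R * Real.exp (X ω ^ 2 / (4 * τ ^ 2)))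
      have hKm : 0 ≤ K * m ω := by positivity
      have hTm : 0 ≤ T ^ e * m ω := by positivity
      rcases le_total |X ω| 1 with h | h
      · have := sq_le_half_add_of_le_one (q₂ := q₂) hq₁ (abs_nonneg (X ω)) h
        change _ ≤ 1 / 2 + K * m ω at this
        rw [sq_abs] at this
        linarith
      · rcases le_total |X ω| T with h' | h'
        · have := sq_le_mul_of_one_le (q₁ := q₁) (q₂ := q₂) h h'
          change _ ≤ T ^ e * m ω at this
          rw [sq_abs] at this
          linarith
        · have h3 : T ^ 2 ≤ X ω ^ 2 := by
            rw [← sq_abs (X ω)]; exact pow_le_pow_left₀ hT0.le h' 2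
          have h4 : X ω ^ 2 / (8 * τ ^ 2) ≤ Real.exp (X ω ^ 2 / (8 * τ ^ 2)) := by
            linarith [Real.add_one_le_exp (X ω ^ 2 / (8 * τ ^ 2))]
          have h5 : X ω ^ 2 ≤ R * Real.exp (X ω ^ 2 / (4 * τ ^ 2)) := by
            calc X ω ^ 2 = 8 * τ ^ 2 * (X ω ^ 2 / (8 * τ ^ 2)) := by field_simp
              _ ≤ 8 * τ ^ 2 * Real.exp (X ω ^ 2 / (8 * τ ^ 2)) := by gcongr
              _ ≤ 8 * τ ^ 2 * Real.exp (-(T ^ 2 / (8 * τ ^ 2)) + X ω ^ 2 / (4 * τ ^ 2)) := by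
                  gcongr
                  have : T ^ 2 / (8 * τ ^ 2) ≤ X ω ^ 2 / (8 * τ ^ 2) := by gcongr
                  have h6 : X ω ^ 2 / (4 * τ ^ 2) = 2 * (X ω ^ 2 / (8 * τ ^ 2)) := by
                    field_simp; ring
                  rw [h6]
                  linarith
              _ = _ := by rw [Real.exp_add, ← mul_assoc]
          linarith
    have i1 : Integrable (fun ω => (K + T ^ e) * m ω + R * Real.exp (X ω ^ 2 / (4 * τ ^ 2))) μ :=
      (hmi.const_mul _).add (hm.1.const_mul _)
    rw [h1, integral_add (integrable_const _) i1, integral_add (hmi.const_mul _)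
      (hm.1.const_mul _), integral_const_mul, integral_const_mul] at hle
    simp only [integral_const, probReal_univ, one_smul] at hle
    have hR0 : 0 ≤ R := by positivity
    have hR1 : R * ∫ ω, Real.exp (X ω ^ 2 / (4 * τ ^ 2)) ∂μ ≤ R * 2 :=
      mul_le_mul_of_nonneg_left hm.2 hR0
    have hR2 : R * 2 ≤ 1 / 4 := by
      have := htail τ hτ
      simp only [R, T]
      linarith
    have hex : max (2 - min q₁ q₂ + δ) 0 = e + δ := by
      rw [he', max_eq_left (by linarith)]
    have hTe : K + T ^ e ≤ (K + A ^ e) * τ ^ (e + δ) := by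
      have h7 : T ^ e = A ^ e * τ ^ ((1 + δ) * e) := by
        simp only [T]
        rw [Real.mul_rpow hA0.le (by positivity), ← Real.rpow_mul hτ0.le]
      -- Because `e ≤ 1`, enlarging the truncation level by `τ^δ` costs at most `δ` in the exponent.
      have h8 : τ ^ ((1 + δ) * e) ≤ τ ^ (e + δ) := by
        refine Real.rpow_le_rpow_of_exponent_le hτ ?_
        have : e ≤ 1 := by rw [he']; linarith
        nlinarith
      have h9 : 1 ≤ τ ^ (e + δ) := Real.one_le_rpow hτ (by rw [he']; linarith)
      have h10 : 0 < A ^ e := by positivity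
      rw [h7]
      nlinarith [mul_le_mul_of_nonneg_left h8 h10.le, mul_le_mul_of_nonneg_left h9 hK.le]
    rw [hex]
    have := mul_le_mul_of_nonneg_right hTe hm0
    calc 1 ≤ 4 * ((K + T ^ e) * ∫ ω, m ω ∂μ) := by linarith
      _ ≤ 4 * ((K + A ^ e) * τ ^ (e + δ) * ∫ ω, m ω ∂μ) := by gcongr
      _ = _ := by ring

variable {Ω : Type*} [MeasurableSpace Ω] {n : ℕ} {c η τ : ℝ} {μ : Measure Ω}
  {ψ : Ω → EuclideanSpace ℝ (Fin n)} {C Q₁ Q₂ q₁ q₂ : ℝ} {ρ : ℝ → ℝ} [IsProbabilityMeasure μ]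

/-- Stationarity is tested in the direction `u` of the maximizer itself. There the integrand `⟨u, ψ⟩
s(α ⟨u, ψ⟩)` is nonnegative and at least `c |s(α)|` times a function of `⟨u, ψ⟩` alone, while the
other side is `⟨u, b⟩ ≤ ‖b‖`. -/
theorem WhitenedFeature.link_le (hw : WhitenedFeature c η τ μ ψ) (hp : PEN C c Q₁ Q₂ q₁ q₂ ρ)
    (hC : 0 < C) (hc : 0 < c) (hQ₁ : 1 < Q₁) (hQ₂ : 1 < Q₂) (hq₁ : 1 < q₁) (hq₂ : 1 < q₂)
    {b u : EuclideanSpace ℝ (Fin n)} {α B : ℝ} (hα : 0 < α) (hu : ‖u‖ = 1) (hB : 0 ≤ B)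
    (hmax : ∀ θ', inner ℝ θ' b - ∫ ω, conjugate ρ (inner ℝ (ψ ω) θ') ∂μ ≤
      inner ℝ (α • u) b - ∫ ω, conjugate ρ (inner ℝ (ψ ω) (α • u)) ∂μ)
    (h : 1 ≤ B * ∫ ω, |inner ℝ u (ψ ω)| * min (|inner ℝ u (ψ ω)| ^ (q₁ - 1))
      (|inner ℝ u (ψ ω)| ^ (q₂ - 1)) ∂μ) :
    |link ρ α| ≤ B / c * ‖b‖ := by
  have hs := hw.stationary hp hC hQ₁ hQ₂ (b := b) hmax u
  have hi := (hw.hasDerivAt_dual hp hC hQ₁ hQ₂ b (α • u) u).1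
  set I := ∫ ω, |inner ℝ u (ψ ω)| * min (|inner ℝ u (ψ ω)| ^ (q₁ - 1))
      (|inner ℝ u (ψ ω)| ^ (q₂ - 1)) ∂μ
  have hle : c * |link ρ α| * I ≤ inner ℝ u b := by
    rw [← hs, ← integral_const_mul]
    refine integral_mono_of_nonneg (ae_of_all _ fun ω => by positivity) hi (ae_of_all _ fun ω => ?_)
    have h1 := hp.le_abs_link hq₁ hq₂ hα (inner ℝ u (ψ ω))
    have h2 := hp.mul_link_eq_abs (α * inner ℝ u (ψ ω))
    rw [abs_mul, abs_of_pos hα, mul_assoc, mul_assoc] at h2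
    have h3 := mul_left_cancel₀ hα.ne' h2
    simp only [real_inner_smul_right]
    rw [real_inner_comm u (ψ ω), h3]
    calc _ = |inner ℝ u (ψ ω)| * (c * |link ρ α| * min (|inner ℝ u (ψ ω)| ^ (q₁ - 1))
          (|inner ℝ u (ψ ω)| ^ (q₂ - 1))) := by ring
      _ ≤ _ := by gcongr
  have h1 : (inner ℝ u b : ℝ) ≤ ‖b‖ := by
    have := real_inner_le_norm u b
    rwa [hu, one_mul] at this
  rw [div_mul_eq_mul_div, le_div_iff₀ hc]
  calc |link ρ α| * c = |link ρ α| * c * 1 := by ring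
    _ ≤ |link ρ α| * c * (B * I) := by gcongr
    _ = B * (c * |link ρ α| * I) := by ring
    _ ≤ B * ‖b‖ := by gcongr; linarith

end Scale

/-! ### The empirical problem -/

section Empirical

variable {n N : ℕ} {C c Q₁ Q₂ q₁ q₂ : ℝ} {ρ : ℝ → ℝ}

/-- The finite-width dual objective in whitened coordinates. -/
noncomputable def empiricalDual (ρ : ℝ → ℝ) (ψ : Fin N → EuclideanSpace ℝ (Fin n))
    (b θ : EuclideanSpace ℝ (Fin n)) : ℝ :=
  inner ℝ θ b - (1 / (N : ℝ)) * ∑ j, conjugate ρ (inner ℝ (ψ j) θ)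

theorem concaveOn_empiricalDual (hp : PEN C c Q₁ Q₂ q₁ q₂ ρ)
    (ψ : Fin N → EuclideanSpace ℝ (Fin n)) (b : EuclideanSpace ℝ (Fin n)) :
    ConcaveOn ℝ univ (empiricalDual ρ ψ b) := by
  refine ⟨convex_univ, fun x _ y _ a a' ha ha' hsum => ?_⟩
  have hG := fun j => (convexOn_conjugate hp.conjugate_finite).2 (mem_univ (inner ℝ (ψ j) x))
      (mem_univ (inner ℝ (ψ j) y)) ha ha' hsum
  have h1 : ∑ j, conjugate ρ (inner ℝ (ψ j) (a • x + a' • y)) ≤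
      a * ∑ j, conjugate ρ (inner ℝ (ψ j) x) + a' * ∑ j, conjugate ρ (inner ℝ (ψ j) y) := by
    rw [Finset.mul_sum, Finset.mul_sum, ← Finset.sum_add_distrib]
    refine Finset.sum_le_sum fun j _ => ?_
    simpa only [inner_add_right, real_inner_smul_right, smul_eq_mul] using hG j
  have h2 := mul_le_mul_of_nonneg_left h1 (by positivity : (0 : ℝ) ≤ 1 / N)
  simp only [empiricalDual, smul_eq_mul, inner_add_left, real_inner_smul_left]
  linarith

theorem continuous_empiricalDual (hp : PEN C c Q₁ Q₂ q₁ q₂ ρ)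
    (ψ : Fin N → EuclideanSpace ℝ (Fin n)) (b : EuclideanSpace ℝ (Fin n)) :
    Continuous (empiricalDual ρ ψ b) := by
  have := hp.continuous
  unfold empiricalDual
  fun_prop

theorem hasDerivAt_empiricalDual (hp : PEN C c Q₁ Q₂ q₁ q₂ ρ)
    (ψ : Fin N → EuclideanSpace ℝ (Fin n)) (b θ v : EuclideanSpace ℝ (Fin n)) :
    HasDerivAt (fun t : ℝ => empiricalDual ρ ψ b (θ + t • v))
      (inner ℝ v b - (1 / (N : ℝ)) * ∑ j, inner ℝ v (ψ j) * link ρ (inner ℝ (ψ j) θ)) 0 := by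
  unfold empiricalDual
  refine HasDerivAt.sub ?_ (HasDerivAt.const_mul _ (HasDerivAt.fun_sum fun j _ => ?_))
  · have : (fun t : ℝ => (inner ℝ (θ + t • v) b : ℝ)) =
        fun t => inner ℝ θ b + t * inner ℝ v b := by
      ext t
      rw [inner_add_left, real_inner_smul_left]
    rw [this]
    simpa using ((hasDerivAt_id (0 : ℝ)).mul_const (inner ℝ v b : ℝ)).const_add (inner ℝ θ b : ℝ)
  · have h1 : HasDerivAt (fun t : ℝ => (inner ℝ (ψ j) (θ + t • v) : ℝ)) (inner ℝ v (ψ j)) 0 := by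
      have : (fun t : ℝ => (inner ℝ (ψ j) (θ + t • v) : ℝ)) =
          fun t => inner ℝ (ψ j) θ + t * inner ℝ v (ψ j) := by
        ext t
        rw [inner_add_right, real_inner_smul_right, real_inner_comm v]
      rw [this]
      simpa using ((hasDerivAt_id (0 : ℝ)).mul_const (inner ℝ v (ψ j) : ℝ)).const_add
        (inner ℝ (ψ j) θ : ℝ)
    have h2 := (hp.hasDerivAt (inner ℝ (ψ j) (θ + (0 : ℝ) • v))).comp (0 : ℝ) h1
    rw [mul_comm, zero_smul, add_zero] at h2
    exact h2

theorem empirical_stationary (hp : PEN C c Q₁ Q₂ q₁ q₂ ρ)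
    {ψ : Fin N → EuclideanSpace ℝ (Fin n)} {b θ : EuclideanSpace ℝ (Fin n)}
    (hmax : ∀ θ', empiricalDual ρ ψ b θ' ≤ empiricalDual ρ ψ b θ)
    (v : EuclideanSpace ℝ (Fin n)) :
    (1 / (N : ℝ)) * ∑ j, inner ℝ v (ψ j) * link ρ (inner ℝ (ψ j) θ) = inner ℝ v b := by
  have hm : IsLocalMax (fun t : ℝ => empiricalDual ρ ψ b (θ + t • v)) 0 :=
    Eventually.of_forall fun t => by
      have := hmax (θ + t • v)
      simpa using this
  have := hm.hasDerivAt_eq_zero (hasDerivAt_empiricalDual hp ψ b θ v)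
  linarith

/-- If the features span, the empirical maximizer is unique. -/
theorem empirical_unique (hp : PEN C c Q₁ Q₂ q₁ q₂ ρ) (hc : 0 < c) (hq₁ : 1 < q₁) (hq₂ : 1 < q₂)
    (hN : 1 ≤ N) {ψ : Fin N → EuclideanSpace ℝ (Fin n)}
    (hspan : ∀ v, ‖v‖ = 1 → ∃ j, (inner ℝ v (ψ j) : ℝ) ≠ 0) {b θ θ' : EuclideanSpace ℝ (Fin n)}
    (hmax : ∀ θ', empiricalDual ρ ψ b θ' ≤ empiricalDual ρ ψ b θ)
    (hmax' : ∀ θ'', empiricalDual ρ ψ b θ'' ≤ empiricalDual ρ ψ b θ') : θ' = θ := by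
  by_contra hne
  have hv : θ' - θ ≠ 0 := sub_ne_zero.2 hne
  have hN0 : (0 : ℝ) < 1 / N := by
    have : (0 : ℝ) < N := by exact_mod_cast hN
    positivity
  have s1 := empirical_stationary hp hmax (θ' - θ)
  have s2 := empirical_stationary hp hmax' (θ' - θ)
  have h0 : ∑ j, (link ρ (inner ℝ (ψ j) θ') - link ρ (inner ℝ (ψ j) θ)) *
      (inner ℝ (ψ j) θ' - inner ℝ (ψ j) θ) = 0 := by
    have h1 : ∑ j, inner ℝ (θ' - θ) (ψ j) * link ρ (inner ℝ (ψ j) θ') =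
        ∑ j, inner ℝ (θ' - θ) (ψ j) * link ρ (inner ℝ (ψ j) θ) :=
      mul_left_cancel₀ hN0.ne' (s2.trans s1.symm)
    rw [← sub_eq_zero, ← Finset.sum_sub_distrib] at h1
    rw [← h1]
    refine Finset.sum_congr rfl fun j _ => ?_
    rw [inner_sub_left, real_inner_comm (ψ j) θ, real_inner_comm (ψ j) θ']
    ring
  have hnn : ∀ j ∈ Finset.univ, 0 ≤ (link ρ (inner ℝ (ψ j) θ') - link ρ (inner ℝ (ψ j) θ)) *
      (inner ℝ (ψ j) θ' - inner ℝ (ψ j) θ) := fun j _ => by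
    rcases eq_or_ne (inner ℝ (ψ j) θ' : ℝ) (inner ℝ (ψ j) θ) with h | h
    · rw [h]; simp
    · exact (hp.increment_pos hc hq₁ hq₂ h).le
  obtain ⟨j, hj⟩ := hspan ((‖θ' - θ‖⁻¹ : ℝ) • (θ' - θ)) (by simp [norm_smul, hv])
  have hjz := (Finset.sum_eq_zero_iff_of_nonneg hnn).1 h0 j (Finset.mem_univ j)
  apply hj
  have heq : (inner ℝ (ψ j) θ' : ℝ) = inner ℝ (ψ j) θ := by
    by_contra h
    exact (hp.increment_pos hc hq₁ hq₂ h).ne' hjz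
  rw [real_inner_smul_left, inner_sub_left, real_inner_comm (ψ j) θ, real_inner_comm (ψ j) θ',
    heq, sub_self, mul_zero]

/-- Existence and localization of the empirical maximizer around `α • u`. -/
theorem exists_empirical_isArgMax (hp : PEN C c Q₁ Q₂ q₁ q₂ ρ) (hc : 0 < c) (hq₁ : 1 < q₁)
    (hq₂ : 1 < q₂) (hN : 1 ≤ N) {ψ : Fin N → EuclideanSpace ℝ (Fin n)}
    (hspan : ∀ v, ‖v‖ = 1 → ∃ j, (inner ℝ v (ψ j) : ℝ) ≠ 0) {b u g : EuclideanSpace ℝ (Fin n)}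
    (hu : ‖u‖ = 1) {α L : ℝ} (hα : 0 < α) (hL : 0 < L)
    (hg : ∀ v, inner ℝ v g =
      inner ℝ v b - (1 / (N : ℝ)) * ∑ j, inner ℝ v (ψ j) * link ρ (α * inner ℝ u (ψ j)))
    (hlow : ∀ v, ‖v‖ = 1 → ∀ D : ℝ, 0 ≤ D → L * (D * min D 1) ≤ (1 / (N : ℝ)) *
      ∑ j, (link ρ (α * (inner ℝ u (ψ j) + D * inner ℝ v (ψ j))) - link ρ (α * inner ℝ u (ψ j))) *
        (D * inner ℝ v (ψ j)))
    (hgL : ‖g‖ < L) :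
    ∃ (v : EuclideanSpace ℝ (Fin n)) (D : ℝ), ‖v‖ = 1 ∧ 0 ≤ D ∧ D ≤ ‖g‖ / L ∧
      IsArgMax (empiricalDual ρ ψ b) (α • (u + D • v)) ∧ (1 / (N : ℝ)) *
      ∑ j, (link ρ (α * (inner ℝ u (ψ j) + D * inner ℝ v (ψ j))) - link ρ (α * inner ℝ u (ψ j))) *
        (D * inner ℝ v (ψ j)) ≤ D * ‖g‖ := by
  -- The maximum over the ball of radius `α` exists by compactness. It will turn out to be interior,
  -- and concavity then makes it global.
  obtain ⟨θ, hθball, hθ⟩ := (isCompact_closedBall (α • u) α).exists_isMaxOn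
    ⟨α • u, Metric.mem_closedBall_self hα.le⟩ (continuous_empiricalDual hp ψ b).continuousOn
  rw [isMaxOn_iff] at hθ
  obtain ⟨v, D, hv, hD, hθD⟩ : ∃ (v : EuclideanSpace ℝ (Fin n)) (D : ℝ), ‖v‖ = 1 ∧ 0 ≤ D ∧
      θ = α • (u + D • v) := by
    rcases eq_or_ne θ (α • u) with h | h
    · exact ⟨u, 0, hu, le_rfl, by simp [h]⟩
    · have h0 : 0 < ‖θ - α • u‖ := norm_pos_iff.2 (sub_ne_zero.2 h)
      refine ⟨(‖θ - α • u‖⁻¹ : ℝ) • (θ - α • u), ‖θ - α • u‖ / α, ?_, by positivity, ?_⟩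
      · rw [norm_smul, norm_inv, norm_norm, inv_mul_cancel₀ h0.ne']
      · rw [smul_add, smul_smul, smul_smul, mul_div_cancel₀ _ hα.ne', mul_inv_cancel₀ h0.ne',
          one_smul, add_sub_cancel]
  have hDα : α * D ≤ α := by
    rw [mem_closedBall_iff_norm, hθD, smul_add, add_sub_cancel_left, smul_smul, norm_smul, hv,
      mul_one, Real.norm_eq_abs, abs_of_nonneg (by positivity)] at hθball
    exact hθball
  have hD1 : D ≤ 1 := by nlinarith
  have hinner : ∀ j, (inner ℝ (ψ j) θ : ℝ) = α * (inner ℝ u (ψ j) + D * inner ℝ v (ψ j)) := by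
    intro j
    rw [hθD, real_inner_smul_right, inner_add_right, real_inner_smul_right, real_inner_comm u,
      real_inner_comm v]
  set E := (1 / (N : ℝ)) *
      ∑ j, (link ρ (α * (inner ℝ u (ψ j) + D * inner ℝ v (ψ j))) - link ρ (α * inner ℝ u (ψ j))) *
        (D * inner ℝ v (ψ j))
  -- The constrained maximizer might lie on the boundary, so only the one-sided variation towards
  -- the centre is available. It bounds the Bregman average `E` by `D ‖g‖`; with the curvature bound
  -- `L D² ≤ E` this yields `D ≤ ‖g‖ / L < 1`.
  have hvar : inner ℝ (-(D • v)) b - (1 / (N : ℝ)) *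
      ∑ j, inner ℝ (-(D • v)) (ψ j) * link ρ (inner ℝ (ψ j) θ) ≤ 0 := by
    have h1 := (hasDerivAt_empiricalDual hp ψ b θ (-(D • v))).tendsto_slope_zero_right
    refine le_of_tendsto h1 ?_
    filter_upwards [Ioo_mem_nhdsGT hα] with t ht
    have h2 : θ + t • (-(D • v)) ∈ Metric.closedBall (α • u) α := by
      have h3 : θ + t • (-(D • v)) - α • u = ((α - t) * D) • v := by
        rw [hθD]; module
      have h4 : 0 ≤ (α - t) * D := mul_nonneg (by linarith [ht.2]) hD
      rw [mem_closedBall_iff_norm, h3, norm_smul, hv, mul_one, Real.norm_eq_abs, abs_of_nonneg h4]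
      nlinarith [mul_nonneg ht.1.le hD]
    have := hθ _ h2
    simp only [zero_add, zero_smul, add_zero, smul_eq_mul]
    exact mul_nonpos_of_nonneg_of_nonpos (by have := ht.1; positivity) (by linarith)
  have hEle : E ≤ D * ‖g‖ := by
    have h1 : E = D * inner ℝ v g - (inner ℝ (D • v) b - (1 / (N : ℝ)) *
      ∑ j, inner ℝ (D • v) (ψ j) * link ρ (inner ℝ (ψ j) θ)) := by
      have h2 : ∑ j, (link ρ (α * (inner ℝ u (ψ j) + D * inner ℝ v (ψ j))) -
          link ρ (α * inner ℝ u (ψ j))) * (D * inner ℝ v (ψ j)) =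
          ∑ j, inner ℝ (D • v) (ψ j) * link ρ (inner ℝ (ψ j) θ) -
            D * ∑ j, inner ℝ v (ψ j) * link ρ (α * inner ℝ u (ψ j)) := by
        rw [Finset.mul_sum, ← Finset.sum_sub_distrib]
        refine Finset.sum_congr rfl fun j _ => ?_
        rw [hinner, real_inner_smul_left]
        ring
      simp only [E]
      rw [hg, h2, real_inner_smul_left]
      ring
    have h2 : (inner ℝ v g : ℝ) ≤ ‖g‖ := by
      have := real_inner_le_norm v g
      rwa [hv, one_mul] at this
    have h3 := mul_le_mul_of_nonneg_left h2 hD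
    simp only [inner_neg_left, neg_mul, Finset.sum_neg_distrib, mul_neg] at hvar
    linarith
  have hEge := hlow v hv D hD
  have hDg : D ≤ ‖g‖ / L := by
    rw [min_eq_left hD1] at hEge
    rw [le_div_iff₀ hL]
    rcases hD.eq_or_lt with h | h
    · rw [← h, zero_mul]; exact norm_nonneg g
    · have : D * (D * L) ≤ D * ‖g‖ := by
        calc D * (D * L) = L * (D * D) := by ring
          _ ≤ E := hEge
          _ ≤ _ := hEle
      exact le_of_mul_le_mul_left this h
  have hDlt : D < 1 := hDg.trans_lt ((div_lt_one hL).2 hgL)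
  have hmax : ∀ θ', empiricalDual ρ ψ b θ' ≤ empiricalDual ρ ψ b θ := by
    have hloc : IsLocalMax (empiricalDual ρ ψ b) θ := by
      have h1 : Metric.closedBall (α • u) α ∈ 𝓝 θ := by
        refine mem_of_superset (Metric.isOpen_ball.mem_nhds ?_) Metric.ball_subset_closedBall
        rw [mem_ball_iff_norm, hθD, smul_add, add_sub_cancel_left, smul_smul, norm_smul, hv,
          mul_one, Real.norm_eq_abs, abs_of_nonneg (by positivity)]
        nlinarith
      filter_upwards [h1] with x hx using hθ x hx
    exact fun θ' => IsMaxOn.of_isLocalMax_of_convex_univ hloc (concaveOn_empiricalDual hp ψ b) θ'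
  refine ⟨v, D, hv, hD, hDg, ?_, hEle⟩
  rw [← hθD]
  exact ⟨hmax, fun θ' hθ' => empirical_unique hp hc hq₁ hq₂ hN hspan hmax hθ'⟩

/-- Restricted strong convexity from a uniform small-ball count. -/
theorem empirical_lower (hp : PEN C c Q₁ Q₂ q₁ q₂ ρ) (hc : 0 < c) (hq₁ : 1 < q₁)
    (hq₂ : 1 < q₂) (hN : 1 ≤ N) {ψ : Fin N → EuclideanSpace ℝ (Fin n)}
    {u v : EuclideanSpace ℝ (Fin n)} {α η A κ D : ℝ} (hα : 0 < α) (hη : 0 < η) (hη1 : η ≤ 1)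
    (hA : 1 ≤ A) {J : Finset (Fin N)}
    (hJ : ∀ j ∈ J, η ≤ |inner ℝ u (ψ j)| ∧ |inner ℝ u (ψ j)| ≤ A)
    (hcount : κ * N ≤ (J.filter fun j => η / 2 ≤ |inner ℝ v (ψ j)|).card) (hD : 0 ≤ D) :
    c * |link ρ α| * ((η / 2) ^ max (max q₁ q₂ - 2) 0 / (A + 1)) * (η / 2) ^ 2 * κ *
      (D * min D 1) ≤ (1 / (N : ℝ)) *
      ∑ j, (link ρ (α * (inner ℝ u (ψ j) + D * inner ℝ v (ψ j))) - link ρ (α * inner ℝ u (ψ j))) *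
        (D * inner ℝ v (ψ j)) := by
  have hN0 : (0 : ℝ) < N := by exact_mod_cast hN
  set k := c * |link ρ α| * ((η / 2) ^ max (max q₁ q₂ - 2) 0 / (A + 1))
  have hk : 0 ≤ k := by positivity
  set m := D * min D 1
  have hm : 0 ≤ m := by positivity
  set f : Fin N → ℝ := fun j => (link ρ (α * (inner ℝ u (ψ j) + D * inner ℝ v (ψ j))) -
    link ρ (α * inner ℝ u (ψ j))) * (D * inner ℝ v (ψ j))
  have hf0 : ∀ j, 0 ≤ f j := by
    intro j
    simp only [f]
    rcases eq_or_ne (D * inner ℝ v (ψ j)) 0 with h | h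
    · rw [h, mul_zero]
    · have h1 : α * (inner ℝ u (ψ j) + D * inner ℝ v (ψ j)) ≠ α * inner ℝ u (ψ j) := by
        intro h2
        exact h (by linarith [mul_left_cancel₀ hα.ne' h2])
      have h2 := hp.increment_pos hc hq₁ hq₂ h1
      have h3 : α * (inner ℝ u (ψ j) + D * inner ℝ v (ψ j)) - α * inner ℝ u (ψ j) =
        α * (D * inner ℝ v (ψ j)) := by ring
      rw [h3, mul_left_comm] at h2
      exact (pos_of_mul_pos_right h2 hα.le).le
  have hf1 : ∀ j ∈ J.filter fun j => η / 2 ≤ |inner ℝ v (ψ j)|, k * (η / 2) ^ 2 * m ≤ f j := by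
    intro j hj
    rw [Finset.mem_filter] at hj
    have h1 := hp.increment_lower hc hq₁ hq₂ hα (r := inner ℝ u (ψ j) + D * inner ℝ v (ψ j)) hη hη1
      hA (hJ j hj.1).1 (hJ j hj.1).2
    rw [add_sub_cancel_left] at h1
    refine le_trans ?_ h1
    rw [mul_assoc]
    refine mul_le_mul_of_nonneg_left ?_ hk
    have h2 : D * (η / 2) ≤ |D * inner ℝ v (ψ j)| := by
      rw [abs_mul, abs_of_nonneg hD]; exact mul_le_mul_of_nonneg_left hj.2 hD
    calc (η / 2) ^ 2 * m = (D * (η / 2)) * (min D 1 * (η / 2)) := by simp only [m]; ring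
      _ = (D * (η / 2)) * min (D * (η / 2)) (η / 2) := by
          rw [min_mul_of_nonneg _ _ (by positivity), one_mul]
      _ ≤ _ := by gcongr
  calc k * (η / 2) ^ 2 * κ * m = (1 / (N : ℝ)) * (κ * N * (k * (η / 2) ^ 2 * m)) := by
        field_simp
    _ ≤ (1 / (N : ℝ)) * ((J.filter fun j => η / 2 ≤ |inner ℝ v (ψ j)|).card *
          (k * (η / 2) ^ 2 * m)) := by gcongr
    _ = (1 / (N : ℝ)) * ∑ _j ∈ J.filter fun j => η / 2 ≤ |inner ℝ v (ψ j)|,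
          (k * (η / 2) ^ 2 * m) := by rw [Finset.sum_const, nsmul_eq_mul]
    _ ≤ (1 / (N : ℝ)) * ∑ j ∈ J.filter fun j => η / 2 ≤ |inner ℝ v (ψ j)|, f j := by
        gcongr with j hj
        exact hf1 j hj
    _ ≤ (1 / (N : ℝ)) * ∑ j, f j := by
        refine mul_le_mul_of_nonneg_left ?_ (by positivity)
        exact Finset.sum_le_univ_sum_of_nonneg hf0

/-- Pointwise bound of the increment of the link by the Bregman term and a weight. -/
theorem abs_increment_le (hp : PEN C c Q₁ Q₂ q₁ q₂ ρ) (hC : 0 < C) (hc : 0 < c) (hQ₁ : 1 < Q₁)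
    (hQ₂ : 1 < Q₂) (hq₁ : 1 < q₁) (hq₂ : 1 < q₂) {α : ℝ} (hα : 0 < α) {r r' t : ℝ} (ht : 0 < t) :
    |link ρ (α * r) - link ρ (α * r')| ≤
      √(4 * C * |link ρ α| * ((link ρ (α * r) - link ρ (α * r')) * (r - r')) *
        (max |r'| t ^ (-max (2 - min Q₁ Q₂) 0) + max |r| |r'| ^ max (max Q₁ Q₂ - 2) 0)) +
      8 * C * |link ρ α| * t *
        (max |r'| t ^ (-max (2 - min Q₁ Q₂) 0) + max |r| |r'| ^ max (max Q₁ Q₂ - 2) 0) := by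
  set β := max (2 - min Q₁ Q₂) 0
  set γ := max (max Q₁ Q₂ - 2) 0
  have hβ0 : 0 ≤ β := le_max_right _ _
  have hβ1 : β < 1 := max_lt (by linarith [lt_min hQ₁ hQ₂]) one_pos
  set M := max |r| |r'|
  set W := max |r'| t ^ (-β) + M ^ γ
  have hmt : 0 < max |r'| t := lt_max_of_lt_right ht
  have hM0 : 0 ≤ M := le_max_of_le_left (abs_nonneg _)
  have hW : 0 ≤ W := by positivity
  set e := (link ρ (α * r) - link ρ (α * r')) * (r - r')
  have he : e = |link ρ (α * r) - link ρ (α * r')| * |r - r'| := by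
    rw [← abs_mul, abs_of_nonneg]
    rcases eq_or_ne r r' with rfl | h
    · simp
    · have := hp.increment_pos hc hq₁ hq₂ (a := α * r) (b := α * r')
        (fun h' => h (mul_left_cancel₀ hα.ne' h'))
      rw [← mul_sub, mul_left_comm] at this
      exact (pos_of_mul_pos_right this hα.le).le
  rcases hM0.eq_or_lt with hM | hM
  · have h1 : r = 0 := abs_nonpos_iff.1 (hM ▸ le_max_left _ _)
    have h2 : r' = 0 := abs_nonpos_iff.1 (hM ▸ le_max_right _ _)
    have : |link ρ (α * r) - link ρ (α * r')| = 0 := by rw [h1, h2, sub_self, abs_zero]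
    rw [this]
    positivity
  have hup := hp.increment_upper hC hQ₁ hQ₂ hα (r := r) (r' := r') hM rfl
  change _ ≤ 4 * C * |link ρ α| * |r - r'| * (M ^ (-β) + M ^ γ) at hup
  set I := |link ρ (α * r) - link ρ (α * r')|
  -- If `t ≤ M`, one factor of `I²` is bounded by `increment_upper` and the other is kept in `e`;
  -- since `max |r'| t ≤ M`, the negative power of `M` may be replaced by one that does not involve
  -- `r`. If `M < t`, then `|r - r'| ≤ 2 M` and `M^{1-β} ≤ t^{1-β}`, because `β < 1`.
  rcases le_or_gt t M with h | h
  · have h1 : M ^ (-β) ≤ max |r'| t ^ (-β) :=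
      Real.rpow_le_rpow_of_nonpos hmt (max_le (le_max_right _ _) h) (by linarith)
    have h2 : I ^ 2 ≤ 4 * C * |link ρ α| * e * W := by
      calc I ^ 2 = I * I := sq I
        _ ≤ I * (4 * C * |link ρ α| * |r - r'| * (M ^ (-β) + M ^ γ)) := by gcongr
        _ ≤ I * (4 * C * |link ρ α| * |r - r'| * W) := by
            have : M ^ (-β) + M ^ γ ≤ W := add_le_add_left h1 _
            gcongr
        _ = _ := by rw [he]; ring
    have h3 : I ≤ √(4 * C * |link ρ α| * e * W) := Real.le_sqrt_of_sq_le h2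
    have h4 : 0 ≤ 8 * C * |link ρ α| * t * W := by positivity
    linarith
  · have h1 : max |r'| t = t := max_eq_right ((le_max_right _ _).trans h.le)
    have h2 : |r - r'| ≤ 2 * M := by
      have := abs_sub r r'
      have h3 : |r| ≤ M := le_max_left _ _
      have h4 : |r'| ≤ M := le_max_right _ _
      linarith
    have h3 : M * M ^ (-β) ≤ t * t ^ (-β) := by
      rw [← Real.rpow_one_add' hM.le (by linarith), ← Real.rpow_one_add' ht.le (by linarith)]
      exact Real.rpow_le_rpow hM.le h.le (by linarith)
    have h4 : M * M ^ γ ≤ t * M ^ γ := by gcongr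
    have h5 : I ≤ 8 * C * |link ρ α| * t * W := by
      calc I ≤ 4 * C * |link ρ α| * |r - r'| * (M ^ (-β) + M ^ γ) := hup
        _ ≤ 4 * C * |link ρ α| * (2 * M) * (M ^ (-β) + M ^ γ) := by gcongr
        _ = 8 * C * |link ρ α| * (M * M ^ (-β) + M * M ^ γ) := by ring
        _ ≤ 8 * C * |link ρ α| * (t * t ^ (-β) + t * M ^ γ) := by gcongr
        _ = _ := by simp only [W, h1]; ring
    have := Real.sqrt_nonneg (4 * C * |link ρ α| * e * W)
    linarith

/-- Cauchy–Schwarz, once for each term of the bound on `d j`, separates the Bregman average,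
controlled by maximality, from weighted averages that do not see the increments. -/
theorem sq_mean_mul_le {k : ℝ} (hk : 0 ≤ k) {t : ℝ} (a d e W : Fin N → ℝ)
    (hW : ∀ j, 0 ≤ W j) (he : ∀ j, 0 ≤ e j) (hd : ∀ j, |d j| ≤ √(k * e j * W j) + t * W j) :
    ((1 / (N : ℝ)) * ∑ j, a j * d j) ^ 2 ≤
      (2 * k * ((1 / (N : ℝ)) * ∑ j, e j) + 2 * t ^ 2 * ((1 / (N : ℝ)) * ∑ j, W j)) *
        ((1 / (N : ℝ)) * ∑ j, a j ^ 2 * W j) := by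
  set m : ℝ := 1 / (N : ℝ)
  have hm : 0 ≤ m := by positivity
  set S₁ := ∑ j, |a j| * √(k * e j * W j)
  set S₂ := ∑ j, |a j| * (t * W j)
  have h1 : |∑ j, a j * d j| ≤ S₁ + S₂ := by
    refine (Finset.abs_sum_le_sum_abs _ _).trans ?_
    rw [← Finset.sum_add_distrib]
    refine Finset.sum_le_sum fun j _ => ?_
    rw [abs_mul, ← mul_add]
    exact mul_le_mul_of_nonneg_left (hd j) (abs_nonneg _)
  have hS₁ : S₁ ^ 2 ≤ (∑ j, k * e j) * ∑ j, a j ^ 2 * W j := by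
    refine Finset.sum_sq_le_sum_mul_sum_of_sq_le_mul _ (fun j _ => mul_nonneg hk (he j))
      (fun j _ => mul_nonneg (sq_nonneg _) (hW j)) fun j _ => ?_
    rw [mul_pow, Real.sq_sqrt (mul_nonneg (mul_nonneg hk (he j)) (hW j)), sq_abs]
    exact le_of_eq (by ring)
  have hS₂ : S₂ ^ 2 ≤ (∑ j, t ^ 2 * W j) * ∑ j, a j ^ 2 * W j := by
    refine Finset.sum_sq_le_sum_mul_sum_of_sq_le_mul _ (fun j _ => mul_nonneg (sq_nonneg _) (hW j))
      (fun j _ => mul_nonneg (sq_nonneg _) (hW j)) fun j _ => ?_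
    rw [mul_pow, sq_abs]
    exact le_of_eq (by ring)
  rw [← Finset.mul_sum] at hS₁ hS₂
  have h2 : (∑ j, a j * d j) ^ 2 ≤ 2 * S₁ ^ 2 + 2 * S₂ ^ 2 := by
    have h3 : (∑ j, a j * d j) ^ 2 ≤ (S₁ + S₂) ^ 2 := by
      rw [← sq_abs]
      exact pow_le_pow_left₀ (abs_nonneg _) h1 2
    have := sq_nonneg (S₁ - S₂)
    linarith [add_sq S₁ S₂, sub_sq S₁ S₂]
  calc (m * ∑ j, a j * d j) ^ 2 = m ^ 2 * (∑ j, a j * d j) ^ 2 := by ring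
    _ ≤ m ^ 2 * (2 * (k * (∑ j, e j) * ∑ j, a j ^ 2 * W j) +
          2 * (t ^ 2 * (∑ j, W j) * ∑ j, a j ^ 2 * W j)) := by
        gcongr
        linarith
    _ = _ := by ring

end Empirical

/-! ### Error of the empirical predictor on a good sample -/

section EmpiricalError

variable {n N : ℕ} {C c Q₁ Q₂ q₁ q₂ : ℝ} {ρ : ℝ → ℝ}

/-- The deterministic core. The curvature `L` and the gradient bound `G < L` localize the maximizer
and bound its Bregman average by `G² / L`; Cauchy–Schwarz turns this into a bound on the change of
the predictor. The three terms are the error at the population point, the Bregman contribution, and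
the contribution of arguments below the cutoff `t`. The weight hypothesis ranges over all `v` and
`D` because the displacement depends on the sample. -/
theorem empirical_error {S : Type*} [MeasurableSpace S] {P : Measure S} [IsProbabilityMeasure P]
    (hp : PEN C c Q₁ Q₂ q₁ q₂ ρ) (hC : 0 < C) (hc : 0 < c) (hQ₁ : 1 < Q₁)
    (hQ₂ : 1 < Q₂) (hq₁ : 1 < q₁) (hq₂ : 1 < q₂) (hN : 1 ≤ N)
    {ψ : Fin N → EuclideanSpace ℝ (Fin n)} {a : S → Fin N → ℝ} (ha : ∀ j, Measurable fun x => a x j)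
    {f : S → ℝ} (hf : Measurable f) {b u g : EuclideanSpace ℝ (Fin n)} (hu : ‖u‖ = 1)
    {α η A κ t G H U : ℝ} (hα : 0 < α) (hη : 0 < η) (hη1 : η ≤ 1) (hA : 1 ≤ A) (hκ : 0 < κ)
    (ht : 0 < t) (hU0 : 0 ≤ U) {J : Finset (Fin N)}
    (hJ : ∀ j ∈ J, η ≤ |inner ℝ u (ψ j)| ∧ |inner ℝ u (ψ j)| ≤ A)
    (hcount : ∀ v, ‖v‖ = 1 → κ * N ≤ (J.filter fun j => η / 2 ≤ |inner ℝ v (ψ j)|).card)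
    (hg : ∀ v, inner ℝ v g =
      inner ℝ v b - (1 / (N : ℝ)) * ∑ j, inner ℝ v (ψ j) * link ρ (α * inner ℝ u (ψ j)))
    (hgG : ‖g‖ ≤ G) {L : ℝ} (hL : L = c * |link ρ α| *
      ((η / 2) ^ max (max q₁ q₂ - 2) 0 / (A + 1)) * (η / 2) ^ 2 * κ) (hGL : G < L)
    (hH : ∫⁻ x, ENNReal.ofReal (((1 / (N : ℝ)) * ∑ j, a x j * link ρ (α * inner ℝ u (ψ j)) -
      f x) ^ 2) ∂P ≤ ENNReal.ofReal (H ^ 2))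
    (hU : ∀ v, ‖v‖ = 1 → ∀ D : ℝ, 0 ≤ D → D ≤ 1 →
      ∫⁻ x, ENNReal.ofReal ((1 / (N : ℝ)) * ∑ j, (1 + a x j ^ 2) *
        (max |inner ℝ u (ψ j)| t ^ (-max (2 - min Q₁ Q₂) 0) +
          max |inner ℝ u (ψ j) + D * inner ℝ v (ψ j)| |inner ℝ u (ψ j)| ^
            max (max Q₁ Q₂ - 2) 0)) ∂P ≤ ENNReal.ofReal U) :
    ∃ θ, IsArgMax (empiricalDual ρ ψ b) θ ∧
      ∫⁻ x, ENNReal.ofReal (((1 / (N : ℝ)) * ∑ j, a x j * link ρ (inner ℝ (ψ j) θ) -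
        f x) ^ 2) ∂P ≤
      ENNReal.ofReal (2 * H ^ 2 + 2 * (8 * C * |link ρ α| * (G ^ 2 / L) * U +
        128 * C ^ 2 * |link ρ α| ^ 2 * t ^ 2 * U ^ 2)) := by
  have hN0 : (0 : ℝ) < N := by exact_mod_cast hN
  have hs : 0 < |link ρ α| := abs_pos.2 (hp.link_ne_zero hα.ne')
  have hL0 : 0 < L := by rw [hL]; positivity
  have hG0 : 0 ≤ G := (norm_nonneg g).trans hgG
  have hspan : ∀ v, ‖v‖ = 1 → ∃ j, (inner ℝ v (ψ j) : ℝ) ≠ 0 := by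
    intro v hv
    have h1 : (0 : ℝ) < (J.filter fun j => η / 2 ≤ |inner ℝ v (ψ j)|).card :=
      lt_of_lt_of_le (by positivity) (hcount v hv)
    obtain ⟨j, hj⟩ := Finset.card_pos.1 (by exact_mod_cast h1)
    refine ⟨j, fun h => ?_⟩
    rw [Finset.mem_filter, h, abs_zero] at hj
    linarith [hj.2]
  obtain ⟨v, D, hv, hD, hDg, hmax, hE⟩ := exists_empirical_isArgMax hp hc hq₁ hq₂ hN hspan hu hα
    hL0 hg (fun v hv D hD => by
      rw [hL]
      exact empirical_lower hp hc hq₁ hq₂ hN hα hη hη1 hA hJ (hcount v hv) hD)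
    (hgG.trans_lt hGL)
  refine ⟨_, hmax, ?_⟩
  have hD1 : D ≤ 1 := hDg.trans (((div_le_one hL0).2 (hgG.trans hGL.le)))
  set X : Fin N → ℝ := fun j => inner ℝ u (ψ j)
  set X' : Fin N → ℝ := fun j => inner ℝ u (ψ j) + D * inner ℝ v (ψ j)
  set W : Fin N → ℝ := fun j => max |X j| t ^ (-max (2 - min Q₁ Q₂) 0) +
    max |X' j| |X j| ^ max (max Q₁ Q₂ - 2) 0
  have hW : ∀ j, 0 ≤ W j := fun j => by
    have : 0 ≤ max |X j| t := le_max_of_le_right ht.le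
    have : 0 ≤ max |X' j| |X j| := le_max_of_le_right (abs_nonneg _)
    positivity
  have hinner : ∀ j, (inner ℝ (ψ j) (α • (u + D • v)) : ℝ) = α * X' j := by
    intro j
    simp only [X']
    rw [real_inner_smul_right, inner_add_right, real_inner_smul_right, real_inner_comm u,
      real_inner_comm v]
  set d : Fin N → ℝ := fun j => link ρ (α * X' j) - link ρ (α * X j)
  set e : Fin N → ℝ := fun j => d j * (X' j - X j)
  have he : ∀ j, 0 ≤ e j := by
    intro j
    simp only [e, d]
    rcases eq_or_ne (X' j) (X j) with h | h
    · rw [h]; simp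
    · have := hp.increment_pos hc hq₁ hq₂ (a := α * X' j) (b := α * X j)
        (fun h' => h (mul_left_cancel₀ hα.ne' h'))
      rw [← mul_sub, mul_left_comm] at this
      exact (pos_of_mul_pos_right this hα.le).le
  have hEe : (1 / (N : ℝ)) * ∑ j, e j ≤ G ^ 2 / L := by
    have h1 : ∀ j, e j = (link ρ (α * (inner ℝ u (ψ j) + D * inner ℝ v (ψ j))) -
        link ρ (α * inner ℝ u (ψ j))) * (D * inner ℝ v (ψ j)) := fun j => by
      simp only [e, d, X', X, add_sub_cancel_left]
    simp only [h1]
    refine hE.trans ?_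
    calc D * ‖g‖ ≤ (‖g‖ / L) * ‖g‖ := by gcongr
      _ ≤ (G / L) * G := by gcongr
      _ = _ := by ring
  set U' := ∫⁻ x, ENNReal.ofReal ((1 / (N : ℝ)) * ∑ j, (1 + a x j ^ 2) * W j) ∂P
  have hU' : U' ≤ ENNReal.ofReal U := hU v hv D hD hD1
  have hWU : (1 / (N : ℝ)) * ∑ j, W j ≤ U := by
    refine (ENNReal.ofReal_le_ofReal_iff hU0).1 (le_trans ?_ hU')
    calc ENNReal.ofReal ((1 / (N : ℝ)) * ∑ j, W j)
        = ∫⁻ _x, ENNReal.ofReal ((1 / (N : ℝ)) * ∑ j, W j) ∂P := by simp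
      _ ≤ U' := by
        refine lintegral_mono fun x => ENNReal.ofReal_le_ofReal ?_
        gcongr with j
        have := mul_nonneg (sq_nonneg (a x j)) (hW j)
        linarith
  set Bd := 8 * C * |link ρ α| * (G ^ 2 / L) + 128 * C ^ 2 * |link ρ α| ^ 2 * t ^ 2 * U
  have hBd : 0 ≤ Bd := by positivity
  have hpt : ∀ x, ((1 / (N : ℝ)) * ∑ j, a x j * d j) ^ 2 ≤
      Bd * ((1 / (N : ℝ)) * ∑ j, (1 + a x j ^ 2) * W j) := by
    intro x
    have h1 := sq_mean_mul_le (k := 4 * C * |link ρ α|) (by positivity)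
      (t := 8 * C * |link ρ α| * t) (a x) d e W hW he
      (fun j => abs_increment_le hp hC hc hQ₁ hQ₂ hq₁ hq₂ hα ht)
    refine h1.trans ?_
    have h2 : 2 * (4 * C * |link ρ α|) * ((1 / (N : ℝ)) * ∑ j, e j) +
        2 * (8 * C * |link ρ α| * t) ^ 2 * ((1 / (N : ℝ)) * ∑ j, W j) ≤ Bd := by
      calc _ ≤ 2 * (4 * C * |link ρ α|) * (G ^ 2 / L) + 2 * (8 * C * |link ρ α| * t) ^ 2 * U := by
            gcongr
        _ = Bd := by simp only [Bd]; ring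
    have h3 : (1 / (N : ℝ)) * ∑ j, a x j ^ 2 * W j ≤
        (1 / (N : ℝ)) * ∑ j, (1 + a x j ^ 2) * W j := by
      gcongr with j
      linarith
    have h4 : 0 ≤ (1 / (N : ℝ)) * ∑ j, a x j ^ 2 * W j :=
      mul_nonneg (by positivity) (Finset.sum_nonneg fun j _ => mul_nonneg (sq_nonneg _) (hW j))
    exact mul_le_mul h2 h3 h4 hBd
  have hfin : ∀ x, ((1 / (N : ℝ)) * ∑ j, a x j * link ρ (inner ℝ (ψ j) (α • (u + D • v))) -
      f x) ^ 2 ≤ 2 * ((1 / (N : ℝ)) * ∑ j, a x j * link ρ (α * X j) - f x) ^ 2 +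
        2 * (Bd * ((1 / (N : ℝ)) * ∑ j, (1 + a x j ^ 2) * W j)) := by
    intro x
    have h1 : (1 / (N : ℝ)) * ∑ j, a x j * link ρ (inner ℝ (ψ j) (α • (u + D • v))) =
        (1 / (N : ℝ)) * ∑ j, a x j * link ρ (α * X j) + (1 / (N : ℝ)) * ∑ j, a x j * d j := by
      rw [← mul_add, ← Finset.sum_add_distrib]
      congr 1
      refine Finset.sum_congr rfl fun j _ => ?_
      rw [hinner]
      simp only [d]
      ring
    rw [h1]
    have h2 := hpt x
    set y := (1 / (N : ℝ)) * ∑ j, a x j * d j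
    set z := (1 / (N : ℝ)) * ∑ j, a x j * link ρ (α * X j)
    nlinarith [sq_nonneg (z - f x - y)]
  calc ∫⁻ x, ENNReal.ofReal (((1 / (N : ℝ)) * ∑ j, a x j *
        link ρ (inner ℝ (ψ j) (α • (u + D • v))) - f x) ^ 2) ∂P
      ≤ ∫⁻ x, (ENNReal.ofReal 2 * ENNReal.ofReal
          (((1 / (N : ℝ)) * ∑ j, a x j * link ρ (α * X j) - f x) ^ 2) +
          ENNReal.ofReal (2 * Bd) *
            ENNReal.ofReal ((1 / (N : ℝ)) * ∑ j, (1 + a x j ^ 2) * W j)) ∂P := by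
        refine lintegral_mono fun x => ?_
        rw [← ENNReal.ofReal_mul (by norm_num), ← ENNReal.ofReal_mul (by positivity),
          ← ENNReal.ofReal_add (by positivity) (mul_nonneg (by positivity)
            (mul_nonneg (by positivity) (Finset.sum_nonneg fun j _ =>
              mul_nonneg (by positivity) (hW j))))]
        refine ENNReal.ofReal_le_ofReal ((hfin x).trans (le_of_eq (by ring)))
    _ = ENNReal.ofReal 2 * (∫⁻ x, ENNReal.ofReal
          (((1 / (N : ℝ)) * ∑ j, a x j * link ρ (α * X j) - f x) ^ 2) ∂P) +
          ENNReal.ofReal (2 * Bd) * U' := by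
        rw [lintegral_add_left (by fun_prop), lintegral_const_mul _ (by fun_prop),
          lintegral_const_mul _ (by fun_prop)]
    _ ≤ ENNReal.ofReal 2 * ENNReal.ofReal (H ^ 2) + ENNReal.ofReal (2 * Bd) * ENNReal.ofReal U := by
        gcongr
    _ = _ := by
        rw [← ENNReal.ofReal_mul (by norm_num), ← ENNReal.ofReal_mul (by positivity),
          ← ENNReal.ofReal_add (by positivity) (by positivity)]
        congr 1
        simp only [Bd]
        ring

theorem one_add_sq_mul_rpow_le {a M γ : ℝ} (hM : 0 ≤ M) (hγ : 0 ≤ γ) :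
    (1 + a ^ 2) * M ^ γ ≤ 2 * (1 + |a| ^ (γ + 2) + M ^ (γ + 2)) := by
  set z := max 1 (max |a| M)
  have h1 : 1 ≤ z := le_max_left _ _
  have h2 : |a| ≤ z := (le_max_left _ _).trans (le_max_right _ _)
  have h3 : M ≤ z := (le_max_right _ _).trans (le_max_right _ _)
  have h4 : a ^ 2 ≤ z ^ 2 := by rw [← sq_abs]; gcongr
  have h5 : z ^ (γ + 2) ≤ 1 + |a| ^ (γ + 2) + M ^ (γ + 2) := by
    have ha : 0 ≤ |a| ^ (γ + 2) := by positivity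
    have hM' : 0 ≤ M ^ (γ + 2) := by positivity
    rcases max_choice 1 (max |a| M) with h | h
    · simp only [z]; rw [h, Real.one_rpow]; linarith
    · rcases max_choice |a| M with h' | h' <;> simp only [z] <;> rw [h, h'] <;> linarith
  calc (1 + a ^ 2) * M ^ γ ≤ (2 * z ^ 2) * z ^ γ := by
        gcongr
        nlinarith
    _ = 2 * z ^ (γ + 2) := by
        rw [Real.rpow_add (by linarith), ← Real.rpow_natCast]; push_cast; ring
    _ ≤ _ := by gcongr

/-- Bound of the weighted average in `empirical_error` from moment bounds. -/
theorem lintegral_weight_le {S : Type*} [MeasurableSpace S] {P : Measure S} [IsProbabilityMeasure P]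
    (hN : 1 ≤ N) {a : S → Fin N → ℝ} (ha : ∀ j, Measurable fun x => a x j) {X V W : Fin N → ℝ}
    {γ B U D : ℝ} (hγ : 0 ≤ γ) (hB : 0 ≤ B) (hU : 0 ≤ U) (hD : 0 ≤ D) (hD1 : D ≤ 1)
    (hW0 : ∀ j, 0 ≤ W j)
    (hW : ∫⁻ x, ENNReal.ofReal ((1 / (N : ℝ)) * ∑ j, (1 + a x j ^ 2) * W j) ∂P ≤ ENNReal.ofReal U)
    (hX : (1 / (N : ℝ)) * ∑ j, |X j| ^ (γ + 2) ≤ B) (hV : (1 / (N : ℝ)) * ∑ j, |V j| ^ (γ + 2) ≤ B)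
    (hA : ∫⁻ x, ENNReal.ofReal ((1 / (N : ℝ)) * ∑ j, |a x j| ^ (γ + 2)) ∂P ≤ ENNReal.ofReal B) :
    ∫⁻ x, ENNReal.ofReal ((1 / (N : ℝ)) * ∑ j, (1 + a x j ^ 2) *
      (W j + max |X j + D * V j| |X j| ^ γ)) ∂P ≤
      ENNReal.ofReal (U + (2 * (1 + B + 2 ^ (γ + 2) * (B + B)))) := by
  have hN0 : (0 : ℝ) < N := by exact_mod_cast hN
  have hM : ∀ j, max |X j + D * V j| |X j| ^ (γ + 2) ≤
      2 ^ (γ + 2) * (|X j| ^ (γ + 2) + |V j| ^ (γ + 2)) := by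
    intro j
    have h1 : |X j + D * V j| ≤ |X j| + |V j| := by
      refine (abs_add_le _ _).trans (add_le_add le_rfl ?_)
      rw [abs_mul, abs_of_nonneg hD]
      exact mul_le_of_le_one_left (abs_nonneg _) hD1
    have h2 : max |X j + D * V j| |X j| ≤ 2 * max |X j| |V j| := by
      have := le_max_left |X j| |V j|
      have := le_max_right |X j| |V j|
      have := abs_nonneg (X j)
      exact max_le (by linarith) (by linarith)
    calc max |X j + D * V j| |X j| ^ (γ + 2) ≤ (2 * max |X j| |V j|) ^ (γ + 2) :=
          Real.rpow_le_rpow (le_max_of_le_right (abs_nonneg _)) h2 (by linarith)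
      _ = 2 ^ (γ + 2) * max |X j| |V j| ^ (γ + 2) :=
          Real.mul_rpow (by norm_num) (le_max_of_le_right (abs_nonneg _))
      _ ≤ _ := by
          gcongr
          have h3 : 0 ≤ |X j| ^ (γ + 2) := by positivity
          have h4 : 0 ≤ |V j| ^ (γ + 2) := by positivity
          rcases max_choice |X j| |V j| with h | h <;> rw [h] <;> linarith
  have hpt : ∀ x, (1 / (N : ℝ)) * ∑ j, (1 + a x j ^ 2) * (W j + max |X j + D * V j| |X j| ^ γ) ≤
      (1 / (N : ℝ)) * ∑ j, (1 + a x j ^ 2) * W j +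
        (2 * (1 + 2 ^ (γ + 2) * (B + B)) + 2 * ((1 / (N : ℝ)) * ∑ j, |a x j| ^ (γ + 2))) := by
    intro x
    have h1 : ∀ j, (1 + a x j ^ 2) * (W j + max |X j + D * V j| |X j| ^ γ) ≤
        (1 + a x j ^ 2) * W j + (2 * 1 + 2 * |a x j| ^ (γ + 2) +
          2 * 2 ^ (γ + 2) * |X j| ^ (γ + 2) + 2 * 2 ^ (γ + 2) * |V j| ^ (γ + 2)) := fun j => by
      have h2 := one_add_sq_mul_rpow_le (a := a x j) (M := max |X j + D * V j| |X j|)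
        (le_max_of_le_right (abs_nonneg _)) hγ
      have h3 := hM j
      rw [mul_add]
      linarith
    have h4 := Finset.sum_le_sum fun j (_ : j ∈ Finset.univ) => h1 j
    simp only [Finset.sum_add_distrib, ← Finset.mul_sum, Finset.sum_const, Finset.card_univ,
      Fintype.card_fin, nsmul_eq_mul, mul_one] at h4
    have h5 := mul_le_mul_of_nonneg_left h4 (by positivity : (0 : ℝ) ≤ 1 / N)
    have h6 : (0 : ℝ) ≤ 2 * 2 ^ (γ + 2) := by positivity
    have h7 := mul_le_mul_of_nonneg_left hX h6
    have h8 := mul_le_mul_of_nonneg_left hV h6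
    have h9 : (1 / (N : ℝ)) * (2 * N) = 2 := by field_simp
    simp only [mul_add] at h5 ⊢
    linarith
  calc _ ≤ ∫⁻ x, (ENNReal.ofReal ((1 / (N : ℝ)) * ∑ j, (1 + a x j ^ 2) * W j) +
        (ENNReal.ofReal (2 * (1 + 2 ^ (γ + 2) * (B + B))) +
          ENNReal.ofReal 2 * ENNReal.ofReal ((1 / (N : ℝ)) * ∑ j, |a x j| ^ (γ + 2)))) ∂P := by
        refine lintegral_mono fun x => ?_
        rw [← ENNReal.ofReal_mul (by norm_num), ← ENNReal.ofReal_add (by positivity)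
          (by positivity), ← ENNReal.ofReal_add
          (mul_nonneg (by positivity) (Finset.sum_nonneg fun j _ =>
              mul_nonneg (by positivity) (hW0 j))) (by positivity)]
        exact ENNReal.ofReal_le_ofReal (hpt x)
    _ = (∫⁻ x, ENNReal.ofReal ((1 / (N : ℝ)) * ∑ j, (1 + a x j ^ 2) * W j) ∂P) +
        (ENNReal.ofReal (2 * (1 + 2 ^ (γ + 2) * (B + B))) +
          ENNReal.ofReal 2 * ∫⁻ x, ENNReal.ofReal ((1 / (N : ℝ)) * ∑ j, |a x j| ^ (γ + 2)) ∂P) := by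
        rw [lintegral_add_left (by fun_prop), lintegral_add_left (by fun_prop),
          lintegral_const_mul _ (by fun_prop), lintegral_const, measure_univ, mul_one]
    _ ≤ ENNReal.ofReal U + (ENNReal.ofReal (2 * (1 + 2 ^ (γ + 2) * (B + B))) +
          ENNReal.ofReal 2 * ENNReal.ofReal B) := by gcongr
    _ = _ := by
        rw [← ENNReal.ofReal_mul (by norm_num), ← ENNReal.ofReal_add (by positivity)
          (by positivity), ← ENNReal.ofReal_add hU (by positivity)]
        congr 1
        ring

end EmpiricalError

/-! ### High-probability events -/

section Events

/-- Gradient coordinates and predictor summands have the same form, a sub-Gaussian factor times `s`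
of another one, of total degree `Q`. The exponent is raised to at least `2` as
`concentration_envelope` requires. -/
theorem PEN.abs_mul_link_le_envelope {C c Q₁ Q₂ q₁ q₂ : ℝ} {ρ : ℝ → ℝ}
    (hp : PEN C c Q₁ Q₂ q₁ q₂ ρ) (hC : 0 < C) (hQ₁ : 1 < Q₁) (hQ₂ : 1 < Q₂) {α τ : ℝ} (hα : 0 < α)
    (hτ : 1 ≤ τ) (a x : ℝ) :
    |a * link ρ (α * x)| ≤ C * |link ρ α| * (6 * τ) ^ max Q₁ Q₂ *
      envelope τ a x ^ max (max Q₁ Q₂) 2 := by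
  have hQ : 1 < max Q₁ Q₂ := lt_max_of_lt_left hQ₁
  have hτ0 : 0 < τ := by linarith
  have he := one_le_envelope hτ0 a x
  have hx : 1 + |x| ≤ 6 * τ * envelope τ a x := by
    rw [envelope, mul_add, mul_div_cancel₀ _ (by positivity)]
    linarith [abs_nonneg a]
  have ha := abs_left_le_envelope hτ0 a x
  set z := envelope τ a x
  have hz : 0 < z := by linarith
  rw [abs_mul]
  calc |a| * |link ρ (α * x)| ≤ (6 * τ * z) * (C * |link ρ α| * (1 + |x|) ^ (max Q₁ Q₂ - 1)) := by
        gcongr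
        exact hp.abs_link_le_rpow hC hQ₁ hQ₂ hα x
    _ ≤ (6 * τ * z) * (C * |link ρ α| * (6 * τ * z) ^ (max Q₁ Q₂ - 1)) := by
        have : 0 ≤ max Q₁ Q₂ - 1 := by linarith
        gcongr
    _ = C * |link ρ α| * ((6 * τ * z) * (6 * τ * z) ^ (max Q₁ Q₂ - 1)) := by ring
    _ = C * |link ρ α| * ((6 * τ) ^ max Q₁ Q₂ * z ^ max Q₁ Q₂) := by
        rw [← Real.rpow_one_add' (by positivity) (by linarith), ← Real.mul_rpow (by positivity)
          hz.le]
        congr 2; ring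
    _ ≤ C * |link ρ α| * ((6 * τ) ^ max Q₁ Q₂ * z ^ max (max Q₁ Q₂) 2) := by
        have := Real.rpow_le_rpow_of_exponent_le he (le_max_left (max Q₁ Q₂) 2)
        gcongr
    _ = _ := by ring

theorem abs_rpow_le_envelope {Q τ : ℝ} (hQ : 0 ≤ Q) (hτ : 0 < τ) (a x : ℝ) :
    |a| ^ Q ≤ (6 * τ) ^ Q * envelope τ a x ^ Q := by
  have h1 := one_le_envelope hτ a x
  rw [← Real.mul_rpow (by positivity) (by linarith)]
  exact Real.rpow_le_rpow (abs_nonneg _) (abs_left_le_envelope hτ a x) hQ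

theorem integral_abs_rpow_le {Q : ℝ} (hQ : 0 ≤ Q) :
    ∃ A : ℝ, 0 < A ∧ ∀ (Ω : Type*) [MeasurableSpace Ω] (μ : Measure Ω) (τ : ℝ) (X : Ω → ℝ), 0 < τ →
      Measurable X → HasSqExpMoment τ X μ →
      Integrable (fun ω => |X ω| ^ Q) μ ∧ ∫ ω, |X ω| ^ Q ∂μ ≤ A * τ ^ Q := by
  obtain ⟨A, hA, h⟩ := exists_rpow_le_mul_exp_mul_sq Q (b := 1 / 4) (by norm_num)
  refine ⟨A * 2, by positivity, fun Ω _ μ τ X hτ hX hm => ?_⟩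
  have hpt : ∀ ω, |X ω| ^ Q ≤ τ ^ Q * A * Real.exp (X ω ^ 2 / (4 * τ ^ 2)) := by
    intro ω
    have h1 := h (|X ω| / τ) (by positivity)
    calc |X ω| ^ Q = τ ^ Q * (|X ω| / τ) ^ Q := by
          rw [← Real.mul_rpow hτ.le (by positivity), mul_div_cancel₀ _ hτ.ne']
      _ ≤ τ ^ Q * (1 + |X ω| / τ) ^ Q := by gcongr; linarith
      _ ≤ τ ^ Q * (A * Real.exp (1 / 4 * (|X ω| / τ) ^ 2)) := by gcongr
      _ = _ := by
          rw [div_pow, sq_abs, ← mul_assoc]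
          congr 2
          field_simp
  have hi : Integrable (fun ω => |X ω| ^ Q) μ := by
    refine (hm.1.const_mul (τ ^ Q * A)).mono' (Measurable.aestronglyMeasurable (by fun_prop))
      (ae_of_all _ fun ω => ?_)
    rw [Real.norm_eq_abs, abs_of_nonneg (by positivity)]
    exact hpt ω
  refine ⟨hi, (integral_mono hi (hm.1.const_mul _) hpt).trans ?_⟩
  rw [integral_const_mul]
  have := mul_le_mul_of_nonneg_left hm.2 (by positivity : 0 ≤ τ ^ Q * A)
  linarith

theorem six_pow_le {n N : ℕ} (hN : 2 ≤ N) : (6 : ℝ) ^ n ≤ Real.exp (3 * (n * Real.log N)) := by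
  have hN' : (2 : ℝ) ≤ N := by exact_mod_cast hN
  have h0 : (0 : ℝ) < N := by linarith
  have : Real.exp (3 * (n * Real.log N)) = ((N : ℝ) ^ 3) ^ n := by
    rw [← Real.exp_log (by positivity : (0 : ℝ) < ((N : ℝ) ^ 3) ^ n), Real.log_pow, Real.log_pow]
    congr 1; push_cast; ring
  rw [this]
  have : (2 : ℝ) ^ 3 ≤ (N : ℝ) ^ 3 := by gcongr
  gcongr
  linarith

theorem half_le_mul_log {n N : ℕ} (hn : 1 ≤ n) (hN : 2 ≤ N) : 1 / 2 ≤ (n : ℝ) * Real.log N := by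
  have hn' : (1 : ℝ) ≤ n := by exact_mod_cast hn
  have h1 : Real.log 2 ≤ Real.log N := Real.log_le_log (by norm_num) (by exact_mod_cast hN)
  have := Real.log_two_gt_d9
  nlinarith

theorem log_le_mul_log {n N : ℕ} (hn : 1 ≤ n) : Real.log N ≤ (n : ℝ) * Real.log N := by
  have hn' : (1 : ℝ) ≤ n := by exact_mod_cast hn
  exact le_mul_of_one_le_left (Real.log_natCast_nonneg N) hn'

/-- Concentration, simultaneously over a `1/2`-net of the sphere. -/
theorem concentration_net {Q : ℝ} (hQ : 2 ≤ Q) :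
    ∃ A : ℝ, 0 < A ∧ ∀ (Ω : Type*) [MeasurableSpace Ω] (μ : Measure Ω) [IsProbabilityMeasure μ]
      (n N : ℕ) (T τ : ℝ) (s : Finset (EuclideanSpace ℝ (Fin n)))
      (Y U₁ U₂ : EuclideanSpace ℝ (Fin n) → Ω → ℝ), 1 ≤ n → 2 ≤ N → (s.card : ℝ) ≤ 6 ^ n → 0 < T →
      0 < τ → (∀ v ∈ s, Measurable (Y v) ∧ Measurable (U₁ v) ∧ Measurable (U₂ v)) →
      (∀ v ∈ s, ∀ ω, |Y v ω| ≤ T * envelope τ (U₁ v ω) (U₂ v ω) ^ Q) →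
      (∀ v ∈ s, HasSqExpMoment τ (U₁ v) μ ∧ HasSqExpMoment τ (U₂ v) μ) →
      (Measure.pi fun _ : Fin N => μ) {ω | ∃ v ∈ s,
        A * T * (√(n * Real.log N / N) + (n * Real.log N) ^ (Q / 2) / N) <
          |(1 / (N : ℝ)) * ∑ j, Y v (ω j) - ∫ ω, Y v ω ∂μ|} ≤
      ENNReal.ofReal (A * Real.exp (-(n * Real.log N))) := by
  -- The net has at most `6 ^ n ≤ exp(3 p)` points, so decay `exp(-4 p)` at each of them leaves
  -- `exp(-p)` after the union bound.
  obtain ⟨A, hA, h⟩ := concentration_envelope hQ (K := 4) (by norm_num)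
  refine ⟨A, hA, ?_⟩
  intro Ω _ μ _ n N T τ s Y U₁ U₂ hn hN hs hT hτ hmeas hle hexp
  set p := (n : ℝ) * Real.log N
  set R := A * T * (√(p / N) + p ^ (Q / 2) / N)
  have hp : 1 / 2 ≤ p := half_le_mul_log hn hN
  have hR : 0 ≤ R := by positivity
  have hone : ∀ v ∈ s, (Measure.pi fun _ : Fin N => μ) {ω | R <
      |(1 / (N : ℝ)) * ∑ j, Y v (ω j) - ∫ ω, Y v ω ∂μ|} ≤
      ENNReal.ofReal (A * Real.exp (-(4 * p))) := by
    intro v hv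
    -- A one-point parameter space turns the `L²` statement into one for the single direction `v`.
    obtain ⟨m0, m1, m2⟩ := hmeas v hv
    refine le_trans (measure_mono fun ω hω => ?_) (h Ω Unit μ (Measure.dirac ()) N p T τ
      (fun _ => Y v) (fun _ => U₁ v) (fun _ => U₂ v) (by omega) hp (log_le_mul_log hn) hT hτ
      (m0.comp measurable_snd) (m1.comp measurable_snd) (m2.comp measurable_snd)
      (fun _ => hle v hv) (ae_of_all _ fun _ => hexp v hv))
    simp only [mem_ofPred_eq, lintegral_const, measure_univ, mul_one] at hω ⊢
    have h1 : R ^ 2 < ((1 / (N : ℝ)) * ∑ j, Y v (ω j) - ∫ ω, Y v ω ∂μ) ^ 2 := by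
      rw [← sq_abs ((1 / (N : ℝ)) * ∑ j, Y v (ω j) - ∫ ω, Y v ω ∂μ)]
      exact pow_lt_pow_left₀ hω hR two_ne_zero
    exact (ENNReal.ofReal_lt_ofReal_iff (lt_of_le_of_lt (sq_nonneg _) h1)).2 h1
  have hset : {ω : Fin N → Ω | ∃ v ∈ s, R < |(1 / (N : ℝ)) * ∑ j, Y v (ω j) - ∫ ω, Y v ω ∂μ|} =
      ⋃ v ∈ s, {ω | R < |(1 / (N : ℝ)) * ∑ j, Y v (ω j) - ∫ ω, Y v ω ∂μ|} := by
    ext ω; simp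
  rw [hset]
  calc _ ≤ ∑ v ∈ s, (Measure.pi fun _ : Fin N => μ)
          {ω | R < |(1 / (N : ℝ)) * ∑ j, Y v (ω j) - ∫ ω, Y v ω ∂μ|} :=
        measure_biUnion_finset_le _ _
    _ ≤ ∑ _v ∈ s, ENNReal.ofReal (A * Real.exp (-(4 * p))) := Finset.sum_le_sum hone
    _ = ENNReal.ofReal (s.card * (A * Real.exp (-(4 * p)))) := by
        rw [Finset.sum_const, nsmul_eq_mul,
          ENNReal.ofReal_mul (p := (s.card : ℝ)) (Nat.cast_nonneg _), ENNReal.ofReal_natCast]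
    _ ≤ _ := by
        refine ENNReal.ofReal_le_ofReal ?_
        calc (s.card : ℝ) * (A * Real.exp (-(4 * p)))
            ≤ Real.exp (3 * p) * (A * Real.exp (-(4 * p))) := by
              gcongr
              exact hs.trans (six_pow_le hN)
          _ = A * (Real.exp (3 * p) * Real.exp (-(4 * p))) := by ring
          _ = A * Real.exp (-p) := by rw [← Real.exp_add]; congr 2; ring

theorem exists_half_net (n : ℕ) : ∃ s : Finset (EuclideanSpace ℝ (Fin n)), (∀ c ∈ s, ‖c‖ = 1) ∧
    (s.card : ℝ) ≤ 6 ^ n ∧ ∀ v, ‖v‖ = 1 → ∃ c ∈ s, ‖v - c‖ ≤ 1 / 2 := by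
  obtain ⟨s, h1, h2, h3⟩ := exists_sphere_net n (ε := 1 / 2) (by norm_num) (by norm_num)
  exact ⟨s, h1, h2.trans (le_of_eq (by norm_num)), h3⟩

/-- Uniform concentration of the gradient at the population maximizer. -/
theorem gradient_event {C Q₁ Q₂ : ℝ} (hC : 0 < C) (hQ₁ : 1 < Q₁) (hQ₂ : 1 < Q₂) :
    ∃ A : ℝ, 0 < A ∧ ∀ (Ω : Type*) [MeasurableSpace Ω] (μ : Measure Ω) [IsProbabilityMeasure μ]
      (n N : ℕ) (c η τ q₁ q₂ : ℝ) (ρ : ℝ → ℝ) (ψ : Ω → EuclideanSpace ℝ (Fin n))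
      (b u : EuclideanSpace ℝ (Fin n)) (α : ℝ), 1 ≤ n → 2 ≤ N → WhitenedFeature c η τ μ ψ →
      PEN C c Q₁ Q₂ q₁ q₂ ρ → ‖u‖ = 1 → 0 < α →
      (∀ v, ∫ ω, inner ℝ v (ψ ω) * link ρ (α * inner ℝ u (ψ ω)) ∂μ = inner ℝ v b) →
      (Measure.pi fun _ : Fin N => μ) {ω | ¬ ∃ g : EuclideanSpace ℝ (Fin n),
        ‖g‖ ≤ A * |link ρ α| * τ ^ max Q₁ Q₂ *
          (√(n * Real.log N / N) + (n * Real.log N) ^ (max (max Q₁ Q₂) 2 / 2) / N) ∧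
        ∀ v, inner ℝ v g = inner ℝ v b - (1 / (N : ℝ)) * ∑ j, inner ℝ v (ψ (ω j)) *
          link ρ (α * inner ℝ u (ψ (ω j)))} ≤
      ENNReal.ofReal (A * Real.exp (-(n * Real.log N))) := by
  obtain ⟨A, hA, h⟩ := concentration_net (le_max_right (max Q₁ Q₂) 2)
  have h6 : (0 : ℝ) < 6 ^ max Q₁ Q₂ := by positivity
  refine ⟨max A (2 * (A * (C * 6 ^ max Q₁ Q₂))), lt_max_of_lt_left hA, ?_⟩
  intro Ω _ μ _ n N c η τ q₁ q₂ ρ ψ b u α hn hN hw hp hu hα hstat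
  obtain ⟨s, hs1, hs2, hs3⟩ := exists_half_net n
  have hτ := hw.one_le_tau
  have hτ0 : 0 < τ := by linarith
  have hsα : 0 < |link ρ α| := abs_pos.2 (hp.link_ne_zero hα.ne')
  set Q := max (max Q₁ Q₂) 2
  set p := (n : ℝ) * Real.log N
  set r := √(p / N) + p ^ (Q / 2) / N
  have hp0 : 1 / 2 ≤ p := half_le_mul_log hn hN
  have hr : 0 ≤ r := by positivity
  have hlm : Measurable (link ρ) := hp.monotone.measurable
  refine le_trans (measure_mono fun ω hω => ?_) ((h Ω μ n N (C * |link ρ α| * (6 * τ) ^ max Q₁ Q₂)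
    τ s (fun v ω => inner ℝ v (ψ ω) * link ρ (α * inner ℝ u (ψ ω))) (fun v ω => inner ℝ v (ψ ω))
    (fun _ ω => inner ℝ u (ψ ω)) hn hN hs2 (by positivity) hτ0
    (fun v _ => ⟨(hw.measurable_inner v).mul
      (hlm.comp ((hw.measurable_inner u).const_mul α)), hw.measurable_inner v,
      hw.measurable_inner u⟩)
    (fun v _ ω => hp.abs_mul_link_le_envelope hC hQ₁ hQ₂ hα hτ _ _)
    (fun v hv => ⟨hw.moment v (hs1 v hv), hw.moment u hu⟩)).trans (ENNReal.ofReal_le_ofReal (by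
      gcongr; exact le_max_left _ _)))
  simp only [mem_ofPred_eq] at hω ⊢
  by_contra! hcon
  -- This is the gradient of the empirical dual at `α u`. By stationarity its coordinates are
  -- deviations of empirical means from expectations, so a bound over the net controls its norm.
  refine hω ⟨b - (1 / (N : ℝ)) • ∑ j, link ρ (α * inner ℝ u (ψ (ω j))) • ψ (ω j), ?_, ?_⟩
  swap
  · intro v
    rw [inner_sub_right, real_inner_smul_right, inner_sum]
    congr 2
    refine Finset.sum_congr rfl fun j _ => ?_
    rw [real_inner_smul_right, mul_comm]
  · have hB : 0 ≤ A * (C * |link ρ α| * (6 * τ) ^ max Q₁ Q₂) * r := by positivity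
    refine (norm_le_of_net hs3 hB fun v hv => ?_).trans ?_
    · have h1 := hcon v hv
      rw [hstat, abs_sub_comm] at h1
      refine le_trans (le_of_eq ?_) h1
      rw [inner_sub_right, real_inner_smul_right, inner_sum]
      congr 3
      refine Finset.sum_congr rfl fun j _ => ?_
      rw [real_inner_smul_right, mul_comm]
    · rw [Real.mul_rpow (by norm_num) hτ0.le]
      calc 2 * (A * (C * |link ρ α| * (6 ^ max Q₁ Q₂ * τ ^ max Q₁ Q₂)) * r)
          = 2 * (A * (C * 6 ^ max Q₁ Q₂)) * |link ρ α| * τ ^ max Q₁ Q₂ * r := by ring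
        _ ≤ _ := by gcongr; exact le_max_right _ _

/-- Concentration of the predictor at the population maximizer. -/
theorem predictor_event {C Q₁ Q₂ : ℝ} (hC : 0 < C) (hQ₁ : 1 < Q₁) (hQ₂ : 1 < Q₂) :
    ∃ A : ℝ, 0 < A ∧ ∀ (Ω S : Type*) [MeasurableSpace Ω] [MeasurableSpace S] (μ : Measure Ω)
      (P : Measure S) [IsProbabilityMeasure μ] [IsProbabilityMeasure P]
      (n N : ℕ) (c η τ q₁ q₂ : ℝ) (ρ : ℝ → ℝ) (ψ : Ω → EuclideanSpace ℝ (Fin n)) (a : S → Ω → ℝ)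
      (u : EuclideanSpace ℝ (Fin n)) (α : ℝ), 1 ≤ n → 2 ≤ N → WhitenedFeature c η τ μ ψ →
      PEN C c Q₁ Q₂ q₁ q₂ ρ → Measurable (Function.uncurry a) →
      (∀ᵐ x ∂P, HasSqExpMoment τ (a x) μ) → ‖u‖ = 1 → 0 < α →
      (Measure.pi fun _ : Fin N => μ) {ω | ENNReal.ofReal ((A * |link ρ α| * τ ^ max Q₁ Q₂ *
          (√(n * Real.log N / N) + (n * Real.log N) ^ (max (max Q₁ Q₂) 2 / 2) / N)) ^ 2) <
        ∫⁻ x, ENNReal.ofReal (((1 / (N : ℝ)) * ∑ j, a x (ω j) * link ρ (α * inner ℝ u (ψ (ω j))) -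
          ∫ ω, a x ω * link ρ (α * inner ℝ u (ψ ω)) ∂μ) ^ 2) ∂P} ≤
      ENNReal.ofReal (A * Real.exp (-(n * Real.log N))) := by
  obtain ⟨A, hA, h⟩ := concentration_envelope (le_max_right (max Q₁ Q₂) 2) (K := 1) zero_le_one
  have h6 : (0 : ℝ) < 6 ^ max Q₁ Q₂ := by positivity
  refine ⟨max A (A * (C * 6 ^ max Q₁ Q₂)), lt_max_of_lt_left hA, ?_⟩
  intro Ω S _ _ μ P _ _ n N c η τ q₁ q₂ ρ ψ a u α hn hN hw hp ha hexp hu hα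
  have hτ := hw.one_le_tau
  have hτ0 : 0 < τ := by linarith
  have hsα : 0 < |link ρ α| := abs_pos.2 (hp.link_ne_zero hα.ne')
  set Q := max (max Q₁ Q₂) 2
  set p := (n : ℝ) * Real.log N
  set r := √(p / N) + p ^ (Q / 2) / N
  have hp0 : 1 / 2 ≤ p := half_le_mul_log hn hN
  have hr : 0 ≤ r := by positivity
  have hlm : Measurable (link ρ) := hp.monotone.measurable
  refine le_trans (measure_mono fun ω hω => ?_) ((h Ω S μ P N p
    (C * |link ρ α| * (6 * τ) ^ max Q₁ Q₂)
    τ (fun x ω => a x ω * link ρ (α * inner ℝ u (ψ ω))) a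
    (fun _ ω => inner ℝ u (ψ ω)) (by omega) hp0 (log_le_mul_log hn) (by positivity) hτ0
    (ha.mul ((hlm.comp ((hw.measurable_inner u).const_mul α)).comp measurable_snd)) ha
    ((hw.measurable_inner u).comp measurable_snd)
    (fun x ω => hp.abs_mul_link_le_envelope hC hQ₁ hQ₂ hα hτ _ _)
    (by filter_upwards [hexp] with x hx using ⟨hx, hw.moment u hu⟩)).trans
      (ENNReal.ofReal_le_ofReal (by
        rw [one_mul]; gcongr; exact le_max_left _ _)))
  simp only [mem_ofPred_eq] at hω ⊢
  refine lt_of_le_of_lt (ENNReal.ofReal_le_ofReal ?_) hω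
  refine pow_le_pow_left₀ (by positivity) ?_ 2
  rw [Real.mul_rpow (by norm_num) hτ0.le]
  calc A * (C * |link ρ α| * (6 ^ max Q₁ Q₂ * τ ^ max Q₁ Q₂)) * r
      = (A * (C * 6 ^ max Q₁ Q₂)) * |link ρ α| * τ ^ max Q₁ Q₂ * r := by ring
    _ ≤ _ := by gcongr; exact le_max_right _ _

/-- Uniform bound of the empirical moments. -/
theorem moment_event {Q : ℝ} (hQ : 2 ≤ Q) :
    ∃ A : ℝ, 0 < A ∧ ∀ (Ω : Type*) [MeasurableSpace Ω] (μ : Measure Ω) [IsProbabilityMeasure μ]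
      (n N : ℕ) (c η τ : ℝ) (ψ : Ω → EuclideanSpace ℝ (Fin n)), 1 ≤ n → 2 ≤ N →
      WhitenedFeature c η τ μ ψ →
      √(n * Real.log N / N) + (n * Real.log N) ^ (Q / 2) / N ≤ 1 →
      (Measure.pi fun _ : Fin N => μ) {ω | ¬ ∀ v, ∑ j, |inner ℝ v (ψ (ω j))| ^ Q ≤
        N * (A * τ * ‖v‖) ^ Q} ≤
      ENNReal.ofReal (A * Real.exp (-(n * Real.log N))) := by
  obtain ⟨A, hA, h⟩ := concentration_net hQ
  obtain ⟨A', hA', h'⟩ := integral_abs_rpow_le (Q := Q) (by linarith)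
  set A₁ := A * 6 ^ Q + A'
  have hA₁ : 0 < A₁ := by positivity
  refine ⟨max A (2 * A₁ ^ (1 / Q)), lt_max_of_lt_left hA, ?_⟩
  intro Ω _ μ _ n N c η τ ψ hn hN hw hr1
  obtain ⟨s, hs1, hs2, hs3⟩ := exists_half_net n
  have hτ := hw.one_le_tau
  have hτ0 : 0 < τ := by linarith
  have hN0 : (0 : ℝ) < N := by have : 0 < N := by omega
                               exact_mod_cast this
  have hQ0 : 0 < Q := by linarith
  refine le_trans (measure_mono fun ω hω => ?_) ((h Ω μ n N ((6 * τ) ^ Q) τ s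
    (fun v ω => |inner ℝ v (ψ ω)| ^ Q) (fun v ω => inner ℝ v (ψ ω))
    (fun v ω => inner ℝ v (ψ ω)) hn hN hs2 (by positivity) hτ0
    (fun v _ => ⟨by have := hw.measurable_inner v; fun_prop, hw.measurable_inner v,
      hw.measurable_inner v⟩)
    (fun v _ ω => by
      rw [abs_of_nonneg (by positivity)]
      exact abs_rpow_le_envelope hQ0.le hτ0 _ _)
    (fun v hv => ⟨hw.moment v (hs1 v hv), hw.moment v (hs1 v hv)⟩)).trans
      (ENNReal.ofReal_le_ofReal (by gcongr; exact le_max_left _ _)))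
  simp only [mem_ofPred_eq] at hω ⊢
  by_contra! hcon
  refine hω fun v => ?_
  have hB : ∀ v ∈ s, ∑ j, |inner ℝ v (ψ (ω j))| ^ Q ≤ ((N * A₁) ^ (1 / Q) * τ) ^ Q := by
    intro v hv
    have h1 := hcon v hv
    have h2 := (h' Ω μ τ _ hτ0 (hw.measurable_inner v) (hw.moment v (hs1 v hv))).2
    have h3 := (le_abs_self _).trans h1
    have h4 : A * (6 * τ) ^ Q * (√(n * Real.log N / N) + (n * Real.log N) ^ (Q / 2) / N) ≤
        A * (6 * τ) ^ Q := mul_le_of_le_one_right (by positivity) hr1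
    rw [Real.mul_rpow (by positivity) hτ0.le, ← Real.rpow_mul (by positivity),
      one_div_mul_cancel hQ0.ne', Real.rpow_one]
    rw [Real.mul_rpow (by norm_num) hτ0.le] at h4 h3
    have h5 : (1 / (N : ℝ)) * ∑ j, |inner ℝ v (ψ (ω j))| ^ Q ≤ A₁ * τ ^ Q := by
      simp only [A₁]
      rw [Real.mul_rpow (by norm_num) hτ0.le] at h1
      linarith
    rw [one_div_mul_eq_div, div_le_iff₀ hN0] at h5
    linarith
  refine (moment_le_of_net (by linarith) hs3 (fun j => ψ (ω j)) (by positivity) hB v).trans ?_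
  have h5 : (N : ℝ) = (N ^ (1 / Q)) ^ Q := by
    rw [← Real.rpow_mul hN0.le, one_div_mul_cancel hQ0.ne', Real.rpow_one]
  calc (2 * ((N * A₁) ^ (1 / Q) * τ) * ‖v‖) ^ Q
      = (N ^ (1 / Q) * (2 * A₁ ^ (1 / Q) * τ * ‖v‖)) ^ Q := by
        rw [Real.mul_rpow hN0.le hA₁.le]; congr 1; ring
    _ = N * (2 * A₁ ^ (1 / Q) * τ * ‖v‖) ^ Q := by
        rw [Real.mul_rpow (by positivity) (by positivity), ← h5]
    _ ≤ _ := by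
        gcongr
        exact le_max_right _ _

/-- Bound of the empirical moments of the average features. -/
theorem avg_moment_event {Q : ℝ} (hQ : 2 ≤ Q) :
    ∃ A : ℝ, 0 < A ∧ ∀ (Ω S : Type*) [MeasurableSpace Ω] [MeasurableSpace S] (μ : Measure Ω)
      (P : Measure S) [IsProbabilityMeasure μ] [IsProbabilityMeasure P]
      (n N : ℕ) (τ : ℝ) (a : S → Ω → ℝ), 1 ≤ n → 2 ≤ N → 1 ≤ τ →
      Measurable (Function.uncurry a) → (∀ᵐ x ∂P, HasSqExpMoment τ (a x) μ) →
      √(n * Real.log N / N) + (n * Real.log N) ^ (Q / 2) / N ≤ 1 →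
      (Measure.pi fun _ : Fin N => μ) {ω | ENNReal.ofReal (A * τ ^ Q) <
        ∫⁻ x, ENNReal.ofReal ((1 / (N : ℝ)) * ∑ j, |a x (ω j)| ^ Q) ∂P} ≤
      ENNReal.ofReal (A * Real.exp (-(n * Real.log N))) := by
  obtain ⟨A, hA, h⟩ := concentration_envelope hQ (K := 1) zero_le_one
  obtain ⟨A', hA', h'⟩ := integral_abs_rpow_le (Q := Q) (by linarith)
  set B := A * 6 ^ Q
  have hB : 0 < B := by positivity
  refine ⟨max A (A' + 2 * B), lt_max_of_lt_left hA, ?_⟩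
  intro Ω S _ _ μ P _ _ n N τ a hn hN hτ ha hexp hr1
  have hτ0 : 0 < τ := by linarith
  have hQ0 : 0 < Q := by linarith
  set p := (n : ℝ) * Real.log N
  set r := √(p / N) + p ^ (Q / 2) / N
  have hp0 : 1 / 2 ≤ p := half_le_mul_log hn hN
  have hr : 0 ≤ r := by positivity
  have ha' : Measurable fun z : S × Ω => a z.1 z.2 := ha
  have hY : Measurable (Function.uncurry fun x ω => |a x ω| ^ Q) := by
    change Measurable fun z : S × Ω => |a z.1 z.2| ^ Q
    fun_prop
  refine le_trans (measure_mono fun ω hω => ?_) ((h Ω S μ P N p ((6 * τ) ^ Q)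
    τ (fun x ω => |a x ω| ^ Q) a a (by omega) hp0 (log_le_mul_log hn) (by positivity) hτ0
    hY ha ha (fun x ω => by
      rw [abs_of_nonneg (by positivity)]
      exact abs_rpow_le_envelope hQ0.le hτ0 _ _)
    (by filter_upwards [hexp] with x hx using ⟨hx, hx⟩)).trans (ENNReal.ofReal_le_ofReal (by
        rw [one_mul]; gcongr; exact le_max_left _ _)))
  simp only [mem_ofPred_eq] at hω ⊢
  by_contra! hcon
  refine absurd hω (not_lt.2 ?_)
  set T := B * τ ^ Q
  have hT : 0 < T := by positivity
  have hTr : A * (6 * τ) ^ Q * r ≤ T := by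
    rw [Real.mul_rpow (by norm_num) hτ0.le]
    calc A * (6 ^ Q * τ ^ Q) * r ≤ A * (6 ^ Q * τ ^ Q) * 1 := by gcongr
      _ = T := by simp only [T, B]; ring
  set E := A' * τ ^ Q
  have hE : 0 < E := by positivity
  calc ∫⁻ x, ENNReal.ofReal ((1 / (N : ℝ)) * ∑ j, |a x (ω j)| ^ Q) ∂P
      ≤ ∫⁻ x, (ENNReal.ofReal (E + T) + ENNReal.ofReal (1 / T) *
          ENNReal.ofReal (((1 / (N : ℝ)) * ∑ j, |a x (ω j)| ^ Q - ∫ ω, |a x ω| ^ Q ∂μ) ^ 2)) ∂P := by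
        refine lintegral_mono_ae ?_
        filter_upwards [hexp] with x hx
        rw [← ENNReal.ofReal_mul (by positivity), ← ENNReal.ofReal_add (by positivity)
          (by positivity)]
        refine ENNReal.ofReal_le_ofReal ?_
        have h1 := (h' Ω μ τ _ hτ0 ha.of_uncurry_left hx).2
        change _ ≤ E at h1
        set m := (1 / (N : ℝ)) * ∑ j, |a x (ω j)| ^ Q
        set e := ∫ ω, |a x ω| ^ Q ∂μ
        -- The quadratic-mean deviation is converted into a bound on the mean itself, at the scale
        -- `T` of the expected moment.
        have h2 : m - e ≤ T + 1 / T * (m - e) ^ 2 := by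
          have h3 : 0 ≤ (m - e - T) ^ 2 + (m - e) ^ 2 + T ^ 2 := by positivity
          have h4 : T + 1 / T * (m - e) ^ 2 - (m - e) =
            ((m - e - T) ^ 2 + (m - e) ^ 2 + T ^ 2) / (2 * T) := by field_simp; ring
          have h5 : 0 ≤ ((m - e - T) ^ 2 + (m - e) ^ 2 + T ^ 2) / (2 * T) := by positivity
          linarith
        linarith
    _ = ENNReal.ofReal (E + T) + ENNReal.ofReal (1 / T) * ∫⁻ x,
          ENNReal.ofReal (((1 / (N : ℝ)) * ∑ j, |a x (ω j)| ^ Q - ∫ ω, |a x ω| ^ Q ∂μ) ^ 2) ∂P := by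
        rw [lintegral_add_left measurable_const, lintegral_const_mul' _ _ ENNReal.ofReal_ne_top,
          lintegral_const, measure_univ, mul_one]
    _ ≤ ENNReal.ofReal (E + T) + ENNReal.ofReal (1 / T) * ENNReal.ofReal (T ^ 2) := by
        gcongr
        exact hcon.trans (ENNReal.ofReal_le_ofReal (pow_le_pow_left₀ (by positivity) hTr 2))
    _ = ENNReal.ofReal ((A' + 2 * B) * τ ^ Q) := by
        rw [← ENNReal.ofReal_mul (by positivity), ← ENNReal.ofReal_add (by positivity)
          (by positivity)]
        congr 1
        simp only [E, T]
        field_simp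
        ring
    _ ≤ _ := by gcongr; exact le_max_right _ _

end Events

/-! ### Negative-power weights and uniform small-ball counts -/

section WeightsAndCounts

theorem ofReal_max_rpow_le {x t r : ℝ} (hr : r < 0) :
    ENNReal.ofReal (max |x| t ^ r) ≤ ENNReal.ofReal |x| ^ r := by
  rcases eq_or_ne x 0 with rfl | hx
  · rw [abs_zero, ENNReal.ofReal_zero, ENNReal.zero_rpow_of_neg hr]
    exact le_top
  · have h0 : 0 < |x| := abs_pos.2 hx
    rw [ENNReal.ofReal_rpow_of_pos h0]
    exact ENNReal.ofReal_le_ofReal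
      (Real.rpow_le_rpow_of_nonpos h0 (le_max_left _ _) hr.le)

/-- Bound of the average with negative-power weights. -/
theorem weight_event {Q₁ Q₂ : ℝ} (hQ₁ : 1 < Q₁) (hQ₂ : 1 < Q₂) (Cr : ℝ → ℝ) :
    ∃ B : ℝ, 0 < B ∧ ∀ (Ω S : Type*) [MeasurableSpace Ω] [MeasurableSpace S] (μ : Measure Ω)
      (P : Measure S) [IsProbabilityMeasure μ] [IsProbabilityMeasure P]
      (n N : ℕ) (c η τ : ℝ) (ψ : Ω → EuclideanSpace ℝ (Fin n)) (a : S → Ω → ℝ)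
      (u : EuclideanSpace ℝ (Fin n)), 1 ≤ n → 2 ≤ N → WhitenedFeature c η τ μ ψ →
      (min Q₁ Q₂ < 2 → ∀ r : ℝ, -1 < r → r < 0 → ∀ v : EuclideanSpace ℝ (Fin n), ‖v‖ = 1 →
        ∫⁻ ω, (ENNReal.ofReal |inner ℝ v (ψ ω)|) ^ r ∂μ ≤ ENNReal.ofReal (Cr r * η ^ r)) →
      Measurable (Function.uncurry a) → (∀ᵐ x ∂P, HasSqExpMoment τ (a x) μ) → ‖u‖ = 1 →
      n * Real.log N ≤ N →
      (Measure.pi fun _ : Fin N => μ) {ω | ENNReal.ofReal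
          (B * τ ^ 2 * η ^ (-max (2 - min Q₁ Q₂) 0)) <
        ∫⁻ x, ENNReal.ofReal ((1 / (N : ℝ)) * ∑ j, (1 + a x (ω j) ^ 2) *
          max |inner ℝ u (ψ (ω j))| (√(n * Real.log N / N)) ^ (-max (2 - min Q₁ Q₂) 0)) ∂P} ≤
      ENNReal.ofReal (Real.exp (-(n * Real.log N))) := by
  set β := max (2 - min Q₁ Q₂) 0
  have hβ0 : 0 ≤ β := le_max_right _ _
  have hβ1 : β < 1 := max_lt (by linarith [lt_min hQ₁ hQ₂]) one_pos
  rcases hβ0.eq_or_lt with hβ | hβ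
  · obtain ⟨B, hB, h⟩ := weighted_average_le (a := 2) (Cw := 1) (K := 1) one_lt_two zero_le_one
      zero_le_one
    refine ⟨B, hB, ?_⟩
    intro Ω S _ _ μ P _ _ n N c η τ ψ a u hn hN hw hneg ha hexp hu hpN
    have hp0 := half_le_mul_log hn hN
    have := h Ω S μ P N (n * Real.log N) τ 1 a (fun _ => 1) (by omega) hp0 hw.one_le_tau le_rfl ha
      measurable_const (fun _ => zero_le_one)
      (fun _ => (one_le_div (by linarith)).2 hpN) (by simp) hexp
    simpa only [← hβ, neg_zero, Real.rpow_zero, mul_one, one_mul] using this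
  · have hmin : min Q₁ Q₂ < 2 := by
      by_contra! hcon
      have : β = 0 := max_eq_right (by linarith)
      linarith
    -- The midpoint between `-1` and `-β`: the negative moment of order `r` is still assumed finite,
    -- and as `r = -β e` it is a moment of order `e > 1` of the weight, which `weighted_average_le`
    -- needs.
    set r := -((1 + β) / 2)
    set e := (1 + β) / (2 * β)
    have he : 1 < e := by
      rw [one_lt_div (by positivity)]; linarith
    have her : -β * e = r := by simp only [e, r]; field_simp
    obtain ⟨B, hB, h⟩ := weighted_average_le (a := e) (Cw := max (Cr r) 0) (K := 1) he
      (le_max_right _ _) zero_le_one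
    refine ⟨B, hB, ?_⟩
    intro Ω S _ _ μ P _ _ n N c η τ ψ a u hn hN hw hneg ha hexp hu hpN
    have hp0 := half_le_mul_log hn hN
    set p := (n : ℝ) * Real.log N
    have hNp : 1 ≤ N / p := (one_le_div (by linarith)).2 hpN
    have hη := hw.eta_pos
    -- The cutoff bounds the weight by `(N / p)^{β/2} ≤ N / p`, the size that the exponential moment
    -- argument tolerates.
    have ht : 0 < √(p / N) := Real.sqrt_pos.2 (by
      have : (0 : ℝ) < N := by linarith
      have : 0 < p := by linarith
      positivity)
    have hmax : ∀ ω, 0 < max |inner ℝ u (ψ ω)| (√(p / N)) := fun ω => lt_max_of_lt_right ht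
    have := h Ω S μ P N p τ (η ^ (-β)) a
      (fun ω => max |inner ℝ u (ψ ω)| (√(p / N)) ^ (-β)) (by omega) hp0 hw.one_le_tau
      (Real.one_le_rpow_of_pos_of_le_one_of_nonpos hη hw.eta_le (by linarith)) ha
      (by have := hw.measurable_inner u; fun_prop) (fun ω => by have := hmax ω; positivity)
      (fun ω => by
        calc max |inner ℝ u (ψ ω)| (√(p / N)) ^ (-β) ≤ √(p / N) ^ (-β) :=
              Real.rpow_le_rpow_of_nonpos ht (le_max_right _ _) (by linarith)
          _ = (N / p) ^ (β / 2) := by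
              rw [Real.sqrt_eq_rpow, ← Real.rpow_mul (by positivity), ← inv_div,
                Real.inv_rpow (by positivity), ← Real.rpow_neg (by positivity)]
              congr 1; ring
          _ ≤ (N / p) ^ (1 : ℝ) := Real.rpow_le_rpow_of_exponent_le hNp (by linarith)
          _ = N / p := Real.rpow_one _)
      (by
        calc _ ≤ ∫⁻ ω, (ENNReal.ofReal |inner ℝ u (ψ ω)|) ^ r ∂μ := by
              refine lintegral_mono fun ω => ?_
              rw [← Real.rpow_mul (hmax ω).le, her]
              exact ofReal_max_rpow_le (by simp only [r]; linarith)
          _ ≤ ENNReal.ofReal (Cr r * η ^ r) :=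
              hneg hmin r (by simp only [r]; linarith) (by simp only [r]; linarith) u hu
          _ ≤ _ := by
              refine ENNReal.ofReal_le_ofReal ?_
              rw [← Real.rpow_mul hη.le, her]
              gcongr
              exact le_max_left _ _) hexp
    simpa only [one_mul] using this

/-- Uniform small-ball count. -/
theorem count_event {Ω : Type*} [MeasurableSpace Ω] {μ : Measure Ω} [IsProbabilityMeasure μ]
    {n N : ℕ} {c η τ Q A p : ℝ} {ψ : Ω → EuclideanSpace ℝ (Fin n)} (hw : WhitenedFeature c η τ μ ψ)
    (hc : 0 < c) (hQ : 2 ≤ Q) (hA : 1 ≤ A) {u : EuclideanSpace ℝ (Fin n)} (hu : ‖u‖ = 1)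
    (hcard : (96 * A * τ / (c * η)) ^ n * Real.exp (-(c / 8 * N)) ≤ Real.exp (-p)) :
    (Measure.pi fun _ : Fin N => μ) {ω |
      (∀ v, ∑ j, |inner ℝ v (ψ (ω j))| ^ Q ≤ N * (A * τ * ‖v‖) ^ Q) ∧
      ¬ ∃ J : Finset (Fin N), (∀ j ∈ J, η ≤ |inner ℝ u (ψ (ω j))| ∧
        |inner ℝ u (ψ (ω j))| ≤ 1 + 2 / c) ∧ ∀ v, ‖v‖ = 1 →
        c / 16 * N ≤ (J.filter fun j => η / 2 ≤ |inner ℝ v (ψ (ω j))|).card} ≤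
      ENNReal.ofReal (Real.exp (-p)) := by
  classical
  have hη := hw.eta_pos
  have hτ := hw.one_le_tau
  have hτ0 : 0 < τ := by linarith
  have hc1 : c ≤ 1 := (hw.smallBall u u hu hu).trans measureReal_le_one
  -- With `B = A * τ` this resolution gives `2 * B * ε / η = c / 16`, half of the count level `c /
  -- 8` on the net, so `c / 16` survives on the sphere.
  set ε := c * η / (32 * A * τ)
  have hε : 0 < ε := by positivity
  have hε1 : ε ≤ 1 := by
    rw [div_le_one (by positivity)]
    have h1 : c * η ≤ 1 := mul_le_one₀ hc1 hη.le hw.eta_le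
    have h2 : 1 ≤ A * τ := one_le_mul_of_one_le_of_one_le hA hτ
    linarith
  obtain ⟨s, hs1, hs2, hs3⟩ := exists_sphere_net n hε hε1
  have hmu := hw.measurable_inner u
  -- By the unit second moment this event has probability at most `c / 2`, so imposing the upper
  -- bound `1 + 2 / c` keeps half of the small-ball probability.
  set F := {ω | 1 + 2 / c < |inner ℝ u (ψ ω)|}
  have hF : μ.real F ≤ c / 2 := by
    have hsq : Integrable (fun ω => (inner ℝ u (ψ ω) : ℝ) ^ 2) μ := by
      by_contra hn
      have := hw.isotropic u hu
      rw [integral_undef hn] at this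
      exact zero_ne_one this
    have h1 := mul_meas_ge_le_integral_of_nonneg (ae_of_all _ fun ω => sq_nonneg _) hsq
      ((1 + 2 / c) ^ 2)
    rw [hw.isotropic u hu] at h1
    have h2 : μ.real F ≤ μ.real {ω | (1 + 2 / c) ^ 2 ≤ (inner ℝ u (ψ ω) : ℝ) ^ 2} := by
      refine measureReal_mono fun ω hω => ?_
      have hω' : 1 + 2 / c < |inner ℝ u (ψ ω)| := hω
      simp only [mem_ofPred_eq]
      rw [← sq_abs (inner ℝ u (ψ ω) : ℝ)]
      exact pow_le_pow_left₀ (by positivity) hω'.le 2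
    have h3 : 2 / c ≤ (1 + 2 / c) ^ 2 := by
      have : 0 < 2 / c := by positivity
      nlinarith
    have h4 : 2 / c * μ.real F ≤ 1 := by
      calc 2 / c * μ.real F ≤ (1 + 2 / c) ^ 2 * μ.real F := by gcongr
        _ ≤ _ := by
          refine le_trans ?_ h1
          gcongr
    have h5 : 2 / c * μ.real F * (c / 2) = μ.real F := by field_simp
    nlinarith
  set E : EuclideanSpace ℝ (Fin n) → Set Ω := fun v =>
    {ω | (η ≤ |inner ℝ u (ψ ω)| ∧ |inner ℝ u (ψ ω)| ≤ 1 + 2 / c) ∧ η ≤ |inner ℝ v (ψ ω)|}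
  have habs : ∀ v, Measurable fun ω => |inner ℝ v (ψ ω)| := fun v =>
    continuous_abs.measurable.comp (hw.measurable_inner v)
  have hEm : ∀ v, MeasurableSet (E v) := fun v =>
    ((measurableSet_le measurable_const (habs u)).inter
      (measurableSet_le (habs u) measurable_const)).inter
      (measurableSet_le measurable_const (habs v))
  have hE : ∀ v ∈ s, c / 2 ≤ μ.real (E v) := by
    intro v hv
    have h1 := hw.smallBall u v hu (hs1 v hv)
    have h2 : μ.real {ω | η ≤ |inner ℝ u (ψ ω)| ∧ η ≤ |inner ℝ v (ψ ω)|} ≤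
        μ.real (E v) + μ.real F := by
      refine le_trans (measureReal_mono fun ω hω => ?_) (measureReal_union_le _ _)
      by_cases h : ω ∈ F
      · exact Or.inr h
      · exact Or.inl ⟨⟨hω.1, not_lt.1 h⟩, hω.2⟩
    linarith
  refine le_trans (b := (Measure.pi fun _ : Fin N => μ) (⋃ v ∈ s,
    {ω | ∑ j, (E v).indicator (fun _ => (1 : ℝ)) (ω j) < c / 2 / 4 * N}))
    (measure_mono fun ω hω => ?_) ?_
  · obtain ⟨hmom, hno⟩ := hω
    by_contra hcon
    simp only [mem_iUnion, mem_ofPred_eq, not_exists, not_lt] at hcon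
    refine hno ⟨Finset.univ.filter fun j => η ≤ |inner ℝ u (ψ (ω j))| ∧
        |inner ℝ u (ψ (ω j))| ≤ 1 + 2 / c, fun j hj => (Finset.mem_filter.1 hj).2, fun v hv => ?_⟩
    have := count_le_of_net (κ := c / 8) (ε := ε) (B := A * τ) (by linarith) hη (by positivity)
      hε.le (by simp only [ε]; apply le_of_eq; field_simp; norm_num) (by linarith) hs3
      (fun j => ψ (ω j)) hmom
      (Finset.univ.filter fun j => η ≤ |inner ℝ u (ψ (ω j))| ∧
        |inner ℝ u (ψ (ω j))| ≤ 1 + 2 / c) (fun v hv => ?_) hv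
    · refine le_trans (le_of_eq (by ring)) this
    · refine le_trans (le_trans (le_of_eq (by ring)) (hcon v hv)) (le_of_eq ?_)
      rw [Finset.filter_filter, Finset.card_filter]
      push_cast
      refine Finset.sum_congr rfl fun j _ => ?_
      simp only [indicator, E, mem_ofPred_eq]
  · calc _ ≤ ∑ v ∈ s, (Measure.pi fun _ : Fin N => μ)
          {ω | ∑ j, (E v).indicator (fun _ => (1 : ℝ)) (ω j) < c / 2 / 4 * N} :=
        measure_biUnion_finset_le _ _
      _ ≤ ∑ _v ∈ s, ENNReal.ofReal (Real.exp (-(c / 2 / 4 * N))) :=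
        Finset.sum_le_sum fun v hv => measure_count_le N (hEm v) (hE v hv)
      _ = ENNReal.ofReal (s.card * Real.exp (-(c / 2 / 4 * N))) := by
        rw [Finset.sum_const, nsmul_eq_mul,
          ENNReal.ofReal_mul (p := (s.card : ℝ)) (Nat.cast_nonneg _), ENNReal.ofReal_natCast]
      _ ≤ _ := by
        refine ENNReal.ofReal_le_ofReal (le_trans ?_ hcard)
        have h1 : (3 / ε) = 96 * A * τ / (c * η) := by simp only [ε]; field_simp; norm_num
        rw [← h1]
        have h2 : c / 2 / 4 * N = c / 8 * (N : ℝ) := by ring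
        rw [h2]
        gcongr

end WeightsAndCounts

/-! ### Consequences of the lower bounds on the width -/

section Numerics

/-- The lower bounds on the width make the rate small, apart from a trivial regime. -/
theorem rate_small {K Q κ : ℝ} (hK : 0 ≤ K) (hQ : 2 ≤ Q) (hκ : 0 < κ) :
    ∃ C₀ : ℝ, 0 < C₀ ∧ ∀ (n N : ℕ) (R : ℝ), 1 ≤ n → 1 ≤ N → 1 ≤ R → R ≤ (n : ℝ) ^ K →
      C₀ * R ^ 2 * (n * Real.log n) ≤ N → C₀ * R * (n * Real.log n) ^ (Q / 2) ≤ N →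
      (n = 1 ∧ (N : ℝ) ≤ C₀) ∨ (2 ≤ N ∧ n * Real.log N * R ^ 2 ≤ κ ^ 2 * N ∧
        (n * Real.log N) ^ (Q / 2) * R ≤ κ * N) := by
  -- For `N ≤ n^K₁`, `log N` is at most `K₁ log n` and the assumed bounds apply directly. For `N >
  -- n^K₁` the quantities `n R²` and `n^{Q/2} R` are both at most `√N`, and the powers of `log N`
  -- fit into the other factor `√N`.
  set K₁ := 4 * K + 2 + Q
  have hK₁ : 0 < K₁ := by positivity
  have hlim : ∀ a ε : ℝ, 0 < ε → ∀ᶠ N : ℕ in atTop,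
      Real.log N ^ a ≤ ε * (N : ℝ) ^ (1 / 2 : ℝ) := by
    intro a ε hε
    have h1 := (isLittleO_log_rpow_rpow_atTop a (by norm_num : (0 : ℝ) < 1 / 2)).bound hε
    have h2 := tendsto_natCast_atTop_atTop (R := ℝ) |>.eventually h1
    filter_upwards [h2, eventually_ge_atTop 1] with N hN hN1
    rw [Real.norm_eq_abs, Real.norm_eq_abs, abs_of_nonneg (by positivity : (0 : ℝ) ≤ (N : ℝ) ^ (1 / 2 : ℝ))]
      at hN
    exact (le_abs_self _).trans hN
  obtain ⟨N₀, hN₀⟩ := eventually_atTop.1 ((hlim 1 (κ ^ 2) (by positivity)).and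
    ((hlim (Q / 2) κ hκ).and (eventually_ge_atTop 2)))
  set C₀ := max (N₀ : ℝ) (max (K₁ / κ ^ 2) (K₁ ^ (Q / 2) / κ))
  have hC₀ : 0 < C₀ := lt_max_of_lt_right (lt_max_of_lt_left (by positivity))
  have hC1 : K₁ ≤ κ ^ 2 * C₀ := by
    have : K₁ / κ ^ 2 ≤ C₀ := (le_max_left _ _).trans (le_max_right _ _)
    rw [div_le_iff₀ (by positivity)] at this
    linarith
  have hC2 : K₁ ^ (Q / 2) ≤ κ * C₀ := by
    have : K₁ ^ (Q / 2) / κ ≤ C₀ := (le_max_right _ _).trans (le_max_right _ _)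
    rw [div_le_iff₀ (by positivity)] at this
    linarith
  refine ⟨C₀, hC₀, fun n N R hn hN hR hRn h1 h2 => ?_⟩
  have hn' : (1 : ℝ) ≤ n := by exact_mod_cast hn
  have hR0 : 0 < R := by linarith
  rcases lt_or_ge N N₀ with hlt | hge
  · have hNC : (N : ℝ) < C₀ := lt_of_lt_of_le (by exact_mod_cast hlt) (le_max_left _ _)
    -- For `n ≥ 2` one has `n log n ≥ 1`, so the width condition would give `N ≥ C₀`. For `n = 1`
    -- the logarithm vanishes and the condition is empty, hence this separate case.
    refine Or.inl ⟨?_, hNC.le⟩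
    by_contra hn1
    have hn2 : (2 : ℝ) ≤ n := by
      have : 2 ≤ n := by omega
      exact_mod_cast this
    have h3 : 1 ≤ (n : ℝ) * Real.log n := by
      have h4 : Real.log 2 ≤ Real.log n := Real.log_le_log (by norm_num) hn2
      have := Real.log_two_gt_d9
      nlinarith
    have h5 : 1 ≤ R ^ 2 := one_le_pow₀ hR
    have h6 : C₀ ≤ C₀ * R ^ 2 * (n * Real.log n) := by
      rw [mul_assoc]
      exact le_mul_of_one_le_right hC₀.le (one_le_mul_of_one_le_of_one_le h5 h3)
    linarith
  · obtain ⟨hl1, hl2, hN2⟩ := hN₀ N hge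
    have hN2' : (2 : ℝ) ≤ N := by
      have : 2 ≤ N := by
        have := (hN₀ N hge).2.2; omega
      exact_mod_cast this
    refine Or.inr ⟨by exact_mod_cast hN2', ?_⟩
    have hN0 : (0 : ℝ) < N := by linarith
    have hlog : 0 ≤ Real.log N := Real.log_natCast_nonneg N
    have hlogn : 0 ≤ Real.log n := Real.log_natCast_nonneg n
    rw [Real.rpow_one] at hl1
    have hhalf : (N : ℝ) ^ (1 / 2 : ℝ) * (N : ℝ) ^ (1 / 2 : ℝ) = N := by
      rw [← Real.rpow_add hN0]; norm_num
    rcases le_or_gt (N : ℝ) ((n : ℝ) ^ K₁) with hle | hgt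
    · have h3 : Real.log N ≤ K₁ * Real.log n := by
        rw [← Real.log_rpow (by linarith)]
        exact Real.log_le_log hN0 hle
      have h4 : (n : ℝ) * Real.log N ≤ K₁ * (n * Real.log n) := by nlinarith
      constructor
      · calc (n : ℝ) * Real.log N * R ^ 2 ≤ K₁ * (n * Real.log n) * R ^ 2 := by gcongr
          _ ≤ κ ^ 2 * C₀ * (n * Real.log n) * R ^ 2 := by gcongr
          _ = κ ^ 2 * (C₀ * R ^ 2 * (n * Real.log n)) := by ring
          _ ≤ _ := by gcongr
      · calc ((n : ℝ) * Real.log N) ^ (Q / 2) * R ≤ (K₁ * (n * Real.log n)) ^ (Q / 2) * R := by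
              gcongr
          _ = K₁ ^ (Q / 2) * (n * Real.log n) ^ (Q / 2) * R := by
              rw [Real.mul_rpow hK₁.le (by positivity)]
          _ ≤ κ * C₀ * (n * Real.log n) ^ (Q / 2) * R := by gcongr
          _ = κ * (C₀ * R * (n * Real.log n) ^ (Q / 2)) := by ring
          _ ≤ _ := by gcongr
    · have h3 : ∀ e : ℝ, e ≤ K₁ / 2 → (n : ℝ) ^ e ≤ (N : ℝ) ^ (1 / 2 : ℝ) := fun e he => by
        calc (n : ℝ) ^ e ≤ (n : ℝ) ^ (K₁ / 2) := Real.rpow_le_rpow_of_exponent_le hn' he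
          _ = ((n : ℝ) ^ K₁) ^ (1 / 2 : ℝ) := by
              rw [← Real.rpow_mul (by linarith)]; congr 1; ring
          _ ≤ _ := Real.rpow_le_rpow (by positivity) hgt.le (by norm_num)
      have hn0 : (0 : ℝ) < n := by linarith
      constructor
      · have h4 : (n : ℝ) * R ^ 2 ≤ (N : ℝ) ^ (1 / 2 : ℝ) := by
          calc (n : ℝ) * R ^ 2 ≤ n * ((n : ℝ) ^ K) ^ 2 := by gcongr
            _ = (n : ℝ) ^ (1 + K * 2) := by
                rw [Real.rpow_add hn0, Real.rpow_one, Real.rpow_mul hn0.le, Real.rpow_two]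
            _ ≤ _ := h3 _ (by simp only [K₁]; linarith)
        calc (n : ℝ) * Real.log N * R ^ 2 = n * R ^ 2 * Real.log N := by ring
          _ ≤ (N : ℝ) ^ (1 / 2 : ℝ) * (κ ^ 2 * (N : ℝ) ^ (1 / 2 : ℝ)) := by gcongr
          _ = κ ^ 2 * ((N : ℝ) ^ (1 / 2 : ℝ) * (N : ℝ) ^ (1 / 2 : ℝ)) := by ring
          _ = _ := by rw [hhalf]
      · have h4 : (n : ℝ) ^ (Q / 2) * R ≤ (N : ℝ) ^ (1 / 2 : ℝ) := by
          calc (n : ℝ) ^ (Q / 2) * R ≤ (n : ℝ) ^ (Q / 2) * (n : ℝ) ^ K := by gcongr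
            _ = (n : ℝ) ^ (Q / 2 + K) := by rw [Real.rpow_add hn0]
            _ ≤ _ := h3 _ (by simp only [K₁]; linarith)
        calc ((n : ℝ) * Real.log N) ^ (Q / 2) * R
            = ((n : ℝ) ^ (Q / 2) * R) * Real.log N ^ (Q / 2) := by
              rw [Real.mul_rpow hn0.le hlog]; ring
          _ ≤ (N : ℝ) ^ (1 / 2 : ℝ) * (κ * (N : ℝ) ^ (1 / 2 : ℝ)) := by gcongr
          _ = κ * ((N : ℝ) ^ (1 / 2 : ℝ) * (N : ℝ) ^ (1 / 2 : ℝ)) := by ring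
          _ = _ := by rw [hhalf]

/-- Since `R ≤ N`, the net has at most `exp((2 M + 1) p)` points with `p = n log N`. The Chernoff
factor `exp(-c N / 8)` outweighs this and leaves `exp(-p)`, because `p ≤ κ² N` with `κ` small. -/
theorem net_card_le {n N : ℕ} {M R κ c : ℝ} (hn : 1 ≤ n) (hN : 2 ≤ N) (hM : 0 < M) (hR : 1 ≤ R)
    (hκ : κ ^ 2 ≤ 1 / 2) (hκM : (2 * M + 2) * κ ^ 2 ≤ c / 8)
    (h : n * Real.log N * R ^ 2 ≤ κ ^ 2 * N) {y : ℝ} (hy0 : 0 ≤ y) (hy : y ≤ M * R) :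
    y ^ n * Real.exp (-(c / 8 * N)) ≤ Real.exp (-(n * Real.log N)) := by
  have hp := half_le_mul_log hn hN
  have hN2 : (2 : ℝ) ≤ N := by exact_mod_cast hN
  have hN0 : (0 : ℝ) < N := by linarith
  set p := (n : ℝ) * Real.log N
  have hR2 : 1 ≤ R ^ 2 := one_le_pow₀ hR
  have hRN : R ≤ N := by nlinarith
  have hpN : p ≤ κ ^ 2 * N := by nlinarith
  have hlog : 1 / 2 ≤ Real.log N := by
    have h1 : Real.log 2 ≤ Real.log N := Real.log_le_log (by norm_num) hN2
    have := Real.log_two_gt_d9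
    linarith
  have h1 : y ≤ Real.exp ((2 * M + 1) * Real.log N) := by
    calc y ≤ M * R := hy
      _ ≤ Real.exp M * N := by
          have := Real.add_one_le_exp M
          exact mul_le_mul (by linarith) hRN (by linarith) (Real.exp_pos _).le
      _ = Real.exp (M + Real.log N) := by rw [Real.exp_add, Real.exp_log hN0]
      _ ≤ _ := Real.exp_le_exp.2 (by nlinarith)
  have h2 : y ^ n ≤ Real.exp ((2 * M + 1) * p) := by
    calc y ^ n ≤ Real.exp ((2 * M + 1) * Real.log N) ^ n := by gcongr
      _ = _ := by rw [← Real.exp_nat_mul]; congr 1; simp only [p]; ring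
  calc y ^ n * Real.exp (-(c / 8 * N)) ≤ Real.exp ((2 * M + 1) * p) * Real.exp (-(c / 8 * N)) := by
        gcongr
    _ = Real.exp ((2 * M + 1) * p - c / 8 * N) := by rw [← Real.exp_add]; congr 1
    _ ≤ _ := by
        refine Real.exp_le_exp.2 ?_
        have h3 : (2 * M + 2) * p ≤ (2 * M + 2) * (κ ^ 2 * N) := by gcongr
        have h4 := mul_le_mul_of_nonneg_right hκM hN0.le
        linarith

end Numerics

/-! ### Error bound on a good sample -/

section GoodSample

theorem one_le_scale {τ η Q₁ Q₂ : ℝ} (hτ : 1 ≤ τ) (hη : 0 < η) (hη1 : η ≤ 1) :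
    1 ≤ max (τ ^ (max Q₁ Q₂ - 2)) (η ^ (min Q₁ Q₂ - 2)) := by
  rcases le_total 2 (max Q₁ Q₂) with h | h
  · exact le_max_of_le_left (Real.one_le_rpow hτ (by linarith))
  · exact le_max_of_le_right (Real.one_le_rpow_of_pos_of_le_one_of_nonpos hη hη1
      (by linarith [min_le_left Q₁ Q₂, le_max_left Q₁ Q₂]))

theorem rpow_neg_le_scale {τ η Q₁ Q₂ : ℝ} (hτ : 1 ≤ τ) (hη : 0 < η) (hη1 : η ≤ 1) :
    η ^ (-max (2 - min Q₁ Q₂) 0) ≤ max (τ ^ (max Q₁ Q₂ - 2)) (η ^ (min Q₁ Q₂ - 2)) := by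
  rcases le_total 0 (2 - min Q₁ Q₂) with h | h
  · rw [max_eq_left h, neg_sub]
    exact le_max_right _ _
  · rw [max_eq_right h, neg_zero, Real.rpow_zero]
    exact one_le_scale hτ hη hη1

theorem rpow_le_sq_mul_scale {τ η Q₁ Q₂ : ℝ} (hτ : 1 ≤ τ) (hη : 0 < η) (hη1 : η ≤ 1) :
    τ ^ max (max Q₁ Q₂) 2 ≤ τ ^ 2 * max (τ ^ (max Q₁ Q₂ - 2)) (η ^ (min Q₁ Q₂ - 2)) := by
  have hτ0 : 0 < τ := by linarith
  rcases le_total 2 (max Q₁ Q₂) with h | h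
  · rw [max_eq_left h]
    calc τ ^ max Q₁ Q₂ = τ ^ 2 * τ ^ (max Q₁ Q₂ - 2) := by
          rw [← Real.rpow_natCast, ← Real.rpow_add hτ0]; congr 1; push_cast; ring
      _ ≤ _ := by gcongr; exact le_max_left _ _
  · rw [max_eq_right h, Real.rpow_two]
    exact le_mul_of_one_le_right (by positivity) (one_le_scale hτ hη hη1)

/-- In the application `x = τ^Q`, `w = η^{-(q∨3)}` and `Y` is the factor `τ^{Q-2} ∨ η^{Q'-2}`. All
of them are at least `1`, so each of the three error contributions is dominated by the square of the
product `Z`; the Bregman one carries a single `w`, relaxed to `w²`. -/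
theorem scale_algebra {σ r x w Y τ C l Mu t U A₁ A₂ E : ℝ} (hσ : 0 ≤ σ) (hx : 1 ≤ x)
    (hw : 1 ≤ w) (hY : 1 ≤ Y) (hτ : 1 ≤ τ) (hC : 0 < C) (hl : 0 < l) (hMu : 0 < Mu) (ht : 0 ≤ t)
    (htr : t ≤ r) (hU : 0 ≤ U) (hUle : U ≤ Mu * (τ ^ 2 * Y))
    (hEle : E ≤ A₁ ^ 2 / l * σ * (x ^ 2 * w) * r ^ 2) {M : ℝ}
    (hM : M = 2 * A₂ ^ 2 + 2 * (8 * C * A₁ ^ 2 * Mu / l + 128 * C ^ 2 * Mu ^ 2)) :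
    2 * (A₂ * σ * x * r) ^ 2 + 2 * (8 * C * σ * E * U + 128 * C ^ 2 * σ ^ 2 * t ^ 2 * U ^ 2) ≤
      ((1 + M) * σ * (x * τ ^ 2 * w * Y) * r) ^ 2 := by
  set Z := x * τ ^ 2 * w * Y
  have hτ2 : 1 ≤ τ ^ 2 := one_le_pow₀ hτ
  have hx0 : 0 < x := by linarith
  have hY0 : 0 < Y := by linarith
  have hw0 : 0 < w := by linarith
  have z1 : x ^ 2 ≤ Z ^ 2 := by
    have : x ≤ Z := by
      calc x = x * 1 * 1 * 1 := by ring
        _ ≤ x * τ ^ 2 * w * Y := by gcongr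
    gcongr
  have z2 : x ^ 2 * (τ ^ 2 * Y) * w ≤ Z ^ 2 := by
    calc x ^ 2 * (τ ^ 2 * Y) * w = x ^ 2 * (τ ^ 2 * 1) * (w * 1) * (Y * 1) := by ring
      _ ≤ x ^ 2 * (τ ^ 2 * τ ^ 2) * (w * w) * (Y * Y) := by gcongr
      _ = Z ^ 2 := by simp only [Z]; ring
  have z3 : (τ ^ 2 * Y) ^ 2 ≤ Z ^ 2 := by
    have : τ ^ 2 * Y ≤ Z := by
      calc τ ^ 2 * Y = 1 * τ ^ 2 * 1 * Y := by ring
        _ ≤ x * τ ^ 2 * w * Y := by gcongr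
    gcongr
  calc _ ≤ 2 * (A₂ * σ * x * r) ^ 2 + 2 * (8 * C * σ * (A₁ ^ 2 / l * σ * (x ^ 2 * w) * r ^ 2) *
        (Mu * (τ ^ 2 * Y)) + 128 * C ^ 2 * σ ^ 2 * r ^ 2 * (Mu * (τ ^ 2 * Y)) ^ 2) := by
        gcongr
    _ = σ ^ 2 * r ^ 2 * (2 * A₂ ^ 2 * x ^ 2 + 2 * (8 * C * A₁ ^ 2 * Mu / l *
        (x ^ 2 * (τ ^ 2 * Y) * w) + 128 * C ^ 2 * Mu ^ 2 * (τ ^ 2 * Y) ^ 2)) := by ring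
    _ ≤ σ ^ 2 * r ^ 2 * (2 * A₂ ^ 2 * Z ^ 2 + 2 * (8 * C * A₁ ^ 2 * Mu / l *
        Z ^ 2 + 128 * C ^ 2 * Mu ^ 2 * Z ^ 2)) := by gcongr
    _ = M * (σ ^ 2 * Z ^ 2 * r ^ 2) := by rw [hM]; ring
    _ ≤ (1 + M) ^ 2 * (σ ^ 2 * Z ^ 2 * r ^ 2) := by
        have : 0 ≤ M := by rw [hM]; positivity
        gcongr
        nlinarith
    _ = _ := by ring

set_option maxHeartbeats 800000 in
/-- The error of the empirical predictor on a good sample. -/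
theorem good_sample_error {C c Q₁ Q₂ q₁ q₂ A₁ A₂ A₃ A₄ B : ℝ} (hC : 0 < C) (hc : 0 < c)
    (hQ₁ : 1 < Q₁) (hQ₂ : 1 < Q₂) (hq₁ : 1 < q₁) (hq₂ : 1 < q₂) (hA₁ : 0 < A₁) (hA₂ : 0 < A₂)
    (hA₃ : 0 < A₃) (hA₄ : 0 < A₄) (hB : 0 < B) :
    ∃ κ : ℝ, 0 < κ ∧ ∃ M : ℝ, 0 < M ∧ ∀ (S : Type*) [MeasurableSpace S] (P : Measure S)
      [IsProbabilityMeasure P] (n N : ℕ) (η τ t r : ℝ) (ρ : ℝ → ℝ)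
      (ψ : Fin N → EuclideanSpace ℝ (Fin n)) (a : S → Fin N → ℝ) (f : S → ℝ)
      (b u g : EuclideanSpace ℝ (Fin n)) (α : ℝ) (J : Finset (Fin N)),
      1 ≤ N → 0 < η → η ≤ 1 → 1 ≤ τ → PEN C c Q₁ Q₂ q₁ q₂ ρ → (∀ j, Measurable fun x => a x j) →
      Measurable f → ‖u‖ = 1 → 0 < α → 0 < t → t ≤ r →
      r * (τ ^ max (max Q₁ Q₂) 2 / η ^ max (max q₁ q₂) 3) ≤ κ →
      (∀ j ∈ J, η ≤ |inner ℝ u (ψ j)| ∧ |inner ℝ u (ψ j)| ≤ 1 + 2 / c) →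
      (∀ v, ‖v‖ = 1 → c / 16 * N ≤ (J.filter fun j => η / 2 ≤ |inner ℝ v (ψ j)|).card) →
      (∀ v, inner ℝ v g =
        inner ℝ v b - (1 / (N : ℝ)) * ∑ j, inner ℝ v (ψ j) * link ρ (α * inner ℝ u (ψ j))) →
      ‖g‖ ≤ A₁ * |link ρ α| * τ ^ max Q₁ Q₂ * r →
      ∫⁻ x, ENNReal.ofReal (((1 / (N : ℝ)) * ∑ j, a x j * link ρ (α * inner ℝ u (ψ j)) -
        f x) ^ 2) ∂P ≤ ENNReal.ofReal ((A₂ * |link ρ α| * τ ^ max Q₁ Q₂ * r) ^ 2) →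
      (∀ v, ∑ j, |inner ℝ v (ψ j)| ^ max (max Q₁ Q₂) 2 ≤
        N * (A₃ * τ * ‖v‖) ^ max (max Q₁ Q₂) 2) →
      ∫⁻ x, ENNReal.ofReal ((1 / (N : ℝ)) * ∑ j, |a x j| ^ max (max Q₁ Q₂) 2) ∂P ≤
        ENNReal.ofReal (A₄ * τ ^ max (max Q₁ Q₂) 2) →
      ∫⁻ x, ENNReal.ofReal ((1 / (N : ℝ)) * ∑ j, (1 + a x j ^ 2) *
          max |inner ℝ u (ψ j)| t ^ (-max (2 - min Q₁ Q₂) 0)) ∂P ≤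
        ENNReal.ofReal (B * τ ^ 2 * η ^ (-max (2 - min Q₁ Q₂) 0)) →
      ∃ θ, IsArgMax (empiricalDual ρ ψ b) θ ∧
        ∫⁻ x, ENNReal.ofReal (((1 / (N : ℝ)) * ∑ j, a x j * link ρ (inner ℝ (ψ j) θ) -
          f x) ^ 2) ∂P ≤
        ENNReal.ofReal ((M * |link ρ α| * (τ ^ (max Q₁ Q₂ + 2) / η ^ max (max q₁ q₂) 3 *
          max (τ ^ (max Q₁ Q₂ - 2)) (η ^ (min Q₁ Q₂ - 2))) * r) ^ 2) := by
  set Q := max Q₁ Q₂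
  set Qb := max Q 2
  set q3 := max (max q₁ q₂) 3
  set e := max (max q₁ q₂ - 2) 0
  have he0 : 0 ≤ e := le_max_right _ _
  have he3 : e + 2 ≤ q3 := by
    rcases max_choice (max q₁ q₂ - 2) 0 with h | h <;> simp only [e, q3] <;> rw [h]
    · linarith [le_max_left (max q₁ q₂) 3]
    · linarith [le_max_right (max q₁ q₂) 3]
  have hQb : Qb = max (Q - 2) 0 + 2 := by
    rw [← max_add_add_right]; simp only [Qb]; congr 1 <;> ring
  -- The numerical constant of the curvature: since `e + 2 ≤ q ∨ 3` and `η ≤ 1`, the curvature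
  -- satisfies `L ≥ l |s(α)| η^{q∨3}`.
  set l := c * (c / 16) / (1 + 2 / c + 1) * (1 / 2) ^ (e + 2)
  have hl : 0 < l := by positivity
  set Bm := A₃ ^ Qb + A₄
  have hBm : 0 < Bm := by positivity
  set Mu := B + 2 * (1 + Bm * (1 + 2 * 2 ^ Qb))
  have hMu : 0 < Mu := by positivity
  set M2 := 2 * A₂ ^ 2 + 2 * (8 * C * A₁ ^ 2 * Mu / l + 128 * C ^ 2 * Mu ^ 2)
  have hM2 : 0 < M2 := by positivity
  -- This smallness of the rate makes `G` at most half of `l |s(α)| η^{q∨3}`, hence `G < L`.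
  refine ⟨l / (2 * A₁), by positivity, 1 + M2, by positivity, ?_⟩
  intro S _ P _ n N η τ t r ρ ψ a f b u g α J hN hη hη1 hτ hp ha hf hu hα ht htr hrκ hJ hcount hg hgG
    hH hmom havg hwt
  have hN0 : (0 : ℝ) < N := by exact_mod_cast hN
  have hτ0 : 0 < τ := by linarith
  have hs : 0 < |link ρ α| := abs_pos.2 (hp.link_ne_zero hα.ne')
  have hr : 0 < r := by linarith
  set σ := |link ρ α|
  set Y := max (τ ^ (Q - 2)) (η ^ (min Q₁ Q₂ - 2))
  have hY1 : 1 ≤ Y := one_le_scale hτ hη hη1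
  have hYη : η ^ (-max (2 - min Q₁ Q₂) 0) ≤ Y := rpow_neg_le_scale hτ hη hη1
  have hYτ : τ ^ Qb ≤ τ ^ 2 * Y := rpow_le_sq_mul_scale hτ hη hη1
  set x := τ ^ Q
  have hx1 : 1 ≤ x := Real.one_le_rpow hτ (by simp only [Q]; linarith [le_max_left Q₁ Q₂])
  have hxQ : x ≤ τ ^ Qb := Real.rpow_le_rpow_of_exponent_le hτ (le_max_left _ _)
  set h := η ^ q3
  have hh0 : 0 < h := by positivity
  have hh1 : h ≤ 1 := Real.rpow_le_one hη.le hη1 (by simp only [q3]; positivity)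
  set L := c * σ * ((η / 2) ^ e / (1 + 2 / c + 1)) * (η / 2) ^ 2 * (c / 16)
  have hL : l * σ * h ≤ L := by
    have h1 : (η / 2) ^ e * (η / 2) ^ 2 = (1 / 2) ^ (e + 2) * η ^ (e + 2) := by
      rw [← Real.rpow_natCast, ← Real.rpow_add (by positivity), ← Real.mul_rpow (by norm_num) hη.le]
      congr 1
      ring
    have h2 : h ≤ η ^ (e + 2) := Real.rpow_le_rpow_of_exponent_ge hη hη1 he3
    calc l * σ * h ≤ l * σ * η ^ (e + 2) := by gcongr
      _ = c * (c / 16) / (1 + 2 / c + 1) * σ * ((1 / 2) ^ (e + 2) * η ^ (e + 2)) := by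
          simp only [l]; ring
      _ = L := by rw [← h1]; simp only [L]; ring
  have hL0 : 0 < L := lt_of_lt_of_le (by positivity) hL
  have hrh : A₁ * (x * r) ≤ l / 2 * h := by
    have h1 : r * τ ^ Qb ≤ l / (2 * A₁) * h := by
      rw [← mul_div_assoc, div_le_iff₀ hh0] at hrκ
      exact hrκ
    calc A₁ * (x * r) ≤ A₁ * (τ ^ Qb * r) := by gcongr
      _ ≤ A₁ * (l / (2 * A₁) * h) :=
          mul_le_mul_of_nonneg_left (by rw [mul_comm]; exact h1) hA₁.le
      _ = _ := by field_simp
  set G := A₁ * σ * x * r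
  have hGL : G < L := by
    refine lt_of_lt_of_le ?_ hL
    calc G = σ * (A₁ * (x * r)) := by simp only [G]; ring
      _ ≤ σ * (l / 2 * h) := by gcongr
      _ < l * σ * h := by
          have : 0 < l * σ * h := by positivity
          linarith
  set U := B * τ ^ 2 * η ^ (-max (2 - min Q₁ Q₂) 0) +
    2 * (1 + Bm * τ ^ Qb + 2 ^ Qb * (Bm * τ ^ Qb + Bm * τ ^ Qb))
  have hU0 : 0 ≤ U := by positivity
  have hUle : U ≤ Mu * (τ ^ 2 * Y) := by
    have h1 : 1 ≤ τ ^ 2 * Y := one_le_mul_of_one_le_of_one_le (one_le_pow₀ hτ) hY1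
    calc U ≤ B * τ ^ 2 * Y + 2 * (τ ^ 2 * Y + Bm * (τ ^ 2 * Y) +
          2 ^ Qb * (Bm * (τ ^ 2 * Y) + Bm * (τ ^ 2 * Y))) := by
          simp only [U]; gcongr
      _ = _ := by simp only [Mu]; ring
  have hmom' : ∀ v, ‖v‖ = 1 → (1 / (N : ℝ)) * ∑ j, |inner ℝ v (ψ j)| ^ (max (Q - 2) 0 + 2) ≤
      Bm * τ ^ Qb := by
    intro v hv
    have h1 := hmom v
    rw [hv, mul_one, Real.mul_rpow hA₃.le hτ0.le] at h1
    rw [one_div_mul_eq_div, div_le_iff₀ hN0, ← hQb]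
    refine h1.trans ?_
    have : 0 ≤ (N : ℝ) * (A₄ * τ ^ Qb) := by positivity
    simp only [Bm]
    linarith
  obtain ⟨θ, hθ, hθle⟩ := empirical_error (P := P) hp hC hc hQ₁ hQ₂ hq₁ hq₂ hN ha hf hu (t := t)
    (G := G) (H := A₂ * σ * x * r) (U := U) hα hη hη1
    (le_add_of_nonneg_right (by positivity : 0 ≤ 2 / c)) (by positivity : 0 < c / 16) ht hU0 hJ
    hcount hg hgG (L := L) rfl hGL hH
    (fun v hv D hD hD1 => by
      have h2 := lintegral_weight_le (P := P) hN ha (X := fun j => inner ℝ u (ψ j))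
        (V := fun j => inner ℝ v (ψ j)) (γ := max (Q - 2) 0) (B := Bm * τ ^ Qb)
        (le_max_right _ _) (by positivity) (by positivity) hD hD1
        (fun j => by
          have : 0 < max |inner ℝ u (ψ j)| t := lt_max_of_lt_right ht
          positivity) hwt (hmom' u hu) (hmom' v hv)
        (by
          rw [← hQb]
          refine havg.trans (ENNReal.ofReal_le_ofReal ?_)
          gcongr
          simp only [Bm]
          linarith [(by positivity : 0 < A₃ ^ Qb)])
      rw [← hQb] at h2
      exact h2)
  refine ⟨θ, hθ, hθle.trans (ENNReal.ofReal_le_ofReal ?_)⟩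
  have hZ : τ ^ (Q + 2) / h * Y = x * τ ^ 2 * (1 / h) * Y := by
    simp only [x]
    rw [Real.rpow_add hτ0, Real.rpow_two]
    ring
  have hGL2 : G ^ 2 / L ≤ A₁ ^ 2 / l * σ * (x ^ 2 * (1 / h)) * r ^ 2 := by
    calc G ^ 2 / L ≤ G ^ 2 / (l * σ * h) := by gcongr
      _ = _ := by simp only [G]; field_simp
  rw [hZ]
  exact scale_algebra hs.le hx1 ((one_le_div hh0).2 hh1) hY1 hτ hC hl hMu ht.le htr hU0 hUle
    hGL2 rfl

theorem isArgMax_empiricalDual_zero {C c Q₁ Q₂ q₁ q₂ : ℝ} {ρ : ℝ → ℝ} {n N : ℕ}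
    (hp : PEN C c Q₁ Q₂ q₁ q₂ ρ) (hc : 0 < c) (hq₁ : 1 < q₁) (hq₂ : 1 < q₂) (hN : 1 ≤ N)
    {ψ : Fin N → EuclideanSpace ℝ (Fin n)}
    (hspan : ∀ v, ‖v‖ = 1 → ∃ j, (inner ℝ v (ψ j) : ℝ) ≠ 0) :
    IsArgMax (empiricalDual ρ ψ 0) 0 := by
  have hmax : ∀ θ', empiricalDual ρ ψ 0 θ' ≤ empiricalDual ρ ψ 0 0 := by
    intro θ'
    simp only [empiricalDual, inner_zero_right]
    have : ∑ _j : Fin N, conjugate ρ 0 ≤ ∑ j, conjugate ρ (inner ℝ (ψ j) θ') :=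
      Finset.sum_le_sum fun j _ => by
        have := hp.subgradient 0 (inner ℝ (ψ j) θ')
        rw [hp.link_zero] at this
        linarith
    have := mul_le_mul_of_nonneg_left this (by positivity : (0 : ℝ) ≤ 1 / N)
    linarith
  exact ⟨hmax, fun θ' h => empirical_unique hp hc hq₁ hq₂ hN hspan hmax h⟩

/-- For `Q < 2` the exponent `Q ∨ 2` gives the term `p / N`, which is at most `√(p / N)` because `p
≤ N`. -/
theorem width_rate_le {Q : ℝ} {n N : ℕ} (hN : 2 ≤ N) (hpN : n * Real.log N ≤ N) :
    √(n * Real.log N / N) + (n * Real.log N) ^ (max Q 2 / 2) / N ≤ 2 * rate Q n N := by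
  have hN0 : (0 : ℝ) < N := by
    have : 0 < N := by omega
    exact_mod_cast this
  have hlog : 0 ≤ Real.log N := Real.log_natCast_nonneg N
  rw [two_mul, rate]
  refine add_le_add (le_max_left _ _) ?_
  rcases le_total 2 Q with h | h
  · rw [max_eq_left h]; exact le_max_right _ _
  · rw [max_eq_right h, div_self two_ne_zero, Real.rpow_one]
    refine le_max_of_le_left (Real.le_sqrt_of_sq_le ?_)
    have h1 : n * Real.log N / N ≤ 1 := (div_le_one hN0).2 hpN
    have h0 : 0 ≤ n * Real.log N / N := by positivity
    nlinarith

end GoodSample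

/-! ### The estimate in whitened coordinates -/

section WhitenedMain

theorem exists_unit_vector {n : ℕ} (hn : 1 ≤ n) : ∃ u : EuclideanSpace ℝ (Fin n), ‖u‖ = 1 :=
  ⟨EuclideanSpace.single ⟨0, hn⟩ 1, by simp⟩

theorem exp_neg_mul_log {n N : ℕ} (hN : 1 ≤ N) :
    Real.exp (-(n * Real.log N)) = (N : ℝ) ^ (-(n : ℝ)) := by
  have hN0 : (0 : ℝ) < N := by exact_mod_cast hN
  rw [Real.rpow_def_of_pos hN0]
  congr 1
  ring

theorem rate_conditions {n N : ℕ} {R κ Q : ℝ} (hN : 2 ≤ N) (hR : 1 ≤ R) (hκ : 0 < κ)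
    (hκ1 : κ ≤ 1 / 2) (h1 : n * Real.log N * R ^ 2 ≤ κ ^ 2 * N)
    (h2 : (n * Real.log N) ^ (Q / 2) * R ≤ κ * N) :
    (√(n * Real.log N / N) + (n * Real.log N) ^ (Q / 2) / N) * R ≤ 2 * κ ∧
    √(n * Real.log N / N) + (n * Real.log N) ^ (Q / 2) / N ≤ 1 ∧ n * Real.log N ≤ N := by
  have hN0 : (0 : ℝ) < N := by
    have : 0 < N := by omega
    exact_mod_cast this
  have hlog : 0 ≤ Real.log N := Real.log_natCast_nonneg N
  set p := n * Real.log N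
  have hp : 0 ≤ p := by positivity
  have hR0 : 0 < R := by linarith
  have e1 : √(p / N) * R ≤ κ := by
    refine abs_le_of_sq_le_sq' ?_ hκ.le |>.2
    rw [mul_pow, Real.sq_sqrt (by positivity), div_mul_eq_mul_div, div_le_iff₀ hN0]
    exact h1
  have e2 : p ^ (Q / 2) / N * R ≤ κ := by
    rw [div_mul_eq_mul_div, div_le_iff₀ hN0]; exact h2
  have e3 : (√(p / N) + p ^ (Q / 2) / N) * R ≤ 2 * κ := by rw [add_mul]; linarith
  refine ⟨e3, ?_, ?_⟩
  · have : 0 ≤ √(p / N) + p ^ (Q / 2) / N := by positivity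
    nlinarith
  · have hR2 : 1 ≤ R ^ 2 := one_le_pow₀ hR
    have h3 : p * 1 ≤ p * R ^ 2 := by gcongr
    have h4 : κ ^ 2 * N ≤ 1 * N := by
      gcongr
      nlinarith
    linarith

set_option maxHeartbeats 1000000 in
/-- The main estimate in whitened coordinates. -/
theorem whitened_main {C c Q₁ Q₂ q₁ q₂ K : ℝ} (Cr : ℝ → ℝ) (hC : 0 < C) (hc : 0 < c)
    (hQ₁ : 1 < Q₁) (hQ₂ : 1 < Q₂) (hq₁ : 1 < q₁) (hq₂ : 1 < q₂) (hK : 0 ≤ K) :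
    ∃ C' : ℝ, 0 < C' ∧ ∃ C'' : ℝ → ℝ, (∀ δ, 0 ≤ C'' δ) ∧
      ∀ (Ω S : Type*) [MeasurableSpace Ω] [MeasurableSpace S] (μ : Measure Ω) (P : Measure S)
        [IsProbabilityMeasure μ] [IsProbabilityMeasure P] (n N : ℕ) (η τ : ℝ) (ρ : ℝ → ℝ)
        (ψ : Ω → EuclideanSpace ℝ (Fin n)) (a : S → Ω → ℝ) (b : EuclideanSpace ℝ (Fin n)),
        1 ≤ n → 1 ≤ N → WhitenedFeature c η τ μ ψ → PEN C c Q₁ Q₂ q₁ q₂ ρ →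
        (min Q₁ Q₂ < 2 → ∀ r : ℝ, -1 < r → r < 0 → ∀ v : EuclideanSpace ℝ (Fin n), ‖v‖ = 1 →
          ∫⁻ ω, (ENNReal.ofReal |inner ℝ v (ψ ω)|) ^ r ∂μ ≤ ENNReal.ofReal (Cr r * η ^ r)) →
        Measurable (Function.uncurry a) → (∀ᵐ x ∂P, HasSqExpMoment τ (a x) μ) →
        τ ^ max (max Q₁ Q₂) 2 / η ^ max (max q₁ q₂) 3 ≤ (n : ℝ) ^ K →
        C' * (τ ^ max (max Q₁ Q₂) 2 / η ^ max (max q₁ q₂) 3) ^ 2 * ((n : ℝ) * Real.log n) ≤ N →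
        C' * (τ ^ max (max Q₁ Q₂) 2 / η ^ max (max q₁ q₂) 3) *
          ((n : ℝ) * Real.log n) ^ max (max Q₁ Q₂ / 2) 1 ≤ N →
        ∃ θ, IsArgMax (fun θ => inner ℝ θ b - ∫ ω, conjugate ρ (inner ℝ (ψ ω) θ) ∂μ) θ ∧
          ∀ δ : ℝ, (0 < δ ∨ δ = 0 ∧ 2 ≤ min q₁ q₂) →
            (Measure.pi fun _ : Fin N => μ) {ω | ¬ ∃ θN,
              IsArgMax (empiricalDual ρ (fun j => ψ (ω j)) b) θN ∧
              ∫⁻ x, ENNReal.ofReal (((1 / (N : ℝ)) * ∑ j, a x (ω j) *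
                link ρ (inner ℝ (ψ (ω j)) θN) -
                ∫ ω, a x ω * link ρ (inner ℝ (ψ ω) θ) ∂μ) ^ 2) ∂P ≤
              ENNReal.ofReal ((boundFactor Q₁ Q₂ q₁ q₂ (C'' δ) δ τ η * rate (max Q₁ Q₂) n N *
                ‖b‖) ^ 2)} ≤
            ENNReal.ofReal (C' * (N : ℝ) ^ (-(n : ℝ))) := by
  set Q := max Q₁ Q₂
  set Qb := max Q 2
  have hQb : 2 ≤ Qb := le_max_right _ _
  obtain ⟨A₁, hA₁, hgrad⟩ := gradient_event hC hQ₁ hQ₂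
  obtain ⟨A₂, hA₂, hpred⟩ := predictor_event hC hQ₁ hQ₂
  obtain ⟨A₀, hA₀, hmom⟩ := moment_event hQb
  obtain ⟨A₄, hA₄, havg⟩ := avg_moment_event hQb
  obtain ⟨B, hB, hwt⟩ := weight_event hQ₁ hQ₂ Cr
  set A₃ := max A₀ 1
  have hA₃ : 1 ≤ A₃ := le_max_right _ _
  obtain ⟨κ₀, hκ₀, M, hM, hgood⟩ := good_sample_error hC hc hQ₁ hQ₂ hq₁ hq₂ hA₁ hA₂
    (by linarith : 0 < A₃) hA₄ hB
  set Mnet := 96 * A₃ / c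
  have hMnet : 0 < Mnet := by positivity
  -- The three bounds serve, in order, the condition `G < L`, the inequalities `r ≤ 1` and `p ≤ N`,
  -- and the cardinality of the small-ball net.
  set κ := min (κ₀ / 2) (min (1 / 2) (c / (8 * (2 * Mnet + 2))))
  have hκ : 0 < κ := lt_min (by positivity) (lt_min (by norm_num) (by positivity))
  have hκa : κ ≤ κ₀ / 2 := min_le_left _ _
  have hκb : κ ≤ 1 / 2 := (min_le_right _ _).trans (min_le_left _ _)
  have hκc : (2 * Mnet + 2) * κ ^ 2 ≤ c / 8 := by
    have h1 : κ ≤ c / (8 * (2 * Mnet + 2)) := (min_le_right _ _).trans (min_le_right _ _)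
    rw [le_div_iff₀ (by positivity)] at h1
    have h2 : κ ^ 2 ≤ κ := by nlinarith
    have h3 : (2 * Mnet + 2) * κ ^ 2 ≤ (2 * Mnet + 2) * κ := by gcongr
    linarith
  obtain ⟨C₀, hC₀, hrate⟩ := rate_small hK hQb hκ
  -- The constant must be a function of `δ` chosen before all data; at inadmissible `δ` it takes the
  -- default value `1`.
  have hlow : ∀ δ : ℝ, ∃ Bd : ℝ, 0 < Bd ∧ ((0 < δ ∨ δ = 0 ∧ 2 ≤ min q₁ q₂) →
      ∀ (Ω : Type _) [MeasurableSpace Ω] (μ : Measure Ω) [IsProbabilityMeasure μ]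
      (τ : ℝ) (X : Ω → ℝ), 1 ≤ τ → Measurable X → HasSqExpMoment τ X μ → ∫ ω, X ω ^ 2 ∂μ = 1 →
      1 ≤ Bd * τ ^ max (2 - min q₁ q₂ + δ) 0 *
        ∫ ω, |X ω| * min (|X ω| ^ (q₁ - 1)) (|X ω| ^ (q₂ - 1)) ∂μ) := by
    intro δ
    by_cases h : 0 < δ ∨ δ = 0 ∧ 2 ≤ min q₁ q₂
    · obtain ⟨Bd, h1, h2⟩ := one_le_mul_integral_min hq₁ hq₂ h
      exact ⟨Bd, h1, fun _ => h2⟩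
    · exact ⟨1, one_pos, fun h' => absurd h' h⟩
  choose Bd hBd hlow using hlow
  refine ⟨C₀ + (A₁ + (A₂ + (A₀ + (1 + (A₄ + 1))))), by positivity, fun δ => 2 * M * (Bd δ / c),
    fun δ => by have := hBd δ; positivity, ?_⟩
  intro Ω S _ _ μ P _ _ n N η τ ρ ψ a b hn hN hw hp hneg ha hexp hRK hN1 hN2
  obtain ⟨θ, hθ⟩ := hw.exists_isArgMax hp hC hc hQ₁ hQ₂ hq₁ hq₂ b
  refine ⟨θ, hθ, fun δ hδ => ?_⟩
  set C' := C₀ + (A₁ + (A₂ + (A₀ + (1 + (A₄ + 1)))))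
  have hC' : C₀ ≤ C' := le_add_of_nonneg_right (by positivity)
  have hη := hw.eta_pos
  have hη1 := hw.eta_le
  have hτ := hw.one_le_tau
  have hτ0 : 0 < τ := by linarith
  have hN0 : (0 : ℝ) < N := by exact_mod_cast hN
  set R := τ ^ Qb / η ^ max (max q₁ q₂) 3
  have hη3 : η ^ max (max q₁ q₂) 3 ≤ η :=
    (Real.rpow_le_rpow_of_exponent_ge hη hη1 (by
      linarith [le_max_right (max q₁ q₂) 3] : (1 : ℝ) ≤ max (max q₁ q₂) 3)).trans
      (le_of_eq (Real.rpow_one η))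
  have hτb : τ ≤ τ ^ Qb := le_trans (le_of_eq (Real.rpow_one τ).symm)
    (Real.rpow_le_rpow_of_exponent_le hτ (by linarith))
  have hRτ : τ / η ≤ R := by simp only [R]; gcongr
  have hR : 1 ≤ R := le_trans ((one_le_div hη).2 (hη1.trans hτ)) hRτ
  have hmax2 : max (Q / 2) 1 = Qb / 2 := by
    simp only [Qb]
    rcases le_total 2 Q with h | h
    · rw [max_eq_left h, max_eq_left (by linarith)]
    · rw [max_eq_right h, max_eq_right (by linarith), div_self two_ne_zero]
  rw [hmax2] at hN2
  have hnlog : 0 ≤ (n : ℝ) * Real.log n :=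
    mul_nonneg (Nat.cast_nonneg n) (Real.log_natCast_nonneg n)
  rcases hrate n N R hn hN hR hRK (le_trans (by gcongr) hN1) (le_trans (by gcongr) hN2) with
    ⟨h1, hNC⟩ | ⟨hN2', hr1, hr2⟩
  -- Here `n = 1` and `N ≤ C₀ ≤ C'`, so the claimed bound `C' N^{-n}` is at least `1`.
  · refine prob_le_one.trans ?_
    rw [← ENNReal.ofReal_one]
    refine ENNReal.ofReal_le_ofReal ?_
    rw [h1, Nat.cast_one, Real.rpow_neg_one, ← div_eq_mul_inv, le_div_iff₀ hN0]
    linarith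
  obtain ⟨hrR, hr1', hpN⟩ := rate_conditions hN2' hR hκ hκb hr1 hr2
  have hcard : (96 * A₃ * τ / (c * η)) ^ n * Real.exp (-(c / 8 * N)) ≤
      Real.exp (-(n * Real.log N)) := by
    refine net_card_le hn hN2' hMnet hR (by nlinarith) hκc hr1 (by positivity) ?_
    calc 96 * A₃ * τ / (c * η) = Mnet * (τ / η) := by simp only [Mnet]; field_simp
      _ ≤ Mnet * R := by gcongr
  have hp0 := half_le_mul_log hn hN2'
  set p := (n : ℝ) * Real.log N
  set r := √(p / N) + p ^ (Qb / 2) / N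
  have hpp : 0 < p := by linarith
  have ht : 0 < √(p / N) := Real.sqrt_pos.2 (by positivity)
  have htr : √(p / N) ≤ r := le_add_of_nonneg_right (by positivity)
  have hrκ : r * R ≤ κ₀ := by linarith
  set μN := Measure.pi fun _ : Fin N => μ
  set e := Real.exp (-p)
  have he : 0 ≤ e := (Real.exp_pos _).le
  rw [← exp_neg_mul_log hN]
  change _ ≤ ENNReal.ofReal (C' * e)
  set Emom := {ω : Fin N → Ω | ¬ ∀ v, ∑ j, |inner ℝ v (ψ (ω j))| ^ Qb ≤ N * (A₀ * τ * ‖v‖) ^ Qb}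
  have hEmom : μN Emom ≤ ENNReal.ofReal (A₀ * e) := hmom Ω μ n N c η τ ψ hn hN2' hw hr1'
  have hEmom' : ∀ ω ∉ Emom, ∀ v, ∑ j, |inner ℝ v (ψ (ω j))| ^ Qb ≤ N * (A₃ * τ * ‖v‖) ^ Qb := by
    intro ω hω v
    refine (not_not.1 hω v).trans ?_
    gcongr
    exact le_max_left _ _
  -- If `θ = 0`, stationarity gives `b = 0`. The empirical maximizer is then `0` as soon as the
  -- sampled features span, which the count in any one direction provides, and both predictors
  -- vanish.
  rcases eq_or_ne θ 0 with h0 | h0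
  · obtain ⟨u, hu⟩ := exists_unit_vector hn
    have hb : b = 0 := by
      have h1 := hw.stationary hp hC hQ₁ hQ₂ (b := b) (θ := θ) hθ.1 b
      rw [h0] at h1
      simp only [inner_zero_right, hp.link_zero, mul_zero, integral_zero] at h1
      exact inner_self_eq_zero.1 h1.symm
    have hcount := count_event (N := N) (p := p) hw hc hQb hA₃ hu hcard
    calc _ ≤ μN (Emom ∪ _) := measure_mono fun ω hω => ?_
      _ ≤ μN Emom + _ := measure_union_le _ _
      _ ≤ ENNReal.ofReal (A₀ * e) + ENNReal.ofReal e := add_le_add hEmom hcount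
      _ = ENNReal.ofReal ((A₀ + 1) * e) := by
          rw [← ENNReal.ofReal_add (by positivity) he]; congr 1; ring
      _ ≤ _ := by
          refine ENNReal.ofReal_le_ofReal (mul_le_mul_of_nonneg_right ?_ he)
          simp only [C']; linarith
    by_contra hcon
    rw [mem_union, not_or] at hcon
    refine hω ?_
    have hJ := hcon.2
    simp only [mem_ofPred_eq, not_and, not_not] at hJ
    obtain ⟨J, hJ1, hJ2⟩ := hJ (hEmom' ω hcon.1)
    have hspan : ∀ v, ‖v‖ = 1 → ∃ j, (inner ℝ v (ψ (ω j)) : ℝ) ≠ 0 := by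
      intro v hv
      have h1 : (0 : ℝ) < (J.filter fun j => η / 2 ≤ |inner ℝ v (ψ (ω j))|).card :=
        lt_of_lt_of_le (by positivity) (hJ2 v hv)
      obtain ⟨j, hj⟩ := Finset.card_pos.1 (by exact_mod_cast h1)
      refine ⟨j, fun h => ?_⟩
      rw [Finset.mem_filter, h, abs_zero] at hj
      linarith [hj.2]
    refine ⟨0, hb ▸ isArgMax_empiricalDual_zero hp hc hq₁ hq₂ hN hspan, ?_⟩
    simp only [h0, inner_zero_right, hp.link_zero, mul_zero, Finset.sum_const_zero, integral_zero,
      sub_zero, ne_eq, OfNat.ofNat_ne_zero, not_false_eq_true, zero_pow, ENNReal.ofReal_zero,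
      lintegral_const, zero_mul]
    exact zero_le
  -- The scale `α` and the direction `u` are determined by the population problem, so the events
  -- below concern a nonrandom direction.
  · set α := ‖θ‖
    have hα : 0 < α := norm_pos_iff.2 h0
    set u := (α⁻¹ : ℝ) • θ
    have hu : ‖u‖ = 1 := by
      simp only [u]; rw [norm_smul, norm_inv, Real.norm_eq_abs, abs_of_pos hα, inv_mul_cancel₀ hα.ne']
    have hθu : θ = α • u := by simp only [u]; rw [smul_smul, mul_inv_cancel₀ hα.ne', one_smul]
    have hin : ∀ ω, (inner ℝ (ψ ω) θ : ℝ) = α * inner ℝ u (ψ ω) := fun ω => by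
      rw [hθu, real_inner_smul_right, real_inner_comm]
    have hstat : ∀ v, ∫ ω, inner ℝ v (ψ ω) * link ρ (α * inner ℝ u (ψ ω)) ∂μ = inner ℝ v b :=
      fun v => by
        have := hw.stationary hp hC hQ₁ hQ₂ (b := b) (θ := θ) hθ.1 v
        simpa only [hin] using this
    have hσ : |link ρ α| ≤ Bd δ * τ ^ max (2 - min q₁ q₂ + δ) 0 / c * ‖b‖ := by
      refine hw.link_le hp hC hc hQ₁ hQ₂ hq₁ hq₂ (b := b) (u := u) hα hu
        (by have := hBd δ; positivity) (fun θ' => ?_)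
        (hlow δ hδ Ω μ τ _ hτ (hw.measurable_inner u) (hw.moment u hu) (hw.isotropic u hu))
      rw [← hθu]
      exact hθ.1 θ'
    have g1 := hgrad Ω μ n N c η τ q₁ q₂ ρ ψ b u α hn hN2' hw hp hu hα hstat
    have g2 := hpred Ω S μ P n N c η τ q₁ q₂ ρ ψ a u α hn hN2' hw hp ha hexp hu hα
    have g4 := count_event (N := N) (p := p) hw hc hQb hA₃ hu hcard
    have g5 := havg Ω S μ P n N τ a hn hN2' hτ ha hexp hr1'
    have g6 := hwt Ω S μ P n N c η τ ψ a u hn hN2' hw hneg ha hexp hu hpN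
    have hsum : ENNReal.ofReal (A₁ * e) + (ENNReal.ofReal (A₂ * e) + (ENNReal.ofReal (A₀ * e) +
        (ENNReal.ofReal e + (ENNReal.ofReal (A₄ * e) + ENNReal.ofReal e)))) ≤
        ENNReal.ofReal (C' * e) := by
      rw [← ENNReal.ofReal_add (by positivity) (by positivity),
        ← ENNReal.ofReal_add (by positivity) (by positivity),
        ← ENNReal.ofReal_add (by positivity) (by positivity),
        ← ENNReal.ofReal_add (by positivity) (by positivity),
        ← ENNReal.ofReal_add (by positivity) (by positivity)]
      refine ENNReal.ofReal_le_ofReal ?_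
      simp only [C']
      have : 0 ≤ C₀ * e := by positivity
      linarith
    refine le_trans ?_ hsum
    refine le_trans ?_ (add_le_add g1 (add_le_add g2 (add_le_add hEmom (add_le_add g4
      (add_le_add g5 g6)))))
    refine le_trans ?_ (add_le_add le_rfl (add_le_add le_rfl (add_le_add le_rfl (add_le_add le_rfl
      (measure_union_le _ _)))))
    refine le_trans ?_ (add_le_add le_rfl (add_le_add le_rfl (add_le_add le_rfl
      (measure_union_le _ _))))
    refine le_trans ?_ (add_le_add le_rfl (add_le_add le_rfl (measure_union_le _ _)))
    refine le_trans ?_ (add_le_add le_rfl (measure_union_le _ _))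
    refine le_trans ?_ (measure_union_le _ _)
    refine measure_mono fun ω hω => ?_
    by_contra hcon
    simp only [mem_union, not_or] at hcon
    obtain ⟨k1, k2, k3, k4, k5, k6⟩ := hcon
    refine hω ?_
    obtain ⟨g, hgG, hg⟩ := not_not.1 k1
    have k4' := k4
    simp only [mem_ofPred_eq, not_and, not_not] at k4'
    obtain ⟨J, hJ1, hJ2⟩ := k4' (hEmom' ω k3)
    have hlm : Measurable (link ρ) := hp.monotone.measurable
    have hf : Measurable fun x => ∫ ω, a x ω * link ρ (α * inner ℝ u (ψ ω)) ∂μ := by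
      have h1 : Measurable fun z : S × Ω => a z.1 z.2 * link ρ (α * inner ℝ u (ψ z.2)) :=
        ha.mul ((hlm.comp ((hw.measurable_inner u).const_mul α)).comp measurable_snd)
      exact (h1.stronglyMeasurable.integral_prod_right').measurable
    obtain ⟨θN, hθN, hle⟩ := hgood S P n N η τ (√(p / N)) r ρ (fun j => ψ (ω j))
      (fun x j => a x (ω j)) _ b u g α J hN hη hη1 hτ hp (fun j => ha.of_uncurry_right) hf hu hα ht
      htr hrκ hJ1 hJ2 hg hgG (not_lt.1 k2) (hEmom' ω k3) (not_lt.1 k5) (not_lt.1 k6)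
    refine ⟨θN, hθN, ?_⟩
    simp only [hin]
    refine hle.trans (ENNReal.ofReal_le_ofReal ?_)
    have hrr : r ≤ 2 * rate Q n N := width_rate_le hN2' hpN
    have hBδ := hBd δ
    have hY := one_le_scale (Q₁ := Q₁) (Q₂ := Q₂) hτ hη hη1
    refine pow_le_pow_left₀ (by positivity) ?_ 2
    rw [boundFactor]
    set Y := max (τ ^ (max Q₁ Q₂ - 2)) (η ^ (min Q₁ Q₂ - 2))
    have hsplit : τ ^ (max Q₁ Q₂ + 2 + max (2 - min q₁ q₂ + δ) 0) =
        τ ^ (max Q₁ Q₂ + 2) * τ ^ max (2 - min q₁ q₂ + δ) 0 := Real.rpow_add hτ0 _ _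
    rw [hsplit]
    calc M * |link ρ α| * (τ ^ (max Q₁ Q₂ + 2) / η ^ max (max q₁ q₂) 3 * Y) * r
        ≤ M * (Bd δ * τ ^ max (2 - min q₁ q₂ + δ) 0 / c * ‖b‖) *
          (τ ^ (max Q₁ Q₂ + 2) / η ^ max (max q₁ q₂) 3 * Y) * (2 * rate Q n N) := by gcongr
      _ = _ := by ring

end WhitenedMain

/-! ### The spectral inverse square root -/

section InverseSquareRoot

variable {n : ℕ}

theorem isHermitian_cfc_invSqrt (K : Matrix (Fin n) (Fin n) ℝ) :
    (cfc (fun t : ℝ => t ^ (-(1 / 2) : ℝ)) K).IsHermitian :=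
  cfc_predicate (p := IsSelfAdjoint) (fun t : ℝ => t ^ (-(1 / 2) : ℝ)) K

theorem inner_invSqrt_left (K : Matrix (Fin n) (Fin n) ℝ) (u v : EuclideanSpace ℝ (Fin n)) :
    inner ℝ (invSqrt K u) v = (inner ℝ u (invSqrt K v) : ℝ) := by
  have h := Matrix.toEuclideanLin_conjTranspose_eq_adjoint
    (cfc (fun t : ℝ => t ^ (-(1 / 2) : ℝ)) K)
  rw [(isHermitian_cfc_invSqrt K).eq] at h
  unfold invSqrt
  conv_lhs => rw [h]
  exact LinearMap.adjoint_inner_left _ _ _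

/-- On the spectrum the identity reads `f (f t f) = f` for `f(t) = t^{-1/2}`. It persists at `t = 0`
because the real power takes the value `0` there, so invertibility of `K` is not needed. -/
theorem cfc_invSqrt_mul {K : Matrix (Fin n) (Fin n) ℝ} (hK : K.PosSemidef) :
    cfc (fun t : ℝ => t ^ (-(1 / 2) : ℝ)) K * (cfc (fun t : ℝ => t ^ (-(1 / 2) : ℝ)) K * K *
      cfc (fun t : ℝ => t ^ (-(1 / 2) : ℝ)) K) = cfc (fun t : ℝ => t ^ (-(1 / 2) : ℝ)) K := by
  set f : ℝ → ℝ := fun t => t ^ (-(1 / 2) : ℝ)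
  have hcont : ∀ g : ℝ → ℝ, ContinuousOn g (spectrum ℝ K) :=
    fun g => Matrix.finite_real_spectrum.continuousOn g
  have hsa : IsSelfAdjoint K := hK.isHermitian
  have hspec : ∀ t ∈ spectrum ℝ K, 0 ≤ t :=
    (Matrix.posSemidef_iff_isHermitian_and_spectrum_nonneg.1 hK).2
  have hid : cfc (fun t : ℝ => t) K = K := cfc_id' ℝ K hsa
  calc cfc f K * (cfc f K * K * cfc f K)
      = cfc f K * (cfc f K * cfc (fun t : ℝ => t) K * cfc f K) := by rw [hid]
    _ = cfc (fun t => f t * (f t * t * f t)) K := by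
        rw [← cfc_mul f (fun t => t) K (hcont _) (hcont _),
          ← cfc_mul (fun t => f t * t) f K (hcont _) (hcont _),
          ← cfc_mul f (fun t => f t * t * f t) K (hcont _) (hcont _)]
    _ = cfc f K := by
        refine cfc_congr fun t ht => ?_
        rcases (hspec t ht).eq_or_lt with h | h
        · simp only [f, ← h]
          rw [Real.zero_rpow (by norm_num)]
          simp
        · simp only [f]
          have h1 : t ^ (-(1 / 2) : ℝ) * t * t ^ (-(1 / 2) : ℝ) = 1 := by
            have h2 : t ^ (-(1 / 2) : ℝ) * t ^ (-(1 / 2) : ℝ) = t⁻¹ := by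
              rw [← Real.rpow_add h, ← Real.rpow_neg_one]; norm_num
            rw [mul_right_comm, h2, inv_mul_cancel₀ h.ne']
          rw [h1, mul_one]

/-- If `K^{-1/2}` is injective, it whitens `K`. -/
theorem invSqrt_whitens {K : Matrix (Fin n) (Fin n) ℝ} (hK : K.PosSemidef)
    (hinj : Function.Injective (invSqrt K)) (v : EuclideanSpace ℝ (Fin n)) :
    inner ℝ (invSqrt K v) (Matrix.toEuclideanLin K (invSqrt K v)) = ‖v‖ ^ 2 := by
  have h1 : invSqrt K (invSqrt K (Matrix.toEuclideanLin K (invSqrt K v))) = invSqrt K v := by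
    have h2 := cfc_invSqrt_mul hK
    have h3 := congrArg (fun A => A.mulVec v.ofLp) h2
    simp only [← Matrix.mulVec_mulVec] at h3
    apply (WithLp.ofLp_injective 2)
    simpa [invSqrt, Matrix.toLpLin_apply, ← Matrix.mulVec_mulVec] using h3
  rw [inner_invSqrt_left, hinj h1, real_inner_self_eq_norm_sq]

end InverseSquareRoot

/-! ### From the original problem to whitened coordinates -/

section Transfer

variable {V : Type*} {Z : Type*} [MeasurableSpace V] [MeasurableSpace Z] {d n N : ℕ}
  {μ : Measure V} {ν : Measure Z} {φ : EuclideanSpace ℝ (Fin d) → V → Z → ℝ}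
  {x : Fin n → EuclideanSpace ℝ (Fin d)}

instance isProbabilityMeasure_featureLaw [IsProbabilityMeasure μ] [IsProbabilityMeasure ν] :
    IsProbabilityMeasure (featureLaw μ ν n) := by
  unfold featureLaw; infer_instance

theorem measurable_featureVec (hr : Regular μ ν φ x) : Measurable (featureVec φ x) := by
  have h : Measurable fun p : V × (Fin n → Z) => fun i => φ (x i) p.1 (p.2 i) :=
    measurable_pi_lambda _ fun i => (hr.measurable (x i)).comp
      (measurable_fst.prodMk ((measurable_pi_apply i).comp measurable_snd))
  exact (WithLp.measurable_toLp 2 (Fin n → ℝ)).comp h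

theorem measurable_whitened (hr : Regular μ ν φ x) : Measurable (whitened μ ν φ x) :=
  (LinearMap.continuous_of_finiteDimensional
    (invSqrt (kernelMatrix μ ν φ x))).measurable.comp (measurable_featureVec hr)

theorem inner_featureVec_sq_integral (hr : Regular μ ν φ x) (v : EuclideanSpace ℝ (Fin n)) :
    inner ℝ v (Matrix.toEuclideanLin (kernelMatrix μ ν φ x) v) =
      ∫ p, (inner ℝ v (featureVec φ x p) : ℝ) ^ 2 ∂(featureLaw μ ν n) := by
  have hint : ∀ i j, Integrable (fun p => featureVec φ x p i * featureVec φ x p j)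
      (featureLaw μ ν n) := fun i j => (hr.sqIntegrable i).integrable_mul (hr.sqIntegrable j)
  have h1 : ∀ p, (inner ℝ v (featureVec φ x p) : ℝ) ^ 2 =
      ∑ i, ∑ j, v i * v j * (featureVec φ x p i * featureVec φ x p j) := by
    intro p
    rw [sq, PiLp.inner_apply, Finset.sum_mul_sum]
    refine Finset.sum_congr rfl fun i _ => Finset.sum_congr rfl fun j _ => ?_
    simp only [RCLike.inner_apply, conj_trivial]
    ring
  simp only [h1]
  rw [integral_finsetSum _ fun i _ => integrable_finsetSum _ fun j _ => (hint i j).const_mul _]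
  rw [PiLp.inner_apply]
  refine Finset.sum_congr rfl fun i _ => ?_
  rw [integral_finsetSum _ fun j _ => (hint i j).const_mul _]
  simp only [RCLike.inner_apply, conj_trivial, Matrix.toLpLin_apply, Matrix.mulVec, dotProduct]
  rw [Finset.sum_mul]
  refine Finset.sum_congr rfl fun j _ => ?_
  rw [integral_const_mul, kernelMatrix, Matrix.of_apply]
  ring

theorem posSemidef_kernelMatrix (hr : Regular μ ν φ x) : (kernelMatrix μ ν φ x).PosSemidef := by
  refine Matrix.PosSemidef.of_dotProduct_mulVec_nonneg ?_ fun v => ?_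
  · ext i j
    simp only [kernelMatrix, Matrix.conjTranspose_apply, Matrix.of_apply, star_trivial, mul_comm]
  · have h := inner_featureVec_sq_integral hr (WithLp.toLp 2 v)
    have h2 : star v ⬝ᵥ (kernelMatrix μ ν φ x).mulVec v = inner ℝ (WithLp.toLp 2 v)
        (Matrix.toEuclideanLin (kernelMatrix μ ν φ x) (WithLp.toLp 2 v)) := by
      simp only [dotProduct, PiLp.inner_apply, RCLike.inner_apply, conj_trivial, star_trivial,
        Matrix.toLpLin_apply]
      exact Finset.sum_congr rfl fun i _ => mul_comm _ _
    rw [h2, h]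
    exact integral_nonneg fun p => sq_nonneg _

/-- If `K^{-1/2} v = 0`, then by symmetry `⟨v, ψ⟩ = ⟨K^{-1/2} v, φ_n⟩` vanishes identically, against
the small ball property. Nondegeneracy of the kernel matrix is thus a consequence, not an
assumption. -/
theorem injective_invSqrt [IsProbabilityMeasure μ] [IsProbabilityMeasure ν] {C c η : ℝ}
    (hη : 0 < η) (hc : 0 < c) (h3 : FEAT3 C c η μ ν φ x) :
    Function.Injective (invSqrt (kernelMatrix μ ν φ x)) := by
  rw [← LinearMap.ker_eq_bot, LinearMap.ker_eq_bot']
  intro v hv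
  by_contra hne
  have hu : ‖(‖v‖⁻¹ : ℝ) • v‖ = 1 := by simp [norm_smul, hne]
  have h := h3.smallBall _ _ hu hu
  have hempty : {p | η ≤ |inner ℝ ((‖v‖⁻¹ : ℝ) • v) (whitened μ ν φ x p)| ∧
      η ≤ |inner ℝ ((‖v‖⁻¹ : ℝ) • v) (whitened μ ν φ x p)|} = ∅ := by
    ext p
    simp only [mem_ofPred_eq, mem_empty_iff_false, iff_false, not_and, not_le]
    rw [real_inner_smul_left, whitened, ← inner_invSqrt_left, hv, inner_zero_left, mul_zero,
      abs_zero]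
    exact fun _ => hη
  rw [hempty, measureReal_empty] at h
  linarith

theorem whitenedFeature_of_features [IsProbabilityMeasure μ] [IsProbabilityMeasure ν]
    {C c r₀ η τ : ℝ} (hc : 0 < c) (hη : 0 < η) (hr : Regular μ ν φ x)
    (h1 : FEAT1 C r₀ τ μ ν φ x) (h3 : FEAT3 C c η μ ν φ x) :
    WhitenedFeature c η τ (featureLaw μ ν n) (whitened μ ν φ x) where
  measurable := measurable_whitened hr
  one_le_tau := h1.one_le
  eta_pos := hη
  eta_le := h3.le_one
  moment v hv := by
    have hm := measurable_whitened hr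
    refine hasSqExpMoment_of_subgaussian (by linarith [h1.one_le]) (by fun_prop) fun t => ?_
    have := h1.vec (t • v)
    rw [norm_smul, hv, mul_one, Real.norm_eq_abs, sq_abs] at this
    simpa only [real_inner_smul_left] using this
  isotropic v hv := by
    have h := invSqrt_whitens (posSemidef_kernelMatrix hr) (injective_invSqrt hη hc h3) v
    rw [inner_featureVec_sq_integral hr, hv, one_pow] at h
    rw [← h]
    simp only [whitened, inner_invSqrt_left]
  smallBall := h3.smallBall

theorem measurable_avgFeature [SFinite ν] (hr : Regular μ ν φ x) (u : EuclideanSpace ℝ (Fin d)) :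
    Measurable (avgFeature ν φ u) :=
  ((hr.measurable u).stronglyMeasurable.integral_prod_right').measurable

/-- The average feature is continuous in the covariate by the Lipschitz condition and measurable in
the weight, hence jointly measurable. Integrals over `P` and over the sample can then be exchanged.
-/
theorem measurable_uncurry_avgFeature [SFinite ν] {C τ : ℝ} (hr : Regular μ ν φ x)
    (h2 : FEAT2 C τ μ ν φ) :
    Measurable (Function.uncurry fun (u : EuclideanSpace ℝ (Fin d)) (p : V × (Fin n → Z)) =>
      avgFeature ν φ u p.1) := by
  obtain ⟨L, -, hL, -⟩ := h2
  refine measurable_uncurry_of_continuous_of_measurable (fun p => ?_) fun u =>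
    (measurable_avgFeature hr u).comp measurable_fst
  refine (LipschitzWith.of_dist_le_mul (K := (L p.1).toNNReal) fun u u' => ?_).continuous
  rw [Real.dist_eq, dist_eq_norm]
  exact (hL p.1 u u').trans (mul_le_mul_of_nonneg_right (Real.le_coe_toNNReal _) (norm_nonneg _))

theorem hasSqExpMoment_avgFeature [IsProbabilityMeasure μ] [IsProbabilityMeasure ν] {τ : ℝ}
    (hτ : 0 < τ) (hr : Regular μ ν φ x) {u : EuclideanSpace ℝ (Fin d)}
    (h : IsSubgaussian (τ ^ 2) (fun w => avgFeature ν φ u w) μ) :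
    HasSqExpMoment τ (fun p : V × (Fin n → Z) => avgFeature ν φ u p.1) (featureLaw μ ν n) := by
  have hm := measurable_avgFeature hr u
  have h1 : HasSqExpMoment τ (avgFeature ν φ u) μ := by
    refine hasSqExpMoment_of_subgaussian hτ hm fun t => ?_
    have := h t
    simpa [mul_comm] using this
  have hmp : MeasurePreserving Prod.fst (featureLaw μ ν n) μ := measurePreserving_fst
  have hs : AEStronglyMeasurable (fun w => Real.exp (avgFeature ν φ u w ^ 2 / (4 * τ ^ 2))) μ :=
    h1.1.aestronglyMeasurable
  refine ⟨hmp.integrable_comp_of_integrable h1.1, ?_⟩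
  have h2 := integral_map hmp.measurable.aemeasurable (by rw [hmp.map_eq]; exact hs)
  rw [hmp.map_eq] at h2
  rw [← h2]
  exact h1.2

theorem IsArgMax.of_bijective {α β : Type*} {F : β → ℝ} {T : α → β} (hT : Function.Bijective T)
    {a : α} (h : IsArgMax (fun a => F (T a)) a) : IsArgMax F (T a) := by
  refine ⟨fun b => ?_, fun b hb => ?_⟩
  · obtain ⟨a', rfl⟩ := hT.2 b
    exact h.1 a'
  · obtain ⟨a', rfl⟩ := hT.2 b
    rw [h.2 a' fun a'' => hb (T a'')]

theorem bijective_invSqrt [IsProbabilityMeasure μ] [IsProbabilityMeasure ν] {C c η : ℝ}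
    (hη : 0 < η) (hc : 0 < c) (h3 : FEAT3 C c η μ ν φ x) :
    Function.Bijective (invSqrt (kernelMatrix μ ν φ x)) :=
  ⟨injective_invSqrt hη hc h3, LinearMap.injective_iff_surjective.1 (injective_invSqrt hη hc h3)⟩

theorem inner_featureVec_invSqrt (p : V × (Fin n → Z)) (θ : EuclideanSpace ℝ (Fin n)) :
    inner ℝ (featureVec φ x p) (invSqrt (kernelMatrix μ ν φ x) θ) =
      (inner ℝ (whitened μ ν φ x p) θ : ℝ) := (inner_invSqrt_left _ _ _).symm

theorem dualFin_invSqrt (ρ : ℝ → ℝ) (y θ : EuclideanSpace ℝ (Fin n))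
    (ω : Fin N → V × (Fin n → Z)) :
    dualFin ρ φ x y ω (invSqrt (kernelMatrix μ ν φ x) θ) =
      empiricalDual ρ (fun j => whitened μ ν φ x (ω j))
        (invSqrt (kernelMatrix μ ν φ x) y) θ := by
  simp only [dualFin, empiricalDual, inner_featureVec_invSqrt, inner_invSqrt_left]

variable [IsProbabilityMeasure μ] [IsProbabilityMeasure ν] {C c η τ Q₁ Q₂ q₁ q₂ : ℝ} {ρ : ℝ → ℝ}

/-- The iterated integral equals the integral over the product law because the growth of `ρ*` is
polynomial and `ψ` is sub-Gaussian, so Fubini applies. -/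
theorem dualInf_invSqrt (hw : WhitenedFeature c η τ (featureLaw μ ν n) (whitened μ ν φ x))
    (hp : PEN C c Q₁ Q₂ q₁ q₂ ρ) (hC : 0 < C) (hQ₁ : 1 < Q₁) (hQ₂ : 1 < Q₂)
    (y θ : EuclideanSpace ℝ (Fin n)) :
    dualInf ρ μ ν φ x y (invSqrt (kernelMatrix μ ν φ x) θ) =
      inner ℝ θ (invSqrt (kernelMatrix μ ν φ x) y) -
        ∫ p, conjugate ρ (inner ℝ (whitened μ ν φ x p) θ) ∂(featureLaw μ ν n) := by
  have hi := hw.integrable_conjugate hp hC hQ₁ hQ₂ θ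
  unfold featureLaw at hi
  have h1 := integral_prod _ hi
  simp only [dualInf, inner_featureVec_invSqrt, inner_invSqrt_left, featureLaw, h1]

theorem integrable_mul_link {Ω : Type*} [MeasurableSpace Ω] {P : Measure Ω} [IsProbabilityMeasure P]
    {ψ : Ω → EuclideanSpace ℝ (Fin n)} (hw : WhitenedFeature c η τ P ψ)
    (hp : PEN C c Q₁ Q₂ q₁ q₂ ρ) (hC : 0 < C) (hQ₁ : 1 < Q₁) (hQ₂ : 1 < Q₂) {a : Ω → ℝ}
    (ha : Measurable a) (hexp : HasSqExpMoment τ a P) (θ : EuclideanSpace ℝ (Fin n)) :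
    Integrable (fun ω => a ω * link ρ (inner ℝ (ψ ω) θ)) P := by
  have hQ : 1 < max Q₁ Q₂ := lt_max_of_lt_left hQ₁
  have hτ0 : 0 < τ := by linarith [hw.one_le_tau]
  have hm := hw.measurable
  have i1 := hexp.integrable_rpow hτ0 ha 1 2 zero_le_one zero_le_two
  have i2 := (hw.integrable_rpow θ (a := (max Q₁ Q₂ - 1) * 2) (by linarith) zero_le_one).const_mul
    ((C * |link ρ 1|) ^ 2)
  refine (i1.add i2).mono' (ha.mul (hp.monotone.measurable.comp
    (by fun_prop))).aestronglyMeasurable (ae_of_all _ fun ω => ?_)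
  have h1 := hp.abs_link_le_rpow hC hQ₁ hQ₂ one_pos (inner ℝ (ψ ω) θ)
  rw [one_mul] at h1
  rw [Real.norm_eq_abs, abs_mul, Pi.add_apply, one_mul, one_mul, Real.rpow_mul (by positivity),
    Real.rpow_two, Real.rpow_two, ← mul_pow, real_inner_comm (ψ ω) θ]
  set s := |link ρ (inner ℝ (ψ ω) θ)|
  have hs : 0 ≤ s := abs_nonneg _
  have h2 : s ^ 2 ≤ (C * |link ρ 1| * (1 + |(inner ℝ (ψ ω) θ : ℝ)|) ^ (max Q₁ Q₂ - 1)) ^ 2 :=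
    pow_le_pow_left₀ hs h1 2
  have h3 := abs_nonneg (a ω)
  nlinarith [sq_nonneg (|a ω| - s)]

theorem predictorInf_invSqrt
    (hw : WhitenedFeature c η τ (featureLaw μ ν n) (whitened μ ν φ x))
    (hp : PEN C c Q₁ Q₂ q₁ q₂ ρ) (hC : 0 < C) (hQ₁ : 1 < Q₁) (hQ₂ : 1 < Q₂)
    (hr : Regular μ ν φ x) {u : EuclideanSpace ℝ (Fin d)}
    (hexp : HasSqExpMoment τ (fun p : V × (Fin n → Z) => avgFeature ν φ u p.1) (featureLaw μ ν n))
    (θ : EuclideanSpace ℝ (Fin n)) :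
    predictorInf ρ μ ν φ x (invSqrt (kernelMatrix μ ν φ x) θ) u =
      ∫ p, avgFeature ν φ u p.1 * link ρ (inner ℝ (whitened μ ν φ x p) θ) ∂(featureLaw μ ν n) := by
  have hi := integrable_mul_link hw hp hC hQ₁ hQ₂
    ((measurable_avgFeature hr u).comp measurable_fst) hexp θ
  unfold featureLaw at hi
  have h1 := integral_prod _ hi
  simp only [Function.comp_apply, integral_const_mul] at h1
  simp only [predictorInf, inner_featureVec_invSqrt, featureLaw, h1]

theorem eLpNorm_two_le_of_lintegral {S : Type*} [MeasurableSpace S] {P : Measure S} {f : S → ℝ}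
    {B : ℝ} (hB : 0 ≤ B)
    (h : ∫⁻ x, ENNReal.ofReal (f x ^ 2) ∂P ≤ ENNReal.ofReal (B ^ 2)) :
    eLpNorm f 2 P ≤ ENNReal.ofReal B := by
  rw [eLpNorm_eq_lintegral_rpow_enorm_toReal two_ne_zero ENNReal.ofNat_ne_top]
  simp only [ENNReal.toReal_ofNat]
  have h1 : ∀ x, ‖f x‖ₑ ^ (2 : ℝ) = ENNReal.ofReal (f x ^ 2) := fun x => by
    rw [← ofReal_norm, ENNReal.ofReal_rpow_of_nonneg (norm_nonneg _) zero_le_two,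
      Real.rpow_two, Real.norm_eq_abs, sq_abs]
  simp only [h1]
  calc (∫⁻ x, ENNReal.ofReal (f x ^ 2) ∂P) ^ (1 / 2 : ℝ)
      ≤ ENNReal.ofReal (B ^ 2) ^ (1 / 2 : ℝ) := by gcongr
    _ = ENNReal.ofReal B := by
        rw [ENNReal.ofReal_rpow_of_nonneg (sq_nonneg B) (by norm_num), ← Real.sqrt_eq_rpow,
          Real.sqrt_sq hB]

end Transfer

/-- A polynomial bound in `n` on the ratio is what lets `rate_small` trade `log n` for `log N`. -/
theorem signal_ratio_le {n : ℕ} {C η τ Q q : ℝ} (hn : 1 ≤ n) (hτ : 1 ≤ τ)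
    (hτn : τ ≤ (n : ℝ) ^ C) (hη : (n : ℝ) ^ (-C) ≤ η) (hQ : 0 ≤ Q) (hq : 0 ≤ q) :
    τ ^ Q / η ^ q ≤ (n : ℝ) ^ (C * (Q + q)) := by
  have hn0 : (0 : ℝ) < n := by exact_mod_cast hn
  have hp : 0 < (n : ℝ) ^ (-C) := by positivity
  calc τ ^ Q / η ^ q ≤ ((n : ℝ) ^ C) ^ Q / ((n : ℝ) ^ (-C)) ^ q := by gcongr
    _ = _ := by
        rw [← Real.rpow_mul hn0.le, ← Real.rpow_mul hn0.le, ← Real.rpow_sub hn0]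
        congr 1
        ring

end RandomFeatures

/-! ### Conclusion in the original coordinates -/

theorem theorem1 (C c r₀ Q₁ Q₂ q₁ q₂ : ℝ) (Cr : ℝ → ℝ)
    (hC : 0 < C) (hc : 0 < c) (hr₀ : 0 < r₀)
    (hQ₁ : 1 < Q₁) (hQ₂ : 1 < Q₂) (hq₁ : 1 < q₁) (hq₂ : 1 < q₂) :
    -- the constants depend only on the parameters above
    ∃ C' : ℝ, 0 < C' ∧ ∃ c' : ℝ, 0 < c' ∧ ∃ C'' : ℝ → ℝ,
      ∀ (V : Type*) (Z : Type*) [MeasurableSpace V] [MeasurableSpace Z]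
        (μ : Measure V) (ν : Measure Z) [IsProbabilityMeasure μ] [IsProbabilityMeasure ν]
        (d n N : ℕ) (φ : EuclideanSpace ℝ (Fin d) → V → Z → ℝ)
        (x : Fin n → EuclideanSpace ℝ (Fin d)) (y : EuclideanSpace ℝ (Fin n))
        (ρ : ℝ → ℝ) (τ η : ℝ)
        (P : Measure (EuclideanSpace ℝ (Fin d))) [IsProbabilityMeasure P],
        1 ≤ n → 1 ≤ N →
        (∀ i, ‖x i‖ ≤ r₀ * √d) →
        P (Metric.closedBall 0 (r₀ * √d))ᶜ = 0 →
        RandomFeatures.Regular μ ν φ x →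
        RandomFeatures.FEAT1 C r₀ τ μ ν φ x →
        RandomFeatures.FEAT2 C τ μ ν φ →
        RandomFeatures.FEAT3 C c η μ ν φ x →
        RandomFeatures.PEN C c Q₁ Q₂ q₁ q₂ ρ →
        (min Q₁ Q₂ < 2 → RandomFeatures.FEAT3' Cr η μ ν φ x) →
        C' * (τ ^ max (max Q₁ Q₂) 2 / η ^ max (max q₁ q₂) 3) ^ 2 * ((n : ℝ) * Real.log n) ≤ (N : ℝ) →
        C' * (τ ^ max (max Q₁ Q₂) 2 / η ^ max (max q₁ q₂) 3) *
          ((n : ℝ) * Real.log n) ^ max (max Q₁ Q₂ / 2) 1 ≤ N →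
        c' * (d : ℝ) ≤ (n : ℝ) →
        ∃ lamHat : EuclideanSpace ℝ (Fin n),
          RandomFeatures.IsArgMax (RandomFeatures.dualInf ρ μ ν φ x y) lamHat ∧
          ∀ δ : ℝ, (0 < δ ∨ (δ = 0 ∧ q₁ = q₂ ∧ 2 ≤ q₁)) →
            -- the exceptional event has probability at most `C' N^{-c' n}`
            RandomFeatures.sampleLaw μ ν n N
              {ω | ¬ ∃ lamN : EuclideanSpace ℝ (Fin n),
                RandomFeatures.IsArgMax (RandomFeatures.dualFin ρ φ x y ω) lamN ∧
                eLpNorm (fun u => RandomFeatures.predictorFin ρ ν φ x ω lamN u -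
                    RandomFeatures.predictorInf ρ μ ν φ x lamHat u) 2 P ≤
                  ENNReal.ofReal
                    (RandomFeatures.boundFactor Q₁ Q₂ q₁ q₂ (C'' δ) δ τ η *
                      RandomFeatures.rate (max Q₁ Q₂) n N *
                      ‖RandomFeatures.invSqrt (RandomFeatures.kernelMatrix μ ν φ x) y‖)} ≤
              ENNReal.ofReal (C' * (N : ℝ) ^ (-(c' * (n : ℝ)))) := by
  have hK : 0 ≤ C * (max (max Q₁ Q₂) 2 + max (max q₁ q₂) 3) := by positivity
  obtain ⟨C', hC', C'', hC'', hmain⟩ := RandomFeatures.whitened_main Cr hC hc hQ₁ hQ₂ hq₁ hq₂ hK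
  -- The value `c' = 1` is possible because every exceptional event above has probability of order
  -- `exp(-n log N)`.
  refine ⟨C', hC', 1, one_pos, C'', ?_⟩
  intro V Z _ _ μ ν _ _ d n N φ x y ρ τ η P _ hn hN _ hP hr h1 h2 h3 hp h3' hN1 hN2 _
  have hn0 : (0 : ℝ) < n := by exact_mod_cast hn
  have hη : 0 < η := lt_of_lt_of_le (by positivity) h3.pow_le
  have hτ0 : 0 < τ := by linarith [h1.one_le]
  have hw := RandomFeatures.whitenedFeature_of_features hc hη hr h1 h3
  have hbij := RandomFeatures.bijective_invSqrt hη hc h3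
  have hexp : ∀ᵐ u ∂P, RandomFeatures.HasSqExpMoment τ
      (fun p : V × (Fin n → Z) => RandomFeatures.avgFeature ν φ u p.1)
      (RandomFeatures.featureLaw μ ν n) := by
    have hball : ∀ᵐ u ∂P, u ∈ Metric.closedBall (0 : EuclideanSpace ℝ (Fin d)) (r₀ * √d) := by
      rw [ae_iff]; exact hP
    filter_upwards [hball] with u hu
    exact RandomFeatures.hasSqExpMoment_avgFeature hτ0 hr
      (h1.avg u (mem_closedBall_zero_iff.1 hu))
  obtain ⟨θ, hθ, hprob⟩ := hmain (V × (Fin n → Z)) (EuclideanSpace ℝ (Fin d))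
    (RandomFeatures.featureLaw μ ν n) P n N η τ ρ (RandomFeatures.whitened μ ν φ x)
    (fun u p => RandomFeatures.avgFeature ν φ u p.1)
    (RandomFeatures.invSqrt (RandomFeatures.kernelMatrix μ ν φ x) y) hn hN hw hp h3'
    (RandomFeatures.measurable_uncurry_avgFeature hr h2) hexp
    (RandomFeatures.signal_ratio_le hn h1.one_le h1.le_pow h3.pow_le (by positivity)
      (by positivity)) hN1 hN2
  refine ⟨RandomFeatures.invSqrt (RandomFeatures.kernelMatrix μ ν φ x) θ, ?_, fun δ hδ => ?_⟩
  · refine RandomFeatures.IsArgMax.of_bijective hbij ?_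
    simpa only [RandomFeatures.dualInf_invSqrt hw hp hC hQ₁ hQ₂] using hθ
  · rw [one_mul]
    have hδ' : 0 < δ ∨ δ = 0 ∧ 2 ≤ min q₁ q₂ :=
      hδ.imp_right fun ⟨h0, heq, h2⟩ => ⟨h0, le_min h2 (heq ▸ h2)⟩
    refine le_trans (measure_mono fun ω hω => ?_) (hprob δ hδ')
    simp only [Set.mem_ofPred_eq] at hω ⊢
    refine fun ⟨θN, hθN, hle⟩ => hω
      ⟨RandomFeatures.invSqrt (RandomFeatures.kernelMatrix μ ν φ x) θN, ?_, ?_⟩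
    · refine RandomFeatures.IsArgMax.of_bijective hbij ?_
      simpa only [RandomFeatures.dualFin_invSqrt] using hθN
    · have hη0 := hη.le
      have hrate : 0 ≤ RandomFeatures.rate (max Q₁ Q₂) n N :=
        le_max_of_le_left (Real.sqrt_nonneg _)
      have hfac : 0 ≤ RandomFeatures.boundFactor Q₁ Q₂ q₁ q₂ (C'' δ) δ τ η := by
        have := hC'' δ
        have : 0 ≤ max (τ ^ (max Q₁ Q₂ - 2)) (η ^ (min Q₁ Q₂ - 2)) :=
          le_max_of_le_left (by positivity)
        unfold RandomFeatures.boundFactor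
        positivity
      refine RandomFeatures.eLpNorm_two_le_of_lintegral (by positivity) (le_trans (le_of_eq ?_) hle)
      refine lintegral_congr_ae ?_
      filter_upwards [hexp] with u hu
      simp only [RandomFeatures.predictorFin, RandomFeatures.inner_featureVec_invSqrt,
        RandomFeatures.predictorInf_invSqrt hw hp hC hQ₁ hQ₂ hr hu]
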